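/- **Theorem.** Let $j=n+\tfrac12$ with $n\in\{0,1,2,\dots\}$, let $\eta=\mathrm{diag}(1,-1,-1,-1)$, and for $i\ge 1$ let $\tau_i=D(\tfrac i2,\tfrac{i-1}2)$ and $\dot\tau_i=D(\tfrac{i-1}2,\tfrac i2)$ be the finite-dimensional irreducible Lorentz representations with labels $[l_0,l_1]=[j_1-j_2,\,j_1+j_2+1]$ equal to $[\tfrac12,i+\tfrac12]$ and $[-\tfrac12,i+\tfrac12]$. Two irreducible representations are said to interlock if $[l_0',l_1']=[l_0\pm1,l_1]$ or $[l_0',l_1']=[l_0,l_1\pm1]$. *Multiplicities.* For positive integers $M_1,\dots,M_{n+1}$ and $1\le i\le n+1$, $l=i-\tfrac12$, put $$B_l=\sum_{k=i}^{n+1}M_k,\qquad A_l=\sum_{k=i}^{n+1}\frac{M_k(M_k+1)}2+\sum_{k=i}^{n}M_kM_{k+1}-\sum_{l<l'\le j}B_{l'} .$$ Start with $M_1=\dots=M_{n+1}=1$ and treat $l=j,j-1,\dots,\tfrac12$ in this order; for each $l$, as long as $A_l<B_l$, raise $M_{l+1/2}$ by one. This algorithm terminates; its output $(M_i)$ is unique,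 satisfies $A_l\ge B_l$ for all $l$, and begins with $M_{n+1}=M_n=1$, $M_{n-1}=M_{n-2}=M_{n-3}=2$, $M_{n-4}=3$ (as far as these indices are positive). *Equation.* Let $\rho_j=\bigoplus_{i=1}^{n+1}M_i(\tau_i\oplus\dot\tau_i)$ with these multiplicities, acting on a complex vector space $V$ with Lorentz generators $M_{\alpha\beta}$. There are linear operators $X_0,\dots,X_3$ and $P$ on $V$, and a non-degenerate Hermitean form $\overline\Psi\Phi$ on $V$, such that: 1. $[X_\gamma,M_{\alpha\beta}]=i\eta_{\gamma\alpha}X_\beta-i\eta_{\gamma\beta}X_\alpha$, and $X_\alpha$ couples only those irreducible summands of $\rho_j$ which interlock. 2. $P^2=1$, $P$ commutes with the rotation generators and anticommutes with the boost generators, $PX_0=X_0P$ and $PX_k=-X_kP$ for $k=1,2,3$. 3. The form is invariant under the $M_{\alpha\beta}$ and under $P$, and the $X_\alpha$ are symmetric with respect to it. 4. On vectors of spin $l<j$ the matrix $X_0$ has only the eigenvalue $0$ (it is nilpotent there); on vectors of spin $j$ it satisfies $X_0^2=1$, and both eigenvalues $\pm1$ occur. 5. For every $\kappa>0$ the equation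 $(i\eta^{\alpha\beta}X_\alpha\partial_\beta-\kappa)\Psi=0$ for fields $\Psi:\mathbb R^4\to V$ has the following properties. - It is Poincaré invariant: if $\Psi$ is a solution, so is $x\mapsto D(\Lambda)\Psi(\Lambda^{-1}(x-a))$, for every $a\in\mathbb R^4$ and every $\Lambda=\exp(\theta^{\alpha}{}_{\beta})$, $D(\Lambda)=\exp(-\tfrac i2\theta^{\alpha\beta}M_{\alpha\beta})$, $\theta^{\alpha\beta}=-\theta^{\beta\alpha}$ real. - It is parity invariant: if $\Psi$ is a solution, so is $(t,\mathbf x)\mapsto P\Psi(t,-\mathbf x)$. - For smooth fields it is the system of Euler–Lagrange equations of the Lagrangian $\mathrm{Re}\,\overline\Psi(i\eta^{\alpha\beta}X_\alpha\partial_\beta-\kappa)\Psi$. - It describes only spin $j$ and mass $\kappa$, with particles and antiparticles: a non-zero plane wave $e^{-ip_\mu x^\mu}u$ with real $p$ can be a solution only if $p^2=\kappa^2$; for each such $p$, with $p_0>0$ or $p_0<0$, the amplitudes $u$ of the solutions form a space of dimension $2j+1$ on which the square of the Pauli–Lubanski vector has the value $-\kappa^2j(j+1)$. - The charge is positive: $\int\overline\Psi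 X_0\Psi\,d^3x>0$ at every time for every non-zero smooth solution which decreases rapidly in space together with all its derivatives, locally uniformly in time; and $\overline uX_0u>0$ for the amplitude $u\ne0$ of every plane-wave solution, of either sign of the energy. -/

import Mathlib

open scoped Matrix ContDiff Kronecker

noncomputable section

namespace DiracType

/-! ### Minkowski space and the Lorentz algebra on the irreducible representations -/

/-- The Minkowski metric `diag(1,-1,-1,-1)`; it equals its own inverse. -/
def mink : Matrix (Fin 4) (Fin 4) ℝ := Matrix.diagonal ![1, -1, -1, -1]

/-- The finite-dimensional irreducible Lorentz representation `D(j₁, j₂)`, given by the natural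
numbers `2 j₁` and `2 j₂`. -/
structure LorentzLabel where
  twoJ₁ : ℕ
  twoJ₂ : ℕ

/-- `l₀ = j₁ - j₂`. -/
def LorentzLabel.l₀ (τ : LorentzLabel) : ℚ := ((τ.twoJ₁ : ℚ) - τ.twoJ₂) / 2

/-- `l₁ = j₁ + j₂ + 1`. -/
def LorentzLabel.l₁ (τ : LorentzLabel) : ℚ := ((τ.twoJ₁ : ℚ) + τ.twoJ₂) / 2 + 1

/-- The conjugate representation. -/
def LorentzLabel.conj (τ : LorentzLabel) : LorentzLabel := ⟨τ.twoJ₂, τ.twoJ₁⟩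

/-- `τ_i = D(i/2, (i-1)/2)`, for `i ≥ 1`. -/
def tau (i : ℕ) : LorentzLabel := ⟨i, i - 1⟩

theorem tau_label (i : ℕ) (hi : 1 ≤ i) :
    (tau i).l₀ = 1 / 2 ∧ (tau i).l₁ = i + 1 / 2 ∧
      (tau i).conj.l₀ = -1 / 2 ∧ (tau i).conj.l₁ = i + 1 / 2 := by
  obtain ⟨k, rfl⟩ : ∃ k, i = k + 1 := ⟨i - 1, by omega⟩
  simp only [tau, LorentzLabel.l₀, LorentzLabel.l₁, LorentzLabel.conj, Nat.add_sub_cancel]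
  push_cast
  refine ⟨by ring, by ring, by ring, by ring⟩

/-- Two irreducible representations interlock: `[l₀', l₁'] = [l₀ ± 1, l₁]` (type A) or
`[l₀', l₁'] = [l₀, l₁ ± 1]` (type B). -/
def Interlock (τ τ' : LorentzLabel) : Prop :=
  (τ'.l₁ = τ.l₁ ∧ (τ'.l₀ = τ.l₀ + 1 ∨ τ'.l₀ = τ.l₀ - 1)) ∨
    (τ'.l₀ = τ.l₀ ∧ (τ'.l₁ = τ.l₁ + 1 ∨ τ'.l₁ = τ.l₁ - 1))

/-- The spin-`a/2` raising operator `x ∂/∂y` in the monomial basis `x^(a-k) y^k`, `0 ≤ k ≤ a`. -/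
def spinPlus (a : ℕ) : Matrix (Fin (a + 1)) (Fin (a + 1)) ℂ :=
  Matrix.of fun r k => if (r : ℕ) + 1 = k then ((k : ℕ) : ℂ) else 0

/-- The spin-`a/2` lowering operator `y ∂/∂x` in the monomial basis. -/
def spinMinus (a : ℕ) : Matrix (Fin (a + 1)) (Fin (a + 1)) ℂ :=
  Matrix.of fun r k => if (r : ℕ) = k + 1 then (a : ℂ) - ((k : ℕ) : ℂ) else 0

/-- The spin-`a/2` operator `(x ∂/∂x - y ∂/∂y) / 2` in the monomial basis. -/
def spinZ (a : ℕ) : Matrix (Fin (a + 1)) (Fin (a + 1)) ℂ :=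
  Matrix.diagonal fun k => (a : ℂ) / 2 - ((k : ℕ) : ℂ)

/-- The three components of the spin-`a/2` angular momentum. -/
def spin (a : ℕ) : Fin 3 → Matrix (Fin (a + 1)) (Fin (a + 1)) ℂ :=
  ![(1 / 2 : ℂ) • (spinPlus a + spinMinus a),
    (1 / (2 * Complex.I)) • (spinPlus a - spinMinus a),
    spinZ a]

/-- The carrier of `D(j₁, j₂)` has basis indexed by the pairs `(m₁, m₂)`. -/
abbrev LorentzLabel.Carrier (τ : LorentzLabel) : Type := Fin (τ.twoJ₁ + 1) × Fin (τ.twoJ₂ + 1)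

/-- Rotation generators of `D(j₁, j₂)`: `J = J⁽¹⁾ + J⁽²⁾`. -/
def rotGen (τ : LorentzLabel) (k : Fin 3) : Matrix τ.Carrier τ.Carrier ℂ :=
  spin τ.twoJ₁ k ⊗ₖ (1 : Matrix (Fin (τ.twoJ₂ + 1)) (Fin (τ.twoJ₂ + 1)) ℂ) +
    (1 : Matrix (Fin (τ.twoJ₁ + 1)) (Fin (τ.twoJ₁ + 1)) ℂ) ⊗ₖ spin τ.twoJ₂ k

/-- Boost generators of `D(j₁, j₂)`: `i (J⁽¹⁾ - J⁽²⁾)`. -/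
def boostGen (τ : LorentzLabel) (k : Fin 3) : Matrix τ.Carrier τ.Carrier ℂ :=
  Complex.I • (spin τ.twoJ₁ k ⊗ₖ (1 : Matrix (Fin (τ.twoJ₂ + 1)) (Fin (τ.twoJ₂ + 1)) ℂ) -
    (1 : Matrix (Fin (τ.twoJ₁ + 1)) (Fin (τ.twoJ₁ + 1)) ℂ) ⊗ₖ spin τ.twoJ₂ k)

/-- The Lorentz generators `M_{αβ}` of `D(j₁, j₂)`, with `M_{ab} = ε_{abc} J_c` and
`M_{0a}` the boosts. -/
def irrepGen (τ : LorentzLabel) (α β : Fin 4) : Matrix τ.Carrier τ.Carrier ℂ :=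
  !![0, boostGen τ 0, boostGen τ 1, boostGen τ 2;
    -boostGen τ 0, 0, rotGen τ 2, -rotGen τ 1;
    -boostGen τ 1, -rotGen τ 2, 0, rotGen τ 0;
    -boostGen τ 2, rotGen τ 1, -rotGen τ 0, 0] α β

/-! ### The representation `ρ_j`, `j = n + 1/2` -/

/-- The irreducible summands of the representation with multiplicities `M i` of `τ_i` and of its
conjugate, `1 ≤ i ≤ n + 1`: the summand `⟨r, (c, dotted)⟩` is the `c`-th copy of `τ_{r+1}`
(`dotted = false`) or of its conjugate (`dotted = true`). -/
abbrev Summand (n : ℕ) (M : ℕ → ℕ) : Type := Σ r : Fin (n + 1), Fin (M (r + 1)) × Bool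

/-- The isomorphism type of a summand. -/
def Summand.label {n : ℕ} {M : ℕ → ℕ} (s : Summand n M) : LorentzLabel :=
  if s.2.2 then (tau (s.1 + 1)).conj else tau (s.1 + 1)

/-- Index set of a basis of the direct sum of all summands. -/
abbrev RhoIdx (n : ℕ) (M : ℕ → ℕ) : Type := Σ s : Summand n M, (Summand.label s).Carrier

/-- The Lorentz generators `M_{αβ}` on the direct sum
`⨁_{i=1}^{n+1} M_i (τ_i ⊕ τ̇_i)`. -/
def rhoGen (n : ℕ) (M : ℕ → ℕ) (α β : Fin 4) : Matrix (RhoIdx n M) (RhoIdx n M) ℂ :=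
  Matrix.blockDiagonal' fun s : Summand n M => irrepGen (Summand.label s) α β

/-- A family of matrices `X_α` follows the interlocking scheme: it couples only summands which
interlock. -/
def FollowsScheme {n : ℕ} {M : ℕ → ℕ} (X : Fin 4 → Matrix (RhoIdx n M) (RhoIdx n M) ℂ) : Prop :=
  ∀ (α : Fin 4) (a b : RhoIdx n M),
    ¬ Interlock (Summand.label a.1) (Summand.label b.1) → X α a b = 0

/-! ### The parameter-counting algorithm

The compartment matrix of spin `l` is addressed by `i = l + 1/2`, `1 ≤ i ≤ n + 1`. The partial
diagram belonging to it consists of the representations `τ_k`, `τ̇_k` with `i ≤ k ≤ n + 1`. -/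

/-- Weight of the `m`-fold arrow which joins `τ_k` and `τ̇_k`. -/
def weightA (m : ℕ) : ℕ := m * (m + 1) / 2

/-- Weight of the arrow between an `m`-fold and an `m'`-fold arrow; it is counted for the undotted
representations only, the arrow between the dotted ones having weight zero. -/
def weightB (m m' : ℕ) : ℕ := m * m'

/-- The number `B_l` of parameters which are fixed at `i = l + 1/2`. -/
def numFixed (n : ℕ) (M : ℕ → ℕ) (i : ℕ) : ℕ := ∑ k ∈ Finset.Icc i (n + 1), M k

/-- The number `A_l` of free parameters at `i = l + 1/2`: the sum of the weights of all arrows in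
the partial diagram, minus the numbers `B_{l'}` with `l < l' ≤ j`. -/
def numFree (n : ℕ) (M : ℕ → ℕ) (i : ℕ) : ℤ :=
  (∑ k ∈ Finset.Icc i (n + 1), (weightA (M k) : ℤ)) +
    (∑ k ∈ Finset.Ico i (n + 1), (weightB (M k) (M (k + 1)) : ℤ)) -
    ∑ k ∈ Finset.Ioc i (n + 1), (numFixed n M k : ℤ)

/-- One step of the algorithm. In the state `(i, M)` the partial diagram of `i` is examined: if
`A_l < B_l` the multiplicity `M_i` is raised by one, otherwise the algorithm goes on to `i - 1`. -/
inductive AlgStep (n : ℕ) : ℕ × (ℕ → ℕ) → ℕ × (ℕ → ℕ) → Prop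
  | raise (i : ℕ) (M : ℕ → ℕ) (h : numFree n M (i + 1) < numFixed n M (i + 1)) :
      AlgStep n (i + 1, M) (i + 1, Function.update M (i + 1) (M (i + 1) + 1))
  | next (i : ℕ) (M : ℕ → ℕ) (h : (numFixed n M (i + 1) : ℤ) ≤ numFree n M (i + 1)) :
      AlgStep n (i + 1, M) (i, M)

/-- Started at `i = n + 1` with simple arrows everywhere, the algorithm terminates after `i = 1`
with the multiplicities `M`. -/
def AlgOutput (n : ℕ) (M : ℕ → ℕ) : Prop :=
  Relation.ReflTransGen (AlgStep n) (n + 1, fun _ => 1) (0, M)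

/-! ### Dirac-type equations -/

section Equation

variable {ι : Type} [Fintype ι] [DecidableEq ι]

/-- `X_α` is a Lorentz vector operator: `[X_γ, M_{αβ}] = i g_{γα} X_β - i g_{γβ} X_α`. -/
def IsVectorOperator (G : Fin 4 → Fin 4 → Matrix ι ι ℂ) (X : Fin 4 → Matrix ι ι ℂ) : Prop :=
  ∀ γ α β, X γ * G α β - G α β * X γ =
    (Complex.I * (mink γ α : ℂ)) • X β - (Complex.I * (mink γ β : ℂ)) • X α

/-- The partial derivative `∂_μ f`. -/
def pderiv {E : Type} [NormedAddCommGroup E] [NormedSpace ℝ E] (μ : Fin 4)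
    (f : (Fin 4 → ℝ) → E) (x : Fin 4 → ℝ) : E :=
  fderiv ℝ f x (Pi.single μ 1)

/-- `(i η^{αβ} X_α d_β - κ) ψ`, for the values `ψ` of a field and `d_β` of its derivatives. -/
def diracExpr (X : Fin 4 → Matrix ι ι ℂ) (κ : ℝ) (ψ : ι → ℂ) (d : Fin 4 → ι → ℂ) : ι → ℂ :=
  (∑ α, ∑ β, (Complex.I * (mink α β : ℂ)) • (X α *ᵥ d β)) - (κ : ℂ) • ψ

/-- `Ψ` solves `(i η^{αβ} X_α ∂_β - κ) Ψ = 0`. -/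
def IsSolution (X : Fin 4 → Matrix ι ι ℂ) (κ : ℝ) (Ψ : (Fin 4 → ℝ) → ι → ℂ) : Prop :=
  Differentiable ℝ Ψ ∧ ∀ x, diracExpr X κ (Ψ x) (fun β => pderiv β Ψ x) = 0

/-- The restricted Lorentz transformation `exp(θ^α_β)` with parameters `θ^{αβ} = -θ^{βα}`. -/
def lorentz (θ : Matrix (Fin 4) (Fin 4) ℝ) : Matrix (Fin 4) (Fin 4) ℝ :=
  NormedSpace.exp (θ * mink)

/-- Its action `exp(-(i/2) θ^{αβ} M_{αβ})` on the field components. -/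
def lorentzRep (G : Fin 4 → Fin 4 → Matrix ι ι ℂ) (θ : Matrix (Fin 4) (Fin 4) ℝ) :
    Matrix ι ι ℂ :=
  NormedSpace.exp (∑ α, ∑ β, (-(Complex.I / 2) * (θ α β : ℂ)) • G α β)

/-- Poincaré invariance: with `Ψ`, also `x ↦ D(Λ) Ψ(Λ⁻¹ (x - a))` is a solution. -/
def PoincareInvariant (G : Fin 4 → Fin 4 → Matrix ι ι ℂ) (X : Fin 4 → Matrix ι ι ℂ) (κ : ℝ) :
    Prop :=
  ∀ (θ : Matrix (Fin 4) (Fin 4) ℝ) (a : Fin 4 → ℝ), θᵀ = -θ → ∀ Ψ, IsSolution X κ Ψ →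
    IsSolution X κ fun x => lorentzRep G θ *ᵥ Ψ ((lorentz θ)⁻¹ *ᵥ (x - a))

/-- `P` represents the space reflection, compatibly with the Lorentz generators: it makes `G` a
representation of the complete (orthochronous) Lorentz algebra. -/
def IsParityOperator (G : Fin 4 → Fin 4 → Matrix ι ι ℂ) (P : Matrix ι ι ℂ) : Prop :=
  P * P = 1 ∧ ∀ α β, P * G α β = ((mink α α * mink β β : ℝ) : ℂ) • (G α β * P)

/-- Parity invariance: the matrices `X_α` transform as a vector under the space reflection, and
with `Ψ`, also `(t, x) ↦ P Ψ(t, -x)` is a solution. -/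
def ParityInvariant (P : Matrix ι ι ℂ) (X : Fin 4 → Matrix ι ι ℂ) (κ : ℝ) : Prop :=
  (∀ α, P * X α = (mink α α : ℂ) • (X α * P)) ∧
    ∀ Ψ, IsSolution X κ Ψ → IsSolution X κ fun x => P *ᵥ Ψ (mink *ᵥ x)

/-- `H` is the matrix of a non-degenerate Hermitean form which is invariant under the Lorentz
generators and the space reflection; the matrices `X_α` are symmetric for it. The Dirac adjoint of
`Ψ` is `Ψ† H`. -/
def IsInvariantForm (G : Fin 4 → Fin 4 → Matrix ι ι ℂ) (P : Matrix ι ι ℂ)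
    (X : Fin 4 → Matrix ι ι ℂ) (H : Matrix ι ι ℂ) : Prop :=
  H.IsHermitian ∧ IsUnit H.det ∧ (∀ α β, (G α β)ᴴ * H = H * G α β) ∧ Pᴴ * H * P = H ∧
    ∀ α, (X α)ᴴ * H = H * X α

/-- The Lagrangian density `Re Ψ̄ (i η^{αβ} X_α ∂_β - κ) Ψ`, as a function of the values of the
field and of its first derivatives. -/
def lagrangian (H : Matrix ι ι ℂ) (X : Fin 4 → Matrix ι ι ℂ) (κ : ℝ) (ψ : ι → ℂ)
    (d : Fin 4 → ι → ℂ) : ℝ :=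
  (star ψ ⬝ᵥ (H *ᵥ diracExpr X κ ψ d)).re

/-- The Euler-Lagrange equations
`∂L/∂Ψ = ∂_μ (∂L/∂(∂_μ Ψ))` of a Lagrangian density `L(Ψ, ∂Ψ)`, contracted with an arbitrary
direction `v` of the (real) space of field values. -/
def EulerLagrange (L : (ι → ℂ) → (Fin 4 → ι → ℂ) → ℝ) (Ψ : (Fin 4 → ℝ) → ι → ℂ) : Prop :=
  ∀ (x : Fin 4 → ℝ) (v : ι → ℂ),
    fderiv ℝ (fun ψ => L ψ fun β => pderiv β Ψ x) (Ψ x) v =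
      ∑ μ, pderiv μ (fun y =>
        fderiv ℝ (fun d => L (Ψ y) d) (fun β => pderiv β Ψ y) (Pi.single μ v)) x

/-- The equation is the Euler-Lagrange equation of the Lagrangian density of the form `H`. -/
def DerivableFromLagrangian (H : Matrix ι ι ℂ) (X : Fin 4 → Matrix ι ι ℂ) (κ : ℝ) : Prop :=
  ∀ Ψ, ContDiff ℝ ∞ Ψ → (EulerLagrange (lagrangian H X κ) Ψ ↔ IsSolution X κ Ψ)

/-! ### Particle content -/

/-- The square `J²` of the angular momentum. -/
def angSq (G : Fin 4 → Fin 4 → Matrix ι ι ℂ) : Matrix ι ι ℂ :=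
  G 2 3 * G 2 3 + G 3 1 * G 3 1 + G 1 2 * G 1 2

/-- The matrix `X₀` has the eigenvalues `1` and `-1`, both of which occur, and is diagonalizable
on the states of spin `j = n + 1/2`, and has only the eigenvalue zero on the states of spin
`l = i - 1/2 < j`. -/
def EliminatesLowerSpins (n : ℕ) (G : Fin 4 → Fin 4 → Matrix ι ι ℂ)
    (X : Fin 4 → Matrix ι ι ℂ) : Prop :=
  (∀ i : ℕ, 1 ≤ i → i ≤ n → ∀ v : ι → ℂ,
      angSq G *ᵥ v = (((i : ℂ) - 1 / 2) * ((i : ℂ) + 1 / 2)) • v → ∃ k : ℕ, (X 0) ^ k *ᵥ v = 0) ∧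
    (∀ v : ι → ℂ, angSq G *ᵥ v = (((n : ℂ) + 1 / 2) * ((n : ℂ) + 3 / 2)) • v →
      X 0 *ᵥ (X 0 *ᵥ v) = v) ∧
    ∀ s : ℂ, s = 1 ∨ s = -1 → ∃ v : ι → ℂ, v ≠ 0 ∧
      angSq G *ᵥ v = (((n : ℂ) + 1 / 2) * ((n : ℂ) + 3 / 2)) • v ∧ X 0 *ᵥ v = s • v

/-- The plane wave `exp(-i p_μ x^μ) u` with momentum `p` (covariant components). -/
def planeWave (p : Fin 4 → ℝ) (u : ι → ℂ) (x : Fin 4 → ℝ) : ι → ℂ :=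
  Complex.exp (-(Complex.I * ((∑ μ, p μ * x μ : ℝ) : ℂ))) • u

/-- `η^{αβ} X_α p_β`. -/
def slash (X : Fin 4 → Matrix ι ι ℂ) (p : Fin 4 → ℝ) : Matrix ι ι ℂ :=
  ∑ α, ∑ β, ((mink α β * p β : ℝ) : ℂ) • X α

/-- `p² = η^{αβ} p_α p_β`. -/
def minkSq (p : Fin 4 → ℝ) : ℝ := ∑ α, ∑ β, mink α β * p α * p β

/-- The amplitudes of the plane-wave solutions with momentum `p`. -/
def amplitudes (X : Fin 4 → Matrix ι ι ℂ) (κ : ℝ) (p : Fin 4 → ℝ) : Submodule ℂ (ι → ℂ) :=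
  LinearMap.ker (Matrix.mulVecLin (slash X p - (κ : ℂ) • 1))

theorem pderiv_planeWave (p : Fin 4 → ℝ) (u : ι → ℂ) (μ : Fin 4) (x : Fin 4 → ℝ) :
    Differentiable ℝ (planeWave p u) ∧
      pderiv μ (planeWave p u) x = (-(Complex.I * (p μ : ℂ))) • planeWave p u x := by
  let l : (Fin 4 → ℝ) →L[ℝ] ℝ := ∑ ν, p ν • ContinuousLinearMap.proj ν
  have hl : ∀ y, l y = ∑ ν, p ν * y ν := fun y => by simp [l]
  have hd : ∀ y, HasFDerivAt (planeWave p u)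
      ((Complex.exp (-(Complex.I * ((∑ ν, p ν * y ν : ℝ) : ℂ))) •
        (-(Complex.I • (Complex.ofRealCLM.comp l)))).smulRight u) y := by
    intro y
    have h1 : HasFDerivAt (fun y : Fin 4 → ℝ => ((∑ ν, p ν * y ν : ℝ) : ℂ))
        (Complex.ofRealCLM.comp l) y := by
      have h := (Complex.ofRealCLM.comp l).hasFDerivAt (x := y)
      refine h.congr_of_eventuallyEq (Filter.Eventually.of_forall fun z => ?_)
      simp [hl]
    exact ((h1.const_mul Complex.I).neg.cexp).smul_const u
  refine ⟨fun y => (hd y).differentiableAt, ?_⟩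
  rw [pderiv, (hd x).fderiv]
  have h2 : l (Pi.single μ 1) = p μ := by
    rw [hl]
    simp [Pi.single_apply]
  ext i
  simp only [ContinuousLinearMap.smulRight_apply, smul_apply,
    neg_apply, ContinuousLinearMap.comp_apply, h2, planeWave, Pi.smul_apply,
    smul_eq_mul, Complex.ofRealCLM_apply]
  ring

/-- A plane wave solves the equation exactly if its amplitude lies in `amplitudes X κ p`. -/
theorem mem_amplitudes_iff (X : Fin 4 → Matrix ι ι ℂ) (κ : ℝ) (p : Fin 4 → ℝ) (u : ι → ℂ) :
    u ∈ amplitudes X κ p ↔ IsSolution X κ (planeWave p u) := by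
  have key : ∀ x, diracExpr X κ (planeWave p u x) (fun β => pderiv β (planeWave p u) x) =
      Complex.exp (-(Complex.I * ((∑ μ, p μ * x μ : ℝ) : ℂ))) •
        ((slash X p - (κ : ℂ) • 1) *ᵥ u) := by
    intro x
    simp only [diracExpr, (pderiv_planeWave p u _ x).2, slash, planeWave, Matrix.sub_mulVec,
      Matrix.sum_mulVec, Matrix.smul_mulVec, Matrix.one_mulVec, Matrix.mulVec_smul, smul_sub,
      Finset.smul_sum, smul_smul]
    congr 1
    · refine Finset.sum_congr rfl fun α _ => Finset.sum_congr rfl fun β _ => ?_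
      congr 1
      push_cast
      linear_combination (-(mink α β : ℂ) * (p β : ℂ) *
        Complex.exp (-(Complex.I * (∑ μ, (p μ : ℂ) * (x μ : ℂ))))) * Complex.I_mul_I
    · rw [mul_comm]
  rw [amplitudes, LinearMap.mem_ker, Matrix.mulVecLin_apply, IsSolution]
  constructor
  · intro h
    exact ⟨(pderiv_planeWave p u 0 0).1, fun x => by rw [key, h, smul_zero]⟩
  · rintro ⟨-, h⟩
    have h0 := h 0
    rw [key] at h0
    exact (smul_eq_zero.mp h0).resolve_left (Complex.exp_ne_zero _)

/-- The Levi-Civita symbol. -/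
def levi (μ ν ρ σ : Fin 4) : ℂ :=
  (Matrix.of fun a b : Fin 4 => if ![μ, ν, ρ, σ] a = b then (1 : ℂ) else 0).det

/-- The Pauli-Lubanski vector `W_μ = (1/2) ε_{μνρσ} M^{νρ} p^σ`; indices are raised with the
diagonal metric, and the orbital part of the generators drops out. -/
def pauliLubanski (G : Fin 4 → Fin 4 → Matrix ι ι ℂ) (p : Fin 4 → ℝ) (μ : Fin 4) :
    Matrix ι ι ℂ :=
  ∑ ν, ∑ ρ, ∑ σ, ((1 / 2 : ℂ) * levi μ ν ρ σ *
    ((mink ν ν * mink ρ ρ * mink σ σ * p σ : ℝ) : ℂ)) • G ν ρ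

/-- `W² = η^{μν} W_μ W_ν`. -/
def pauliLubanskiSq (G : Fin 4 → Fin 4 → Matrix ι ι ℂ) (p : Fin 4 → ℝ) : Matrix ι ι ℂ :=
  ∑ μ, (mink μ μ : ℂ) • (pauliLubanski G p μ * pauliLubanski G p μ)

/-- The equation describes precisely one particle of mass `κ` and spin `j = n + 1/2`, and its
antiparticle: every plane-wave solution has a momentum on the mass shell `p² = κ²`; for each such
momentum, of positive or of negative energy, the amplitudes form a space of dimension `2j + 1`, on
which the Casimir operator `W²` has the value `-κ² j (j + 1)`. -/
def DescribesOnlySpin (n : ℕ) (G : Fin 4 → Fin 4 → Matrix ι ι ℂ) (X : Fin 4 → Matrix ι ι ℂ)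
    (κ : ℝ) : Prop :=
  (∀ p, amplitudes X κ p ≠ ⊥ → minkSq p = κ ^ 2) ∧
    ∀ p, minkSq p = κ ^ 2 → Module.finrank ℂ (amplitudes X κ p) = 2 * n + 2 ∧
      ∀ u ∈ amplitudes X κ p, pauliLubanskiSq G p *ᵥ u =
        (-((κ : ℂ) ^ 2 * (((n : ℂ) + 1 / 2) * ((n : ℂ) + 3 / 2)))) • u

/-- The charge density `J₀ = Ψ̄ X₀ Ψ`. -/
def chargeDensity (H : Matrix ι ι ℂ) (X : Fin 4 → Matrix ι ι ℂ) (ψ : ι → ℂ) : ℝ :=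
  (star ψ ⬝ᵥ (H *ᵥ (X 0 *ᵥ ψ))).re

/-- The point of space-time with time `t` and position `x`. -/
def event (t : ℝ) (x : EuclideanSpace ℝ (Fin 3)) : Fin 4 → ℝ := ![t, x 0, x 1, x 2]

/-- Wave packets: smooth fields which decrease rapidly in space together with all their
derivatives, locally uniformly in time. -/
def IsWavePacket (Ψ : (Fin 4 → ℝ) → ι → ℂ) : Prop :=
  ContDiff ℝ ∞ Ψ ∧ ∀ (T : ℝ) (m N : ℕ), ∃ C : ℝ, ∀ (t : ℝ) (x : EuclideanSpace ℝ (Fin 3)),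
    |t| ≤ T → ‖x‖ ^ N * ‖iteratedFDeriv ℝ m Ψ (event t x)‖ ≤ C

/-- Positive charge: the charge of every non-zero wave packet which solves the equation is
positive, and so is the charge density of every plane-wave solution, of either sign of the
energy. -/
def PositiveCharge (H : Matrix ι ι ℂ) (X : Fin 4 → Matrix ι ι ℂ) (κ : ℝ) : Prop :=
  (∀ Ψ, IsSolution X κ Ψ → IsWavePacket Ψ → Ψ ≠ 0 →
      ∀ t, 0 < ∫ x : EuclideanSpace ℝ (Fin 3), chargeDensity H X (Ψ (event t x))) ∧
    ∀ p, ∀ u ∈ amplitudes X κ p, u ≠ 0 → 0 < chargeDensity H X u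

end Equation

end DiracType

end

open scoped Matrix ContDiff Kronecker

noncomputable section

namespace DiracType

/-! ### The multiplicity algorithm -/

section Algorithm

/-! The equation is constructed explicitly. The algorithm enters only through three facts about its
output: $M_{n+1}=1$, $M_n=1$ if $n\ge1$, and $M_i\ge2$ for $1\le i<n$ (`surplus_add_lt`,
`exists_algOutput`). At most two copies of each $\tau_i$, $\dot\tau_i$ are coupled; on all further
copies the $X_\alpha$ vanish.

Vector operators: spin $a/2$ is realized on binary forms of degree $a$. Multiplication by $(x,y)$
and the derivations $(\partial_y,-\partial_x)$ are spinor operators, and tensor products of two of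
them give the vector operators between interlocking representations (`vectorOp_isVector`). The time
component $S$ commutes with rotations, and each product of $S$ forth and back is a constant minus
$K=J^2+\tfrac14$ (`singletOp_back_forth`), where $K=i^2$ on spin $i-\tfrac12$.

Lower spins: on spin $i-\tfrac12$ every component of an eigenvector of $X_0$ can be lowered
injectively to $\tau_i$ (`eq_zero_of_lowering`). The eigenvalue equation becomes a scalar chain over
the levels $k=i,\dots,n+1$. With $N=n+1$ and $t$ equal to $N$ times the eigenvalue, the constants
`ratio`, `stepCoef`, `topCoef` are such that solving the chain from the top makes the inflow from
below proportional to $t^2+N^2(k^2-i^2)/(N^2-k^2)$, simultaneously for all $i$. At $k=i$ the inflow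
is zero, so $t\ne0$ admits only the zero solution (`chain_eq_zero`), and $X_0$ is nilpotent on spins
below $j$.

Highest spin: spin $j$ occurs only in the single pair $\tau_{n+1}\oplus\dot\tau_{n+1}$, where $X_0$
is the exchange of the two tensor factors, so $X_0^2=1$ there (`IsTop.sq`).

Form: $P$ exchanges the factors with a sign alternating in the level. A Hermitean matrix $F$ for
which $X_0$ is symmetric and boosts are skew gives the invariant form $FP$. On spin $j$ one has
$P=X_0$ and $F>0$, so the charge at rest is $u^\dagger Fu>0$ (`diracForm_pos`).

Moving frames: exponentials of the generators are handled by one differential equation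
(`exp_mul_eq_mul_exp`). Boosts carry $X_0^D(X_0^2-1)=0$ to $S(p)^D(S(p)^2-p^2)=0$ for timelike $p$,
where $S(p)$ denotes `slash X p`, and since this is polynomial in the energy it holds for every $p$
and complex energies (`slash_pow_identity`). This yields the mass shell; dimension, spin and charge
are read off at rest.

Wave packets: after a Fourier transform in space the equation at fixed momentum is $iX_0f'=Af$ with
$A$ invertible. Positivity of the charge of plane waves makes the nonzero eigenvalues $\pm1/E$ of
$A^{-1}X_0$ semisimple, and $f=iA^{-1}X_0f'$ removes the nilpotent part. So $f$ is a sum of a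
positive and a negative energy mode, orthogonal for the charge, and Plancherel's theorem gives the
positive total charge (`IsCharged.integral_pos`). -/

theorem numFixed_eq_add (n : ℕ) (M : ℕ → ℕ) {i : ℕ} (hi : i ≤ n + 1) :
    numFixed n M i = M i + numFixed n M (i + 1) := by
  rw [numFixed, numFixed, ← Finset.insert_Icc_add_one_left_eq_Icc hi, Finset.sum_insert (by simp)]

theorem numFixed_of_lt (n : ℕ) (M : ℕ → ℕ) {i : ℕ} (hi : n + 1 < i) : numFixed n M i = 0 := by
  rw [numFixed, Finset.Icc_eq_empty (by omega), Finset.sum_empty]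

/-- Enlarging the partial diagram by one level adds two arrow weights and subtracts one more
`numFixed`. The counting thus becomes a one-step recursion in `i`. -/
theorem numFree_eq_add (n : ℕ) (M : ℕ → ℕ) {i : ℕ} (hi : i ≤ n) :
    numFree n M i = numFree n M (i + 1) - numFixed n M (i + 1) + weightA (M i) +
      M i * M (i + 1) := by
  have h1 := Finset.insert_Icc_add_one_left_eq_Icc (a := i) (b := n + 1) (by omega)
  have h2 := Finset.insert_Ico_add_one_left_eq_Ico (a := i) (b := n + 1) (by omega)
  have h3 : Finset.Ioc i (n + 1) = insert (i + 1) (Finset.Ioc (i + 1) (n + 1)) := by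
    ext x; simp only [Finset.mem_Ioc, Finset.mem_insert]; omega
  rw [numFree, numFree, ← h1, ← h2, h3, Finset.sum_insert (by simp), Finset.sum_insert (by simp),
    Finset.sum_insert (by simp), weightB]
  push_cast
  ring

theorem numFree_last (n : ℕ) (M : ℕ → ℕ) : numFree n M (n + 1) = weightA (M (n + 1)) := by
  simp [numFree]

theorem numFixed_congr (n : ℕ) {M M' : ℕ → ℕ} {i : ℕ} (h : ∀ k, i ≤ k → M k = M' k) :
    numFixed n M i = numFixed n M' i :=
  Finset.sum_congr rfl fun k hk => h k (Finset.mem_Icc.mp hk).1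

theorem numFree_congr (n : ℕ) {M M' : ℕ → ℕ} {i : ℕ} (h : ∀ k, i ≤ k → M k = M' k) :
    numFree n M i = numFree n M' i := by
  unfold numFree
  congr 1
  · congr 1
    · exact Finset.sum_congr rfl fun k hk => by rw [h k (Finset.mem_Icc.mp hk).1]
    · exact Finset.sum_congr rfl fun k hk => by
        have := (Finset.mem_Ico.mp hk).1
        rw [h k this, h (k + 1) (by omega)]
  · exact Finset.sum_congr rfl fun k hk => by
      have := (Finset.mem_Ioc.mp hk).1
      rw [numFixed_congr n fun l hl => h l (by omega)]

theorem update_add_apply (M : ℕ → ℕ) {i k : ℕ} (m : ℕ) (h : i < k) :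
    Function.update M i m k = M k := Function.update_of_ne (by omega) _ _

/-- The multiplicity `m` suffices at the index `i`, given those at larger indices. -/
def Suffices (n : ℕ) (M : ℕ → ℕ) (i m : ℕ) : Prop :=
  (numFixed n (Function.update M i m) i : ℤ) ≤ numFree n (Function.update M i m) i

theorem suffices_iff (n : ℕ) (M : ℕ → ℕ) {i : ℕ} (m : ℕ) (hi : i ≤ n) :
    Suffices n M i m ↔ (numFixed n M (i + 1) : ℤ) + m ≤
      numFree n M (i + 1) - numFixed n M (i + 1) + weightA m + m * M (i + 1) := by
  have h : ∀ k, i + 1 ≤ k → Function.update M i m k = M k :=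
    fun k hk => update_add_apply M m (by omega)
  rw [Suffices, numFixed_eq_add n _ (by omega), numFree_eq_add n _ hi, numFixed_congr n h,
    numFree_congr n h, Function.update_self, h (i + 1) le_rfl]
  push_cast
  constructor <;> intro h <;> linarith

theorem suffices_last (n : ℕ) (M : ℕ → ℕ) : Suffices n M (n + 1) 1 := by
  rw [Suffices, numFree_last, numFixed_eq_add n _ le_rfl, numFixed_of_lt n _ (by omega)]
  simp [weightA]

theorem suffices_congr (n : ℕ) {M M' : ℕ → ℕ} {i : ℕ} (m : ℕ) (h : ∀ k, i < k → M k = M' k) :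
    Suffices n M i m ↔ Suffices n M' i m := by
  have h' : ∀ k, i ≤ k → Function.update M i m k = Function.update M' i m k := by
    intro k hk
    rcases hk.eq_or_lt with rfl | hk
    · simp
    · rw [update_add_apply _ _ hk, update_add_apply _ _ hk, h k hk]
  rw [Suffices, Suffices, numFixed_congr n h', numFree_congr n h']

theorem two_mul_weightA (m : ℕ) : 2 * (weightA m : ℤ) = m * (m + 1) := by
  have : 2 * weightA m = m * (m + 1) :=
    Nat.mul_div_cancel' (Nat.even_mul_succ_self m).two_dvd
  exact_mod_cast this

/-- The demand grows linearly in the multiplicity while `weightA` grows quadratically, so raising it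
succeeds in the end; this is the termination of the algorithm. -/
theorem exists_suffices (n : ℕ) (M : ℕ → ℕ) {i : ℕ} (hi : i ≤ n + 1) (hM : M i = 1) :
    ∃ m, 1 ≤ m ∧ Suffices n M i m := by
  rcases hi.eq_or_lt with rfl | hi
  · exact ⟨1, le_rfl, suffices_last n M⟩
  · set c : ℤ := 2 * numFixed n M (i + 1) - numFree n M (i + 1) with hc
    -- The requirement is `c + m ≤ weightA m + m * M (i + 1)`. For `m = c + 1` with `c ≥ 0` it
    -- follows from $(c+1)(c+2)/2\ge 2c+1$, that is from $c^2\ge c$.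
    refine ⟨c.toNat + 1 , by omega, (suffices_iff n M _ (by omega)).mpr ?_⟩
    have h1 := two_mul_weightA (c.toNat + 1)
    have h2 : c ≤ c.toNat := Int.self_le_toNat c
    have h3 : (0 : ℤ) ≤ ((c.toNat + 1 : ℕ) : ℤ) * M (i + 1) := by positivity
    have h4 : (0 : ℤ) ≤ c.toNat := by positivity
    push_cast at h1 h3 ⊢
    rcases h4.eq_or_lt with h5 | h5
    · rw [← h5] at h1 h2 h3 ⊢
      linarith
    · nlinarith

/-- The multiplicities chosen by the algorithm are the least sufficient ones. -/
def IsLeastSufficient (n : ℕ) (M : ℕ → ℕ) (i : ℕ) : Prop :=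
  1 ≤ M i ∧ Suffices n M i (M i) ∧ ∀ m, 1 ≤ m → m < M i → ¬ Suffices n M i m

theorem reach_raise (n : ℕ) (M : ℕ → ℕ) (i : ℕ) (hM : M (i + 1) = 1) (m : ℕ)
    (h : ∀ l, 1 ≤ l → l < m + 1 → ¬ Suffices n M (i + 1) l) :
    Relation.ReflTransGen (AlgStep n) (i + 1, M) (i + 1, Function.update M (i + 1) (m + 1)) := by
  induction m with
  | zero =>
    have : Function.update M (i + 1) 1 = M := by
      simp [Function.update_eq_self_iff, hM]
    rw [zero_add, this]
  | succ m ih =>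
    refine (ih fun l h1 h2 => h l h1 (by omega)).tail ?_
    have h1 := h (m + 1) (by omega) (by omega)
    have h2 := AlgStep.raise i (Function.update M (i + 1) (m + 1)) (not_le.mp h1)
    simpa using h2

/-- The state of the algorithm on arrival at `i`. Sufficiency at `k` depends only on the
multiplicities above `k`, so the later raises at smaller indices do not disturb what has been
settled. -/
theorem exists_stage (n : ℕ) {i : ℕ} (hi : i ≤ n + 1) :
    ∃ M, Relation.ReflTransGen (AlgStep n) (n + 1, fun _ => 1) (i, M) ∧
      (∀ k, k ≤ i → M k = 1) ∧ ∀ k, i < k → k ≤ n + 1 → IsLeastSufficient n M k := by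
  induction hi using Nat.decreasingInduction with
  | self => exact ⟨_, .refl, fun _ _ => rfl, fun k h1 h2 => by omega⟩
  | of_succ i hi ih =>
    obtain ⟨M, hr, h1, hl⟩ := ih
    classical
    have hex := exists_suffices n M (i := i + 1) (by omega) (h1 _ le_rfl)
    obtain ⟨hm1, hm2⟩ := Nat.find_spec hex
    have hmin := fun l => Nat.find_min hex (m := l)
    set m := Nat.find hex
    obtain ⟨m', hm'⟩ : ∃ m', m = m' + 1 := ⟨m - 1, by omega⟩
    have hmin' : ∀ l, 1 ≤ l → l < m → ¬ Suffices n M (i + 1) l :=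
      fun l h3 h4 h5 => hmin l h4 ⟨h3, h5⟩
    refine ⟨Function.update M (i + 1) m, (hr.trans ?_).tail (AlgStep.next _ _ hm2), ?_, ?_⟩
    · rw [hm']
      exact reach_raise n M i (h1 _ le_rfl) m' (by rwa [← hm'])
    · intro k hk
      rw [Function.update_of_ne (by omega), h1 k (by omega)]
    · intro k hk1 hk2
      have hc : ∀ l, Suffices n (Function.update M (i + 1) m) k l ↔ Suffices n M k l :=
        fun l => suffices_congr n l fun j hj => update_add_apply M m (by omega)
      rcases (show i + 1 ≤ k from hk1).eq_or_lt with rfl | hk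
      · simp only [IsLeastSufficient, hc, Function.update_self]
        exact ⟨hm1, hm2, hmin'⟩
      · simp only [IsLeastSufficient, hc, update_add_apply M m hk]
        exact hl k hk hk2

/-- The guards of the two kinds of step are complementary, so the algorithm is deterministic. -/
theorem algStep_rightUnique (n : ℕ) : Relator.RightUnique (AlgStep n) := by
  rintro _ b c hb hc
  cases hb with
  | raise i M h =>
    cases hc with
    | raise _ _ _ => rfl
    | next _ _ h' => omega
  | next i M h =>
    cases hc with
    | raise _ _ h' => omega
    | next _ _ _ => rfl

/-- Of two runs of a deterministic process from the same state one continues the other, and a state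
with index `0` has no successor. -/
theorem algOutput_unique (n : ℕ) {M M' : ℕ → ℕ} (h : AlgOutput n M) (h' : AlgOutput n M') :
    M' = M := by
  have key : ∀ {N N' : ℕ → ℕ}, Relation.ReflTransGen (AlgStep n) (0, N) (0, N') → N = N' := by
    intro N N' h
    rcases Relation.ReflTransGen.cases_head h with h | ⟨c, hc, -⟩
    · exact (Prod.mk.inj h).2
    · cases hc
  rcases Relation.ReflTransGen.total_of_right_unique (algStep_rightUnique n) h h' with h | h
  · exact (key h).symm
  · exact key h

variable {n : ℕ} {M : ℕ → ℕ}

/-- The surplus of free parameters. -/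
def surplus (n : ℕ) (M : ℕ → ℕ) (i : ℕ) : ℤ := numFree n M i - numFixed n M i

theorem surplus_eq (n : ℕ) (M : ℕ → ℕ) {i : ℕ} (hi : i ≤ n) :
    surplus n M i =
      surplus n M (i + 1) + weightA (M i) + M i * M (i + 1) - numFixed n M (i + 1) - M i := by
  rw [surplus, surplus, numFree_eq_add n M hi, numFixed_eq_add n M (i := i) (by omega)]
  push_cast
  ring

theorem suffices_iff_surplus (n : ℕ) (M : ℕ → ℕ) {i : ℕ} (m : ℕ) (hi : i ≤ n) :
    Suffices n M i m ↔ (numFixed n M (i + 1) : ℤ) + m ≤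
      surplus n M (i + 1) + weightA m + m * M (i + 1) := suffices_iff n M m hi

theorem IsLeastSufficient.eq_of {i m : ℕ} (h : IsLeastSufficient n M i) (hm : 1 ≤ m)
    (h1 : Suffices n M i m) (h2 : ∀ l, 1 ≤ l → l < m → ¬ Suffices n M i l) : M i = m := by
  rcases lt_trichotomy (M i) m with h3 | h3 | h3
  · exact absurd h.2.1 (h2 _ h.1 h3)
  · exact h3
  · exact absurd h1 (h.2.2 m hm h3)

/-- One level of the recursion with numerical data. All inequalities are doubled so that the
division in `weightA` disappears. -/
theorem IsLeastSufficient.next {i : ℕ} (h : IsLeastSufficient n M i) (hi : i ≤ n) (m : ℕ)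
    {m' B : ℕ} {L : ℤ} (h1 : M (i + 1) = m') (h2 : surplus n M (i + 1) = L)
    (h3 : numFixed n M (i + 1) = B) (hm : 1 ≤ m)
    (hs : 2 * (B : ℤ) + 2 * m ≤ 2 * L + m * (m + 1) + 2 * m * m')
    (hn : ∀ l < m, 1 ≤ l → 2 * L + l * (l + 1) + 2 * l * m' < 2 * (B : ℤ) + 2 * l) :
    M i = m ∧ 2 * surplus n M i = 2 * L + m * (m + 1) + 2 * m * m' - 2 * B - 2 * m ∧
      numFixed n M i = m + B := by
  have hMi : M i = m := by
    refine h.eq_of hm ?_ fun l hl1 hl2 => ?_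
    · rw [suffices_iff_surplus n M _ hi, h1, h2, h3]
      linarith [two_mul_weightA m]
    · rw [suffices_iff_surplus n M _ hi, h1, h2, h3]
      linarith [two_mul_weightA l, hn l hl2 hl1]
  refine ⟨hMi, ?_, ?_⟩
  · rw [surplus_eq n M hi, h1, h2, h3, hMi]
    linarith [two_mul_weightA m]
  · rw [numFixed_eq_add n M (by omega), h3, hMi]

/-- The recursion evaluated from the top. The pairs of `numFixed` and `surplus` are
$(1,0),(2,0),(4,1),(6,2),(8,1)$ at the indices $n+1,\dots,n-3$. -/
theorem multiplicity_values (hl : ∀ k, 1 ≤ k → k ≤ n + 1 → IsLeastSufficient n M k) :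
    M (n + 1) = 1 ∧ numFixed n M (n + 1) = 1 ∧ surplus n M (n + 1) = 0 ∧
    (1 ≤ n → M n = 1 ∧ numFixed n M n = 2 ∧ surplus n M n = 0) ∧
    ∀ d : Fin 6, (d : ℕ) ≤ n → M (n + 1 - d) = ![1, 1, 2, 2, 2, 3] d := by
  have e0 : M (n + 1) = 1 :=
    (hl (n + 1) (by omega) le_rfl).eq_of le_rfl (suffices_last n M) fun l h1 h2 => by omega
  have b0 : numFixed n M (n + 1) = 1 := by
    rw [numFixed_eq_add n M le_rfl, numFixed_of_lt n M (by omega), e0]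
  have l0 : surplus n M (n + 1) = 0 := by
    rw [surplus, numFree_last, b0, e0]; simp [weightA]
  have s1 : 1 ≤ n → M n = 1 ∧ numFixed n M n = 2 ∧ surplus n M n = 0 := by
    intro hn
    have := (hl n hn (by omega)).next (m := 1) le_rfl e0 l0 b0 (by omega) (by norm_num)
      (fun l h1 h2 => by omega)
    norm_num at this; exact ⟨this.1, this.2.2, this.2.1⟩
  have s2 : 2 ≤ n → M (n - 1) = 2 ∧ numFixed n M (n - 1) = 4 ∧ surplus n M (n - 1) = 1 := by
    intro hn
    have e : n - 1 + 1 = n := by omega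
    obtain ⟨h1, h2, h3⟩ := s1 (by omega)
    have := (hl (n - 1) (by omega) (by omega)).next (m := 2) (by omega) (by rw [e, h1])
      (by rw [e, h3]) (by rw [e, h2]) (by omega) (by norm_num)
      (fun l h1 h2 => by interval_cases l; norm_num)
    norm_num at this; exact ⟨this.1, this.2.2, by omega⟩
  have s3 : 3 ≤ n → M (n - 2) = 2 ∧ numFixed n M (n - 2) = 6 ∧ surplus n M (n - 2) = 2 := by
    intro hn
    have e : n - 2 + 1 = n - 1 := by omega
    obtain ⟨h1, h2, h3⟩ := s2 (by omega)
    have := (hl (n - 2) (by omega) (by omega)).next (m := 2) (by omega) (by rw [e, h1])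
      (by rw [e, h3]) (by rw [e, h2]) (by omega) (by norm_num)
      (fun l h1 h2 => by interval_cases l; norm_num)
    norm_num at this; exact ⟨this.1, this.2.2, by omega⟩
  have s4 : 4 ≤ n → M (n - 3) = 2 ∧ numFixed n M (n - 3) = 8 ∧ surplus n M (n - 3) = 1 := by
    intro hn
    have e : n - 3 + 1 = n - 2 := by omega
    obtain ⟨h1, h2, h3⟩ := s3 (by omega)
    have := (hl (n - 3) (by omega) (by omega)).next (m := 2) (by omega) (by rw [e, h1])
      (by rw [e, h3]) (by rw [e, h2]) (by omega) (by norm_num)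
      (fun l h1 h2 => by interval_cases l; norm_num)
    norm_num at this; exact ⟨this.1, this.2.2, by omega⟩
  have s5 : 5 ≤ n → M (n - 4) = 3 := by
    intro hn
    have e : n - 4 + 1 = n - 3 := by omega
    obtain ⟨h1, h2, h3⟩ := s4 (by omega)
    exact ((hl (n - 4) (by omega) (by omega)).next (m := 3) (by omega) (by rw [e, h1])
      (by rw [e, h3]) (by rw [e, h2]) (by omega) (by norm_num)
      (fun l h1 h2 => by interval_cases l <;> norm_num)).1
  refine ⟨e0, b0, l0, s1, ?_⟩
  intro d hd
  fin_cases d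
  · simpa using e0
  · simpa using (s1 hd).1
  · have := (s2 hd).1; simpa [show n + 1 - 2 = n - 1 by omega] using this
  · have := (s3 hd).1; simpa [show n + 1 - 3 = n - 2 by omega] using this
  · have := (s4 hd).1; simpa [show n + 1 - 4 = n - 3 by omega] using this
  · have := s5 hd; simpa [show n + 1 - 5 = n - 4 by omega] using this

/-- The multiplicity `1` suffices at `i - 1` exactly if `numFixed n M i ≤ surplus n M i + M i`. The
strict opposite inequality is therefore an invariant which excludes simple arrows below `n`; it is
propagated by the minimality of each multiplicity. -/
theorem surplus_add_lt (hl : ∀ k, 1 ≤ k → k ≤ n + 1 → IsLeastSufficient n M k) {i : ℕ}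
    (hi : i ≤ n) (h1 : 1 ≤ i) :
    surplus n M i + M i < numFixed n M i ∧ (i < n → 2 ≤ M i) := by
  obtain ⟨-, -, -, hn, -⟩ := multiplicity_values hl
  induction hi using Nat.decreasingInduction with
  | self =>
    obtain ⟨a, b, c⟩ := hn h1
    rw [a, b, c]; norm_num
  | of_succ i hi ih =>
    obtain ⟨ih1, -⟩ := ih (by omega)
    obtain ⟨hp, hs, hm⟩ := hl i h1 (by omega)
    have hsi : ∀ m, Suffices n M i m ↔ _ := fun m => suffices_iff_surplus n M m (by omega)
    have h2 : 2 ≤ M i := by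
      by_contra hcon
      have hMi : M i = 1 := by omega
      rw [hMi, hsi] at hs
      norm_num [weightA] at hs
      omega
    refine ⟨?_, fun _ => h2⟩
    have hp' : 1 ≤ M (i + 1) := (hl (i + 1) (by omega) (by omega)).1
    have hB : 1 + M (i + 1) ≤ numFixed n M (i + 1) := by
      rw [numFixed_eq_add n M (by omega), numFixed_eq_add n M (i := i + 1 + 1) (by omega)]
      have := (hl (i + 2) (by omega) (by omega)).1
      have e : i + 1 + 1 = i + 2 := rfl
      rw [e]
      omega
    have hL : 0 ≤ surplus n M (i + 1) := by
      have := (hl (i + 1) (by omega) (by omega)).2.1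
      rw [Suffices, Function.update_eq_self] at this
      rw [surplus]; omega
    -- Failure of the next smaller multiplicity bounds `numFixed n M (i + 1)` from below. Together
    -- with the bound `hB` this gives the invariant at `i`.
    have hmm := hm (M i - 1) (by omega) (by omega)
    rw [hsi, not_le] at hmm
    obtain ⟨a, ha⟩ : ∃ a, M i = a + 2 := ⟨M i - 2, by omega⟩
    have e1 : M i - 1 = a + 1 := by omega
    rw [e1] at hmm
    rw [surplus_eq n M (by omega), numFixed_eq_add n M (i := i) (by omega), ha]
    have hB2 : 1 + (M (i + 1) : ℤ) ≤ numFixed n M (i + 1) := by exact_mod_cast hB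
    have w1 := two_mul_weightA (a + 1)
    have w2 := two_mul_weightA (a + 2)
    push_cast at *
    generalize (weightA (a + 1) : ℤ) = W1 at *
    generalize (weightA (a + 2) : ℤ) = W2 at *
    generalize (numFixed n M (i + 1) : ℤ) = B at *
    generalize surplus n M (i + 1) = L at *
    have hp2 : (1 : ℤ) ≤ M (i + 1) := by exact_mod_cast hp'
    generalize (M (i + 1) : ℤ) = m at *
    have ha0 : (0 : ℤ) ≤ a := by positivity
    generalize (a : ℤ) = a at *
    nlinarith [mul_nonneg ha0 ha0, mul_nonneg ha0 (sub_nonneg.mpr hp2)]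

theorem exists_algOutput (n : ℕ) :
    ∃ M, AlgOutput n M ∧ (∀ i, 1 ≤ i → i ≤ n + 1 →
        1 ≤ M i ∧ (numFixed n M i : ℤ) ≤ numFree n M i) ∧
      (∀ d : Fin 6, (d : ℕ) ≤ n → M (n + 1 - d) = ![1, 1, 2, 2, 2, 3] d) ∧
      M (n + 1) = 1 ∧ (1 ≤ n → M n = 1) ∧ ∀ i, 1 ≤ i → i < n → 2 ≤ M i := by
  obtain ⟨M, hr, -, hl⟩ := exists_stage n (i := 0) (by omega)
  have hl' : ∀ k, 1 ≤ k → k ≤ n + 1 → IsLeastSufficient n M k := fun k h1 h2 => hl k h1 h2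
  obtain ⟨h0, -, -, h1, h6⟩ := multiplicity_values hl'
  refine ⟨M, hr, fun i hi1 hi2 => ⟨(hl' i hi1 hi2).1, ?_⟩, h6, h0, fun h => (h1 h).1,
    fun i hi1 hi2 => (surplus_add_lt hl' hi2.le hi1).2 hi2⟩
  have := (hl' i hi1 hi2).2.1
  rwa [Suffices, Function.update_eq_self] at this

end Algorithm


/-! ### Spinor operators between the spin representations -/

section Spinor

/-- A matrix with at most one entry in each column: the entry `c k` of the column `k` stands in
the row `g k`. -/
def shiftMat (p q : ℕ) (g : ℕ → ℕ) (c : ℕ → ℂ) : Matrix (Fin p) (Fin q) ℂ :=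
  Matrix.of fun r k => if (r : ℕ) = g k then c k else 0

/-- The row maps are functions on all natural numbers, so an intermediate index may leave its range.
The hypothesis asks that then the final row is out of range as well or the coefficient is zero. -/
theorem shiftMat_mul {p q s : ℕ} {g g' : ℕ → ℕ} {c c' : ℕ → ℂ}
    (h : ∀ k < s, q ≤ g' k → p ≤ g (g' k) ∨ c (g' k) * c' k = 0) :
    shiftMat p q g c * shiftMat q s g' c' =
      shiftMat p s (fun k => g (g' k)) fun k => c (g' k) * c' k := by
  ext r k
  simp only [Matrix.mul_apply, shiftMat, Matrix.of_apply]
  by_cases hk : g' k < q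
  · rw [Finset.sum_eq_single (⟨g' k, hk⟩ : Fin q)]
    · simp only [if_true]
      split_ifs <;> simp
    · intro b _ hb
      rw [if_neg fun hb' => hb (Fin.ext hb'), mul_zero]
    · simp
  · rw [Finset.sum_eq_zero]
    · rcases h k k.2 (not_lt.mp hk) with h | h
      · rw [if_neg (by omega)]
      · rw [h, ite_self]
    · intro b _
      rw [if_neg (show ¬((b : ℕ) = g' k) by omega), mul_zero]

/-- Row maps need not agree where the coefficient vanishes. This absorbs truncated subtraction at `k
= 0`. -/
theorem shiftMat_congr {p q : ℕ} {g g' : ℕ → ℕ} {c c' : ℕ → ℂ}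
    (hc : ∀ k < q, c k = c' k) (h : ∀ k < q, g k = g' k ∨ c' k = 0) :
    shiftMat p q g c = shiftMat p q g' c' := by
  ext r k
  simp only [shiftMat, Matrix.of_apply, hc k k.2]
  rcases h k k.2 with h | h <;> simp [h]

theorem shiftMat_sub {p q : ℕ} {g : ℕ → ℕ} {c c' : ℕ → ℂ} :
    shiftMat p q g c - shiftMat p q g c' = shiftMat p q g fun k => c k - c' k := by
  ext r k
  simp only [shiftMat, Matrix.of_apply, Matrix.sub_apply]
  split_ifs <;> simp

theorem shiftMat_add {p q : ℕ} {g : ℕ → ℕ} {c c' : ℕ → ℂ} :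
    shiftMat p q g c + shiftMat p q g c' = shiftMat p q g fun k => c k + c' k := by
  ext r k
  simp only [shiftMat, Matrix.of_apply, Matrix.add_apply]
  split_ifs <;> simp

theorem shiftMat_smul {p q : ℕ} {g : ℕ → ℕ} {c : ℕ → ℂ} (z : ℂ) :
    z • shiftMat p q g c = shiftMat p q g fun k => z * c k := by
  ext r k
  simp only [shiftMat, Matrix.of_apply, Matrix.smul_apply]
  split_ifs <;> simp

theorem shiftMat_neg {p q : ℕ} {g : ℕ → ℕ} {c : ℕ → ℂ} :
    -shiftMat p q g c = shiftMat p q g fun k => -c k := by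
  ext r k
  simp only [shiftMat, Matrix.of_apply, Matrix.neg_apply]
  split_ifs <;> simp

theorem shiftMat_zero {p q : ℕ} {g : ℕ → ℕ} {c : ℕ → ℂ} (h : ∀ k < q, c k = 0) :
    shiftMat p q g c = 0 := by
  ext r k
  simp [shiftMat, h k k.2]

theorem spinMinus_eq (a : ℕ) :
    spinMinus a = shiftMat (a + 1) (a + 1) (fun k => k + 1) fun k => (a : ℂ) - (k : ℂ) := rfl

/-- At `k = 0` the truncated row index `k - 1` is harmless because the coefficient is zero. -/
theorem spinPlus_eq (a : ℕ) :
    spinPlus a = shiftMat (a + 1) (a + 1) (fun k => k - 1) fun k => (k : ℂ) := by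
  ext r k
  simp only [spinPlus, shiftMat, Matrix.of_apply]
  rcases Nat.eq_zero_or_pos (k : ℕ) with h | h
  · simp [h]
  · simp only [show ((r : ℕ) + 1 = k) = ((r : ℕ) = k - 1) by rw [eq_iff_iff]; omega]

theorem spinZ_eq (a : ℕ) :
    spinZ a = shiftMat (a + 1) (a + 1) (fun k => k) fun k => (a : ℂ) / 2 - (k : ℂ) := by
  ext r k
  simp only [spinZ, shiftMat, Matrix.of_apply, Matrix.diagonal_apply, Fin.ext_iff]
  split_ifs with h <;> simp [h]

theorem one_eq_shiftMat (a : ℕ) :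
    (1 : Matrix (Fin (a + 1)) (Fin (a + 1)) ℂ) =
      shiftMat (a + 1) (a + 1) (fun k => k) fun _ => 1 := by
  ext r k
  simp only [shiftMat, Matrix.of_apply, Matrix.one_apply, Fin.ext_iff]

/-- The spinor of multiplications `(x, y)`. -/
def raiseOp (a : ℕ) : Fin 2 → Matrix (Fin (a + 1 + 1)) (Fin (a + 1)) ℂ :=
  ![shiftMat (a + 1 + 1) (a + 1) (fun k => k) fun _ => 1,
    shiftMat (a + 1 + 1) (a + 1) (fun k => k + 1) fun _ => 1]

/-- The spinor of derivations `(∂/∂y, -∂/∂x)`. -/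
def lowerOp (a : ℕ) : Fin 2 → Matrix (Fin (a + 1)) (Fin (a + 1 + 1)) ℂ :=
  ![shiftMat (a + 1) (a + 1 + 1) (fun k => k - 1) fun k => (k : ℂ),
    shiftMat (a + 1) (a + 1 + 1) (fun k => k) fun k => (k : ℂ) - (a + 1)]

theorem two_cases {k : ℕ} : k = 0 ∨ ∃ l, k = l + 1 := by
  rcases k with _ | k
  · exact .inl rfl
  · exact .inr ⟨k, rfl⟩

/-- Multiplication by $x$ and $y$ transforms as a spinor: for example $[x\partial_y,x]=0$ and
$[x\partial_y,y]=x$. -/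
theorem raiseOp_comm (a : ℕ) :
    (spinPlus (a + 1) * raiseOp a 0 - raiseOp a 0 * spinPlus a = 0 ∧
      spinPlus (a + 1) * raiseOp a 1 - raiseOp a 1 * spinPlus a = raiseOp a 0) ∧
    (spinMinus (a + 1) * raiseOp a 0 - raiseOp a 0 * spinMinus a = raiseOp a 1 ∧
      spinMinus (a + 1) * raiseOp a 1 - raiseOp a 1 * spinMinus a = 0) ∧
    (spinZ (a + 1) * raiseOp a 0 - raiseOp a 0 * spinZ a = (1 / 2 : ℂ) • raiseOp a 0 ∧
      spinZ (a + 1) * raiseOp a 1 - raiseOp a 1 * spinZ a = -(1 / 2 : ℂ) • raiseOp a 1) := by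
  simp only [spinPlus_eq, spinMinus_eq, spinZ_eq, raiseOp, Matrix.cons_val_zero,
    Matrix.cons_val_one]
  refine ⟨⟨?_, ?_⟩, ⟨?_, ?_⟩, ?_, ?_⟩
  · rw [shiftMat_mul (by intro k hk h; omega), shiftMat_mul (by intro k hk h; omega), shiftMat_sub,
      shiftMat_zero (by intro k hk; ring)]
  · rw [shiftMat_mul (by intro k hk h; omega), shiftMat_mul (by intro k hk h; omega),
      shiftMat_congr (g := fun k => k - 1 + 1) (g' := fun k => k + 1 - 1) (c' := fun k => 1 * (k : ℂ))
        (fun _ _ => rfl), shiftMat_sub]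
    · exact shiftMat_congr (by intro k hk; push_cast; ring) (by intro k hk; left; omega)
    · intro k hk
      rcases Nat.eq_zero_or_pos k with h | h
      · right; simp [h]
      · left; omega
  · rw [shiftMat_mul (by intro k hk h; omega), shiftMat_mul ?_, shiftMat_sub]
    · exact shiftMat_congr (by intro k hk; push_cast; ring) (by intro k hk; left; omega)
    · intro k hk h
      right
      have : k = a := by omega
      simp [this]
  · rw [shiftMat_mul (by intro k hk h; omega), shiftMat_mul ?_, shiftMat_sub,
      shiftMat_zero (by intro k hk; push_cast; ring)]
    · intro k hk h
      left
      omega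
  · rw [shiftMat_mul (by intro k hk h; omega), shiftMat_mul (by intro k hk h; omega), shiftMat_sub,
      shiftMat_smul]
    exact shiftMat_congr (by intro k hk; push_cast; ring) (by intro k hk; left; omega)
  · rw [shiftMat_mul (by intro k hk h; omega), shiftMat_mul (by intro k hk h; omega), shiftMat_sub,
      shiftMat_smul]
    exact shiftMat_congr (by intro k hk; push_cast; ring) (by intro k hk; left; omega)

/-- The sign in $(\partial_y,-\partial_x)$ is what makes the derivations transform by the same rule
as $(x,y)$. -/
theorem lowerOp_comm (a : ℕ) :
    (spinPlus a * lowerOp a 0 - lowerOp a 0 * spinPlus (a + 1) = 0 ∧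
      spinPlus a * lowerOp a 1 - lowerOp a 1 * spinPlus (a + 1) = lowerOp a 0) ∧
    (spinMinus a * lowerOp a 0 - lowerOp a 0 * spinMinus (a + 1) = lowerOp a 1 ∧
      spinMinus a * lowerOp a 1 - lowerOp a 1 * spinMinus (a + 1) = 0) ∧
    (spinZ a * lowerOp a 0 - lowerOp a 0 * spinZ (a + 1) = (1 / 2 : ℂ) • lowerOp a 0 ∧
      spinZ a * lowerOp a 1 - lowerOp a 1 * spinZ (a + 1) = -(1 / 2 : ℂ) • lowerOp a 1) := by
  simp only [spinPlus_eq, spinMinus_eq, spinZ_eq, lowerOp, Matrix.cons_val_zero,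
    Matrix.cons_val_one]
  refine ⟨⟨?_, ?_⟩, ⟨?_, ?_⟩, ?_, ?_⟩
  · rw [shiftMat_mul (by intro k hk h; omega), shiftMat_mul (by intro k hk h; omega), shiftMat_sub,
      shiftMat_zero (by intro k hk; ring)]
  · rw [shiftMat_mul, shiftMat_mul (by intro k hk h; omega), shiftMat_sub]
    · refine shiftMat_congr (by
        intro k hk
        rcases two_cases (k := k) with rfl | ⟨l, rfl⟩ <;> simp
        ring) (by
        intro k hk; left; omega)
    · intro k hk h
      right
      have : k = a + 1 := by omega
      simp [this]
  · rw [shiftMat_mul (by intro k hk h; omega), shiftMat_mul,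
      shiftMat_congr (g := fun k => k - 1 + 1) (g' := fun k => k)
        (c' := fun k => ((a : ℂ) - (k - 1)) * k),
      shiftMat_congr (g := fun k => k + 1 - 1) (g' := fun k => k)
        (c' := fun k => ((k : ℂ) + 1) * ((a : ℂ) + 1 - k)), shiftMat_sub]
    · exact shiftMat_congr (by intro k hk; push_cast; ring) (by intro k hk; left; omega)
    · intro k hk; push_cast; ring
    · intro k hk; left; omega
    · intro k hk
      rcases two_cases (k := k) with rfl | ⟨l, rfl⟩ <;> simp
    · intro k hk
      rcases two_cases (k := k) with rfl | ⟨l, rfl⟩ <;> simp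
    · intro k hk h
      right
      have : k = a + 1 := by omega
      simp [this]
  · rw [shiftMat_mul, shiftMat_mul ?_, shiftMat_sub,
      shiftMat_zero (by intro k hk; push_cast; ring)]
    · intro k hk h
      left
      omega
    · intro k hk h
      left
      omega
  · rw [shiftMat_mul (by intro k hk h; omega), shiftMat_mul (by intro k hk h; omega), shiftMat_sub,
      shiftMat_smul]
    refine shiftMat_congr (by
      intro k hk
      rcases two_cases (k := k) with rfl | ⟨l, rfl⟩ <;> push_cast
      · simp
      · simp; ring) (by intro k hk; left; omega)
  · rw [shiftMat_mul, shiftMat_mul (by intro k hk h; omega), shiftMat_sub,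
      shiftMat_smul]
    · exact shiftMat_congr (by intro k hk; push_cast; ring) (by intro k hk; left; omega)
    · intro k hk h
      right
      have : k = a + 1 := by omega
      simp [this]

/-- Products such as $\partial_y x=x\partial_y$ or $\partial_y y=1+y\partial_y$; on forms of degree
$a$ Euler's relation turns $y\partial_y$ into $a/2-J_z$. So every product is a constant plus a
component of the spin. -/
theorem lowerOp_mul_raiseOp (a : ℕ) :
    (lowerOp a 0 * raiseOp a 0 = spinPlus a ∧
      lowerOp a 0 * raiseOp a 1 = ((a : ℂ) / 2 + 1) • 1 - spinZ a) ∧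
    lowerOp a 1 * raiseOp a 0 = -((a : ℂ) / 2 + 1) • 1 - spinZ a ∧
      lowerOp a 1 * raiseOp a 1 = -spinMinus a := by
  simp only [spinPlus_eq, spinMinus_eq, spinZ_eq, lowerOp, raiseOp, Matrix.cons_val_zero,
    Matrix.cons_val_one, one_eq_shiftMat, shiftMat_smul, shiftMat_neg, shiftMat_sub]
  refine ⟨⟨?_, ?_⟩, ?_, ?_⟩ <;> rw [shiftMat_mul (by intro k hk h; omega)] <;>
    exact shiftMat_congr (by intro k hk; push_cast; ring) (by intro k hk; left; omega)

theorem raiseOp_mul_lowerOp (a : ℕ) :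
    (raiseOp a 0 * lowerOp a 0 = spinPlus (a + 1) ∧
      raiseOp a 0 * lowerOp a 1 = -(((a + 1 : ℕ) : ℂ) / 2) • 1 - spinZ (a + 1)) ∧
    raiseOp a 1 * lowerOp a 0 = (((a + 1 : ℕ) : ℂ) / 2) • 1 - spinZ (a + 1) ∧
      raiseOp a 1 * lowerOp a 1 = -spinMinus (a + 1) := by
  simp only [spinPlus_eq, spinMinus_eq, spinZ_eq, lowerOp, raiseOp, Matrix.cons_val_zero,
    Matrix.cons_val_one, one_eq_shiftMat, shiftMat_smul, shiftMat_neg, shiftMat_sub]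
  have h1 : ∀ k < a + 1 + 1, a + 1 ≤ k → k = a + 1 := by intro k h1 h2; omega
  refine ⟨⟨?_, ?_⟩, ?_, ?_⟩
  · rw [shiftMat_mul (by intro k hk h; omega)]
    exact shiftMat_congr (by intro k hk; push_cast; ring) (by intro k hk; left; omega)
  · rw [shiftMat_mul (by intro k hk h; right; simp [h1 k hk h])]
    exact shiftMat_congr (by intro k hk; push_cast; ring) (by intro k hk; left; omega)
  · rw [shiftMat_mul (by intro k hk h; omega)]
    exact shiftMat_congr (by intro k hk; push_cast; ring) (by
      intro k hk
      rcases two_cases (k := k) with rfl | ⟨l, rfl⟩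
      · right; push_cast; ring
      · left; omega)
  · rw [shiftMat_mul (by intro k hk h; right; simp [h1 k hk h])]
    exact shiftMat_congr (by intro k hk; push_cast; ring) (by intro k hk; left; omega)

/-- The derivations $\partial_x$ and $\partial_y$ commute. -/
theorem lowerOp_symm (a : ℕ) :
    lowerOp a 0 * lowerOp (a + 1) 1 = lowerOp a 1 * lowerOp (a + 1) 0 := by
  simp only [lowerOp, Matrix.cons_val_zero, Matrix.cons_val_one]
  rw [shiftMat_mul, shiftMat_mul (by intro k hk h; omega)]
  · refine shiftMat_congr ?_ (by intro k hk; left; omega)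
    intro k hk
    rcases two_cases (k := k) with rfl | ⟨l, rfl⟩ <;> simp
    ring
  · intro k hk h
    right
    have : k = a + 1 + 1 := by omega
    simp [this]

theorem spin_comm (a : ℕ) :
    spinPlus a * spinMinus a - spinMinus a * spinPlus a = (2 : ℂ) • spinZ a ∧
    spinZ a * spinPlus a - spinPlus a * spinZ a = spinPlus a ∧
    spinZ a * spinMinus a - spinMinus a * spinZ a = -spinMinus a := by
  simp only [spinPlus_eq, spinMinus_eq, spinZ_eq]
  have h1 : ∀ k < a + 1, a + 1 ≤ k + 1 → k = a := by intro k h1 h2; omega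
  refine ⟨?_, ?_, ?_⟩
  · rw [shiftMat_mul (by intro k hk h; right; simp [h1 k hk h]),
      shiftMat_mul (by intro k hk h; omega), shiftMat_smul,
      shiftMat_congr (g := fun k => k + 1 - 1) (g' := fun k => k)
        (c' := fun k => ((k : ℂ) + 1) * ((a : ℂ) - k)) (by intro k hk; push_cast; ring)
        (by intro k hk; left; omega),
      shiftMat_congr (g := fun k => k - 1 + 1) (g' := fun k => k)
        (c' := fun k => ((a : ℂ) - (k - 1)) * k), shiftMat_sub]
    · exact shiftMat_congr (by intro k hk; push_cast; ring) (by intro k hk; left; omega)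
    · intro k hk
      rcases two_cases (k := k) with rfl | ⟨l, rfl⟩ <;> simp
    · intro k hk
      rcases two_cases (k := k) with rfl | ⟨l, rfl⟩ <;> simp
  · rw [shiftMat_mul (by intro k hk h; omega), shiftMat_mul (by intro k hk h; omega), shiftMat_sub]
    refine shiftMat_congr ?_ (by intro k hk; left; omega)
    intro k hk
    rcases two_cases (k := k) with rfl | ⟨l, rfl⟩ <;> simp
    ring
  · rw [shiftMat_mul (by intro k hk h; left; omega), shiftMat_mul (by intro k hk h; omega),
      shiftMat_sub,
      shiftMat_neg]
    exact shiftMat_congr (by intro k hk; push_cast; ring) (by intro k hk; left; omega)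

theorem spin_casimir (a : ℕ) :
    spinPlus a * spinMinus a + spinMinus a * spinPlus a + (2 : ℂ) • (spinZ a * spinZ a) =
      ((a : ℂ) * (a + 2) / 2) • 1 := by
  simp only [spinPlus_eq, spinMinus_eq, spinZ_eq, one_eq_shiftMat]
  have h1 : ∀ k < a + 1, a + 1 ≤ k + 1 → k = a := by intro k h1 h2; omega
  rw [shiftMat_mul (by intro k hk h; right; simp [h1 k hk h]),
      shiftMat_mul (by intro k hk h; omega), shiftMat_smul,
      shiftMat_congr (g := fun k => k + 1 - 1) (g' := fun k => k)
        (c' := fun k => ((k : ℂ) + 1) * ((a : ℂ) - k)) (by intro k hk; push_cast; ring)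
        (by intro k hk; left; omega),
      shiftMat_congr (g := fun k => k - 1 + 1) (g' := fun k => k)
        (c' := fun k => ((a : ℂ) - (k - 1)) * k), shiftMat_add, shiftMat_mul, shiftMat_smul,
      shiftMat_add]
  · exact shiftMat_congr (by intro k hk; push_cast; ring) (by intro k hk; left; omega)
  · intro k hk h; omega
  · intro k hk
    rcases two_cases (k := k) with rfl | ⟨l, rfl⟩ <;> simp
  · intro k hk
    rcases two_cases (k := k) with rfl | ⟨l, rfl⟩ <;> simp

/-- The squared norm of the monomial `x^(a-k) y^k` in the invariant inner product. -/
def weight (a k : ℕ) : ℝ := (k.factorial : ℝ) * ((a - k).factorial : ℝ)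

theorem weight_pos (a k : ℕ) : 0 < weight a k := by
  unfold weight; positivity

/-- The Gram matrix of the invariant inner product on the spin-`a/2` representation. -/
def gram (a : ℕ) : Matrix (Fin (a + 1)) (Fin (a + 1)) ℂ :=
  Matrix.diagonal fun k => (weight a k : ℂ)

/-- With $\|x^{a-k}y^k\|^2=(a-k)!\,k!$ multiplication by a variable is adjoint to the derivation
with respect to it. The minus sign comes from `lowerOp a 1` being $-\partial_x$. -/
theorem raiseOp_adjoint (a : ℕ) :
    (gram (a + 1) * raiseOp a 0)ᴴ = -(gram a * lowerOp a 1) ∧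
      (gram (a + 1) * raiseOp a 1)ᴴ = gram a * lowerOp a 0 := by
  constructor
  · ext r k
    simp only [Matrix.conjTranspose_apply, gram, Matrix.diagonal_mul, raiseOp, lowerOp,
      Matrix.cons_val_zero, Matrix.cons_val_one, shiftMat, Matrix.of_apply, Matrix.neg_apply]
    by_cases h : (k : ℕ) = r
    · have hr : (r : ℕ) < a + 1 := r.2
      obtain ⟨b, hb⟩ : ∃ b, a = r + b := ⟨a - r, by omega⟩
      have e1 : a + 1 - (r : ℕ) = b + 1 := by omega
      have e2 : a - (r : ℕ) = b := by omega
      have e3 : (a : ℂ) = (r : ℕ) + b := by exact_mod_cast congrArg (Nat.cast : ℕ → ℂ) hb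
      simp only [h, if_true, weight, e1, e2, Nat.factorial_succ, e3]
      simp
      ring
    · rw [if_neg h, if_neg (Ne.symm h)]; simp
  · ext r k
    simp only [Matrix.conjTranspose_apply, gram, Matrix.diagonal_mul, raiseOp, lowerOp,
      Matrix.cons_val_zero, Matrix.cons_val_one, shiftMat, Matrix.of_apply]
    by_cases h : (k : ℕ) = r + 1
    · have e1 : a + 1 - ((r : ℕ) + 1) = a - r := by omega
      simp only [h, if_true, weight, e1, Nat.factorial_succ, Nat.add_sub_cancel]
      simp
      ring
    · rw [if_neg h]
      rcases Nat.eq_zero_or_pos (k : ℕ) with h0 | h0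
      · simp [h0]
      · rw [if_neg (by omega)]; simp

/-- In this inner product $x\partial_y$ and $y\partial_x$ are adjoint to each other, hence the three
spin components are self-adjoint. -/
theorem gram_comm_spin (a : ℕ) (k : Fin 3) : (spin a k)ᴴ * gram a = gram a * spin a k := by
  have hp : (spinPlus a)ᴴ * gram a = gram a * spinMinus a := by
    ext r k
    simp only [Matrix.conjTranspose_apply, gram, Matrix.diagonal_mul, Matrix.mul_diagonal,
      spinPlus, spinMinus, Matrix.of_apply]
    by_cases h : (k : ℕ) + 1 = r
    · have hr : (r : ℕ) < a + 1 := r.2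
      obtain ⟨b, hb⟩ : ∃ b, a = r + b := ⟨a - r, by omega⟩
      have e1 : a - (k : ℕ) = b + 1 := by omega
      have e2 : a - (r : ℕ) = b := by omega
      have e3 : (a : ℂ) = (k : ℕ) + 1 + b := by
        exact_mod_cast congrArg (Nat.cast : ℕ → ℂ) (show a = k + 1 + b by omega)
      have e4 : (r : ℕ) = k + 1 := h.symm
      simp only [weight, e1, e2, e3]
      simp only [e4, Nat.factorial_succ, if_true]
      simp
      ring
    · rw [if_neg h, if_neg fun h' => h (by omega)]; simp
  have hm : (spinMinus a)ᴴ * gram a = gram a * spinPlus a := by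
    have := congrArg Matrix.conjTranspose hp
    have hg : (gram a)ᴴ = gram a := by
      rw [gram, Matrix.diagonal_conjTranspose]
      congr 1
      ext k
      simp
    rw [Matrix.conjTranspose_mul, Matrix.conjTranspose_mul, hg,
      Matrix.conjTranspose_conjTranspose] at this
    exact this.symm
  have hz : (spinZ a)ᴴ * gram a = gram a * spinZ a := by
    rw [spinZ, gram, Matrix.diagonal_conjTranspose, Matrix.diagonal_mul_diagonal,
      Matrix.diagonal_mul_diagonal]
    congr 1
    ext k
    simp [mul_comm]
  fin_cases k
  · simp [spin, Matrix.add_mul, Matrix.mul_add, hp, hm, add_comm]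
  · simp [spin, Matrix.sub_mul, Matrix.mul_sub, hp, hm]
    module
  · simpa [spin] using hz

end Spinor


/-! ### Vector operators between irreducible representations -/

section VectorOp

/-- The spinor operator from spin `a/2` to spin `a'/2`; it vanishes unless `|a' - a| = 1`. -/
def spinorOp (a' a : ℕ) (A : Fin 2) : Matrix (Fin (a' + 1)) (Fin (a + 1)) ℂ :=
  if a' = a + 1 then
    ![shiftMat (a' + 1) (a + 1) (fun k => k) fun _ => 1,
      shiftMat (a' + 1) (a + 1) (fun k => k + 1) fun _ => 1] A
  else if a = a' + 1 then
    ![shiftMat (a' + 1) (a + 1) (fun k => k - 1) fun k => (k : ℂ),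
      shiftMat (a' + 1) (a + 1) (fun k => k) fun k => (k : ℂ) - (a' + 1)] A
  else 0

theorem spinorOp_raise (a : ℕ) : spinorOp (a + 1) a = raiseOp a := by
  funext A
  simp [spinorOp, raiseOp]

theorem spinorOp_lower (a : ℕ) : spinorOp a (a + 1) = lowerOp a := by
  funext A
  simp [spinorOp, lowerOp, show a ≠ a + 1 + 1 by omega]

theorem spinorOp_of_ne {a' a : ℕ} (h : a' ≠ a + 1) (h' : a ≠ a' + 1) : spinorOp a' a = 0 := by
  funext A
  simp [spinorOp, h, h']

theorem spinorOp_comm (a' a : ℕ) :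
    (spinPlus a' * spinorOp a' a 0 - spinorOp a' a 0 * spinPlus a = 0 ∧
      spinPlus a' * spinorOp a' a 1 - spinorOp a' a 1 * spinPlus a = spinorOp a' a 0) ∧
    (spinMinus a' * spinorOp a' a 0 - spinorOp a' a 0 * spinMinus a = spinorOp a' a 1 ∧
      spinMinus a' * spinorOp a' a 1 - spinorOp a' a 1 * spinMinus a = 0) ∧
    (spinZ a' * spinorOp a' a 0 - spinorOp a' a 0 * spinZ a = (1 / 2 : ℂ) • spinorOp a' a 0 ∧
      spinZ a' * spinorOp a' a 1 - spinorOp a' a 1 * spinZ a =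
        -(1 / 2 : ℂ) • spinorOp a' a 1) := by
  by_cases h : a' = a + 1
  · subst h
    rw [spinorOp_raise]
    exact raiseOp_comm a
  · by_cases h' : a = a' + 1
    · subst h'
      rw [spinorOp_lower]
      exact lowerOp_comm a'
    · simp [spinorOp_of_ne h h']

/-- The transformation of the spinor operators under rotations. -/
theorem spinorOp_mul_spin (a' a : ℕ) :
    (spinorOp a' a 0 * spin a 0 = spin a' 0 * spinorOp a' a 0 - (1 / 2 : ℂ) • spinorOp a' a 1 ∧
      spinorOp a' a 1 * spin a 0 = spin a' 0 * spinorOp a' a 1 - (1 / 2 : ℂ) • spinorOp a' a 0) ∧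
    (spinorOp a' a 0 * spin a 1 =
        spin a' 1 * spinorOp a' a 0 - (Complex.I / 2) • spinorOp a' a 1 ∧
      spinorOp a' a 1 * spin a 1 =
        spin a' 1 * spinorOp a' a 1 + (Complex.I / 2) • spinorOp a' a 0) ∧
    (spinorOp a' a 0 * spin a 2 = spin a' 2 * spinorOp a' a 0 - (1 / 2 : ℂ) • spinorOp a' a 0 ∧
      spinorOp a' a 1 * spin a 2 =
        spin a' 2 * spinorOp a' a 1 + (1 / 2 : ℂ) • spinorOp a' a 1) := by
  obtain ⟨⟨h1, h2⟩, ⟨h3, h4⟩, h5, h6⟩ := spinorOp_comm a' a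
  rw [sub_eq_iff_eq_add] at h1 h2 h3 h4 h5 h6
  have hI : (1 / (2 * Complex.I) : ℂ) = -(Complex.I / 2) := by
    field_simp
    simp [Complex.I_sq]
  simp only [spin, Matrix.cons_val_zero, Matrix.cons_val_one, Matrix.cons_val, hI,
    Matrix.mul_smul, Matrix.smul_mul, Matrix.mul_add, Matrix.add_mul, Matrix.mul_sub,
    Matrix.sub_mul, h1, h2, h3, h4, h5, h6]
  refine ⟨⟨?_, ?_⟩, ⟨?_, ?_⟩, ?_, ?_⟩ <;> module

variable (τ'' τ' τ : LorentzLabel)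

/-- The four components of a vector operator, in spinor notation. -/
def bispinorOp (A B : Fin 2) : Matrix τ'.Carrier τ.Carrier ℂ :=
  spinorOp τ'.twoJ₁ τ.twoJ₁ A ⊗ₖ spinorOp τ'.twoJ₂ τ.twoJ₂ B

/-- The first summand of the rotation generators. -/
def leftSpin (k : Fin 3) : Matrix τ.Carrier τ.Carrier ℂ := spin τ.twoJ₁ k ⊗ₖ 1

/-- The second summand of the rotation generators. -/
def rightSpin (k : Fin 3) : Matrix τ.Carrier τ.Carrier ℂ := 1 ⊗ₖ spin τ.twoJ₂ k

theorem rotGen_eq (k : Fin 3) : rotGen τ k = leftSpin τ k + rightSpin τ k := rfl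

theorem boostGen_eq (k : Fin 3) :
    boostGen τ k = Complex.I • (leftSpin τ k - rightSpin τ k) := rfl

theorem bispinorOp_mul_leftSpin (A B : Fin 2) (k : Fin 3) :
    bispinorOp τ' τ A B * leftSpin τ k =
      (spinorOp τ'.twoJ₁ τ.twoJ₁ A * spin τ.twoJ₁ k) ⊗ₖ spinorOp τ'.twoJ₂ τ.twoJ₂ B := by
  rw [bispinorOp, leftSpin, ← Matrix.mul_kronecker_mul, Matrix.mul_one]

theorem bispinorOp_mul_rightSpin (A B : Fin 2) (k : Fin 3) :
    bispinorOp τ' τ A B * rightSpin τ k =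
      spinorOp τ'.twoJ₁ τ.twoJ₁ A ⊗ₖ (spinorOp τ'.twoJ₂ τ.twoJ₂ B * spin τ.twoJ₂ k) := by
  rw [bispinorOp, rightSpin, ← Matrix.mul_kronecker_mul, Matrix.mul_one]

theorem leftSpin_mul_bispinorOp (A B : Fin 2) (k : Fin 3) :
    leftSpin τ' k * bispinorOp τ' τ A B =
      (spin τ'.twoJ₁ k * spinorOp τ'.twoJ₁ τ.twoJ₁ A) ⊗ₖ spinorOp τ'.twoJ₂ τ.twoJ₂ B := by
  rw [bispinorOp, leftSpin, ← Matrix.mul_kronecker_mul, Matrix.one_mul]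

theorem rightSpin_mul_bispinorOp (A B : Fin 2) (k : Fin 3) :
    rightSpin τ' k * bispinorOp τ' τ A B =
      spinorOp τ'.twoJ₁ τ.twoJ₁ A ⊗ₖ (spin τ'.twoJ₂ k * spinorOp τ'.twoJ₂ τ.twoJ₂ B) := by
  rw [bispinorOp, rightSpin, ← Matrix.mul_kronecker_mul, Matrix.one_mul]

theorem sub_kron {l m n p : Type*} (A A' : Matrix l m ℂ) (B : Matrix n p ℂ) :
    (A - A') ⊗ₖ B = A ⊗ₖ B - A' ⊗ₖ B := by
  ext; simp [sub_mul]

theorem kron_sub {l m n p : Type*} (A : Matrix l m ℂ) (B B' : Matrix n p ℂ) :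
    A ⊗ₖ (B - B') = A ⊗ₖ B - A ⊗ₖ B' := by
  ext; simp [mul_sub]

theorem neg_kron {l m n p : Type*} (A : Matrix l m ℂ) (B : Matrix n p ℂ) :
    (-A) ⊗ₖ B = -(A ⊗ₖ B) := by
  ext; simp

theorem kron_neg {l m n p : Type*} (A : Matrix l m ℂ) (B : Matrix n p ℂ) :
    A ⊗ₖ (-B) = -(A ⊗ₖ B) := by
  ext; simp

theorem bispinorOp_left (B : Fin 2) :
    (bispinorOp τ' τ 0 B * leftSpin τ 0 =
        leftSpin τ' 0 * bispinorOp τ' τ 0 B - (1 / 2 : ℂ) • bispinorOp τ' τ 1 B ∧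
      bispinorOp τ' τ 1 B * leftSpin τ 0 =
        leftSpin τ' 0 * bispinorOp τ' τ 1 B - (1 / 2 : ℂ) • bispinorOp τ' τ 0 B) ∧
    (bispinorOp τ' τ 0 B * leftSpin τ 1 =
        leftSpin τ' 1 * bispinorOp τ' τ 0 B - (Complex.I / 2) • bispinorOp τ' τ 1 B ∧
      bispinorOp τ' τ 1 B * leftSpin τ 1 =
        leftSpin τ' 1 * bispinorOp τ' τ 1 B + (Complex.I / 2) • bispinorOp τ' τ 0 B) ∧
    (bispinorOp τ' τ 0 B * leftSpin τ 2 =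
        leftSpin τ' 2 * bispinorOp τ' τ 0 B - (1 / 2 : ℂ) • bispinorOp τ' τ 0 B ∧
      bispinorOp τ' τ 1 B * leftSpin τ 2 =
        leftSpin τ' 2 * bispinorOp τ' τ 1 B + (1 / 2 : ℂ) • bispinorOp τ' τ 1 B) := by
  obtain ⟨⟨h1, h2⟩, ⟨h3, h4⟩, h5, h6⟩ := spinorOp_mul_spin τ'.twoJ₁ τ.twoJ₁
  simp only [bispinorOp_mul_leftSpin, leftSpin_mul_bispinorOp, h1, h2, h3, h4, h5, h6, sub_kron,
    Matrix.add_kronecker, Matrix.smul_kronecker]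
  simp only [bispinorOp, and_self]

theorem bispinorOp_right (A : Fin 2) :
    (bispinorOp τ' τ A 0 * rightSpin τ 0 =
        rightSpin τ' 0 * bispinorOp τ' τ A 0 - (1 / 2 : ℂ) • bispinorOp τ' τ A 1 ∧
      bispinorOp τ' τ A 1 * rightSpin τ 0 =
        rightSpin τ' 0 * bispinorOp τ' τ A 1 - (1 / 2 : ℂ) • bispinorOp τ' τ A 0) ∧
    (bispinorOp τ' τ A 0 * rightSpin τ 1 =
        rightSpin τ' 1 * bispinorOp τ' τ A 0 - (Complex.I / 2) • bispinorOp τ' τ A 1 ∧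
      bispinorOp τ' τ A 1 * rightSpin τ 1 =
        rightSpin τ' 1 * bispinorOp τ' τ A 1 + (Complex.I / 2) • bispinorOp τ' τ A 0) ∧
    (bispinorOp τ' τ A 0 * rightSpin τ 2 =
        rightSpin τ' 2 * bispinorOp τ' τ A 0 - (1 / 2 : ℂ) • bispinorOp τ' τ A 0 ∧
      bispinorOp τ' τ A 1 * rightSpin τ 2 =
        rightSpin τ' 2 * bispinorOp τ' τ A 1 + (1 / 2 : ℂ) • bispinorOp τ' τ A 1) := by
  obtain ⟨⟨h1, h2⟩, ⟨h3, h4⟩, h5, h6⟩ := spinorOp_mul_spin τ'.twoJ₂ τ.twoJ₂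
  simp only [bispinorOp_mul_rightSpin, rightSpin_mul_bispinorOp, h1, h2, h3, h4, h5, h6, kron_sub,
    Matrix.kronecker_add, Matrix.kronecker_smul]
  simp only [bispinorOp, and_self]

/-- The rotation-invariant component of the vector operator. -/
def singletOp : Matrix τ'.Carrier τ.Carrier ℂ := bispinorOp τ' τ 0 1 - bispinorOp τ' τ 1 0

/-- The vector operator from `τ` to `τ'`, unique up to a factor. -/
def vectorOp : Fin 4 → Matrix τ'.Carrier τ.Carrier ℂ :=
  ![singletOp τ' τ,
    bispinorOp τ' τ 0 0 - bispinorOp τ' τ 1 1,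
    -Complex.I • (bispinorOp τ' τ 0 0 + bispinorOp τ' τ 1 1),
    -(bispinorOp τ' τ 0 1 + bispinorOp τ' τ 1 0)]

/-- Under the diagonal rotations a pair of spinors decomposes into a singlet, which is the time
component, and a triplet, which is the space part. -/
theorem vectorOp_mul_rotGen :
    (vectorOp τ' τ 0 * rotGen τ 0 = rotGen τ' 0 * vectorOp τ' τ 0 ∧
      vectorOp τ' τ 0 * rotGen τ 1 = rotGen τ' 1 * vectorOp τ' τ 0 ∧
      vectorOp τ' τ 0 * rotGen τ 2 = rotGen τ' 2 * vectorOp τ' τ 0) ∧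
    (vectorOp τ' τ 1 * rotGen τ 0 = rotGen τ' 0 * vectorOp τ' τ 1 ∧
      vectorOp τ' τ 1 * rotGen τ 1 =
        rotGen τ' 1 * vectorOp τ' τ 1 + Complex.I • vectorOp τ' τ 3 ∧
      vectorOp τ' τ 1 * rotGen τ 2 =
        rotGen τ' 2 * vectorOp τ' τ 1 - Complex.I • vectorOp τ' τ 2) ∧
    (vectorOp τ' τ 2 * rotGen τ 0 =
        rotGen τ' 0 * vectorOp τ' τ 2 - Complex.I • vectorOp τ' τ 3 ∧
      vectorOp τ' τ 2 * rotGen τ 1 = rotGen τ' 1 * vectorOp τ' τ 2 ∧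
      vectorOp τ' τ 2 * rotGen τ 2 =
        rotGen τ' 2 * vectorOp τ' τ 2 + Complex.I • vectorOp τ' τ 1) ∧
    (vectorOp τ' τ 3 * rotGen τ 0 =
        rotGen τ' 0 * vectorOp τ' τ 3 + Complex.I • vectorOp τ' τ 2 ∧
      vectorOp τ' τ 3 * rotGen τ 1 =
        rotGen τ' 1 * vectorOp τ' τ 3 - Complex.I • vectorOp τ' τ 1 ∧
      vectorOp τ' τ 3 * rotGen τ 2 = rotGen τ' 2 * vectorOp τ' τ 3) := by
  obtain ⟨⟨a1, a2⟩, ⟨a3, a4⟩, a5, a6⟩ := bispinorOp_left τ' τ 0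
  obtain ⟨⟨b1, b2⟩, ⟨b3, b4⟩, b5, b6⟩ := bispinorOp_left τ' τ 1
  obtain ⟨⟨c1, c2⟩, ⟨c3, c4⟩, c5, c6⟩ := bispinorOp_right τ' τ 0
  obtain ⟨⟨d1, d2⟩, ⟨d3, d4⟩, d5, d6⟩ := bispinorOp_right τ' τ 1
  simp only [vectorOp, singletOp, rotGen_eq, Matrix.cons_val_zero, Matrix.cons_val_one,
    Matrix.cons_val, Matrix.mul_add, Matrix.add_mul, Matrix.mul_sub, Matrix.sub_mul,
    Matrix.mul_smul, Matrix.smul_mul, Matrix.mul_neg, Matrix.neg_mul,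
    a1, a2, a3, a4, a5, a6, b1, b2, b3, b4, b5, b6, c1, c2, c3, c4, c5, c6, d1, d2, d3, d4, d5, d6]
  refine ⟨⟨?_, ?_, ?_⟩, ⟨?_, ?_, ?_⟩, ⟨?_, ?_, ?_⟩, ⟨?_, ?_, ?_⟩⟩ <;>
    (try simp only [smul_sub, smul_add, smul_neg, smul_smul]) <;> ring_nf <;>
    (try simp only [Complex.I_sq, Complex.I_pow_three]) <;> module

/-- The boosts act with opposite signs on the two spinor indices and therefore mix the singlet with
the triplet. -/
theorem vectorOp_mul_boostGen :
    (vectorOp τ' τ 0 * boostGen τ 0 =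
        boostGen τ' 0 * vectorOp τ' τ 0 + Complex.I • vectorOp τ' τ 1 ∧
      vectorOp τ' τ 0 * boostGen τ 1 =
        boostGen τ' 1 * vectorOp τ' τ 0 + Complex.I • vectorOp τ' τ 2 ∧
      vectorOp τ' τ 0 * boostGen τ 2 =
        boostGen τ' 2 * vectorOp τ' τ 0 + Complex.I • vectorOp τ' τ 3) ∧
    (vectorOp τ' τ 1 * boostGen τ 0 =
        boostGen τ' 0 * vectorOp τ' τ 1 + Complex.I • vectorOp τ' τ 0 ∧
      vectorOp τ' τ 1 * boostGen τ 1 = boostGen τ' 1 * vectorOp τ' τ 1 ∧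
      vectorOp τ' τ 1 * boostGen τ 2 = boostGen τ' 2 * vectorOp τ' τ 1) ∧
    (vectorOp τ' τ 2 * boostGen τ 0 = boostGen τ' 0 * vectorOp τ' τ 2 ∧
      vectorOp τ' τ 2 * boostGen τ 1 =
        boostGen τ' 1 * vectorOp τ' τ 2 + Complex.I • vectorOp τ' τ 0 ∧
      vectorOp τ' τ 2 * boostGen τ 2 = boostGen τ' 2 * vectorOp τ' τ 2) ∧
    (vectorOp τ' τ 3 * boostGen τ 0 = boostGen τ' 0 * vectorOp τ' τ 3 ∧
      vectorOp τ' τ 3 * boostGen τ 1 = boostGen τ' 1 * vectorOp τ' τ 3 ∧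
      vectorOp τ' τ 3 * boostGen τ 2 =
        boostGen τ' 2 * vectorOp τ' τ 3 + Complex.I • vectorOp τ' τ 0) := by
  obtain ⟨⟨a1, a2⟩, ⟨a3, a4⟩, a5, a6⟩ := bispinorOp_left τ' τ 0
  obtain ⟨⟨b1, b2⟩, ⟨b3, b4⟩, b5, b6⟩ := bispinorOp_left τ' τ 1
  obtain ⟨⟨c1, c2⟩, ⟨c3, c4⟩, c5, c6⟩ := bispinorOp_right τ' τ 0
  obtain ⟨⟨d1, d2⟩, ⟨d3, d4⟩, d5, d6⟩ := bispinorOp_right τ' τ 1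
  simp only [vectorOp, singletOp, boostGen_eq, Matrix.cons_val_zero, Matrix.cons_val_one,
    Matrix.cons_val, Matrix.mul_add, Matrix.add_mul, Matrix.mul_sub, Matrix.sub_mul,
    Matrix.mul_smul, Matrix.smul_mul, Matrix.mul_neg, Matrix.neg_mul,
    a1, a2, a3, a4, a5, a6, b1, b2, b3, b4, b5, b6, c1, c2, c3, c4, c5, c6, d1, d2, d3, d4, d5, d6]
  refine ⟨⟨?_, ?_, ?_⟩, ⟨?_, ?_, ?_⟩, ⟨?_, ?_, ?_⟩, ⟨?_, ?_, ?_⟩⟩ <;>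
    (try simp only [smul_sub, smul_add, smul_neg, smul_smul]) <;> ring_nf <;>
    (try simp only [Complex.I_sq, Complex.I_pow_three]) <;> module

theorem vectorOp_isVector (γ α β : Fin 4) :
    vectorOp τ' τ γ * irrepGen τ α β - irrepGen τ' α β * vectorOp τ' τ γ =
      (Complex.I * (mink γ α : ℂ)) • vectorOp τ' τ β -
        (Complex.I * (mink γ β : ℂ)) • vectorOp τ' τ α := by
  obtain ⟨⟨r1, r2, r3⟩, ⟨r4, r5, r6⟩, ⟨r7, r8, r9⟩, r10, r11, r12⟩ := vectorOp_mul_rotGen τ' τ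
  obtain ⟨⟨b1, b2, b3⟩, ⟨b4, b5, b6⟩, ⟨b7, b8, b9⟩, b10, b11, b12⟩ := vectorOp_mul_boostGen τ' τ
  fin_cases γ <;> fin_cases α <;> fin_cases β <;>
    simp [irrepGen, mink, r1, r2, r3, r4, r5, r6, r7, r8, r9, r10, r11, r12,
      b1, b2, b3, b4, b5, b6, b7, b8, b9, b10, b11, b12]

end VectorOp


/-! ### The algebra of the rotation-invariant operators -/

section Singlet

theorem spin_lie (a : ℕ) :
    spin a 0 * spin a 1 - spin a 1 * spin a 0 = Complex.I • spin a 2 ∧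
    spin a 1 * spin a 2 - spin a 2 * spin a 1 = Complex.I • spin a 0 ∧
    spin a 2 * spin a 0 - spin a 0 * spin a 2 = Complex.I • spin a 1 := by
  obtain ⟨h1, h2, h3⟩ := spin_comm a
  rw [sub_eq_iff_eq_add] at h1 h2 h3
  have hI : (1 / (2 * Complex.I) : ℂ) = -(Complex.I / 2) := by
    field_simp
    simp [Complex.I_sq]
  simp only [spin, Matrix.cons_val_zero, Matrix.cons_val_one, Matrix.cons_val, hI,
    Matrix.mul_smul, Matrix.smul_mul, Matrix.mul_add, Matrix.add_mul, Matrix.mul_sub,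
    Matrix.sub_mul, h1, h2, h3]
  refine ⟨?_, ?_, ?_⟩ <;>
    (try simp only [smul_sub, smul_add, smul_smul]) <;> ring_nf <;>
    (try simp only [Complex.I_sq]) <;> module

theorem spin_sq (a : ℕ) :
    spin a 0 * spin a 0 + spin a 1 * spin a 1 + spin a 2 * spin a 2 =
      ((a : ℂ) * (a + 2) / 4) • 1 := by
  have h := congrArg (fun M => (1 / 2 : ℂ) • M) (spin_casimir a)
  have hI : (1 / (2 * Complex.I) : ℂ) = -(Complex.I / 2) := by
    field_simp
    simp [Complex.I_sq]
  simp only [smul_add, smul_smul] at h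
  rw [show (a : ℂ) * (a + 2) / 4 = 1 / 2 * ((a : ℂ) * (a + 2) / 2) by ring, ← h]
  simp only [spin, Matrix.cons_val_zero, Matrix.cons_val_one, Matrix.cons_val, hI,
    Matrix.mul_smul, Matrix.smul_mul, Matrix.mul_add, Matrix.add_mul, Matrix.mul_sub,
    Matrix.sub_mul]
  simp only [smul_sub, smul_add, smul_smul]
  ring_nf
  simp only [Complex.I_sq]
  module

variable (τ'' τ' τ : LorentzLabel)

theorem leftSpin_mul_rightSpin (k l : Fin 3) :
    leftSpin τ k * rightSpin τ l = spin τ.twoJ₁ k ⊗ₖ spin τ.twoJ₂ l := by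
  rw [leftSpin, rightSpin, ← Matrix.mul_kronecker_mul, Matrix.mul_one, Matrix.one_mul]

theorem rightSpin_mul_leftSpin (k l : Fin 3) :
    rightSpin τ l * leftSpin τ k = leftSpin τ k * rightSpin τ l := by
  rw [leftSpin_mul_rightSpin, leftSpin, rightSpin, ← Matrix.mul_kronecker_mul, Matrix.mul_one,
    Matrix.one_mul]

theorem leftSpin_lie :
    leftSpin τ 0 * leftSpin τ 1 - leftSpin τ 1 * leftSpin τ 0 = Complex.I • leftSpin τ 2 ∧
    leftSpin τ 1 * leftSpin τ 2 - leftSpin τ 2 * leftSpin τ 1 = Complex.I • leftSpin τ 0 ∧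
    leftSpin τ 2 * leftSpin τ 0 - leftSpin τ 0 * leftSpin τ 2 = Complex.I • leftSpin τ 1 := by
  obtain ⟨h1, h2, h3⟩ := spin_lie τ.twoJ₁
  simp only [leftSpin, ← Matrix.mul_kronecker_mul, ← sub_kron, Matrix.one_mul, h1, h2, h3,
    Matrix.smul_kronecker, and_self]

theorem rightSpin_lie :
    rightSpin τ 0 * rightSpin τ 1 - rightSpin τ 1 * rightSpin τ 0 = Complex.I • rightSpin τ 2 ∧
    rightSpin τ 1 * rightSpin τ 2 - rightSpin τ 2 * rightSpin τ 1 = Complex.I • rightSpin τ 0 ∧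
    rightSpin τ 2 * rightSpin τ 0 - rightSpin τ 0 * rightSpin τ 2 =
      Complex.I • rightSpin τ 1 := by
  obtain ⟨h1, h2, h3⟩ := spin_lie τ.twoJ₂
  simp only [rightSpin, ← Matrix.mul_kronecker_mul, ← kron_sub, Matrix.one_mul, h1, h2, h3,
    Matrix.kronecker_smul, and_self]

/-- The commutation relations of the Lorentz algebra, for rotation generators `J` and boost
generators `B`. -/
structure LorentzRelations {R : Type*} [Ring R] [Algebra ℂ R] (J B : Fin 3 → R) : Prop where
  J01 : J 0 * J 1 = J 1 * J 0 + Complex.I • J 2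
  J12 : J 1 * J 2 = J 2 * J 1 + Complex.I • J 0
  J20 : J 2 * J 0 = J 0 * J 2 + Complex.I • J 1
  B01 : B 0 * B 1 = B 1 * B 0 - Complex.I • J 2
  B12 : B 1 * B 2 = B 2 * B 1 - Complex.I • J 0
  B20 : B 2 * B 0 = B 0 * B 2 - Complex.I • J 1
  JB00 : J 0 * B 0 = B 0 * J 0
  JB11 : J 1 * B 1 = B 1 * J 1
  JB22 : J 2 * B 2 = B 2 * J 2
  JB01 : J 0 * B 1 = B 1 * J 0 + Complex.I • B 2
  JB12 : J 1 * B 2 = B 2 * J 1 + Complex.I • B 0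
  JB20 : J 2 * B 0 = B 0 * J 2 + Complex.I • B 1
  JB10 : J 1 * B 0 = B 0 * J 1 - Complex.I • B 2
  JB21 : J 2 * B 1 = B 1 * J 2 - Complex.I • B 0
  JB02 : J 0 * B 2 = B 2 * J 0 - Complex.I • B 1

theorem irrep_relations : LorentzRelations (rotGen τ) (boostGen τ) := by
  obtain ⟨h1, h2, h3⟩ := leftSpin_lie τ
  obtain ⟨h4, h5, h6⟩ := rightSpin_lie τ
  rw [sub_eq_iff_eq_add] at h1 h2 h3 h4 h5 h6
  have hc := rightSpin_mul_leftSpin τ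
  constructor <;>
  · simp only [rotGen_eq, boostGen_eq, Matrix.mul_smul, Matrix.smul_mul, Matrix.mul_add,
      Matrix.add_mul, Matrix.mul_sub, Matrix.sub_mul, hc, h1, h2, h3, h4, h5, h6]
    simp only [smul_sub, smul_add, smul_smul, Complex.I_mul_I]
    module

/-- The square of the angular momentum on an irreducible representation. -/
def rotSq : Matrix τ.Carrier τ.Carrier ℂ :=
  rotGen τ 0 * rotGen τ 0 + rotGen τ 1 * rotGen τ 1 + rotGen τ 2 * rotGen τ 2

/-- $J^2=J_1^2+J_2^2+2J_1\cdot J_2$, with the last term in ladder operators and the first two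
replaced by their Casimir values. -/
theorem rotSq_eq :
    rotSq τ = ((τ.twoJ₁ : ℂ) * (τ.twoJ₁ + 2) / 4 + (τ.twoJ₂ : ℂ) * (τ.twoJ₂ + 2) / 4) • 1 +
      (spinPlus τ.twoJ₁ ⊗ₖ spinMinus τ.twoJ₂ + spinMinus τ.twoJ₁ ⊗ₖ spinPlus τ.twoJ₂ +
        (2 : ℂ) • (spinZ τ.twoJ₁ ⊗ₖ spinZ τ.twoJ₂)) := by
  have h1 : leftSpin τ 0 * leftSpin τ 0 + leftSpin τ 1 * leftSpin τ 1 +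
      leftSpin τ 2 * leftSpin τ 2 = ((τ.twoJ₁ : ℂ) * (τ.twoJ₁ + 2) / 4) • 1 := by
    simp only [leftSpin, ← Matrix.mul_kronecker_mul, ← Matrix.add_kronecker, Matrix.one_mul,
      spin_sq, Matrix.smul_kronecker, Matrix.one_kronecker_one]
  have h2 : rightSpin τ 0 * rightSpin τ 0 + rightSpin τ 1 * rightSpin τ 1 +
      rightSpin τ 2 * rightSpin τ 2 = ((τ.twoJ₂ : ℂ) * (τ.twoJ₂ + 2) / 4) • 1 := by
    simp only [rightSpin, ← Matrix.mul_kronecker_mul, ← Matrix.kronecker_add, Matrix.one_mul,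
      spin_sq, Matrix.kronecker_smul, Matrix.one_kronecker_one]
  have h3 : (2 : ℂ) • (leftSpin τ 0 * rightSpin τ 0 + leftSpin τ 1 * rightSpin τ 1 +
      leftSpin τ 2 * rightSpin τ 2) =
      spinPlus τ.twoJ₁ ⊗ₖ spinMinus τ.twoJ₂ + spinMinus τ.twoJ₁ ⊗ₖ spinPlus τ.twoJ₂ +
        (2 : ℂ) • (spinZ τ.twoJ₁ ⊗ₖ spinZ τ.twoJ₂) := by
    have hI : (1 / (2 * Complex.I) : ℂ) = -(Complex.I / 2) := by
      field_simp
      simp [Complex.I_sq]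
    simp only [leftSpin_mul_rightSpin, spin, Matrix.cons_val_zero, Matrix.cons_val_one,
      Matrix.cons_val, hI, Matrix.smul_kronecker, Matrix.kronecker_smul, Matrix.add_kronecker,
      Matrix.kronecker_add, sub_kron, kron_sub]
    simp only [smul_sub, smul_add, smul_smul]
    ring_nf
    simp only [Complex.I_sq]
    module
  rw [← h3, add_smul, ← h1, ← h2, rotSq]
  simp only [rotGen_eq, Matrix.mul_add, Matrix.add_mul, rightSpin_mul_leftSpin]
  module

/-- The products of the spinor operators from spin `a/2` to spin `a'/2` and back. -/
structure BackForth (a' a : ℕ) (κ : ℂ) : Prop where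
  h00 : spinorOp a a' 0 * spinorOp a' a 0 = spinPlus a
  h01 : spinorOp a a' 0 * spinorOp a' a 1 = κ • 1 - spinZ a
  h10 : spinorOp a a' 1 * spinorOp a' a 0 = -κ • 1 - spinZ a
  h11 : spinorOp a a' 1 * spinorOp a' a 1 = -spinMinus a

theorem backForth_raise (a : ℕ) : BackForth (a + 1) a ((a : ℂ) / 2 + 1) := by
  obtain ⟨⟨h1, h2⟩, h3, h4⟩ := lowerOp_mul_raiseOp a
  constructor <;> rw [spinorOp_raise, spinorOp_lower] <;> assumption

theorem backForth_lower (a : ℕ) : BackForth a (a + 1) (-(((a + 1 : ℕ) : ℂ) / 2)) := by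
  obtain ⟨⟨h1, h2⟩, h3, h4⟩ := raiseOp_mul_lowerOp a
  constructor <;> rw [spinorOp_raise, spinorOp_lower]
  · exact h1
  · exact h2
  · rw [neg_neg]; exact h3
  · exact h4

theorem singletOp_mul_singletOp :
    singletOp τ'' τ' * singletOp τ' τ =
      (spinorOp τ''.twoJ₁ τ'.twoJ₁ 0 * spinorOp τ'.twoJ₁ τ.twoJ₁ 0) ⊗ₖ
        (spinorOp τ''.twoJ₂ τ'.twoJ₂ 1 * spinorOp τ'.twoJ₂ τ.twoJ₂ 1) -
      (spinorOp τ''.twoJ₁ τ'.twoJ₁ 0 * spinorOp τ'.twoJ₁ τ.twoJ₁ 1) ⊗ₖ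
        (spinorOp τ''.twoJ₂ τ'.twoJ₂ 1 * spinorOp τ'.twoJ₂ τ.twoJ₂ 0) -
      (spinorOp τ''.twoJ₁ τ'.twoJ₁ 1 * spinorOp τ'.twoJ₁ τ.twoJ₁ 0) ⊗ₖ
        (spinorOp τ''.twoJ₂ τ'.twoJ₂ 0 * spinorOp τ'.twoJ₂ τ.twoJ₂ 1) +
      (spinorOp τ''.twoJ₁ τ'.twoJ₁ 1 * spinorOp τ'.twoJ₁ τ.twoJ₁ 1) ⊗ₖ
        (spinorOp τ''.twoJ₂ τ'.twoJ₂ 0 * spinorOp τ'.twoJ₂ τ.twoJ₂ 0) := by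
  simp only [singletOp, bispinorOp, Matrix.mul_sub, Matrix.sub_mul, ← Matrix.mul_kronecker_mul]
  abel

/-- On both sides the products of spinor operators are a constant plus spin components.
Antisymmetrization leaves the product of the constants and $-2J_1\cdot J_2$, which is expressed by
$J^2$. -/
theorem singletOp_back_forth {κ₁ κ₂ : ℂ} (h₁ : BackForth τ'.twoJ₁ τ.twoJ₁ κ₁)
    (h₂ : BackForth τ'.twoJ₂ τ.twoJ₂ κ₂) :
    singletOp τ τ' * singletOp τ' τ =
      (2 * κ₁ * κ₂ + ((τ.twoJ₁ : ℂ) * (τ.twoJ₁ + 2) / 4 + (τ.twoJ₂ : ℂ) * (τ.twoJ₂ + 2) / 4)) • 1 -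
        rotSq τ := by
  rw [singletOp_mul_singletOp, rotSq_eq, h₁.h00, h₁.h01, h₁.h10, h₁.h11, h₂.h00, h₂.h01, h₂.h10,
    h₂.h11]
  simp only [sub_kron, kron_sub, kron_neg, neg_kron, Matrix.smul_kronecker, Matrix.kronecker_smul,
    Matrix.one_kronecker_one]
  module

/-- The operator `J² + 1/4`, with the value `i²` on the vectors of spin `i - 1/2`. -/
def spinNumSq : Matrix τ.Carrier τ.Carrier ℂ := rotSq τ + (1 / 4 : ℂ) • 1

theorem singletOp_back_forth_eq {κ₁ κ₂ c : ℂ} (h₁ : BackForth τ'.twoJ₁ τ.twoJ₁ κ₁)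
    (h₂ : BackForth τ'.twoJ₂ τ.twoJ₂ κ₂)
    (hc : 2 * κ₁ * κ₂ +
      ((τ.twoJ₁ : ℂ) * (τ.twoJ₁ + 2) / 4 + (τ.twoJ₂ : ℂ) * (τ.twoJ₂ + 2) / 4) + 1 / 4 = c) :
    singletOp τ τ' * singletOp τ' τ = c • 1 - spinNumSq τ := by
  rw [singletOp_back_forth τ' τ h₁ h₂, ← hc, spinNumSq]
  module

/-- The constants add up to exactly $-\tfrac14$. Hence on spin $i-\tfrac12$ the flip from `tau (m +
1)` to its conjugate and back is $-i^2$, at every level the same. -/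
theorem singletOp_flip_flip (m : ℕ) :
    singletOp (tau (m + 1)) (tau (m + 1)).conj *
      singletOp (tau (m + 1)).conj (tau (m + 1)) =
      -spinNumSq (tau (m + 1)) := by
  refine (singletOp_back_forth ⟨m, m + 1⟩ ⟨m + 1, m⟩ (backForth_lower m) (backForth_raise m)).trans ?_
  change _ = -spinNumSq ⟨m + 1, m⟩
  rw [spinNumSq]
  push_cast
  module

theorem singletOp_flip_flip_conj (m : ℕ) :
    singletOp (tau (m + 1)).conj (tau (m + 1)) *
      singletOp (tau (m + 1)) (tau (m + 1)).conj =
      -spinNumSq (tau (m + 1)).conj := by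
  refine (singletOp_back_forth ⟨m + 1, m⟩ ⟨m, m + 1⟩ (backForth_raise m) (backForth_lower m)).trans ?_
  change _ = -spinNumSq ⟨m, m + 1⟩
  rw [spinNumSq]
  push_cast
  module

theorem singletOp_down_up (m : ℕ) :
    singletOp (tau (m + 1)) (tau (m + 2)) *
      singletOp (tau (m + 2)) (tau (m + 1)) =
      ((m : ℂ) + 2) ^ 2 • 1 - spinNumSq (tau (m + 1)) := by
  refine singletOp_back_forth_eq (tau (m + 2)) (tau (m + 1)) (backForth_raise (m + 1)) (backForth_raise m) ?_
  simp only [tau, LorentzLabel.conj, Nat.add_succ_sub_one]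
  push_cast
  ring

theorem singletOp_down_up_conj (m : ℕ) :
    singletOp (tau (m + 1)).conj (tau (m + 2)).conj *
      singletOp (tau (m + 2)).conj (tau (m + 1)).conj =
      ((m : ℂ) + 2) ^ 2 • 1 - spinNumSq (tau (m + 1)).conj := by
  refine singletOp_back_forth_eq (tau (m + 2)).conj (tau (m + 1)).conj (backForth_raise m) (backForth_raise (m + 1)) ?_
  simp only [tau, LorentzLabel.conj, Nat.add_succ_sub_one]
  push_cast
  ring

/-- On spin $i-\tfrac12$ this is $(m+2)^2-i^2$. It vanishes precisely on the spin $m+\tfrac32$,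
which `tau (m + 2)` contains and `tau (m + 1)` does not. -/
theorem singletOp_up_down (m : ℕ) :
    singletOp (tau (m + 2)) (tau (m + 1)) *
      singletOp (tau (m + 1)) (tau (m + 2)) =
      ((m : ℂ) + 2) ^ 2 • 1 - spinNumSq (tau (m + 2)) := by
  refine singletOp_back_forth_eq (tau (m + 1)) (tau (m + 2)) (backForth_lower (m + 1)) (backForth_lower m) ?_
  simp only [tau, LorentzLabel.conj, Nat.add_succ_sub_one]
  push_cast
  ring

theorem singletOp_up_down_conj (m : ℕ) :
    singletOp (tau (m + 2)).conj (tau (m + 1)).conj *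
      singletOp (tau (m + 1)).conj (tau (m + 2)).conj =
      ((m : ℂ) + 2) ^ 2 • 1 - spinNumSq (tau (m + 2)).conj := by
  refine singletOp_back_forth_eq (tau (m + 1)).conj (tau (m + 2)).conj (backForth_lower m) (backForth_lower (m + 1)) ?_
  simp only [tau, LorentzLabel.conj, Nat.add_succ_sub_one]
  push_cast
  ring

theorem spin_zero : spinPlus 0 = 0 ∧ spinMinus 0 = 0 ∧ spinZ 0 = 0 := by
  refine ⟨?_, ?_, ?_⟩ <;> ext i j <;> fin_cases i <;> fin_cases j <;>
    simp [spinPlus, spinMinus, spinZ]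

/-- On `τ_1` the only spin is `1/2`. -/
theorem spinNumSq_tau_one : spinNumSq (tau 1) = 1 := by
  change spinNumSq ⟨1, 0⟩ = 1
  obtain ⟨h1, h2, h3⟩ := spin_zero
  rw [spinNumSq, rotSq_eq]
  simp only [h1, h2, h3, Matrix.kronecker_zero]
  norm_num [← add_smul]

theorem spinNumSq_tau_one_conj : spinNumSq (tau 1).conj = 1 := by
  change spinNumSq ⟨0, 1⟩ = 1
  obtain ⟨h1, h2, h3⟩ := spin_zero
  rw [spinNumSq, rotSq_eq]
  simp only [h1, h2, h3, Matrix.zero_kronecker]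
  norm_num [← add_smul]

/-- The first index goes out and back while the second moves on. Since the second factor is
symmetric in the two spinor indices, the constant `κ` cancels and the product no longer depends on
the intermediate value `a'`. -/
theorem singletOp_mul_of_left {a a' b'' b' b : ℕ} {κ : ℂ} (h : BackForth a' a κ)
    (hs : spinorOp b'' b' 0 * spinorOp b' b 1 = spinorOp b'' b' 1 * spinorOp b' b 0) :
    singletOp ⟨a, b''⟩ ⟨a', b'⟩ * singletOp ⟨a', b'⟩ ⟨a, b⟩ =
      spinPlus a ⊗ₖ (spinorOp b'' b' 1 * spinorOp b' b 1) +
        (2 : ℂ) • (spinZ a ⊗ₖ (spinorOp b'' b' 1 * spinorOp b' b 0)) -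
        spinMinus a ⊗ₖ (spinorOp b'' b' 0 * spinorOp b' b 0) := by
  rw [singletOp_mul_singletOp]
  simp only [h.h00, h.h01, h.h10, h.h11, hs, sub_kron, neg_kron, Matrix.smul_kronecker]
  module

/-- Lowering and flipping commute. -/
theorem singletOp_flip_down (m : ℕ) :
    singletOp (tau (m + 1)) (tau (m + 1)).conj * singletOp (tau (m + 1)).conj (tau (m + 2)).conj =
      singletOp (tau (m + 1)) (tau (m + 2)) * singletOp (tau (m + 2)) (tau (m + 2)).conj := by
  have hs : spinorOp m (m + 1) 0 * spinorOp (m + 1) (m + 1 + 1) 1 =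
      spinorOp m (m + 1) 1 * spinorOp (m + 1) (m + 1 + 1) 0 := by
    simpa only [spinorOp_lower] using lowerOp_symm m
  exact (singletOp_mul_of_left (backForth_lower m) hs).trans
    (singletOp_mul_of_left (backForth_raise (m + 1)) hs).symm

theorem singletOp_mul_rotSq : singletOp τ' τ * rotSq τ = rotSq τ' * singletOp τ' τ := by
  obtain ⟨⟨h0, h1, h2⟩, -⟩ := vectorOp_mul_rotGen τ' τ
  have e : vectorOp τ' τ 0 = singletOp τ' τ := rfl
  rw [e] at h0 h1 h2
  simp only [rotSq, Matrix.mul_add, Matrix.add_mul, ← Matrix.mul_assoc, h0, h1, h2]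
  simp only [Matrix.mul_assoc, h0, h1, h2]

theorem singletOp_mul_spinNumSq :
    singletOp τ' τ * spinNumSq τ = spinNumSq τ' * singletOp τ' τ := by
  rw [spinNumSq, spinNumSq, Matrix.mul_add, Matrix.add_mul, singletOp_mul_rotSq]
  simp

/-! Adjoints with respect to the invariant inner product. -/

/-- The Gram matrix of the rotation-invariant inner product. -/
def irrepGram : Matrix τ.Carrier τ.Carrier ℂ := gram τ.twoJ₁ ⊗ₖ gram τ.twoJ₂

theorem irrepGram_rot (k : Fin 3) :
    (leftSpin τ k)ᴴ * irrepGram τ = irrepGram τ * leftSpin τ k ∧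
      (rightSpin τ k)ᴴ * irrepGram τ = irrepGram τ * rightSpin τ k := by
  simp only [leftSpin, rightSpin, irrepGram, Matrix.conjTranspose_kronecker,
    ← Matrix.mul_kronecker_mul, gram_comm_spin, Matrix.conjTranspose_one, Matrix.one_mul,
    Matrix.mul_one, and_self]

theorem raiseOp_adjoint' (a : ℕ) :
    (gram a * lowerOp a 1)ᴴ = -(gram (a + 1) * raiseOp a 0) ∧
      (gram a * lowerOp a 0)ᴴ = gram (a + 1) * raiseOp a 1 := by
  obtain ⟨h1, h2⟩ := raiseOp_adjoint a
  constructor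
  · rw [← neg_inj, ← Matrix.conjTranspose_neg, ← h1, Matrix.conjTranspose_conjTranspose, neg_neg]
  · rw [← h2, Matrix.conjTranspose_conjTranspose]

theorem irrepGram_mul_singletOp :
    irrepGram τ' * singletOp τ' τ =
      (gram τ'.twoJ₁ * spinorOp τ'.twoJ₁ τ.twoJ₁ 0) ⊗ₖ
        (gram τ'.twoJ₂ * spinorOp τ'.twoJ₂ τ.twoJ₂ 1) -
      (gram τ'.twoJ₁ * spinorOp τ'.twoJ₁ τ.twoJ₁ 1) ⊗ₖ
        (gram τ'.twoJ₂ * spinorOp τ'.twoJ₂ τ.twoJ₂ 0) := by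
  rw [irrepGram, singletOp, Matrix.mul_sub, bispinorOp, bispinorOp, ← Matrix.mul_kronecker_mul,
    ← Matrix.mul_kronecker_mul]

theorem conjTranspose_kron_sub {l m p q : Type*} (A A' : Matrix l m ℂ) (B B' : Matrix p q ℂ) :
    (A ⊗ₖ B - A' ⊗ₖ B')ᴴ = Aᴴ ⊗ₖ Bᴴ - A'ᴴ ⊗ₖ B'ᴴ := by
  rw [Matrix.conjTranspose_sub, Matrix.conjTranspose_kronecker, Matrix.conjTranspose_kronecker]

/-- Raising is adjoint to lowering. -/
theorem singletOp_adjoint_up (m : ℕ) :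
    (irrepGram (tau (m + 2)) * singletOp (tau (m + 2)) (tau (m + 1)))ᴴ =
      irrepGram (tau (m + 1)) * singletOp (tau (m + 1)) (tau (m + 2)) := by
  change (irrepGram ⟨m + 1 + 1, m + 1⟩ * singletOp ⟨m + 1 + 1, m + 1⟩ ⟨m + 1, m⟩)ᴴ =
    irrepGram ⟨m + 1, m⟩ * singletOp ⟨m + 1, m⟩ ⟨m + 1 + 1, m + 1⟩
  rw [irrepGram_mul_singletOp, irrepGram_mul_singletOp, conjTranspose_kron_sub]
  simp only [spinorOp_raise, spinorOp_lower, raiseOp_adjoint, neg_kron, kron_neg]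
  abel

theorem singletOp_adjoint_up_conj (m : ℕ) :
    (irrepGram (tau (m + 2)).conj * singletOp (tau (m + 2)).conj (tau (m + 1)).conj)ᴴ =
      irrepGram (tau (m + 1)).conj * singletOp (tau (m + 1)).conj (tau (m + 2)).conj := by
  change (irrepGram ⟨m + 1, m + 1 + 1⟩ * singletOp ⟨m + 1, m + 1 + 1⟩ ⟨m, m + 1⟩)ᴴ =
    irrepGram ⟨m, m + 1⟩ * singletOp ⟨m, m + 1⟩ ⟨m + 1, m + 1 + 1⟩
  rw [irrepGram_mul_singletOp, irrepGram_mul_singletOp, conjTranspose_kron_sub]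
  simp only [spinorOp_raise, spinorOp_lower, raiseOp_adjoint, neg_kron, kron_neg]
  abel

/-- The two flips are adjoint to each other, up to the sign. -/
theorem singletOp_adjoint_flip (m : ℕ) :
    (irrepGram (tau (m + 1)).conj * singletOp (tau (m + 1)).conj (tau (m + 1)))ᴴ =
      -(irrepGram (tau (m + 1)) * singletOp (tau (m + 1)) (tau (m + 1)).conj) := by
  change (irrepGram ⟨m, m + 1⟩ * singletOp ⟨m, m + 1⟩ ⟨m + 1, m⟩)ᴴ =
    -(irrepGram ⟨m + 1, m⟩ * singletOp ⟨m + 1, m⟩ ⟨m, m + 1⟩)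
  rw [irrepGram_mul_singletOp, irrepGram_mul_singletOp, conjTranspose_kron_sub]
  simp only [spinorOp_raise, spinorOp_lower, raiseOp_adjoint, raiseOp_adjoint', neg_kron, kron_neg]
  abel

/-! The exchange of the two factors. -/

/-- The matrix of the exchange of the two factors. -/
def swapMat (a b : ℕ) : Matrix (Fin (b + 1) × Fin (a + 1)) (Fin (a + 1) × Fin (b + 1)) ℂ :=
  Matrix.of fun p q => if p = q.swap then 1 else 0

theorem swapMat_mul_kron {a' b' a b : ℕ} (A : Matrix (Fin (a' + 1)) (Fin (a + 1)) ℂ)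
    (B : Matrix (Fin (b' + 1)) (Fin (b + 1)) ℂ) :
    swapMat a' b' * (A ⊗ₖ B) = (B ⊗ₖ A) * swapMat a b := by
  ext p q
  rw [Matrix.mul_apply, Matrix.mul_apply, Finset.sum_eq_single p.swap,
    Finset.sum_eq_single q.swap]
  · simp [swapMat, mul_comm]
  · intro r _ hr
    simp [swapMat, hr]
  · simp
  · intro r _ hr
    have : p ≠ r.swap := by rintro rfl; simp at hr
    simp [swapMat, this]
  · simp

/-- The matrix of the exchange of the two factors, from `τ` to its conjugate. -/
def swapOp (τ' τ : LorentzLabel) : Matrix τ'.Carrier τ.Carrier ℂ :=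
  Matrix.of fun p q => if (p.1 : ℕ) = q.2 ∧ (p.2 : ℕ) = q.1 then 1 else 0

theorem swapOp_eq (a b : ℕ) : swapOp ⟨b, a⟩ ⟨a, b⟩ = swapMat a b := by
  ext p q
  simp only [swapOp, swapMat, Matrix.of_apply, Prod.ext_iff, Fin.ext_iff, Prod.fst_swap,
    Prod.snd_swap]

/-- The singlet is antisymmetric in the two spinor indices, so exchanging the tensor factors
produces a minus sign. The signs in `couplingCoef` and `paritySign` compensate it. -/
theorem swapOp_mul_singletOp :
    swapOp τ'.conj τ' * singletOp τ' τ = -(singletOp τ'.conj τ.conj * swapOp τ.conj τ) := by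
  obtain ⟨a', b'⟩ := τ'
  obtain ⟨a, b⟩ := τ
  change swapOp ⟨b', a'⟩ ⟨a', b'⟩ * singletOp ⟨a', b'⟩ ⟨a, b⟩ =
    -(singletOp ⟨b', a'⟩ ⟨b, a⟩ * swapOp ⟨b, a⟩ ⟨a, b⟩)
  have h := @swapMat_mul_kron a' b' a b
  rw [swapOp_eq, swapOp_eq]
  simp only [singletOp, Matrix.mul_sub, bispinorOp, h, Matrix.sub_mul, neg_sub]

theorem swapOp_mul_leftSpin (k : Fin 3) :
    swapOp τ.conj τ * leftSpin τ k = rightSpin τ.conj k * swapOp τ.conj τ := by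
  obtain ⟨a, b⟩ := τ
  change swapOp ⟨b, a⟩ ⟨a, b⟩ * leftSpin ⟨a, b⟩ k =
    rightSpin ⟨b, a⟩ k * swapOp ⟨b, a⟩ ⟨a, b⟩
  rw [swapOp_eq]
  exact swapMat_mul_kron _ _

theorem swapOp_mul_rightSpin (k : Fin 3) :
    swapOp τ.conj τ * rightSpin τ k = leftSpin τ.conj k * swapOp τ.conj τ := by
  obtain ⟨a, b⟩ := τ
  change swapOp ⟨b, a⟩ ⟨a, b⟩ * rightSpin ⟨a, b⟩ k =
    leftSpin ⟨b, a⟩ k * swapOp ⟨b, a⟩ ⟨a, b⟩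
  rw [swapOp_eq]
  exact swapMat_mul_kron _ _

theorem swapOp_mul_irrepGram :
    swapOp τ.conj τ * irrepGram τ = irrepGram τ.conj * swapOp τ.conj τ := by
  obtain ⟨a, b⟩ := τ
  change swapOp ⟨b, a⟩ ⟨a, b⟩ * irrepGram ⟨a, b⟩ = irrepGram ⟨b, a⟩ * swapOp ⟨b, a⟩ ⟨a, b⟩
  rw [swapOp_eq]
  exact swapMat_mul_kron _ _

theorem swapOp_mul_swapOp : swapOp τ τ.conj * swapOp τ.conj τ = 1 := by
  obtain ⟨a, b⟩ := τ
  change swapOp ⟨a, b⟩ ⟨b, a⟩ * swapOp ⟨b, a⟩ ⟨a, b⟩ = 1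
  rw [swapOp_eq, swapOp_eq]
  ext p q
  rw [Matrix.mul_apply, Finset.sum_eq_single q.swap]
  · simp [swapMat, Matrix.one_apply]
  · intro r _ hr
    simp [swapMat, hr]
  · simp

theorem swapOp_conjTranspose : (swapOp τ' τ)ᴴ = swapOp τ τ' := by
  ext p q
  simp only [Matrix.conjTranspose_apply, swapOp, Matrix.of_apply]
  rw [apply_ite (star : ℂ → ℂ), star_one, star_zero]
  congr 1
  rw [eq_iff_iff]
  constructor <;> rintro ⟨h1, h2⟩ <;> exact ⟨h2.symm, h1.symm⟩

end Singlet


/-! ### The coupling constants -/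

section Coupling

/-- The parameter of the coupling matrices at level `k`. -/
def ratio (N k : ℕ) : ℂ := -((k : ℂ) ^ 2 * ((N : ℂ) ^ 2 - (k + 1) ^ 2)) / (N ^ 2 * (2 * k + 1))

/-- The coupling constant between the levels `k` and `k + 1`, below the two highest levels. -/
def stepCoef (N k : ℕ) : ℂ := 1 / (((N : ℂ) ^ 2 - (k + 1) ^ 2) * (1 - ratio N k))

/-- The coupling constant between the two highest levels. -/
def topCoef (n : ℕ) : ℂ := -(n : ℂ) ^ 2 / ((n + 1) ^ 2 * (2 * n + 1))

theorem natCast_sq_sub_ne {N k : ℕ} (h : k < N) : (N : ℂ) ^ 2 - (k : ℂ) ^ 2 ≠ 0 := by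
  intro h0
  have h1 : ((N ^ 2 : ℕ) : ℂ) = ((k ^ 2 : ℕ) : ℂ) := by
    push_cast
    exact sub_eq_zero.mp h0
  exact absurd (Nat.cast_injective h1) (Nat.pow_lt_pow_left h two_ne_zero).ne'

theorem natCast_sq_sub_succ_ne {N k : ℕ} (h : k + 1 < N) :
    (N : ℂ) ^ 2 - ((k : ℂ) + 1) ^ 2 ≠ 0 := by
  exact_mod_cast natCast_sq_sub_ne h

theorem two_mul_natCast_add_one_ne (k : ℕ) : 2 * (k : ℂ) + 1 ≠ 0 := by
  exact_mod_cast Nat.succ_ne_zero (2 * k)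

/-- The factorized form shows that `1 - ratio N k` does not vanish for `k < N`. -/
theorem one_sub_ratio {N k : ℕ} (hN : N ≠ 0) :
    1 - ratio N k = ((k : ℂ) + 1) ^ 2 * (N ^ 2 - k ^ 2) / (N ^ 2 * (2 * k + 1)) := by
  have h1 : (N : ℂ) ≠ 0 := Nat.cast_ne_zero.mpr hN
  have h2 : (N : ℂ) ^ 2 * (2 * k + 1) ≠ 0 :=
    mul_ne_zero (pow_ne_zero _ h1) (two_mul_natCast_add_one_ne k)
  rw [ratio, eq_div_iff h2, sub_mul, div_mul_cancel₀ _ h2]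
  ring

theorem one_sub_ratio_ne {N k : ℕ} (h : k < N) : 1 - ratio N k ≠ 0 := by
  have h1 : (N : ℂ) ≠ 0 := Nat.cast_ne_zero.mpr (by omega)
  rw [one_sub_ratio (by omega)]
  exact div_ne_zero (mul_ne_zero (pow_ne_zero _ (Nat.cast_add_one_ne_zero k))
    (natCast_sq_sub_ne h)) (mul_ne_zero (pow_ne_zero _ h1) (two_mul_natCast_add_one_ne k))

theorem ratio_ne {N k : ℕ} (hk : k ≠ 0) (h : k + 1 < N) : ratio N k ≠ 0 := by
  have h1 : (N : ℂ) ≠ 0 := Nat.cast_ne_zero.mpr (by omega)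
  exact div_ne_zero (neg_ne_zero.mpr (mul_ne_zero (pow_ne_zero _ (Nat.cast_ne_zero.mpr hk))
    (natCast_sq_sub_succ_ne h))) (mul_ne_zero (pow_ne_zero _ h1) (two_mul_natCast_add_one_ne k))

/-- At level `n` the parameter vanishes, so this level with its single copy is a limiting case of
the two-copy formulas. -/
theorem ratio_last (n : ℕ) : ratio (n + 1) n = 0 := by
  simp [ratio]

theorem stepCoef_ne {N k : ℕ} (h : k + 1 < N) : stepCoef N k ≠ 0 :=
  one_div_ne_zero (mul_ne_zero (natCast_sq_sub_succ_ne h) (one_sub_ratio_ne (by omega)))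

theorem topCoef_ne {n : ℕ} (hn : n ≠ 0) : topCoef n ≠ 0 :=
  div_ne_zero (neg_ne_zero.mpr (pow_ne_zero _ (Nat.cast_ne_zero.mpr hn)))
    (mul_ne_zero (pow_ne_zero _ (Nat.cast_add_one_ne_zero n)) (two_mul_natCast_add_one_ne n))

/-- The recursion which makes the coupling matrices nilpotent. -/
theorem ratio_recursion {N k : ℕ} (i : ℂ) (h : k + 1 < N) :
    i ^ 2 + ratio N k * (N ^ 2 * (((k : ℂ) + 1) ^ 2 - i ^ 2) / (N ^ 2 - (k + 1) ^ 2)) =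
      -((1 - ratio N k) * (N ^ 2 * ((k : ℂ) ^ 2 - i ^ 2) / (N ^ 2 - k ^ 2))) := by
  have h1 : (N : ℂ) ≠ 0 := Nat.cast_ne_zero.mpr (by omega)
  have h2 := two_mul_natCast_add_one_ne k
  have h3 := natCast_sq_sub_succ_ne h
  have h4 := natCast_sq_sub_ne (show k < N by omega)
  -- Both sides are affine in $i^2$ and agree at $i^2=N^2$ whatever the value of `ratio N k`.
  -- Agreement at $i=k$, where the right side is zero, is the equation which determines `ratio N k`.
  rw [one_sub_ratio (by omega), ratio]
  obtain ⟨e, he⟩ : ∃ e : ℂ, e = 2 * k + 1 := ⟨_, rfl⟩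
  rw [← he] at h2 ⊢
  field_simp
  rw [he]
  ring

/-- The system of equations for an eigenvector of `X₀` of spin `i - 1/2 < j` has only the trivial
solution. -/
theorem chain_eq_zero {n i : ℕ} (hi : 1 ≤ i) (hin : i ≤ n) {ι t : ℂ} (hι : ι ^ 2 = (i : ℂ) ^ 2)
    (ht : t ≠ 0) (x y z : ℕ → ℂ)
    (htop : t * x (n + 1) = ι * x (n + 1) +
      (n + 1) * (topCoef n * (((n : ℂ) + 1) ^ 2 - i ^ 2) * x n))
    (hn : t * x n = -ι * x n + (n + 1) * x (n + 1) + (n + 1) * z n)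
    (hx : ∀ k, i ≤ k → k < n → t * x k = ι / (1 - ratio (n + 1) k) * (-x k + y k) +
      (n + 1) * x (k + 1) + (n + 1) * z k)
    (hy : ∀ k, i ≤ k → k < n → t * y k =
      ι / (1 - ratio (n + 1) k) * (-ratio (n + 1) k * x k + y k) +
      (n + 1) * x (k + 1) + (n + 1) * (ratio (n + 1) k * z k))
    (hz : ∀ k, i ≤ k → k < n →
      z (k + 1) = stepCoef (n + 1) k * (((k : ℂ) + 1) ^ 2 - i ^ 2) * y k)
    (hzi : z i = 0) (hyn : y n = 0) (hyn' : y (n + 1) = 0) :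
    ∀ k, i ≤ k → k ≤ n + 1 → x k = 0 ∧ y k = 0 := by
  have hN : (n : ℂ) + 1 ≠ 0 := Nat.cast_add_one_ne_zero n
  -- The chain is solved from the top downwards. At each level a single free amplitude `τ` remains;
  -- it fixes `x k` and the inflow `z k`, and its vanishing kills everything at and above the level.
  -- The factor multiplying `τ` in `z k` is the same closed expression at every level.
  have key : ∀ d k, k + d = n → i ≤ k → ∃ τ : ℂ, x k = τ * (t - ι) ∧
      (n + 1) * z k = τ * (t ^ 2 + (n + 1) ^ 2 * ((k : ℂ) ^ 2 - i ^ 2) / ((n + 1) ^ 2 - k ^ 2)) ∧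
      (τ = 0 → ∀ m, k ≤ m → m ≤ n + 1 → x m = 0 ∧ y m = 0) := by
    intro d
    induction d with
    | zero =>
      intro k hk hik
      obtain rfl : k = n := by omega
      have h1 : ((k : ℂ) + 1) ^ 2 - (i : ℂ) ^ 2 ≠ 0 := by
        exact_mod_cast natCast_sq_sub_ne (show i < k + 1 by omega)
      have h2 := topCoef_ne (show k ≠ 0 by omega)
      have h3 : (k : ℂ) ≠ 0 := Nat.cast_ne_zero.mpr (by omega)
      have h4 := two_mul_natCast_add_one_ne k
      -- The top equation reads `(t - ι) * x (k + 1) = a * x k`, whence the amplitude `τ = x (k + 1)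
      -- / a`.
      set a : ℂ := (k + 1) * (topCoef k * (((k : ℂ) + 1) ^ 2 - i ^ 2)) with ha
      have ha0 : a ≠ 0 := mul_ne_zero hN (mul_ne_zero h2 h1)
      have hxk : x k = x (k + 1) / a * (t - ι) := by
        field_simp
        linear_combination -htop
      refine ⟨x (k + 1) / a, hxk, ?_, ?_⟩
      · have e : (k + 1) * z k = (t + ι) * x k - (k + 1) * x (k + 1) := by
          linear_combination -hn
        have e2 : (k + 1) * x (k + 1) = x (k + 1) / a * ((k + 1) * a) := by
          field_simp
        have e3 : (k + 1) * a = -((k : ℂ) ^ 2 * ((k + 1) ^ 2 - i ^ 2)) / (2 * k + 1) := by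
          rw [ha, topCoef]
          generalize 2 * (k : ℂ) + 1 = e at *
          field_simp
        rw [e, hxk, e2, show ((k : ℂ) + 1) ^ 2 - (k : ℂ) ^ 2 = 2 * k + 1 by ring,
          show (t + ι) * (x (k + 1) / a * (t - ι)) = x (k + 1) / a * (t ^ 2 - ι ^ 2) by ring, hι,
          ← mul_sub, e3]
        congr 1
        obtain ⟨e, he⟩ : ∃ e : ℂ, e = 2 * k + 1 := ⟨_, rfl⟩
        rw [← he] at h4 ⊢
        field_simp
        rw [he]
        ring
      · intro h0 m hm hm'
        have hx1 : x (k + 1) = 0 := (div_eq_zero_iff.mp h0).resolve_right ha0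
        have hx0 : x k = 0 := by rw [hxk, h0, zero_mul]
        rcases (show m = k ∨ m = k + 1 by omega) with rfl | rfl
        exacts [⟨hx0, hyn⟩, ⟨hx1, hyn'⟩]
    | succ d ih =>
      intro k hk hik
      have hkn : k < n := by omega
      obtain ⟨τ, h1, h2, h3⟩ := ih (k + 1) (by omega) (by omega)
      have hρ := ratio_ne (show k ≠ 0 by omega) (show k + 1 < n + 1 by omega)
      have hσ := one_sub_ratio_ne (show k < n + 1 by omega)
      have hL := stepCoef_ne (show k + 1 < n + 1 by omega)
      have hs : ((k : ℂ) + 1) ^ 2 - (i : ℂ) ^ 2 ≠ 0 := by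
        exact_mod_cast natCast_sq_sub_ne (show i < k + 1 by omega)
      have hc := natCast_sq_sub_succ_ne (show k + 1 < n + 1 by omega)
      have hr := ratio_recursion (i : ℂ) (show k + 1 < n + 1 by omega)
      specialize hx k hik hkn
      specialize hy k hik hkn
      rw [hz k hik hkn] at h2
      rw [h1] at hx hy
      push_cast at h2 hc hr
      rw [stepCoef] at h2 hL
      push_cast at h2
      generalize ratio (n + 1) k = ρ at *
      set s : ℂ := ((k : ℂ) + 1) ^ 2 - i ^ 2 with hsd
      set w : ℂ := (n + 1) ^ 2 - (k + 1) ^ 2 with hwd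
      -- the value of `y k`
      have hyk : (n + 1) * (s * y k) = τ * (1 - ρ) * (t ^ 2 * w + (n + 1) ^ 2 * s) := by
        field_simp at h2
        linear_combination h2
      -- Both copies receive the same contribution from level `k + 1`, so the difference of their
      -- equations eliminates it.
      have e1 : (t + ι) * x k - t * y k = (n + 1) * (1 - ρ) * z k := by
        field_simp at hx hy
        refine mul_left_cancel₀ hσ ?_
        linear_combination hx - hy
      -- Here `e1` is used to eliminate `z k` from the equation of the second copy.
      have e2 : ρ * t * x k = (t - ι) * (y k - (n + 1) * (1 - ρ) * τ) := by
        field_simp at hy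
        linear_combination ρ * e1 - hy
      have e3 : (n + 1) * s * ρ * x k = (t - ι) * (τ * (1 - ρ) * t * w) := by
        refine mul_left_cancel₀ ht ?_
        linear_combination (n + 1) * s * e2 + (t - ι) * hyk
      have hr' : (i : ℂ) ^ 2 * w + ρ * ((n + 1) ^ 2 * s) = -((1 - ρ) * w *
          ((n + 1) ^ 2 * ((k : ℂ) ^ 2 - i ^ 2) / ((n + 1) ^ 2 - k ^ 2))) := by
        rw [mul_right_comm, ← neg_mul, ← hr]
        field_simp
      -- The new amplitude is read off from `e3`, which already contains the factor `t - ι`.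
      refine ⟨τ * (1 - ρ) * t * w / ((n + 1) * s * ρ), ?_, ?_, ?_⟩
      · field_simp
        linear_combination e3
      · generalize (n + 1) ^ 2 * ((k : ℂ) ^ 2 - i ^ 2) / ((n + 1) ^ 2 - k ^ 2) = E at *
        rw [div_mul_eq_mul_div, eq_div_iff (by positivity)]
        refine mul_left_cancel₀ hσ ?_
        linear_combination (-(n + 1) * s * ρ) * e1 + (t + ι) * e3 - ρ * t * hyk -
          τ * (1 - ρ) * t * w * hι - τ * (1 - ρ) * t * hr'
      · intro h0
        have hτ : τ = 0 := by simpa [hσ, ht, hc, hs, hρ, hN] using h0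
        intro m hm hm'
        rcases hm.eq_or_lt with rfl | hm
        · have hy0 : y k = 0 := by simpa [hτ, hs, hN] using hyk
          have hx0 : x k = 0 := by simpa [hτ, hs, hN, hρ] using e3
          exact ⟨hx0, hy0⟩
        · exact h3 hτ m hm hm'
  -- At the bottom `k = i` the second summand vanishes and `z i = 0`, so that $\tau t^2=0$ remains.
  obtain ⟨τ, -, h2, h3⟩ := key (n - i) i (by omega) le_rfl
  refine h3 ?_
  rw [hzi] at h2
  simpa [ht] using h2

end Coupling

/-! ### Operators on the direct sum -/

section Blocks

variable {n : ℕ} {M : ℕ → ℕ}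

/-- A family of operators between the irreducible representations. -/
abbrev Family : Type := ∀ τ' τ : LorentzLabel, Matrix τ'.Carrier τ.Carrier ℂ

/-- The operator on the direct sum whose blocks are multiples of a given family of operators. -/
def coefOp (g : Matrix (Summand n M) (Summand n M) ℂ) (Op : Family) :
    Matrix (RhoIdx n M) (RhoIdx n M) ℂ :=
  Matrix.of fun a b => g a.1 b.1 * Op (Summand.label a.1) (Summand.label b.1) a.2 b.2

theorem coefOp_congr {g g' : Matrix (Summand n M) (Summand n M) ℂ} {Op Op' : Family}
    (h : ∀ s s', g s s' • Op (Summand.label s) (Summand.label s') =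
      g' s s' • Op' (Summand.label s) (Summand.label s')) :
    coefOp g Op = coefOp g' Op' := by
  ext ⟨s, x⟩ ⟨s', y⟩
  exact congrFun (congrFun (h s s') x) y

theorem sum_rhoIdx (f : RhoIdx n M → ℂ) : ∑ a, f a = ∑ s, ∑ x, f ⟨s, x⟩ :=
  Fintype.sum_sigma f

theorem coefOp_mul_blockDiagonal (g : Matrix (Summand n M) (Summand n M) ℂ) (Op : Family)
    (d : ∀ τ : LorentzLabel, Matrix τ.Carrier τ.Carrier ℂ) :
    coefOp g Op * Matrix.blockDiagonal' (fun s : Summand n M => d (Summand.label s)) =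
      coefOp g fun τ' τ => Op τ' τ * d τ := by
  ext ⟨s, x⟩ ⟨s', y⟩
  rw [Matrix.mul_apply, sum_rhoIdx, Finset.sum_eq_single s']
  · simp only [coefOp, Matrix.of_apply, Matrix.blockDiagonal'_apply_eq, Matrix.mul_apply,
      Finset.mul_sum, mul_assoc]
  · intro s'' _ h
    exact Finset.sum_eq_zero fun z _ => by
      rw [Matrix.blockDiagonal'_apply_ne _ _ _ h, mul_zero]
  · simp

theorem blockDiagonal_mul_coefOp (g : Matrix (Summand n M) (Summand n M) ℂ) (Op : Family)
    (d : ∀ τ : LorentzLabel, Matrix τ.Carrier τ.Carrier ℂ) :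
    Matrix.blockDiagonal' (fun s : Summand n M => d (Summand.label s)) * coefOp g Op =
      coefOp g fun τ' τ => d τ' * Op τ' τ := by
  ext ⟨s, x⟩ ⟨s', y⟩
  rw [Matrix.mul_apply, sum_rhoIdx, Finset.sum_eq_single s]
  · simp only [coefOp, Matrix.of_apply, Matrix.blockDiagonal'_apply_eq, Matrix.mul_apply,
      Finset.mul_sum]
    exact Finset.sum_congr rfl fun z _ => by ring
  · intro s'' _ h
    exact Finset.sum_eq_zero fun z _ => by
      rw [Matrix.blockDiagonal'_apply_ne _ _ _ h.symm, zero_mul]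
  · simp

/-- The coefficient matrices multiply on their own provided the product of the blocks does not
depend on the intermediate summand, among those reached with nonzero coefficients. -/
theorem coefOp_mul {g g' : Matrix (Summand n M) (Summand n M) ℂ} {Op Op' Op'' : Family}
    (h : ∀ s s' s'', g s s' ≠ 0 → g' s' s'' ≠ 0 →
      Op (Summand.label s) (Summand.label s') * Op' (Summand.label s') (Summand.label s'') =
        Op'' (Summand.label s) (Summand.label s'')) :
    coefOp g Op * coefOp g' Op' = coefOp (g * g') Op'' := by
  ext ⟨s, x⟩ ⟨s'', y⟩
  simp only [coefOp, Matrix.mul_apply, Matrix.of_apply, sum_rhoIdx, Finset.sum_mul]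
  refine Finset.sum_congr rfl fun s' _ => ?_
  by_cases h0 : g s s' = 0
  · simp [h0]
  by_cases h1 : g' s' s'' = 0
  · simp [h1]
  rw [← h s s' s'' h0 h1, Matrix.mul_apply, Finset.mul_sum]
  exact Finset.sum_congr rfl fun z _ => by ring

theorem coefOp_sub (g : Matrix (Summand n M) (Summand n M) ℂ) (Op Op' : Family) :
    coefOp g Op - coefOp g Op' = coefOp g fun τ' τ => Op τ' τ - Op' τ' τ := by
  ext a b
  simp [coefOp, mul_sub]

theorem coefOp_smul (g : Matrix (Summand n M) (Summand n M) ℂ) (Op : Family) (c : ℂ) :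
    c • coefOp g Op = coefOp g fun τ' τ => c • Op τ' τ := by
  ext a b
  simp [coefOp, mul_left_comm]

theorem coefOp_conjTranspose (g : Matrix (Summand n M) (Summand n M) ℂ) (Op : Family) :
    (coefOp g Op)ᴴ = coefOp gᴴ fun τ' τ => (Op τ τ')ᴴ := by
  ext a b
  simp [coefOp]

/-- The matrix of coefficients given by a function of the level, the number of the copy and the
dottedness of the two summands. -/
def levelMat (f : ℕ → ℕ → Bool → ℕ → ℕ → Bool → ℂ) : Matrix (Summand n M) (Summand n M) ℂ :=
  Matrix.of fun s s' => f s.1 s.2.1 s.2.2 s'.1 s'.2.1 s'.2.2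

theorem sum_summand {E : Type*} [AddCommMonoid E] (f : ℕ → ℕ → Bool → E) :
    ∑ s : Summand n M, f s.1 s.2.1 s.2.2 =
      ∑ r ∈ Finset.range (n + 1), ∑ c ∈ Finset.range (M (r + 1)), ∑ d, f r c d := by
  rw [Fintype.sum_sigma, Finset.sum_range]
  refine Finset.sum_congr rfl fun r _ => ?_
  rw [Fintype.sum_prod_type, Finset.sum_range]

/-- Sums over copies reduce to the copies `0` and `1`. The first two hypotheses cover levels at
which these copies are missing. -/
theorem sum_range_two {E : Type*} [AddCommMonoid E] {m : ℕ} {f : ℕ → E} (h0 : m = 0 → f 0 = 0)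
    (h1 : m ≤ 1 → f 1 = 0) (h2 : ∀ c, f (c + 2) = 0) :
    ∑ c ∈ Finset.range m, f c = f 0 + f 1 := by
  rcases m with _ | _ | m
  · simp [h0, h1]
  · simp [h1]
  · rw [Finset.sum_range_succ', Finset.sum_range_succ', Finset.sum_eq_zero fun c _ => h2 c,
      zero_add, add_comm]

theorem levelMat_mul (f f' : ℕ → ℕ → Bool → ℕ → ℕ → Bool → ℂ)
    (s s' : Summand n M) :
      ((levelMat f : Matrix (Summand n M) (Summand n M) ℂ) *
        (levelMat f' : Matrix (Summand n M) (Summand n M) ℂ) :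
          Matrix (Summand n M) (Summand n M) ℂ) s s' =
      ∑ r ∈ Finset.range (n + 1), ∑ c ∈ Finset.range (M (r + 1)), ∑ d,
        f s.1 s.2.1 s.2.2 r c d * f' r c d s'.1 s'.2.1 s'.2.2 := by
  rw [Matrix.mul_apply]
  exact sum_summand fun r c d => f s.1 s.2.1 s.2.2 r c d * f' r c d s'.1 s'.2.1 s'.2.2

/-- The isomorphism type at level `r`. -/
abbrev lab (r : ℕ) (d : Bool) : LorentzLabel := if d then (tau (r + 1)).conj else tau (r + 1)

theorem lab_not (r : ℕ) (d : Bool) : lab r (!d) = (lab r d).conj := by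
  cases d <;> rfl

/-- The component of a vector in a summand. -/
def comp (v : RhoIdx n M → ℂ) (r c : ℕ) (d : Bool) : (lab r d).Carrier → ℂ :=
  -- The value zero for missing levels and copies lets the equations of the chain have one form at
  -- all levels.
  if h : r < n + 1 ∧ c < M (r + 1) then fun x => v ⟨⟨⟨r, h.1⟩, ⟨c, h.2⟩, d⟩, x⟩ else 0

theorem comp_apply (v : RhoIdx n M → ℂ) (s : Summand n M) (x : (Summand.label s).Carrier) :
    v ⟨s, x⟩ = comp v s.1 s.2.1 s.2.2 x := by
  obtain ⟨r, c, d⟩ := s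
  simp only [comp]
  rw [dif_pos ⟨r.2, c.2⟩]

theorem comp_of_le (v : RhoIdx n M → ℂ) {r : ℕ} (c : ℕ) (d : Bool) (h : n + 1 ≤ r) :
    comp v r c d = 0 :=
  dif_neg (by omega)

theorem comp_of_le' (v : RhoIdx n M → ℂ) {r c : ℕ} (d : Bool) (h : M (r + 1) ≤ c) :
    comp v r c d = 0 :=
  dif_neg (by omega)

theorem eq_zero_of_comp {v : RhoIdx n M → ℂ}
    (h : ∀ r c d, r < n + 1 → c < M (r + 1) → comp v r c d = 0) : v = 0 := by
  funext ⟨s, x⟩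
  rw [comp_apply v, h _ _ _ s.1.2 s.2.1.2]
  rfl

theorem comp_smul (a : ℂ) (v : RhoIdx n M → ℂ) (r c : ℕ) (d : Bool) :
    comp (a • v) r c d = a • comp v r c d := by
  unfold comp
  split_ifs
  · rfl
  · simp

theorem comp_sub (v w : RhoIdx n M → ℂ) (r c : ℕ) (d : Bool) :
    comp (v - w) r c d = comp v r c d - comp w r c d := by
  unfold comp
  split_ifs
  · rfl
  · simp

theorem comp_coefOp (f : ℕ → ℕ → Bool → ℕ → ℕ → Bool → ℂ) (Op : Family) (v : RhoIdx n M → ℂ)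
    {r c : ℕ} (d : Bool) (hr : r < n + 1) (hc : c < M (r + 1)) :
    comp (coefOp (levelMat f) Op *ᵥ v) r c d =
      ∑ r' ∈ Finset.range (n + 1), ∑ c' ∈ Finset.range (M (r' + 1)), ∑ d',
        f r c d r' c' d' • (Op (lab r d) (lab r' d') *ᵥ comp v r' c' d') := by
  rw [← sum_summand fun r' c' d' =>
    f r c d r' c' d' • (Op (lab r d) (lab r' d') *ᵥ comp v r' c' d')]
  funext x
  rw [comp, dif_pos ⟨hr, hc⟩, Finset.sum_apply]
  simp only [Matrix.mulVec, dotProduct, sum_rhoIdx, Pi.smul_apply, smul_eq_mul,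
    Finset.mul_sum]
  refine Finset.sum_congr rfl fun s _ => Finset.sum_congr rfl fun y _ => ?_
  rw [comp_apply v s y, ← mul_assoc]
  rfl

theorem comp_blockDiagonal (D : ∀ τ : LorentzLabel, Matrix τ.Carrier τ.Carrier ℂ)
    (v : RhoIdx n M → ℂ) (r c : ℕ) (d : Bool) :
    comp (Matrix.blockDiagonal' (fun s : Summand n M => D (Summand.label s)) *ᵥ v) r c d =
      D (lab r d) *ᵥ comp v r c d := by
  unfold comp
  split_ifs with h
  · funext x
    simp only [Matrix.mulVec, dotProduct, sum_rhoIdx]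
    rw [Finset.sum_eq_single (⟨⟨r, h.1⟩, ⟨c, h.2⟩, d⟩ : Summand n M)]
    · exact Finset.sum_congr rfl fun y _ =>
        congrArg (· * _) (Matrix.blockDiagonal'_apply_eq _ _ _ _)
    · intro s'' _ h
      exact Finset.sum_eq_zero fun z _ =>
        (congrArg (· * _) (Matrix.blockDiagonal'_apply_ne _ _ _ h.symm)).trans (zero_mul _)
    · simp
  · simp

end Blocks

/-! ### The matrices `X_α`, the parity and the invariant form -/

section Construction

/-- Coupling of the undotted copies with the dotted copies of level `k`. -/
def flipCoef (N k : ℕ) : ℕ → ℕ → ℂ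
  | 0, 0 => if k = N then 1 / N else -1 / (N * (1 - ratio N k))
  | 0, 1 => if k + 1 < N then 1 / (N * (1 - ratio N k)) else 0
  | 1, 0 => if k + 1 < N then -ratio N k / (N * (1 - ratio N k)) else 0
  | 1, 1 => if k + 1 < N then 1 / (N * (1 - ratio N k)) else 0
  | _, _ => 0

/-- Coupling of the copies of level `k` with the copies of level `k + 1`. -/
def downCoef (N k : ℕ) : ℕ → ℕ → ℂ
  | 0, 0 => 1
  | 1, 0 => if k + 1 < N then 1 else 0
  | _, _ => 0

/-- Coupling of the copies of level `k + 1` with the copies of level `k`. -/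
def upCoef (N k : ℕ) : ℕ → ℕ → ℂ
  | 0, 0 => if k + 1 = N then topCoef k else 0
  | 0, 1 => if k + 1 < N then stepCoef N k else 0
  | 1, 1 => if k + 1 < N then stepCoef N k * ratio N (k + 1) else 0
  | _, _ => 0

/-- The factor between the norms of the levels `k` and `k + 1`. -/
def normStep (N k : ℕ) : ℂ :=
  if k + 1 = N then topCoef k else if k + 2 = N then stepCoef N k
    else stepCoef N k * ratio N (k + 1)

/-- The norm of level `k`. -/
def normCoef (N k : ℕ) : ℂ := ∏ m ∈ Finset.Ico k N, normStep N m

/-- The Hermitean form on the copies of level `k`. -/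
def gramCoef (N k : ℕ) : ℕ → ℕ → ℂ
  | 0, 0 => if k + 1 < N then normCoef N k * ratio N k / (1 - ratio N k) else normCoef N k
  | 0, 1 => if k + 1 < N then -normCoef N k * ratio N k / (1 - ratio N k) else 0
  | 1, 0 => if k + 1 < N then -normCoef N k * ratio N k / (1 - ratio N k) else 0
  | 1, 1 => if k + 1 < N then normCoef N k / (1 - ratio N k) else 1
  | c + 2, c' => if c + 2 = c' then 1 else 0
  | _, _ => 0

/-- The inverse of the Hermitean form. -/
def gramInvCoef (N k : ℕ) : ℕ → ℕ → ℂ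
  | 0, 0 => if k + 1 < N then 1 / (normCoef N k * ratio N k) else 1 / normCoef N k
  | 0, 1 => if k + 1 < N then 1 / normCoef N k else 0
  | 1, 0 => if k + 1 < N then 1 / normCoef N k else 0
  | 1, 1 => if k + 1 < N then 1 / normCoef N k else 1
  | c + 2, c' => if c + 2 = c' then 1 else 0
  | _, _ => 0

theorem star_ratio (N k : ℕ) : star (ratio N k) = ratio N k := by
  simp [ratio]

theorem star_stepCoef (N k : ℕ) : star (stepCoef N k) = stepCoef N k := by
  have h := star_ratio N k
  simp only [RCLike.star_def] at h
  simp [stepCoef, h]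

theorem star_topCoef (k : ℕ) : star (topCoef k) = topCoef k := by
  simp [topCoef]

theorem star_normStep (N k : ℕ) : star (normStep N k) = normStep N k := by
  rw [normStep]
  split_ifs
  · exact star_topCoef _
  · exact star_stepCoef _ _
  · rw [star_mul', star_stepCoef, star_ratio]

theorem star_normCoef (N k : ℕ) : star (normCoef N k) = normCoef N k := by
  rw [normCoef, star_prod]
  exact Finset.prod_congr rfl fun m _ => star_normStep N m

theorem normCoef_step {N k : ℕ} (h : k < N) :
    normCoef N k = normStep N k * normCoef N (k + 1) :=
  Finset.prod_eq_prod_Ico_succ_bot h _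

theorem normCoef_self (N : ℕ) : normCoef N N = 1 := by
  simp [normCoef]

theorem normStep_ne {N k : ℕ} (hk : k ≠ 0) (h : k < N) : normStep N k ≠ 0 := by
  rw [normStep]
  split_ifs with h1 h2
  · exact topCoef_ne hk
  · exact stepCoef_ne (by omega)
  · exact mul_ne_zero (stepCoef_ne (by omega)) (ratio_ne (by omega) (by omega))

theorem normCoef_ne {N k : ℕ} (hk : k ≠ 0) : normCoef N k ≠ 0 :=
  Finset.prod_ne_zero_iff.mpr fun m hm => by
    rw [Finset.mem_Ico] at hm
    exact normStep_ne (by omega) hm.2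

theorem star_gramCoef (N k c c' : ℕ) : star (gramCoef N k c c') = gramCoef N k c c' := by
  rcases c with _ | _ | c <;> rcases c' with _ | _ | c' <;> simp only [gramCoef] <;>
    (try split_ifs) <;>
    simp [star_normCoef, star_ratio]

theorem gramCoef_comm (N k c c' : ℕ) : gramCoef N k c c' = gramCoef N k c' c := by
  rcases c with _ | _ | c <;> rcases c' with _ | _ | c' <;> simp [gramCoef, eq_comm]

theorem star_flipCoef (N k c c' : ℕ) : star (flipCoef N k c c') = flipCoef N k c c' := by
  have h : (starRingEnd ℂ) (ratio N k) = ratio N k := star_ratio N k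
  rcases c with _ | _ | c <;> rcases c' with _ | _ | c' <;> simp only [flipCoef] <;>
    (try split_ifs) <;> simp [h]

theorem star_upCoef (N k c c' : ℕ) : star (upCoef N k c c') = upCoef N k c c' := by
  rcases c with _ | _ | c <;> rcases c' with _ | _ | c' <;> simp only [upCoef] <;>
    (try split_ifs) <;>
    simp only [star_mul', star_zero, star_stepCoef, star_topCoef, star_ratio]

/-- The product of the Hermitean form with the coupling of the dotted and undotted copies. -/
theorem gram_flip_symm (N k c c' : ℕ) :
    gramCoef N k c 0 * flipCoef N k 0 c' + gramCoef N k c 1 * flipCoef N k 1 c' =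
      star (gramCoef N k c' 0 * flipCoef N k 0 c + gramCoef N k c' 1 * flipCoef N k 1 c) := by
  -- Writing $\rho_k$ for `ratio N k`, for `k + 1 < N` the Gram matrix is a multiple of
  -- $\begin{pmatrix}\rho_k&-\rho_k\\-\rho_k&1\end{pmatrix}$ and the flip of
  -- $\begin{pmatrix}-1&1\\-\rho_k&1\end{pmatrix}$; their product is diagonal, proportional to
  -- $\mathrm{diag}(-\rho_k,1)$.
  simp only [star_add, star_mul', star_gramCoef, star_flipCoef]
  rcases c with _ | _ | c <;> rcases c' with _ | _ | c' <;> simp [gramCoef, flipCoef] <;>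
    split_ifs <;> first | (exfalso; omega) | ring

/-- The product of the Hermitean form with the coupling of neighbouring levels. -/
theorem gram_down_up {N k : ℕ} (h : k < N) (c c' : ℕ) :
    gramCoef N k c 0 * downCoef N k 0 c' + gramCoef N k c 1 * downCoef N k 1 c' =
      star (gramCoef N (k + 1) c' 0 * upCoef N k 0 c + gramCoef N (k + 1) c' 1 * upCoef N k 1 c) := by
  simp only [star_add, star_mul', star_gramCoef, star_upCoef]
  -- Each side has a single nonzero entry. Below level `n` it joins copy `1` of level `k` with copy
  -- `0` of level `k + 1`; at level `n` it joins the two copies `0`. Equality of the entries is the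
  -- defining property of `normStep`, whose three values belong to the three cases.
  rcases lt_trichotomy (k + 1) N with h1 | h1 | h1
  · rcases Nat.lt_or_ge (k + 2) N with h2 | h2
    · have e : normCoef N k = stepCoef N k * ratio N (k + 1) * normCoef N (k + 1) := by
        rw [normCoef_step h, normStep, if_neg (by omega), if_neg (by omega)]
      have h3 := one_sub_ratio_ne (show k < N by omega)
      have h4 := one_sub_ratio_ne (show k + 1 < N by omega)
      rcases c with _ | _ | c <;> rcases c' with _ | _ | c' <;>
        simp [gramCoef, downCoef, upCoef, h1, h1.ne, show k + 1 + 1 < N from h2] <;>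
        field_simp <;> (try rw [e]) <;> ring
    · have e : normCoef N k = stepCoef N k * normCoef N (k + 1) := by
        rw [normCoef_step h, normStep, if_neg (by omega), if_pos (by omega)]
      have h3 := one_sub_ratio_ne (show k < N by omega)
      have h5 : ratio N (k + 1) = 0 := by
        obtain rfl : N = k + 1 + 1 := by omega
        exact ratio_last _
      rcases c with _ | _ | c <;> rcases c' with _ | _ | c' <;>
        simp [gramCoef, downCoef, upCoef, h1, h1.ne, show ¬ k + 1 + 1 < N by omega, h5] <;>
        field_simp <;> (try rw [e]) <;> ring
  · subst h1
    have e : normCoef (k + 1) k = topCoef k := by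
      rw [normCoef_step h, normStep, if_pos rfl, normCoef_self, mul_one]
    rcases c with _ | _ | c <;> rcases c' with _ | _ | c' <;>
      simp [gramCoef, downCoef, upCoef, e, normCoef_self]
  · omega

/-- The two-by-two Gram matrix has determinant $\nu^2\rho/(1-\rho)$, with $\nu$ = `normCoef N k` and
$\rho$ = `ratio N k`, which is nonzero for $k\ge1$ and `k + 1 < N`. Otherwise the matrix is
diagonal. -/
theorem gram_mul_inv {N k : ℕ} (hk : k ≠ 0) (c c' : ℕ) (hc : c < 2) :
    gramCoef N k c 0 * gramInvCoef N k 0 c' + gramCoef N k c 1 * gramInvCoef N k 1 c' =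
      if c = c' then 1 else 0 := by
  have h0 := @normCoef_ne N k hk
  by_cases h1 : k + 1 < N
  · have h3 := one_sub_ratio_ne (show k < N by omega)
    have h4 := ratio_ne hk h1
    rcases c with _ | _ | c <;> rcases c' with _ | _ | c' <;>
      (try simp [gramCoef, gramInvCoef, h1]) <;> (try omega) <;> (try field_simp) <;> (try ring)
  · rcases c with _ | _ | c <;> rcases c' with _ | _ | c' <;>
      (try simp [gramCoef, gramInvCoef, h1, h0]) <;> (try omega)

end Construction

/-! ### The assembled matrices and their symmetries. -/

section Operators

variable (n : ℕ) (M : ℕ → ℕ)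

/-- The multiplicities leave room for the coupling constants. -/
structure IsAdmissible : Prop where
  last : M (n + 1) = 1
  next : 1 ≤ n → M n = 1
  below : ∀ i, 1 ≤ i → i < n → 2 ≤ M i

variable {n M} in
theorem IsAdmissible.ne_zero (hM : IsAdmissible n M) {r : ℕ} (hr : r < n + 1) : M (r + 1) ≠ 0 := by
  rcases lt_trichotomy (r + 1) n with h | h | h
  · exact Nat.ne_of_gt (lt_of_lt_of_le two_pos (hM.below _ (Nat.succ_pos r) h))
  · have := hM.next (by omega)
    rw [h]
    omega
  · obtain rfl : r = n := by omega
    rw [hM.last]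
    exact one_ne_zero

variable {n M} in
theorem IsAdmissible.not_lt (hM : IsAdmissible n M) {r : ℕ} (h : M (r + 1) ≤ 1) :
    ¬ r + 1 + 1 < n + 1 := by
  intro h1
  have := hM.below (r + 1) (Nat.succ_pos r) (by omega)
  omega

/-- The coupling constants. -/
def couplingCoef (r c : ℕ) (d : Bool) (r' c' : ℕ) (d' : Bool) : ℂ :=
  if d = d' then
    if r' = r + 1 then downCoef (n + 1) (r + 1) c c'
    else if r = r' + 1 then upCoef (n + 1) (r' + 1) c c' else 0
  else if r = r' then (if d then 1 else -1) * flipCoef (n + 1) (r + 1) c c' else 0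

/-- The matrices `X_α`. -/
def diracOp (α : Fin 4) : Matrix (RhoIdx n M) (RhoIdx n M) ℂ :=
  coefOp (levelMat (couplingCoef n)) fun τ' τ => vectorOp τ' τ α

theorem coefOp_mul_rhoGen (g : Matrix (Summand n M) (Summand n M) ℂ) (Op : Family) (α β : Fin 4) :
    coefOp g Op * rhoGen n M α β = coefOp g fun τ' τ => Op τ' τ * irrepGen τ α β :=
  coefOp_mul_blockDiagonal g Op fun τ => irrepGen τ α β

theorem rhoGen_mul_coefOp (g : Matrix (Summand n M) (Summand n M) ℂ) (Op : Family) (α β : Fin 4) :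
    rhoGen n M α β * coefOp g Op = coefOp g fun τ' τ => irrepGen τ' α β * Op τ' τ :=
  blockDiagonal_mul_coefOp g Op fun τ => irrepGen τ α β

/-- The coefficients are scalars for each pair of summands and do not depend on the component, so
the relation holds block by block. -/
theorem diracOp_isVector : IsVectorOperator (rhoGen n M) (diracOp n M) := by
  intro γ α β
  simp only [diracOp]
  rw [coefOp_mul_rhoGen, rhoGen_mul_coefOp, coefOp_sub, coefOp_smul, coefOp_smul,
    coefOp_sub]
  simp only [vectorOp_isVector]

/-- The spinor operators vanish unless $2j_1$ and $2j_2$ both change by one. The four sign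
combinations are exactly the four ways to interlock. -/
theorem vectorOp_of_not_interlock {τ' τ : LorentzLabel} (h : ¬ Interlock τ' τ) (α : Fin 4) :
    vectorOp τ' τ α = 0 := by
  obtain ⟨a', b'⟩ := τ'
  obtain ⟨a, b⟩ := τ
  by_cases h1 : a' = a + 1 ∨ a = a' + 1
  · by_cases h2 : b' = b + 1 ∨ b = b' + 1
    · refine absurd ?_ h
      simp only [Interlock, LorentzLabel.l₀, LorentzLabel.l₁]
      rcases h1 with rfl | rfl <;> rcases h2 with rfl | rfl <;> push_cast
      · exact Or.inr ⟨by ring, Or.inr (by ring)⟩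
      · exact Or.inl ⟨by ring, Or.inr (by ring)⟩
      · exact Or.inl ⟨by ring, Or.inl (by ring)⟩
      · exact Or.inr ⟨by ring, Or.inl (by ring)⟩
    · push Not at h2
      fin_cases α <;> simp [vectorOp, singletOp, bispinorOp, spinorOp_of_ne h2.1 h2.2]
  · push Not at h1
    fin_cases α <;> simp [vectorOp, singletOp, bispinorOp, spinorOp_of_ne h1.1 h1.2]

theorem diracOp_followsScheme : FollowsScheme (diracOp n M) := by
  intro α a b h
  simp only [diracOp, coefOp, Matrix.of_apply, vectorOp_of_not_interlock h, Matrix.zero_apply,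
    mul_zero]

/-- The conjugate summand. -/
def flip (s : Summand n M) : Summand n M := ⟨s.1, s.2.1, !s.2.2⟩

variable {n M} in
theorem flip_flip (s : Summand n M) : flip n M (flip n M s) = s := by
  obtain ⟨r, c, d⟩ := s
  simp [flip]

variable {n M} in
theorem label_flip (s : Summand n M) :
    Summand.label (flip n M s) = (Summand.label s).conj :=
  lab_not _ _

/-- The sign of the parity on a summand. -/
def paritySign (s : Summand n M) : ℂ := (-1) ^ ((s.1 : ℕ) + n)

/-- The coefficients of the parity operator. -/
def parityCoef : Matrix (Summand n M) (Summand n M) ℂ :=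
  Matrix.of fun s s' => if s' = flip n M s then paritySign n M s else 0

/-- The operator of the space reflection. -/
def parityOp : Matrix (RhoIdx n M) (RhoIdx n M) ℂ := coefOp (parityCoef n M) swapOp

theorem parityCoef_mul (g : Matrix (Summand n M) (Summand n M) ℂ) (s s' : Summand n M) :
    (parityCoef n M * g) s s' = paritySign n M s * g (flip n M s) s' := by
  rw [Matrix.mul_apply, Finset.sum_eq_single (flip n M s)]
  · simp [parityCoef]
  · intro t _ ht
    simp [parityCoef, ht]
  · simp

theorem mul_parityCoef (g : Matrix (Summand n M) (Summand n M) ℂ) (s s' : Summand n M) :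
    (g * parityCoef n M) s s' = paritySign n M s' * g s (flip n M s') := by
  rw [Matrix.mul_apply, Finset.sum_eq_single (flip n M s')]
  · simp [parityCoef, mul_comm, paritySign, flip]
  · intro t _ ht
    have : s' ≠ flip n M t := by
      rintro rfl
      exact ht (flip_flip t).symm
    simp [parityCoef, this]
  · simp

/-- The identification of equal representations. -/
def oneFam : Family := fun _ _ =>
  Matrix.of fun p q => if (p.1 : ℕ) = q.1 ∧ (p.2 : ℕ) = q.2 then 1 else 0

theorem oneFam_self (τ : LorentzLabel) : oneFam τ τ = 1 := by
  ext p q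
  simp only [oneFam, Matrix.of_apply, Matrix.one_apply, Prod.ext_iff, Fin.ext_iff]

theorem coefOp_one : coefOp (1 : Matrix (Summand n M) (Summand n M) ℂ) oneFam = 1 := by
  ext ⟨s, x⟩ ⟨s', y⟩
  by_cases h : s = s'
  · subst h
    simp [coefOp, oneFam_self, Matrix.one_apply]
  · simp [coefOp, Matrix.one_apply, h]

theorem parityCoef_ne {s s' : Summand n M} (h : parityCoef n M s s' ≠ 0) : s' = flip n M s := by
  by_contra h1
  exact h (by simp [parityCoef, h1])

theorem parityOp_sq : parityOp n M * parityOp n M = 1 := by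
  rw [parityOp, coefOp_mul (Op'' := oneFam), ← coefOp_one]
  · congr 1
    ext s s'
    rw [parityCoef_mul, Matrix.one_apply, parityCoef, Matrix.of_apply, flip_flip]
    by_cases h : s = s'
    · subst h
      simp [paritySign, flip, ← mul_pow]
    · rw [if_neg (Ne.symm h), if_neg h, mul_zero]
  · intro s s' s'' h h'
    obtain rfl := parityCoef_ne n M h
    obtain rfl := parityCoef_ne n M h'
    rw [flip_flip, label_flip, oneFam_self]
    exact swapOp_mul_swapOp _

/-- The sign of a Lorentz generator under space reflection. -/
def genSign (α β : Fin 4) : ℂ := ((mink α α * mink β β : ℝ) : ℂ)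

/-- The exchange interchanges the two spins, which preserves their sum and reverses their
difference. -/
theorem swapOp_mul_irrepGen (τ : LorentzLabel) (α β : Fin 4) :
    swapOp τ.conj τ * irrepGen τ α β =
      genSign α β • (irrepGen τ.conj α β * swapOp τ.conj τ) := by
  have h1 : ∀ k, swapOp τ.conj τ * rotGen τ k = rotGen τ.conj k * swapOp τ.conj τ := fun k => by
    rw [rotGen_eq, rotGen_eq, Matrix.mul_add, Matrix.add_mul, swapOp_mul_leftSpin,
      swapOp_mul_rightSpin, add_comm]
  have h2 : ∀ k, swapOp τ.conj τ * boostGen τ k = -(boostGen τ.conj k * swapOp τ.conj τ) :=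
    fun k => by
      rw [boostGen_eq, boostGen_eq, Matrix.mul_smul, Matrix.mul_sub, Matrix.smul_mul,
        Matrix.sub_mul, swapOp_mul_leftSpin, swapOp_mul_rightSpin, ← smul_neg, neg_sub]
  fin_cases α <;> fin_cases β <;> simp [irrepGen, genSign, mink, h1, h2]

/-- For the positive inner product rotations are self-adjoint and boosts skew. The sign is the same
as under the exchange, so it cancels in the product of the inner product with the parity. -/
theorem irrepGen_adjoint (τ : LorentzLabel) (α β : Fin 4) :
    (irrepGen τ α β)ᴴ * irrepGram τ = genSign α β • (irrepGram τ * irrepGen τ α β) := by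
  have h1 : ∀ k, (rotGen τ k)ᴴ * irrepGram τ = irrepGram τ * rotGen τ k := fun k => by
    rw [rotGen_eq, Matrix.conjTranspose_add, Matrix.mul_add, Matrix.add_mul, (irrepGram_rot τ k).1,
      (irrepGram_rot τ k).2]
  have h2 : ∀ k, (boostGen τ k)ᴴ * irrepGram τ = -(irrepGram τ * boostGen τ k) := fun k => by
    rw [boostGen_eq, Matrix.conjTranspose_smul, Matrix.conjTranspose_sub, Matrix.smul_mul,
      Matrix.sub_mul, Matrix.mul_smul, Matrix.mul_sub, (irrepGram_rot τ k).1,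
      (irrepGram_rot τ k).2]
    simp
  fin_cases α <;> fin_cases β <;>
    simp [irrepGen, genSign, mink, h1, h2]

theorem parityOp_isParity : IsParityOperator (rhoGen n M) (parityOp n M) := by
  refine ⟨parityOp_sq n M, fun α β => ?_⟩
  rw [parityOp, coefOp_mul_rhoGen, rhoGen_mul_coefOp, coefOp_smul]
  refine coefOp_congr fun s s' => ?_
  by_cases h : parityCoef n M s s' = 0
  · rw [h, zero_smul, zero_smul]
  · obtain rfl := parityCoef_ne n M h
    congr 1
    have := swapOp_mul_irrepGen (Summand.label (flip n M s)) α β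
    rw [label_flip] at this ⊢
    exact this

/-- Between neighbouring levels the minus sign arises from the alternating factor; within a level it
arises from the opposite signs of the two flips. It cancels the sign in `swapOp_mul_singletOp`. -/
theorem couplingCoef_not (r c : ℕ) (d : Bool) (r' c' : ℕ) (d' : Bool) :
    (-1) ^ (r + n) * couplingCoef n r c (!d) r' c' d' =
      -((-1) ^ (r' + n) * couplingCoef n r c d r' c' (!d')) := by
  cases d <;> cases d' <;> simp only [couplingCoef, Bool.not_true, Bool.not_false, if_true,
    Bool.true_eq_false, Bool.false_eq_true, if_false] <;> split_ifs <;> (try subst_vars) <;> ring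

theorem coupling_flip (s s' : Summand n M) :
    paritySign n M s * levelMat (couplingCoef n) (flip n M s) s' =
      -(paritySign n M s' * levelMat (couplingCoef n) s (flip n M s')) :=
  couplingCoef_not n s.1 s.2.1 s.2.2 s'.1 s'.2.1 s'.2.2

theorem parityOp_mul_diracOp : parityOp n M * diracOp n M 0 = diracOp n M 0 * parityOp n M := by
  rw [parityOp, diracOp,
    coefOp_mul (Op'' := fun τ' τ => swapOp τ' τ'.conj * singletOp τ'.conj τ),
    coefOp_mul (Op'' := fun τ' τ => singletOp τ' τ.conj * swapOp τ.conj τ)]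
  · refine coefOp_congr fun s s' => ?_
    rw [parityCoef_mul, mul_parityCoef, coupling_flip, neg_smul, ← smul_neg]
    congr 1
    rw [neg_eq_iff_eq_neg]
    exact swapOp_mul_singletOp (Summand.label s).conj (Summand.label s')
  · intro s s' s'' _ h'
    obtain rfl := parityCoef_ne n M h'
    rw [label_flip]
    rfl
  · intro s s' s'' h _
    obtain rfl := parityCoef_ne n M h
    rw [label_flip]
    rfl

/-- The coefficients of the rotation-invariant inner product. -/
def formCoef (r c : ℕ) (d : Bool) (r' c' : ℕ) (d' : Bool) : ℂ :=
  if r' = r ∧ d' = d then gramCoef (n + 1) (r + 1) c c' else 0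

/-- The inverse coefficients. -/
def formInvCoef (r c : ℕ) (d : Bool) (r' c' : ℕ) (d' : Bool) : ℂ :=
  if r' = r ∧ d' = d then gramInvCoef (n + 1) (r + 1) c c' else 0

/-- The Gram matrices, between equal representations. -/
def gramFam : Family := fun τ' _ =>
  Matrix.of fun p q => if (p.1 : ℕ) = q.1 ∧ (p.2 : ℕ) = q.2 then
    ((weight τ'.twoJ₁ p.1 : ℂ) * (weight τ'.twoJ₂ p.2 : ℂ)) else 0

/-- The inverses of the Gram matrices, between equal representations. -/
def gramInvFam : Family := fun τ' _ =>
  Matrix.of fun p q => if (p.1 : ℕ) = q.1 ∧ (p.2 : ℕ) = q.2 then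
    ((weight τ'.twoJ₁ p.1 : ℂ) * (weight τ'.twoJ₂ p.2 : ℂ))⁻¹ else 0

theorem irrepGram_eq (τ : LorentzLabel) : irrepGram τ =
    Matrix.diagonal fun p => (weight τ.twoJ₁ p.1 : ℂ) * (weight τ.twoJ₂ p.2 : ℂ) := by
  rw [irrepGram, gram, gram, Matrix.diagonal_kronecker_diagonal]

theorem gramFam_self (τ : LorentzLabel) : gramFam τ τ = irrepGram τ := by
  rw [irrepGram_eq]
  ext p q
  simp only [gramFam, Matrix.of_apply, Matrix.diagonal_apply, Prod.ext_iff, Fin.ext_iff]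

theorem irrepGram_mul_gramInvFam (τ : LorentzLabel) : irrepGram τ * gramInvFam τ τ = oneFam τ τ := by
  rw [irrepGram_eq]
  ext p q
  have h1 := (weight_pos τ.twoJ₁ p.1).ne'
  have h2 := (weight_pos τ.twoJ₂ p.2).ne'
  rw [Matrix.diagonal_mul]
  simp only [gramInvFam, oneFam, Matrix.of_apply]
  split_ifs
  · exact mul_inv_cancel₀ (by exact_mod_cast mul_ne_zero h1 h2)
  · rw [mul_zero]

/-- The rotation-invariant inner product, invariant under parity. -/
def formOp : Matrix (RhoIdx n M) (RhoIdx n M) ℂ := coefOp (levelMat (formCoef n)) gramFam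

variable {n M}

theorem formCoef_ne {s s' : Summand n M} (h : levelMat (formCoef n) s s' ≠ 0) :
    Summand.label s' = Summand.label s := by
  rw [levelMat, Matrix.of_apply, formCoef] at h
  by_cases h1 : (s'.1 : ℕ) = s.1 ∧ s'.2.2 = s.2.2
  · exact congrArg₂ lab h1.1 h1.2
  · exact absurd (if_neg h1) h

theorem formOp_mul_coefOp (g : Matrix (Summand n M) (Summand n M) ℂ) (Op : Family) :
    formOp n M * coefOp g Op =
      coefOp (levelMat (formCoef n) * g) fun τ' τ => irrepGram τ' * Op τ' τ :=
  coefOp_mul fun s s' s'' h _ => by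
    rw [formCoef_ne h, gramFam_self]

theorem formMat_mul (f : ℕ → ℕ → Bool → ℕ → ℕ → Bool → ℂ) (s s' : Summand n M) :
    ((levelMat (formCoef n) : Matrix (Summand n M) (Summand n M) ℂ) *
      (levelMat f : Matrix (Summand n M) (Summand n M) ℂ) :
          Matrix (Summand n M) (Summand n M) ℂ) s s' =
      ∑ c ∈ Finset.range (M (s.1 + 1)), gramCoef (n + 1) (s.1 + 1) s.2.1 c *
        f s.1 c s.2.2 s'.1 s'.2.1 s'.2.2 := by
  rw [levelMat_mul, Finset.sum_eq_single (s.1 : ℕ)]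
  · refine Finset.sum_congr rfl fun c _ => ?_
    rw [Finset.sum_eq_single s.2.2]
    · simp [formCoef]
    · intro d _ hd
      simp [formCoef, hd]
    · simp
  · intro r _ hr
    simp [formCoef, hr]
  · intro h
    exact absurd (Finset.mem_range.mpr s.1.2) h

theorem formOp_isUnit (hM : IsAdmissible n M) : IsUnit (formOp n M).det := by
  have h : formOp n M * coefOp (levelMat (formInvCoef n)) gramInvFam = 1 := by
    rw [formOp_mul_coefOp, ← coefOp_one]
    have e : (levelMat (formCoef n) * levelMat (formInvCoef n) :
        Matrix (Summand n M) (Summand n M) ℂ) = 1 := by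
      ext s s'
      rw [formMat_mul, Matrix.one_apply]
      obtain ⟨r, c, d⟩ := s
      obtain ⟨r', c', d'⟩ := s'
      by_cases h1 : (r' : ℕ) = r ∧ d' = d
      · obtain ⟨h2, rfl⟩ := h1
        obtain rfl : r' = r := Fin.ext h2
        simp only [formInvCoef, and_self, if_true]
        have e2 : ((⟨r', c, d'⟩ : Summand n M) = ⟨r', c', d'⟩) ↔ (c : ℕ) = c' := by
          simp [Fin.ext_iff]
        simp only [e2]
        -- On the first two copies the inverse is that of `gram_mul_inv`; on all further copies the
        -- form is the identity.
        by_cases hc : (c : ℕ) < 2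
        · rw [← gram_mul_inv (N := n + 1) (Nat.succ_ne_zero r') c c' hc]
          refine sum_range_two (fun h => absurd h (hM.ne_zero r'.2)) (fun h => ?_) fun m => ?_
          · have h1 := hM.not_lt h
            have h0 : (c : ℕ) = 0 := by have := c.2; omega
            simp [h0, gramCoef, h1]
          · obtain h0 | h0 : (c : ℕ) = 0 ∨ (c : ℕ) = 1 := by omega
            all_goals simp [h0, gramCoef]
        · obtain ⟨m, hm⟩ : ∃ m, (c : ℕ) = m + 2 := ⟨c - 2, by omega⟩
          rw [Finset.sum_eq_single (c : ℕ)]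
          · simp [hm, gramCoef, gramInvCoef]
          · intro b _ hb
            rw [hm] at hb ⊢
            simp [gramCoef, hb.symm]
          · intro h
            exact absurd (Finset.mem_range.mpr c.2) h
      · rw [if_neg]
        · exact Finset.sum_eq_zero fun b _ => by rw [formInvCoef, if_neg h1, mul_zero]
        · intro h
          cases h
          exact h1 ⟨rfl, rfl⟩
    rw [e]
    refine coefOp_congr fun s s' => ?_
    by_cases hs : s = s'
    · subst hs
      rw [irrepGram_mul_gramInvFam]
    · rw [Matrix.one_apply_ne hs, zero_smul, zero_smul]
  exact (Matrix.isUnit_iff_isUnit_det _).mp (IsUnit.of_mul_eq_one _ h)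

theorem star_formCoef (r c : ℕ) (d : Bool) (r' c' : ℕ) (d' : Bool) :
    star (formCoef n r' c' d' r c d) = formCoef n r c d r' c' d' := by
  unfold formCoef
  by_cases h : r' = r ∧ d' = d
  · rw [if_pos h, if_pos ⟨h.1.symm, h.2.symm⟩, star_gramCoef, h.1, gramCoef_comm]
  · rw [if_neg h, if_neg (fun h' => h ⟨h'.1.symm, h'.2.symm⟩), star_zero]

theorem formCoef_not (r c : ℕ) (d : Bool) (r' c' : ℕ) (d' : Bool) :
    (-1) ^ (r' + n) * formCoef n r c d r' c' (!d') =
      (-1) ^ (r + n) * formCoef n r c (!d) r' c' d' := by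
  unfold formCoef
  by_cases h : r' = r
  · subst h
    cases d <;> cases d' <;> simp
  · simp [h]

theorem formOp_isHermitian : (formOp n M).IsHermitian := by
  rw [Matrix.IsHermitian, formOp, coefOp_conjTranspose]
  refine coefOp_congr fun s s' => ?_
  have e : (levelMat (formCoef n) : Matrix (Summand n M) (Summand n M) ℂ)ᴴ s s' =
      levelMat (formCoef n) s s' := star_formCoef _ _ _ _ _ _
  rw [e]
  by_cases h : (levelMat (formCoef n) : Matrix (Summand n M) (Summand n M) ℂ) s s' = 0
  · rw [h, zero_smul, zero_smul]
  · rw [formCoef_ne h, gramFam_self, irrepGram_eq, Matrix.diagonal_conjTranspose]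
    congr 2
    funext p
    simp

theorem rhoGen_adjoint (α β : Fin 4) :
    (rhoGen n M α β)ᴴ * formOp n M = genSign α β • (formOp n M * rhoGen n M α β) := by
  have e : (rhoGen n M α β)ᴴ = Matrix.blockDiagonal' fun s : Summand n M =>
      (fun τ => (irrepGen τ α β)ᴴ) (Summand.label s) := Matrix.blockDiagonal'_conjTranspose _
  rw [formOp, coefOp_mul_rhoGen, e,
    blockDiagonal_mul_coefOp _ _ fun τ => (irrepGen τ α β)ᴴ, coefOp_smul]
  refine coefOp_congr fun s s' => ?_
  by_cases h : (levelMat (formCoef n) : Matrix (Summand n M) (Summand n M) ℂ) s s' = 0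
  · rw [h, zero_smul, zero_smul]
  · rw [formCoef_ne h, gramFam_self, irrepGen_adjoint]

theorem parityOp_conjTranspose : (parityOp n M)ᴴ = parityOp n M := by
  rw [parityOp, coefOp_conjTranspose]
  refine coefOp_congr fun s s' => ?_
  rw [swapOp_conjTranspose]
  congr 1
  simp only [Matrix.conjTranspose_apply, parityCoef, Matrix.of_apply]
  by_cases h : s' = flip n M s
  · subst h
    simp [paritySign, flip]
  · have h1 : s ≠ flip n M s' := by
      rintro rfl
      exact h (flip_flip s').symm
    simp [h, h1]

theorem formOp_mul_parityOp : formOp n M * parityOp n M = parityOp n M * formOp n M := by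
  rw [formOp, parityOp,
    coefOp_mul (Op'' := fun τ' τ => irrepGram τ' * swapOp τ' τ),
    coefOp_mul (Op'' := fun τ' τ => swapOp τ' τ * irrepGram τ)]
  · refine coefOp_congr fun s s' => ?_
    rw [parityCoef_mul, mul_parityCoef]
    have e : paritySign n M s' * levelMat (formCoef n) s (flip n M s') =
        paritySign n M s * levelMat (formCoef n) (flip n M s) s' :=
      formCoef_not s.1 s.2.1 s.2.2 s'.1 s'.2.1 s'.2.2
    rw [e]
    by_cases h : (levelMat (formCoef n) : Matrix (Summand n M) (Summand n M) ℂ)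
      (flip n M s) s' = 0
    · rw [h, mul_zero, zero_smul, zero_smul]
    · have h1 := formCoef_ne h
      rw [label_flip] at h1
      congr 1
      rw [h1]
      exact (swapOp_mul_irrepGram (Summand.label s).conj).symm
  · intro s s' s'' _ h
    rw [formCoef_ne h, gramFam_self]
  · intro s s' s'' h _
    rw [formCoef_ne h, gramFam_self]

/-- The third and later copies are decoupled. They are present because the algorithm prescribes
their number, and $X_\alpha$ is zero on them. -/
theorem couplingCoef_of_two_le (r c : ℕ) (d : Bool) (r' c' : ℕ) (d' : Bool) :
    couplingCoef n r (c + 2) d r' c' d' = 0 := by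
  unfold couplingCoef
  split_ifs <;> rcases c' with _ | _ | c' <;> simp [downCoef, upCoef, flipCoef]

theorem couplingCoef_of_two_le' (r c : ℕ) (d : Bool) (r' c' : ℕ) (d' : Bool) :
    couplingCoef n r c d r' (c' + 2) d' = 0 := by
  unfold couplingCoef
  split_ifs <;> rcases c with _ | _ | c <;> simp [downCoef, upCoef, flipCoef]

/-- The coefficients of the product of the inner product with the coupling. -/
theorem formMat_mul_coupling (hM : IsAdmissible n M) (s s' : Summand n M) :
    ((levelMat (formCoef n) : Matrix (Summand n M) (Summand n M) ℂ) *
      (levelMat (couplingCoef n) : Matrix (Summand n M) (Summand n M) ℂ) :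
          Matrix (Summand n M) (Summand n M) ℂ) s s' =
      gramCoef (n + 1) (s.1 + 1) s.2.1 0 *
        couplingCoef n s.1 0 s.2.2 s'.1 s'.2.1 s'.2.2 +
      gramCoef (n + 1) (s.1 + 1) s.2.1 1 *
        couplingCoef n s.1 1 s.2.2 s'.1 s'.2.1 s'.2.2 := by
  rw [formMat_mul]
  refine sum_range_two (fun h => absurd h (hM.ne_zero s.1.2)) (fun h => ?_) fun m => ?_
  · have h1 := hM.not_lt h
    have h0 : (s.2.1 : ℕ) = 0 := by have := s.2.1.2; omega
    simp [h0, gramCoef, h1]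
  · rw [couplingCoef_of_two_le, mul_zero]

/-- Hermiticity of the product of form and $X_0$, block by block. Neighbouring levels combine
`gram_down_up` with the adjointness of raising and lowering; within a level the sign in
`singletOp_adjoint_flip` matches the opposite signs of the two flips. -/
theorem form_coupling_symm {n : ℕ} {r c : ℕ} {d : Bool} {r' c' : ℕ} {d' : Bool}
    (hr : r < n + 1) (hr' : r' < n + 1) :
    (gramCoef (n + 1) (r + 1) c 0 * couplingCoef n r 0 d r' c' d' +
      gramCoef (n + 1) (r + 1) c 1 * couplingCoef n r 1 d r' c' d') •
        (irrepGram (lab r d) * singletOp (lab r d) (lab r' d')) =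
    ((gramCoef (n + 1) (r' + 1) c' 0 * couplingCoef n r' 0 d' r c d +
      gramCoef (n + 1) (r' + 1) c' 1 * couplingCoef n r' 1 d' r c d) •
        (irrepGram (lab r' d') * singletOp (lab r' d') (lab r d)))ᴴ := by
  rw [Matrix.conjTranspose_smul]
  by_cases hd : d = d'
  · subst hd
    have hup : ∀ m, (irrepGram (lab (m + 1) d) * singletOp (lab (m + 1) d) (lab m d))ᴴ =
        irrepGram (lab m d) * singletOp (lab m d) (lab (m + 1) d) := by
      intro m
      cases d
      · exact singletOp_adjoint_up m
      · exact singletOp_adjoint_up_conj m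
    simp only [couplingCoef, if_true]
    by_cases h1 : r' = r + 1
    · subst h1
      simp only [if_true, if_neg (show ¬ r = r + 1 + 1 by omega)]
      rw [hup, gram_down_up (by omega)]
    · by_cases h2 : r = r' + 1
      · subst h2
        simp only [if_true, if_neg (show ¬ r' = r' + 1 + 1 by omega)]
        rw [gram_down_up (by omega), star_star, ← hup, Matrix.conjTranspose_conjTranspose]
      · simp [h1, h2]
  · by_cases hr : r = r'
    · subst hr
      have hs := gram_flip_symm (n + 1) (r + 1) c c'
      have h1 : (irrepGram (lab r true) * singletOp (lab r true) (lab r false))ᴴ =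
        -(irrepGram (lab r false) * singletOp (lab r false) (lab r true)) :=
          singletOp_adjoint_flip r
      simp only [couplingCoef, if_neg hd, if_neg (Ne.symm hd), if_true]
      cases d <;> cases d'
      · exact absurd rfl hd
      · rw [h1]
        simp only [if_true, Bool.false_eq_true, if_false, one_mul, ← hs]
        module
      · have h2 := congrArg Matrix.conjTranspose h1
        rw [Matrix.conjTranspose_conjTranspose, Matrix.conjTranspose_neg,
          ← neg_eq_iff_eq_neg] at h2
        rw [← h2]
        have e : ∀ a b x y : ℂ, a * (-1 * x) + b * (-1 * y) = -(a * x + b * y) := fun _ _ _ _ => by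
          ring
        simp only [if_true, Bool.false_eq_true, if_false, one_mul, e, star_neg, ← hs]
        module
      · exact absurd rfl hd
    · simp only [couplingCoef, if_neg hd, if_neg (Ne.symm hd), if_neg hr, if_neg (Ne.symm hr)]
      simp

theorem diracOp_zero_adjoint (hM : IsAdmissible n M) :
    (diracOp n M 0)ᴴ * formOp n M = formOp n M * diracOp n M 0 := by
  have h : (formOp n M * diracOp n M 0)ᴴ = formOp n M * diracOp n M 0 := by
    rw [diracOp, formOp_mul_coefOp, coefOp_conjTranspose]
    refine coefOp_congr fun s s' => ?_
    rw [Matrix.conjTranspose_apply, formMat_mul_coupling hM, formMat_mul_coupling hM,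
      ← Matrix.conjTranspose_smul]
    exact (form_coupling_symm s.1.2 s'.1.2).symm
  rw [Matrix.conjTranspose_mul, formOp_isHermitian] at h
  exact h

variable (n M) in
/-- The matrix of the invariant form. -/
def diracForm : Matrix (RhoIdx n M) (RhoIdx n M) ℂ := formOp n M * parityOp n M

theorem diracForm_isInvariantForm (hM : IsAdmissible n M) :
    IsInvariantForm (rhoGen n M) (parityOp n M) (diracOp n M) (diracForm n M) := by
  have hP := parityOp_isParity n M
  have hinv : ∀ α β, (rhoGen n M α β)ᴴ * diracForm n M = diracForm n M * rhoGen n M α β := by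
    intro α β
    have h1 : parityOp n M * rhoGen n M α β = genSign α β • (rhoGen n M α β * parityOp n M) :=
      hP.2 α β
    rw [diracForm, ← Matrix.mul_assoc, rhoGen_adjoint, Matrix.mul_assoc, h1, Matrix.mul_smul,
      Matrix.smul_mul, Matrix.mul_assoc]
  have h0 : (diracOp n M 0)ᴴ * diracForm n M = diracForm n M * diracOp n M 0 := by
    rw [diracForm, ← Matrix.mul_assoc, diracOp_zero_adjoint hM, Matrix.mul_assoc, Matrix.mul_assoc,
      parityOp_mul_diracOp]
  refine ⟨?_, ?_, hinv, ?_, fun α => ?_⟩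
  · rw [Matrix.IsHermitian, diracForm, Matrix.conjTranspose_mul, parityOp_conjTranspose,
      formOp_isHermitian, formOp_mul_parityOp]
  · rw [diracForm, Matrix.det_mul]
    exact (formOp_isUnit hM).mul
      ((Matrix.isUnit_iff_isUnit_det _).mp (IsUnit.of_mul_eq_one _ hP.1))
  · rw [parityOp_conjTranspose, diracForm, Matrix.mul_assoc, Matrix.mul_assoc, hP.1, Matrix.mul_one,
      formOp_mul_parityOp]
  · by_cases hα : α = 0
    · subst hα
      exact h0
    · have hv := diracOp_isVector n M 0 0 α
      have e : (mink 0 α : ℂ) = 0 := by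
        have : mink 0 α = 0 := Matrix.diagonal_apply_ne' _ hα
        simp [this]
      have e0 : (mink 0 0 : ℂ) = 1 := by simp [mink]
      rw [e, e0, mul_one, mul_zero, zero_smul, sub_zero] at hv
      -- The space components are commutators of $X_0$ with boosts, so their symmetry follows from
      -- that of $X_0$ and the invariance of the form.
      have hX : diracOp n M α = (-Complex.I) • (diracOp n M 0 * rhoGen n M 0 α -
          rhoGen n M 0 α * diracOp n M 0) := by
        rw [hv, smul_smul]
        simp
      rw [hX, Matrix.conjTranspose_smul, Matrix.conjTranspose_sub, Matrix.conjTranspose_mul,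
        Matrix.conjTranspose_mul, Matrix.smul_mul, Matrix.sub_mul, Matrix.mul_assoc,
        Matrix.mul_assoc, h0, hinv, ← Matrix.mul_assoc, ← Matrix.mul_assoc, hinv, h0,
        Matrix.mul_assoc, Matrix.mul_assoc, Matrix.mul_smul, Matrix.mul_sub]
      simp [← smul_neg]

/-- The case of $X_0$ is already settled; a space component is a commutator of $X_0$ with a boost,
and the boost changes sign under `parityOp`. -/
theorem parityOp_diracOp (α : Fin 4) :
    parityOp n M * diracOp n M α = (mink α α : ℂ) • (diracOp n M α * parityOp n M) := by
  have hP := (parityOp_isParity n M).2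
  by_cases hα : α = 0
  · subst hα
    simpa [mink] using parityOp_mul_diracOp n M
  · have hv := diracOp_isVector n M 0 0 α
    have e : (mink 0 α : ℂ) = 0 := by
      have : mink 0 α = 0 := Matrix.diagonal_apply_ne' _ hα
      simp [this]
    have e0 : (mink 0 0 : ℂ) = 1 := by simp [mink]
    rw [e, e0, mul_one, mul_zero, zero_smul, sub_zero] at hv
    have hX : diracOp n M α = (-Complex.I) • (diracOp n M 0 * rhoGen n M 0 α -
        rhoGen n M 0 α * diracOp n M 0) := by
      rw [hv, smul_smul]
      simp
    have h1 := hP 0 α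
    rw [Complex.ofReal_mul, e0, one_mul] at h1
    have h0 := parityOp_mul_diracOp n M
    rw [hX, Matrix.mul_smul, Matrix.mul_sub, ← Matrix.mul_assoc, ← Matrix.mul_assoc, h0, h1,
      Matrix.mul_assoc, h1, Matrix.smul_mul, Matrix.mul_assoc, h0, Matrix.mul_smul,
      ← Matrix.mul_assoc, ← Matrix.mul_assoc, ← smul_sub, ← Matrix.sub_mul, smul_comm,
      Matrix.smul_mul]

end Operators

/-! ### Elimination of the lower spins -/

section LowerSpins

theorem lab_up_down (r : ℕ) (d : Bool) :
    singletOp (lab (r + 1) d) (lab r d) * singletOp (lab r d) (lab (r + 1) d) =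
      ((r : ℂ) + 2) ^ 2 • 1 - spinNumSq (lab (r + 1) d) := by
  cases d
  · exact singletOp_up_down r
  · exact singletOp_up_down_conj r

theorem lab_down_up (r : ℕ) (d : Bool) :
    singletOp (lab r d) (lab (r + 1) d) * singletOp (lab (r + 1) d) (lab r d) =
      ((r : ℂ) + 2) ^ 2 • 1 - spinNumSq (lab r d) := by
  cases d
  · exact singletOp_down_up r
  · exact singletOp_down_up_conj r

theorem lab_flip_flip (r : ℕ) (d : Bool) :
    singletOp (lab r d) (lab r (!d)) * singletOp (lab r (!d)) (lab r d) =
      -spinNumSq (lab r d) := by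
  cases d
  · exact singletOp_flip_flip r
  · exact singletOp_flip_flip_conj r

theorem spinNumSq_mulVec_singletOp {τ' τ : LorentzLabel} {w : τ.Carrier → ℂ} {μ : ℂ}
    (hw : spinNumSq τ *ᵥ w = μ • w) :
    spinNumSq τ' *ᵥ (singletOp τ' τ *ᵥ w) = μ • (singletOp τ' τ *ᵥ w) := by
  rw [Matrix.mulVec_mulVec, ← singletOp_mul_spinNumSq, ← Matrix.mulVec_mulVec, hw,
    Matrix.mulVec_smul]

/-- The spins which occur at level `r + 1` are `1/2, …, r + 1/2`. -/
theorem eq_zero_of_spinNumSq {μ : ℂ} (d : Bool) : ∀ (r : ℕ),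
    (∀ k : ℕ, 1 ≤ k → k ≤ r + 1 → μ ≠ (k : ℂ) ^ 2) → ∀ w : (lab r d).Carrier → ℂ,
      spinNumSq (lab r d) *ᵥ w = μ • w → w = 0 := by
  intro r
  induction r with
  | zero =>
    intro hμ w hw
    have e : spinNumSq (lab 0 d) = 1 := by
      cases d
      exacts [spinNumSq_tau_one, spinNumSq_tau_one_conj]
    rw [e, Matrix.one_mulVec] at hw
    have h1 : (1 - μ) • w = 0 := by rw [sub_smul, one_smul, ← hw, sub_self]
    have h2 := hμ 1 le_rfl le_rfl
    rw [Nat.cast_one, one_pow] at h2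
    exact (smul_eq_zero.mp h1).resolve_left (sub_ne_zero.mpr h2.symm)
  | succ r ih =>
    intro hμ w hw
    -- The lowered vector vanishes by induction. Raising it again multiplies by $(r+2)^2-\mu$, which
    -- is nonzero by hypothesis.
    have h1 : singletOp (lab r d) (lab (r + 1) d) *ᵥ w = 0 :=
      ih (fun k h h' => hμ k h (by omega)) _ (spinNumSq_mulVec_singletOp hw)
    have h2 := congrArg (singletOp (lab (r + 1) d) (lab r d) *ᵥ ·) h1
    simp only [Matrix.mulVec_mulVec, lab_up_down, Matrix.sub_mulVec, Matrix.smul_mulVec,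
      Matrix.one_mulVec, hw, Matrix.mulVec_zero, ← sub_smul] at h2
    have h3 := hμ (r + 2) (by omega) le_rfl
    push_cast at h3
    exact (smul_eq_zero.mp h2).resolve_left (sub_ne_zero.mpr h3.symm)

/-- The operator of the spin is semisimple. -/
theorem spinNumSq_semisimple (μ : ℂ) (d : Bool) : ∀ (r : ℕ) (w : (lab r d).Carrier → ℂ),
    spinNumSq (lab r d) *ᵥ (spinNumSq (lab r d) *ᵥ w - μ • w) =
      μ • (spinNumSq (lab r d) *ᵥ w - μ • w) → spinNumSq (lab r d) *ᵥ w = μ • w := by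
  intro r
  induction r with
  | zero =>
    intro w hw
    have e : spinNumSq (lab 0 d) = 1 := by
      cases d
      exacts [spinNumSq_tau_one, spinNumSq_tau_one_conj]
    rw [e, Matrix.one_mulVec] at hw ⊢
    have h1 : (1 - μ) • (w - μ • w) = 0 := by
      rw [sub_smul, one_smul, Matrix.one_mulVec] at *
      rw [← hw, sub_self]
    rcases smul_eq_zero.mp h1 with h2 | h2
    · rw [← sub_eq_zero.mp h2, one_smul]
    · exact sub_eq_zero.mp h2
  | succ r ih =>
    intro w hw
    set C := spinNumSq (lab (r + 1) d) with hC
    set u := C *ᵥ w - μ • w with hu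
    have hcomm : ∀ x, singletOp (lab r d) (lab (r + 1) d) *ᵥ (C *ᵥ x) =
        spinNumSq (lab r d) *ᵥ (singletOp (lab r d) (lab (r + 1) d) *ᵥ x) := fun x => by
      rw [Matrix.mulVec_mulVec, Matrix.mulVec_mulVec, singletOp_mul_spinNumSq]
    have hback : ∀ x, singletOp (lab (r + 1) d) (lab r d) *ᵥ
        (singletOp (lab r d) (lab (r + 1) d) *ᵥ x) = ((r : ℂ) + 2) ^ 2 • x - C *ᵥ x := fun x => by
      rw [Matrix.mulVec_mulVec, lab_up_down, Matrix.sub_mulVec, Matrix.smul_mulVec,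
        Matrix.one_mulVec]
    have h1 := ih (singletOp (lab r d) (lab (r + 1) d) *ᵥ w) (by
      rw [← hcomm, ← Matrix.mulVec_smul, ← Matrix.mulVec_sub, ← hcomm, ← hu, hw,
        Matrix.mulVec_smul])
    -- If `μ` belongs to the spin which is new at this level, lowering annihilates `w` and the
    -- product of lowering and raising gives the eigenvalue equation. Otherwise lowering annihilates
    -- the defect `u`, and raising back shows `u = 0`.
    by_cases hμ : μ = ((r : ℂ) + 2) ^ 2
    · have h2 : singletOp (lab r d) (lab (r + 1) d) *ᵥ w = 0 := by
        refine eq_zero_of_spinNumSq d r (μ := μ) (fun k _ hk h => ?_) _ h1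
        rw [hμ] at h
        have h3 : (((r + 2) ^ 2 : ℕ) : ℂ) = ((k ^ 2 : ℕ) : ℂ) := by push_cast; exact h
        have h4 := Nat.pow_left_injective two_ne_zero (Nat.cast_injective h3)
        omega
      have h3 := hback w
      rw [h2, Matrix.mulVec_zero, ← hμ] at h3
      exact (sub_eq_zero.mp h3.symm).symm
    · have h2 : singletOp (lab r d) (lab (r + 1) d) *ᵥ u = 0 := by
        rw [hu, Matrix.mulVec_sub, hcomm, h1, Matrix.mulVec_smul, sub_self]
      have h3 := hback u
      rw [h2, Matrix.mulVec_zero, hw, ← sub_smul] at h3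
      have h4 := (smul_eq_zero.mp h3.symm).resolve_left (sub_ne_zero.mpr (Ne.symm hμ))
      exact sub_eq_zero.mp h4

variable {n : ℕ} {M : ℕ → ℕ}

/-- The contribution of the level `r'` to the component of `X₀ v` at level `r`. -/
def levelTerm (v : RhoIdx n M → ℂ) (r c : ℕ) (d : Bool) (r' : ℕ) : (lab r d).Carrier → ℂ :=
  ∑ d', (couplingCoef n r c d r' 0 d' • (singletOp (lab r d) (lab r' d') *ᵥ comp v r' 0 d') +
    couplingCoef n r c d r' 1 d' • (singletOp (lab r d) (lab r' d') *ᵥ comp v r' 1 d'))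

theorem comp_diracOp (v : RhoIdx n M → ℂ) {r c : ℕ} (d : Bool) (hr : r < n + 1)
    (hc : c < M (r + 1)) :
    comp (diracOp n M 0 *ᵥ v) r c d = ∑ r' ∈ Finset.range (n + 1), levelTerm v r c d r' := by
  rw [diracOp, comp_coefOp _ _ _ d hr hc]
  refine Finset.sum_congr rfl fun r' _ => ?_
  rw [sum_range_two, levelTerm, Finset.sum_add_distrib]
  · rfl
  · intro h
    simp [comp_of_le' v _ h.le]
  · intro h
    simp [comp_of_le' v _ h]
  · intro c'
    simp [couplingCoef_of_two_le']

theorem levelTerm_of_le (v : RhoIdx n M → ℂ) (r c : ℕ) (d : Bool) {r' : ℕ} (h : n + 1 ≤ r') :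
    levelTerm v r c d r' = 0 := by
  simp [levelTerm, comp_of_le v _ _ h]

theorem levelTerm_of_ne (v : RhoIdx n M → ℂ) {r c : ℕ} (d : Bool) {r' : ℕ} (h : r' ≠ r + 1)
    (h' : r ≠ r' + 1) (h'' : r ≠ r') : levelTerm v r c d r' = 0 := by
  simp [levelTerm, couplingCoef, h, h', h'']

theorem levelTerm_self (v : RhoIdx n M → ℂ) (r c : ℕ) (d : Bool) :
    levelTerm v r c d r = (if d then (1 : ℂ) else -1) •
      (singletOp (lab r d) (lab r (!d)) *ᵥ (flipCoef (n + 1) (r + 1) c 0 • comp v r 0 (!d) +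
        flipCoef (n + 1) (r + 1) c 1 • comp v r 1 (!d))) := by
  have h1 : ∀ c', couplingCoef n r c d r c' (!d) =
      (if d then (1 : ℂ) else -1) * flipCoef (n + 1) (r + 1) c c' := fun c' => by
    cases d <;> simp [couplingCoef]
  have h2 : ∀ c', couplingCoef n r c d r c' d = 0 := fun c' => by simp [couplingCoef]
  have h3 : ∀ f : Bool → (lab r d).Carrier → ℂ, ∑ d', f d' = f (!d) + f d := fun f => by
    cases d
    · exact Fintype.sum_bool f
    · exact (Fintype.sum_bool f).trans (add_comm _ _)
  rw [levelTerm, h3, h1, h1, h2, h2, Matrix.mulVec_add, Matrix.mulVec_smul, Matrix.mulVec_smul]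
  module

theorem levelTerm_succ (v : RhoIdx n M → ℂ) (r c : ℕ) (d : Bool) :
    levelTerm v r c d (r + 1) = singletOp (lab r d) (lab (r + 1) d) *ᵥ
      (downCoef (n + 1) (r + 1) c 0 • comp v (r + 1) 0 d +
        downCoef (n + 1) (r + 1) c 1 • comp v (r + 1) 1 d) := by
  cases d <;>
    simp [levelTerm, couplingCoef, Matrix.mulVec_add, Matrix.mulVec_smul]

theorem levelTerm_pred (v : RhoIdx n M → ℂ) (r c : ℕ) (d : Bool) :
    levelTerm v (r + 1) c d r = singletOp (lab (r + 1) d) (lab r d) *ᵥ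
      (upCoef (n + 1) (r + 1) c 0 • comp v r 0 d +
        upCoef (n + 1) (r + 1) c 1 • comp v r 1 d) := by
  cases d <;>
    simp [levelTerm, couplingCoef, show r ≠ r + 1 + 1 by omega, Matrix.mulVec_add, Matrix.mulVec_smul]

theorem comp_diracOp_succ (v : RhoIdx n M → ℂ) {r c : ℕ} (d : Bool) (hr : r + 1 < n + 1)
    (hc : c < M (r + 1 + 1)) :
    comp (diracOp n M 0 *ᵥ v) (r + 1) c d = levelTerm v (r + 1) c d (r + 1) +
      levelTerm v (r + 1) c d (r + 1 + 1) + levelTerm v (r + 1) c d r := by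
  rw [comp_diracOp v d hr hc]
  -- The range is extended by vanishing terms so that the level `r + 1 + 1` is included even when it
  -- does not exist.
  have h1 : ∑ r' ∈ Finset.range (n + 1), levelTerm v (r + 1) c d r' =
      ∑ r' ∈ Finset.range (n + 3), levelTerm v (r + 1) c d r' :=
    Finset.sum_subset (Finset.range_subset_range.mpr (by omega)) fun r' _ h =>
      levelTerm_of_le v _ _ _ (by simpa using h)
  have h2 : ∑ r' ∈ ({r, r + 1, r + 1 + 1} : Finset ℕ), levelTerm v (r + 1) c d r' =
      ∑ r' ∈ Finset.range (n + 3), levelTerm v (r + 1) c d r' := by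
    refine Finset.sum_subset (fun r' h => ?_) fun r' _ h => ?_
    · simp only [Finset.mem_insert, Finset.mem_singleton, Finset.mem_range] at h ⊢
      omega
    · simp only [Finset.mem_insert, Finset.mem_singleton] at h
      exact levelTerm_of_ne v d (by omega) (by omega) (by omega)
  rw [h1, ← h2, Finset.sum_insert (by simp [show r ≠ r + 1 + 1 by omega]),
    Finset.sum_insert (by simp), Finset.sum_singleton]
  abel

/-- The first row of the chain: with all components below `r` zero, nothing flows in from below. It
applies to vectors of spin $r+\tfrac12$. -/
theorem comp_diracOp_of_lower (v : RhoIdx n M → ℂ) {r c : ℕ} (d : Bool) (hr : r < n + 1)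
    (hc : c < M (r + 1)) (hlow : ∀ r' < r, ∀ c' d', comp v r' c' d' = 0) :
    comp (diracOp n M 0 *ᵥ v) r c d = levelTerm v r c d r + levelTerm v r c d (r + 1) := by
  rw [comp_diracOp v d hr hc]
  have h1 : ∑ r' ∈ Finset.range (n + 1), levelTerm v r c d r' =
      ∑ r' ∈ Finset.range (n + 3), levelTerm v r c d r' :=
    Finset.sum_subset (Finset.range_subset_range.mpr (by omega)) fun r' _ h =>
      levelTerm_of_le v _ _ _ (by simpa using h)
  have h2 : ∑ r' ∈ ({r, r + 1} : Finset ℕ), levelTerm v r c d r' =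
      ∑ r' ∈ Finset.range (n + 3), levelTerm v r c d r' := by
    refine Finset.sum_subset (fun r' h => ?_) fun r' _ h => ?_
    · simp only [Finset.mem_insert, Finset.mem_singleton, Finset.mem_range] at h ⊢
      omega
    · simp only [Finset.mem_insert, Finset.mem_singleton] at h
      by_cases h3 : r = r' + 1
      · simp [levelTerm, hlow r' (by omega)]
      · exact levelTerm_of_ne v d (by omega) h3 (by omega)
  rw [h1, ← h2, Finset.sum_insert (by simp), Finset.sum_singleton]

end LowerSpins

/-! ### Reduction of the eigenvalue equation of X₀ to scalar equations. -/

section Nilpotency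

/-- Lowering from level `m + e + 1` to level `m + 1`. -/
def lowerTo (m : ℕ) : ∀ e : ℕ, Matrix (lab m false).Carrier (lab (m + e) false).Carrier ℂ
  | 0 => 1
  | e + 1 => lowerTo m e * singletOp (lab (m + e) false) (lab (m + e + 1) false)

/-- Lowering from the dotted level `m + e + 1` to level `m + 1`. -/
def lowerDot (m e : ℕ) : Matrix (lab m false).Carrier (lab (m + e) true).Carrier ℂ :=
  lowerTo m e * singletOp (lab (m + e) false) (lab (m + e) true)

/-- The lowering operators, by dottedness. -/
def lowering (m e : ℕ) : ∀ d : Bool, Matrix (lab m false).Carrier (lab (m + e) d).Carrier ℂ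
  | false => lowerTo m e
  | true => lowerDot m e

/-- A dotted component is first flipped and then lowered. By `singletOp_flip_down` it may as well be
lowered first, so both kinds of components satisfy the same recursion. -/
theorem lowering_succ (m e : ℕ) (d : Bool) :
    lowering m e d * singletOp (lab (m + e) d) (lab (m + e + 1) d) = lowering m (e + 1) d := by
  cases d
  · rfl
  · have h : singletOp (lab (m + e) false) (lab (m + e) true) *
        singletOp (lab (m + e) true) (lab (m + e + 1) true) =
        singletOp (lab (m + e) false) (lab (m + e + 1) false) *
          singletOp (lab (m + e + 1) false) (lab (m + e + 1) true) := singletOp_flip_down (m + e)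
    change lowerTo m e * singletOp (lab (m + e) false) (lab (m + e) true) * _ =
      lowerTo m e * singletOp (lab (m + e) false) (lab (m + e + 1) false) *
        singletOp (lab (m + e + 1) false) (lab (m + e + 1) true)
    rw [Matrix.mul_assoc, h, Matrix.mul_assoc]

/-- One step up followed by one step down is a scalar on a fixed spin, so after lowering the
coupling from below becomes multiplication by a number. -/
theorem lowering_up (m e : ℕ) (d : Bool) {μ : ℂ} {w : (lab (m + e) d).Carrier → ℂ}
    (hw : spinNumSq (lab (m + e) d) *ᵥ w = μ • w) :
    lowering m (e + 1) d *ᵥ (singletOp (lab (m + e + 1) d) (lab (m + e) d) *ᵥ w) =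
      ((((m + e : ℕ) : ℂ) + 2) ^ 2 - μ) • (lowering m e d *ᵥ w) := by
  rw [← lowering_succ, ← Matrix.mulVec_mulVec, Matrix.mulVec_mulVec w, lab_down_up,
    Matrix.sub_mulVec, Matrix.smul_mulVec, Matrix.one_mulVec, hw, ← sub_smul, Matrix.mulVec_smul]

theorem lowering_flip_true (m e : ℕ) (w : (lab (m + e) true).Carrier → ℂ) :
    lowering m e false *ᵥ (singletOp (lab (m + e) false) (lab (m + e) true) *ᵥ w) =
      lowering m e true *ᵥ w := by
  rw [Matrix.mulVec_mulVec]
  rfl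

theorem lowering_flip_false (m e : ℕ) {μ : ℂ} {w : (lab (m + e) false).Carrier → ℂ}
    (hw : spinNumSq (lab (m + e) false) *ᵥ w = μ • w) :
    lowering m e true *ᵥ (singletOp (lab (m + e) true) (lab (m + e) false) *ᵥ w) =
      -μ • (lowering m e false *ᵥ w) := by
  have h : singletOp (lab (m + e) false) (lab (m + e) true) *
      singletOp (lab (m + e) true) (lab (m + e) false) = -spinNumSq (lab (m + e) false) :=
    lab_flip_flip (m + e) false
  change (lowerTo m e * singletOp (lab (m + e) false) (lab (m + e) true)) *ᵥ _ = _
  rw [← Matrix.mulVec_mulVec, Matrix.mulVec_mulVec w, h, Matrix.neg_mulVec, hw, ← neg_smul,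
    Matrix.mulVec_smul]
  rfl

/-- Each lowering step can be undone up to $(m+e+2)^2-(m+1)^2\ne0$, and the flip up to
$-(m+1)^2\ne0$. Hence nothing is lost by the reduction to the lowest level. -/
theorem eq_zero_of_lowering {μ : ℂ} (m : ℕ) (hμ : μ = ((m : ℂ) + 1) ^ 2) (d : Bool) :
    ∀ (e : ℕ) (w : (lab (m + e) d).Carrier → ℂ), spinNumSq (lab (m + e) d) *ᵥ w = μ • w →
      lowering m e d *ᵥ w = 0 → w = 0 := by
  have hm : (m : ℂ) + 1 ≠ 0 := Nat.cast_add_one_ne_zero m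
  intro e
  induction e with
  | zero =>
    intro w hw h
    cases d
    · change (1 : Matrix (lab m false).Carrier (lab m false).Carrier ℂ) *ᵥ w = 0 at h
      rwa [Matrix.one_mulVec] at h
    · change ((1 : Matrix (lab m false).Carrier (lab m false).Carrier ℂ) *
        singletOp (lab m false) (lab m true)) *ᵥ w = 0 at h
      rw [Matrix.one_mul] at h
      have h1 : singletOp (lab m true) (lab m false) * singletOp (lab m false) (lab m true) =
        -spinNumSq (lab m true) := lab_flip_flip m true
      have hw' : spinNumSq (lab m true) *ᵥ w = μ • w := hw
      have h2 := congrArg (singletOp (lab m true) (lab m false) *ᵥ ·) h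
      simp only [Matrix.mulVec_zero] at h2
      rw [Matrix.mulVec_mulVec, h1, Matrix.neg_mulVec, hw', neg_eq_zero, hμ] at h2
      exact (smul_eq_zero.mp h2).resolve_left (pow_ne_zero _ hm)
  | succ e ih =>
    intro w hw h
    rw [← lowering_succ, ← Matrix.mulVec_mulVec] at h
    have h1 := ih _ (spinNumSq_mulVec_singletOp hw) h
    have h2 := congrArg (singletOp (lab (m + e + 1) d) (lab (m + e) d) *ᵥ ·) h1
    simp only [Matrix.mulVec_zero] at h2
    have hw' : spinNumSq (lab (m + e + 1) d) *ᵥ w = μ • w := hw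
    have h3 : singletOp (lab (m + e + 1) d) (lab (m + e) d) *
        singletOp (lab (m + e) d) (lab (m + (e + 1)) d) =
        ((((m + e : ℕ) : ℂ) + 2) ^ 2 • 1 - spinNumSq (lab (m + e + 1) d)) := lab_up_down (m + e) d
    rw [Matrix.mulVec_mulVec, h3, Matrix.sub_mulVec, Matrix.smul_mulVec,
      Matrix.one_mulVec, hw', ← sub_smul] at h2
    refine (smul_eq_zero.mp h2).resolve_left ?_
    rw [hμ]
    have := natCast_sq_sub_ne (show m + 1 < m + e + 2 by omega)
    push_cast at this ⊢
    exact this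

variable {n : ℕ} {M : ℕ → ℕ}

/-- An eigenvector of `X₀` and of the spin, reduced to the lowest level. -/
def reduced (v : RhoIdx n M → ℂ) (m e c : ℕ) (d : Bool) : (lab m false).Carrier → ℂ :=
  lowering m e d *ᵥ comp v (m + e) c d

/-- The combination of the dotted and undotted components which diagonalizes the flip. -/
def combined (v : RhoIdx n M → ℂ) (m : ℕ) (z : ℂ) (e c : ℕ) : (lab m false).Carrier → ℂ :=
  reduced v m e c false + z • reduced v m e c true

section Equations

variable {v : RhoIdx n M → ℂ} {a μ : ℂ}

theorem spinNumSq_combination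
    (hC : ∀ r c d, spinNumSq (lab r d) *ᵥ comp v r c d = μ • comp v r c d)
    (r : ℕ) (d : Bool) (x y : ℂ) :
    spinNumSq (lab r d) *ᵥ (x • comp v r 0 d + y • comp v r 1 d) =
      μ • (x • comp v r 0 d + y • comp v r 1 d) := by
  rw [Matrix.mulVec_add, Matrix.mulVec_smul, Matrix.mulVec_smul, hC, hC]
  module

/-- After lowering, the flip sends undotted to dotted and back with square `μ`, up to the
coefficients. The combination with `z * ι = -1` is its eigenvector with eigenvalue `ι`, one of the
two square roots of `μ`. -/
theorem reduced_flip
    (hC : ∀ r c d, spinNumSq (lab r d) *ᵥ comp v r c d = μ • comp v r c d)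
    (m e c : ℕ) {z ι : ℂ} (hz : z * ι = -1) (hμ : ι ^ 2 = μ) :
    lowering m e false *ᵥ levelTerm v (m + e) c false (m + e) +
      z • (lowering m e true *ᵥ levelTerm v (m + e) c true (m + e)) =
      (ι * flipCoef (n + 1) (m + e + 1) c 0) • combined v m z e 0 +
        (ι * flipCoef (n + 1) (m + e + 1) c 1) • combined v m z e 1 := by
  have hf : levelTerm v (m + e) c false (m + e) = (-1 : ℂ) •
      (singletOp (lab (m + e) false) (lab (m + e) true) *ᵥ
        (flipCoef (n + 1) (m + e + 1) c 0 • comp v (m + e) 0 true +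
          flipCoef (n + 1) (m + e + 1) c 1 • comp v (m + e) 1 true)) :=
    levelTerm_self v (m + e) c false
  have ht : levelTerm v (m + e) c true (m + e) = (1 : ℂ) •
      (singletOp (lab (m + e) true) (lab (m + e) false) *ᵥ
        (flipCoef (n + 1) (m + e + 1) c 0 • comp v (m + e) 0 false +
          flipCoef (n + 1) (m + e + 1) c 1 • comp v (m + e) 1 false)) :=
    levelTerm_self v (m + e) c true
  have hw := spinNumSq_combination hC (m + e) false (flipCoef (n + 1) (m + e + 1) c 0)
    (flipCoef (n + 1) (m + e + 1) c 1)
  rw [hf, ht, Matrix.mulVec_smul, Matrix.mulVec_smul, lowering_flip_true,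
    lowering_flip_false m e hw, Matrix.mulVec_add, Matrix.mulVec_add]
  simp only [Matrix.mulVec_smul, combined, reduced]
  have hι : z * μ = -ι := by rw [← hμ]; linear_combination ι * hz
  match_scalars
  · linear_combination -flipCoef (n + 1) (m + e + 1) c 0 * hz
  · linear_combination -flipCoef (n + 1) (m + e + 1) c 1 * hz
  · linear_combination -flipCoef (n + 1) (m + e + 1) c 0 * hι
  · linear_combination -flipCoef (n + 1) (m + e + 1) c 1 * hι

theorem reduced_down (m e c : ℕ) (z : ℂ) :
    lowering m e false *ᵥ levelTerm v (m + e) c false (m + e + 1) +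
      z • (lowering m e true *ᵥ levelTerm v (m + e) c true (m + e + 1)) =
      downCoef (n + 1) (m + e + 1) c 0 • combined v m z (e + 1) 0 +
        downCoef (n + 1) (m + e + 1) c 1 • combined v m z (e + 1) 1 := by
  have hdown : ∀ d, lowering m e d *ᵥ levelTerm v (m + e) c d (m + e + 1) =
      downCoef (n + 1) (m + e + 1) c 0 • reduced v m (e + 1) 0 d +
        downCoef (n + 1) (m + e + 1) c 1 • reduced v m (e + 1) 1 d := by
    intro d
    rw [levelTerm_succ, Matrix.mulVec_mulVec, lowering_succ, Matrix.mulVec_add, Matrix.mulVec_smul,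
      Matrix.mulVec_smul]
    rfl
  rw [hdown, hdown]
  simp only [combined]
  module

theorem reduced_up
    (hC : ∀ r c d, spinNumSq (lab r d) *ᵥ comp v r c d = μ • comp v r c d)
    (m e c : ℕ) (z : ℂ) :
    lowering m (e + 1) false *ᵥ levelTerm v (m + e + 1) c false (m + e) +
      z • (lowering m (e + 1) true *ᵥ levelTerm v (m + e + 1) c true (m + e)) =
      ((((m + e : ℕ) : ℂ) + 2) ^ 2 - μ) •
        (upCoef (n + 1) (m + e + 1) c 0 • combined v m z e 0 +
          upCoef (n + 1) (m + e + 1) c 1 • combined v m z e 1) := by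
  have hup : ∀ d, lowering m (e + 1) d *ᵥ levelTerm v (m + e + 1) c d (m + e) =
      ((((m + e : ℕ) : ℂ) + 2) ^ 2 - μ) •
        (upCoef (n + 1) (m + e + 1) c 0 • reduced v m e 0 d +
          upCoef (n + 1) (m + e + 1) c 1 • reduced v m e 1 d) := by
    intro d
    rw [levelTerm_pred, lowering_up m e d (spinNumSq_combination hC (m + e) d _ _),
      Matrix.mulVec_add, Matrix.mulVec_smul, Matrix.mulVec_smul]
    rfl
  rw [hup, hup]
  simp only [combined]
  module

theorem combined_eq_zero_level
    (hC : ∀ r c d, spinNumSq (lab r d) *ᵥ comp v r c d = μ • comp v r c d)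
    (hv : diracOp n M 0 *ᵥ v = a • v) (m c : ℕ) (hlow : ∀ r < m, ∀ c d, comp v r c d = 0)
    (hr : m < n + 1) (hc : c < M (m + 1)) {z ι : ℂ} (hz : z * ι = -1) (hμ : ι ^ 2 = μ) :
    a • combined v m z 0 c =
      (ι * flipCoef (n + 1) (m + 1) c 0) • combined v m z 0 0 +
        (ι * flipCoef (n + 1) (m + 1) c 1) • combined v m z 0 1 +
      (downCoef (n + 1) (m + 1) c 0 • combined v m z 1 0 +
        downCoef (n + 1) (m + 1) c 1 • combined v m z 1 1) := by
  have hrow : ∀ d, a • comp v m c d = levelTerm v m c d m + levelTerm v m c d (m + 1) := by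
    intro d
    rw [← comp_smul, ← hv]
    exact comp_diracOp_of_lower v d hr hc hlow
  have h1 := reduced_flip hC m 0 c hz hμ
  have h2 := reduced_down (v := v) m 0 c z
  simp only [Nat.add_zero, Nat.zero_add] at h1 h2
  rw [← h1, ← h2, combined, smul_add, smul_comm a z, reduced, reduced, ← Matrix.mulVec_smul,
    ← Matrix.mulVec_smul]
  have e : ∀ d, a • comp v (m + 0) c d = a • comp v m c d := fun _ => rfl
  rw [e, e, hrow, hrow, Matrix.mulVec_add, Matrix.mulVec_add]
  module

theorem combined_eq_succ_level
    (hC : ∀ r c d, spinNumSq (lab r d) *ᵥ comp v r c d = μ • comp v r c d)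
    (hv : diracOp n M 0 *ᵥ v = a • v) (m e c : ℕ) (hr : m + e + 1 < n + 1) (hc : c < M (m + e + 1 + 1))
    {z ι : ℂ} (hz : z * ι = -1) (hμ : ι ^ 2 = μ) :
    a • combined v m z (e + 1) c =
      (ι * flipCoef (n + 1) (m + e + 1 + 1) c 0) • combined v m z (e + 1) 0 +
        (ι * flipCoef (n + 1) (m + e + 1 + 1) c 1) • combined v m z (e + 1) 1 +
      (downCoef (n + 1) (m + e + 1 + 1) c 0 • combined v m z (e + 1 + 1) 0 +
        downCoef (n + 1) (m + e + 1 + 1) c 1 • combined v m z (e + 1 + 1) 1) +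
      ((((m + e : ℕ) : ℂ) + 2) ^ 2 - μ) •
        (upCoef (n + 1) (m + e + 1) c 0 • combined v m z e 0 +
          upCoef (n + 1) (m + e + 1) c 1 • combined v m z e 1) := by
  have hrow : ∀ d, a • comp v (m + (e + 1)) c d = levelTerm v (m + (e + 1)) c d (m + (e + 1)) +
      levelTerm v (m + (e + 1)) c d (m + (e + 1) + 1) + levelTerm v (m + e + 1) c d (m + e) := by
    intro d
    rw [← comp_smul, ← hv]
    exact comp_diracOp_succ v d hr hc
  have h1 := reduced_flip hC m (e + 1) c hz hμ
  have h2 := reduced_down (v := v) m (e + 1) c z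
  have h3 := reduced_up hC m e c z
  have e1 : m + e + 1 + 1 = m + (e + 1) + 1 := rfl
  rw [e1, ← h1, ← h2, ← h3, combined, smul_add, smul_comm a z, reduced, reduced,
    ← Matrix.mulVec_smul, ← Matrix.mulVec_smul, hrow, hrow, Matrix.mulVec_add, Matrix.mulVec_add,
    Matrix.mulVec_add, Matrix.mulVec_add]
  module

end Equations

end Nilpotency

/-! ### Nilpotency of X₀ below the highest spin. -/

section Nilpotency

variable {n : ℕ} {M : ℕ → ℕ}

theorem combined_of_le (v : RhoIdx n M → ℂ) (m : ℕ) (z : ℂ) {e : ℕ} (c : ℕ) (h : n + 1 ≤ m + e) :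
    combined v m z e c = 0 := by
  simp [combined, reduced, comp_of_le v c _ h]

theorem combined_of_le' (v : RhoIdx n M → ℂ) (m : ℕ) (z : ℂ) {e c : ℕ} (h : M (m + e + 1) ≤ c) :
    combined v m z e c = 0 := by
  simp [combined, reduced, comp_of_le' v _ h]

theorem flipCoef_low {N k : ℕ} (h : k + 1 < N) (ι : ℂ) (x y : ℂ) :
    (N : ℂ) * (ι * flipCoef N k 0 0 * x + ι * flipCoef N k 0 1 * y) =
      ι / (1 - ratio N k) * (-x + y) ∧
    (N : ℂ) * (ι * flipCoef N k 1 0 * x + ι * flipCoef N k 1 1 * y) =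
      ι / (1 - ratio N k) * (-ratio N k * x + y) := by
  have h1 := one_sub_ratio_ne (show k < N by omega)
  have h2 : (N : ℂ) ≠ 0 := Nat.cast_ne_zero.mpr (by omega)
  simp only [flipCoef, if_pos h, if_neg (show k ≠ N by omega)]
  constructor <;> field_simp

/-- The reduced equations, taken component by component, are an instance of `chain_eq_zero` whose
unknowns are the copies `0` and `1`. Copy `1` is absent at the two highest levels. -/
theorem combined_eq_zero (hM : IsAdmissible n M) {v : RhoIdx n M → ℂ} {a : ℂ} {m : ℕ}
    (hC : ∀ r c d, spinNumSq (lab r d) *ᵥ comp v r c d = ((m : ℂ) + 1) ^ 2 • comp v r c d)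
    (hv : diracOp n M 0 *ᵥ v = a • v) (ha : a ≠ 0) (hmn : m < n)
    (hlow : ∀ r < m, ∀ c d, comp v r c d = 0) {z ι : ℂ} (hz : z * ι = -1)
    (hι : ι ^ 2 = ((m : ℂ) + 1) ^ 2) (e : ℕ) (he : m + e ≤ n) :
    combined v m z e 0 = 0 ∧ combined v m z e 1 = 0 := by
  have hN : (n : ℂ) + 1 ≠ 0 := Nat.cast_add_one_ne_zero n
  suffices h : ∀ p, combined v m z e 0 p = 0 ∧ combined v m z e 1 p = 0 from
    ⟨funext fun p => (h p).1, funext fun p => (h p).2⟩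
  intro p
  have hMn : M n = 1 := hM.next (by omega)
  have hpos : ∀ r, r ≤ n → 0 < M (r + 1) := fun r hr =>
    Nat.pos_of_ne_zero (hM.ne_zero (Nat.lt_succ_of_le hr))
  -- The lowest level is `i = m + 1`, so the level `k` of the chain sits at offset `k - (m + 1)`.
  -- The rows are multiplied by `n + 1`, which explains `t`.
  have key := chain_eq_zero (n := n) (i := m + 1) (Nat.succ_pos m) hmn (ι := ι)
    (t := ((n : ℂ) + 1) * a) (by push_cast; exact hι) (mul_ne_zero hN ha)
    (fun k => combined v m z (k - (m + 1)) 0 p) (fun k => combined v m z (k - (m + 1)) 1 p)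
    -- The inflow `z` is defined as the contribution of copy `1` of the level below, and as zero at
    -- the lowest level.
    (fun k => if k = m + 1 then 0 else stepCoef (n + 1) (k - 1) *
      ((((k - 1 : ℕ) : ℂ) + 1) ^ 2 - ((m : ℂ) + 1) ^ 2) * combined v m z (k - 1 - (m + 1)) 1 p)
    ?_ ?_ ?_ ?_ ?_ ?_ ?_ ?_
  · simpa [Nat.add_sub_cancel_left] using key (m + 1 + e) (by omega) (by omega)
  · -- the highest level
    obtain ⟨f, rfl⟩ : ∃ f, n = m + f + 1 := ⟨n - m - 1, by omega⟩
    have h := congrFun (combined_eq_succ_level hC hv m f 0 (by omega) (hpos _ (by omega)) hz hι) p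
    have h1 : combined v m z (f + 1 + 1) 0 = 0 := combined_of_le v m z 0 (by omega)
    have h2 : combined v m z (f + 1 + 1) 1 = 0 := combined_of_le v m z 1 (by omega)
    have h3 : combined v m z (f + 1) 1 = 0 := combined_of_le' v m z hM.last.le
    have e1 : m + f + 1 + 1 - (m + 1) = f + 1 := by omega
    have e2 : m + f + 1 - (m + 1) = f := by omega
    simp only [h1, h2, h3, Pi.add_apply, Pi.smul_apply, smul_eq_mul, Pi.zero_apply] at h
    simp only [e1, e2]
    simp only [flipCoef, upCoef, if_true, lt_irrefl, if_false] at h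
    push_cast at h hN ⊢
    rw [mul_assoc, h]
    field_simp
    ring
  · -- the level below
    rcases (show n = m + 1 ∨ ∃ f, n = m + f + 1 + 1 by
      rcases Nat.lt_or_ge (m + 1) n with h | h
      · exact Or.inr ⟨n - m - 2, by omega⟩
      · exact Or.inl (by omega)) with rfl | ⟨f, rfl⟩
    · have h := congrFun (combined_eq_zero_level hC hv m 0 hlow (by omega) (hpos _ (by omega))
        hz hι) p
      have h1 : combined v m z 0 1 = 0 := combined_of_le' v m z hMn.le
      simp only [h1, Pi.add_apply, Pi.smul_apply, smul_eq_mul, Pi.zero_apply] at h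
      simp only [if_true, Nat.sub_self, Nat.add_sub_cancel_left, mul_zero, add_zero]
      simp only [flipCoef, downCoef, if_neg (show ¬ m + 1 = m + 1 + 1 by omega), ratio_last] at h
      push_cast at h hN ⊢
      rw [mul_assoc, h]
      field_simp
      simp
    · have h := congrFun (combined_eq_succ_level hC hv m f 0 (by omega) (hpos _ (by omega))
        hz hι) p
      have h1 : combined v m z (f + 1) 1 = 0 := combined_of_le' v m z hMn.le
      have e1 : m + f + 1 + 1 + 1 - (m + 1) = f + 1 + 1 := by omega
      have e2 : m + f + 1 + 1 - (m + 1) = f + 1 := by omega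
      have e3 : m + f + 1 - (m + 1) = f := by omega
      simp only [h1, Pi.add_apply, Pi.smul_apply, smul_eq_mul, Pi.zero_apply] at h
      simp only [e1, e2, if_neg (show ¬ m + f + 1 + 1 = m + 1 by omega),
        Nat.add_sub_cancel (m := 1), e3]
      simp only [flipCoef, downCoef, upCoef,
        if_neg (show ¬ m + f + 1 + 1 = m + f + 1 + 1 + 1 by omega),
        if_pos (show m + f + 1 + 1 < m + f + 1 + 1 + 1 by omega), ratio_last] at h
      push_cast at h hN ⊢
      rw [mul_assoc, h]
      field_simp
      ring
  -- The row of copy `0` at the levels below `n`; the lowest level is treated separately because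
  -- nothing lies beneath it.
  · intro k hk hkn
    have hM2 : 1 < M k := hM.below k (by omega) hkn
    have hlt : k + 1 < n + 1 := by omega
    rcases (show k = m + 1 ∨ ∃ f, k = m + f + 1 + 1 by
      rcases Nat.lt_or_ge (m + 1) k with h | h
      · exact Or.inr ⟨k - m - 2, by omega⟩
      · exact Or.inl (by omega)) with rfl | ⟨f, rfl⟩
    · have h := congrFun (combined_eq_zero_level hC hv m 0 hlow (by omega) (by omega) hz hι) p
      have hf := (flipCoef_low hlt ι (combined v m z 0 0 p) (combined v m z 0 1 p)).1
      simp only [Pi.add_apply, Pi.smul_apply, smul_eq_mul] at h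
      simp only [if_true, Nat.sub_self, Nat.add_sub_cancel_left, mul_zero, add_zero]
      rw [← hf, mul_assoc, h]
      simp only [downCoef]
      push_cast
      ring
    · have h := congrFun (combined_eq_succ_level hC hv m f 0 (by omega) (by omega) hz hι) p
      have hf := (flipCoef_low hlt ι (combined v m z (f + 1) 0 p) (combined v m z (f + 1) 1 p)).1
      have e1 : m + f + 1 + 1 + 1 - (m + 1) = f + 1 + 1 := by omega
      have e2 : m + f + 1 + 1 - (m + 1) = f + 1 := by omega
      have e3 : m + f + 1 - (m + 1) = f := by omega
      simp only [Pi.add_apply, Pi.smul_apply, smul_eq_mul] at h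
      simp only [e1, e2, if_neg (show ¬ m + f + 1 + 1 = m + 1 by omega),
        Nat.add_sub_cancel (m := 1), e3]
      rw [← hf, mul_assoc, h]
      simp only [downCoef, upCoef, if_neg (show ¬ m + f + 1 + 1 = n + 1 by omega),
        if_pos (show m + f + 1 + 1 < n + 1 by omega)]
      push_cast
      ring
  -- The row of copy `1` at these levels; it exists because the multiplicity is at least two.
  · intro k hk hkn
    have hM2 : 1 < M k := hM.below k (by omega) hkn
    have hlt : k + 1 < n + 1 := by omega
    rcases (show k = m + 1 ∨ ∃ f, k = m + f + 1 + 1 by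
      rcases Nat.lt_or_ge (m + 1) k with h | h
      · exact Or.inr ⟨k - m - 2, by omega⟩
      · exact Or.inl (by omega)) with rfl | ⟨f, rfl⟩
    · have h := congrFun (combined_eq_zero_level hC hv m 1 hlow (by omega) hM2 hz hι) p
      have hf := (flipCoef_low hlt ι (combined v m z 0 0 p) (combined v m z 0 1 p)).2
      simp only [Pi.add_apply, Pi.smul_apply, smul_eq_mul] at h
      simp only [if_true, Nat.sub_self, Nat.add_sub_cancel_left, mul_zero, add_zero]
      rw [← hf, mul_assoc, h]
      simp only [downCoef, if_pos hlt]
      push_cast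
      ring
    · have h := congrFun (combined_eq_succ_level hC hv m f 1 (by omega) hM2 hz hι) p
      have hf := (flipCoef_low hlt ι (combined v m z (f + 1) 0 p) (combined v m z (f + 1) 1 p)).2
      have e1 : m + f + 1 + 1 + 1 - (m + 1) = f + 1 + 1 := by omega
      have e2 : m + f + 1 + 1 - (m + 1) = f + 1 := by omega
      have e3 : m + f + 1 - (m + 1) = f := by omega
      simp only [Pi.add_apply, Pi.smul_apply, smul_eq_mul] at h
      simp only [e1, e2, if_neg (show ¬ m + f + 1 + 1 = m + 1 by omega),
        Nat.add_sub_cancel (m := 1), e3]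
      rw [← hf, mul_assoc, h]
      simp only [downCoef, upCoef, if_pos hlt, if_pos (show m + f + 1 + 1 < n + 1 by omega)]
      push_cast
      ring
  · intro k hk hkn
    simp only [if_neg (show k + 1 ≠ m + 1 by omega), Nat.add_sub_cancel]
    push_cast
    rfl
  · simp
  · have h : combined v m z (n - (m + 1)) 1 = 0 :=
      combined_of_le' v m z (by rw [show m + (n - (m + 1)) + 1 = n by omega, hMn])
    simp [h]
  · have h : combined v m z (n + 1 - (m + 1)) 1 = 0 :=
      combined_of_le' v m z (by rw [show m + (n + 1 - (m + 1)) + 1 = n + 1 by omega, hM.last])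
    simp only [h, Pi.zero_apply]

/-- On the vectors of spin `m + 1/2 < j` the matrix `X₀` has no eigenvalue except zero. -/
theorem eq_zero_of_eigenvector (hM : IsAdmissible n M) {v : RhoIdx n M → ℂ} {a : ℂ} {m : ℕ}
    (hC : ∀ r c d, spinNumSq (lab r d) *ᵥ comp v r c d = ((m : ℂ) + 1) ^ 2 • comp v r c d)
    (hv : diracOp n M 0 *ᵥ v = a • v) (ha : a ≠ 0) (hmn : m < n) : v = 0 := by
  have hm : (m : ℂ) + 1 ≠ 0 := Nat.cast_add_one_ne_zero m
  have hlow : ∀ r < m, ∀ c d, comp v r c d = 0 := by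
    intro r hr c d
    refine eq_zero_of_spinNumSq d r (fun k _ hk h => ?_) _ (hC r c d)
    have := natCast_sq_sub_ne (show k < m + 1 by omega)
    push_cast at this
    exact this (sub_eq_zero.mpr h)
  have hred : ∀ e, m + e ≤ n → ∀ d, reduced v m e 0 d = 0 ∧ reduced v m e 1 d = 0 := by
    intro e he
    -- Both square roots `ι` of $(m+1)^2$ are used; from the two combinations the undotted and the
    -- dotted part are recovered separately.
    obtain ⟨h1, h2⟩ := combined_eq_zero hM hC hv ha hmn hlow (z := 1 / (m + 1)) (ι := -(m + 1))
      (by field_simp) (by ring) e he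
    obtain ⟨h3, h4⟩ := combined_eq_zero hM hC hv ha hmn hlow (z := -1 / (m + 1)) (ι := m + 1)
      (by field_simp) (by ring) e he
    have hsum : ∀ x y : (lab m false).Carrier → ℂ, x + (1 / ((m : ℂ) + 1)) • y = 0 →
        x + (-1 / ((m : ℂ) + 1)) • y = 0 → x = 0 ∧ y = 0 := by
      intro x y hx hy
      have e1 : (2 : ℂ) • x = 0 := by
        rw [← add_zero (0 : (lab m false).Carrier → ℂ)]
        nth_rewrite 1 [← hx]
        rw [← hy]
        module
      have hx0 := (smul_eq_zero.mp e1).resolve_left two_ne_zero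
      rw [hx0, zero_add] at hx
      exact ⟨hx0, (smul_eq_zero.mp hx).resolve_left (one_div_ne_zero hm)⟩
    have h5 := hsum _ _ h1 h3
    have h6 := hsum _ _ h2 h4
    intro d
    cases d
    exacts [⟨h5.1, h6.1⟩, ⟨h5.2, h6.2⟩]
  have h01 : ∀ r c d, r ≤ n → c < 2 → comp v r c d = 0 := by
    intro r c d hr hc
    rcases Nat.lt_or_ge r m with h | h
    · exact hlow r h c d
    · obtain ⟨e, rfl⟩ := Nat.exists_eq_add_of_le h
      refine eq_zero_of_lowering m rfl d e _ (hC _ c d) ?_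
      obtain rfl | rfl : c = 0 ∨ c = 1 := by omega
      exacts [(hred e hr d).1, (hred e hr d).2]
  refine eq_zero_of_comp fun r c d hr hc => ?_
  -- The remaining copies: every row is fed only by the copies `0` and `1`, which are already zero,
  -- so `a` times the component vanishes.
  have h := comp_diracOp v d hr hc
  have h2 : ∀ r' ∈ Finset.range (n + 1), levelTerm v r c d r' = 0 := fun r' hr' => by
    have h3 : r' ≤ n := Nat.lt_succ_iff.mp (Finset.mem_range.mp hr')
    simp [levelTerm, h01 r' 0 _ h3 (by omega), h01 r' 1 _ h3 (by omega)]
  rw [Finset.sum_eq_zero h2, hv, comp_smul] at h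
  exact (smul_eq_zero.mp h).resolve_left ha

end Nilpotency

/-! ### The vectors of the highest spin -/

section HighestSpin

theorem sum_shiftMat {p q : ℕ} {g : ℕ → ℕ} {c : ℕ → ℂ} (F : ℕ → ℂ) (r : Fin p) (k₀ : ℕ)
    (hk : k₀ < q) (h : (r : ℕ) = g k₀) (h' : ∀ k < q, (r : ℕ) = g k → k = k₀ ∨ c k = 0) :
    ∑ k : Fin q, shiftMat p q g c r k * F k = c k₀ * F k₀ := by
  rw [Finset.sum_eq_single ⟨k₀, hk⟩]
  · simp [shiftMat, ← h]
  · intro k _ hne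
    simp only [shiftMat, Matrix.of_apply]
    split_ifs with h1
    · rcases h' k k.2 h1 with h2 | h2
      · exact absurd (Fin.ext h2) hne
      · rw [h2, zero_mul]
    · rw [zero_mul]
  · simp

theorem sum_shiftMat_zero {p q : ℕ} {g : ℕ → ℕ} {c : ℕ → ℂ} (F : ℕ → ℂ) (r : Fin p)
    (h' : ∀ k < q, (r : ℕ) = g k → c k * F k = 0) :
    ∑ k : Fin q, shiftMat p q g c r k * F k = 0 := by
  refine Finset.sum_eq_zero fun k _ => ?_
  simp only [shiftMat, Matrix.of_apply]
  split_ifs with h1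
  · exact h' k k.2 h1
  · rw [zero_mul]

theorem sum_lowerOp_zero (a : ℕ) (F : ℕ → ℂ) (r : Fin (a + 1)) :
    ∑ k : Fin (a + 1 + 1), lowerOp a 0 r k * F k = ((r : ℂ) + 1) * F (r + 1) := by
  have h := sum_shiftMat (p := a + 1) (q := a + 1 + 1) (g := fun k => k - 1)
    (c := fun k => (k : ℂ)) F r (r + 1) (by omega) (by simp) (fun k _ h => by
      rcases Nat.eq_zero_or_pos k with h0 | h0
      · exact Or.inr (by simp [h0])
      · exact Or.inl (by omega))
  rw [Nat.cast_add_one] at h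
  exact h

theorem sum_lowerOp_one (a : ℕ) (F : ℕ → ℂ) (r : Fin (a + 1)) :
    ∑ k : Fin (a + 1 + 1), lowerOp a 1 r k * F k = ((r : ℂ) - (a + 1)) * F r :=
  sum_shiftMat (p := a + 1) (q := a + 1 + 1) (g := fun k => k) (c := fun k => (k : ℂ) - (a + 1))
    F r r (by omega) rfl fun _ _ h => Or.inl h.symm

theorem sum_raiseOp_zero (a : ℕ) (F : ℕ → ℂ) (hF : F (a + 1) = 0) (r : Fin (a + 1 + 1)) :
    ∑ k : Fin (a + 1), raiseOp a 0 r k * F k = F r := by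
  by_cases h : (r : ℕ) < a + 1
  · exact (sum_shiftMat (p := a + 1 + 1) (q := a + 1) (g := fun k => k) (c := fun _ => 1)
      F r r h rfl fun _ _ h => Or.inl h.symm).trans (one_mul _)
  · have h1 : (r : ℕ) = a + 1 := by omega
    rw [h1, hF]
    exact sum_shiftMat_zero (p := a + 1 + 1) (q := a + 1) (g := fun k => k) (c := fun _ => 1)
      F r fun k hk h => absurd h (by omega)

theorem sum_raiseOp_one (a : ℕ) (F : ℕ → ℂ) (r : Fin (a + 1 + 1)) :
    ∑ k : Fin (a + 1), raiseOp a 1 r k * F k = if (r : ℕ) = 0 then 0 else F (r - 1) := by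
  split_ifs with h
  · exact sum_shiftMat_zero (p := a + 1 + 1) (q := a + 1) (g := fun k => k + 1) (c := fun _ => 1)
      F r fun k hk h' => absurd h' (by omega)
  · exact (sum_shiftMat (p := a + 1 + 1) (q := a + 1) (g := fun k => k + 1) (c := fun _ => 1)
      F r (r - 1) (by omega) (by omega)
      fun k _ h => Or.inl (by omega)).trans (one_mul _)

theorem kron_mulVec {p q p' q' : ℕ} (A : Matrix (Fin p') (Fin p) ℂ) (B : Matrix (Fin q') (Fin q) ℂ)
    (f : ℕ → ℕ → ℂ) (x : Fin p') (y : Fin q') :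
    ((A ⊗ₖ B) *ᵥ fun r : Fin p × Fin q => f r.1 r.2) (x, y) =
      ∑ a : Fin p, A x a * ∑ b : Fin q, B y b * f a b := by
  simp only [Matrix.mulVec, dotProduct, Matrix.kroneckerMap_apply, Fintype.sum_prod_type,
    Finset.mul_sum, mul_assoc]

/-- The coefficients of the vectors of highest spin. -/
def topFun (n : ℕ) (g : ℕ → ℂ) (a b : ℕ) : ℂ := ((n + 1).choose a : ℂ) * (n.choose b : ℂ) * g (a + b)

/-- The vectors of highest spin at the highest level. -/
def topVec (n : ℕ) (g : ℕ → ℂ) : (lab n false).Carrier → ℂ := fun p => topFun n g p.1 p.2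

/-- On vectors of the form binomials times a function of the sum of the indices, the flip is a
scalar multiple of the exchange. This rests on the absorption identities `e1`, `e2` and on Pascal's
rule. -/
theorem singletOp_flip_topVec (n : ℕ) (g : ℕ → ℂ) :
    singletOp (lab n true) (lab n false) *ᵥ topVec n g =
      ((n : ℂ) + 1) • (swapOp (lab n true) (lab n false) *ᵥ topVec n g) := by
  let w : Fin (n + 1 + 1) × Fin (n + 1) → ℂ := fun p => topFun n g p.1 p.2
  change singletOp ⟨n, n + 1⟩ ⟨n + 1, n⟩ *ᵥ w =
    ((n : ℂ) + 1) • (swapOp ⟨n, n + 1⟩ ⟨n + 1, n⟩ *ᵥ w)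
  funext ⟨x, y⟩
  have hs : (swapOp ⟨n, n + 1⟩ ⟨n + 1, n⟩ *ᵥ w) (x, y) = topFun n g y x := by
    rw [swapOp_eq]
    refine (Finset.sum_eq_single (y, x) ?_ ?_).trans ?_
    · intro r _ hr
      have : (x, y) ≠ r.swap := by
        rintro h
        exact hr (by rw [← Prod.swap_swap r, ← h]; rfl)
      simp [swapMat, this]
    · simp
    · simp [swapMat, w]
  have h1 : ∀ A B, (bispinorOp ⟨n, n + 1⟩ ⟨n + 1, n⟩ A B *ᵥ w) (x, y) =
      ∑ a : Fin (n + 1 + 1), lowerOp n A x a * ∑ b : Fin (n + 1), raiseOp n B y b * topFun n g a b := by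
    intro A B
    rw [← spinorOp_lower, ← spinorOp_raise]
    exact kron_mulVec _ _ (topFun n g) x y
  rw [Pi.smul_apply, hs, singletOp, Matrix.sub_mulVec, Pi.sub_apply, h1, h1]
  have h2 : ∀ a, topFun n g a (n + 1) = 0 := fun a => by simp [topFun]
  simp only [sum_raiseOp_one, sum_raiseOp_zero _ _ (h2 _)]
  rw [sum_lowerOp_zero n (fun a => if (y : ℕ) = 0 then 0 else topFun n g a (y - 1)),
    sum_lowerOp_one n (fun a => topFun n g a y)]
  have e1 : ((n + 1).choose (x + 1) : ℂ) * (x + 1) = (n + 1) * n.choose x := by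
    exact_mod_cast (Nat.add_one_mul_choose_eq n x).symm
  have e2 : ((n + 1).choose x : ℂ) * (n + 1 - x) = (n + 1) * n.choose x := by
    have h := Nat.choose_mul_succ_eq n x
    have h3 : ((n + 1 - x : ℕ) : ℂ) = (n : ℂ) + 1 - x := by
      have hx : (x : ℕ) < n + 1 := x.2
      rw [Nat.cast_sub hx.le]
      push_cast
      rfl
    rw [← h3]
    rw [mul_comm ((n : ℂ) + 1)]
    exact_mod_cast h.symm
  by_cases hy : (y : ℕ) = 0
  · simp only [if_pos hy]
    simp only [topFun, hy, Nat.choose_zero_right, Nat.cast_one, smul_eq_mul]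
    rw [zero_add, add_zero]
    linear_combination g x * e2
  · obtain ⟨y', hy'⟩ : ∃ y', (y : ℕ) = y' + 1 := ⟨y - 1, by omega⟩
    simp only [if_neg hy]
    simp only [topFun, hy', Nat.add_sub_cancel, smul_eq_mul, Nat.choose_succ_succ' n y']
    rw [show (x : ℕ) + 1 + y' = x + (y' + 1) by ring, show y' + 1 + (x : ℕ) = x + (y' + 1) by ring]
    push_cast
    linear_combination (g (x + (y' + 1)) * n.choose y') * e1 +
      (g (x + (y' + 1)) * n.choose (y' + 1)) * e2

/-- The equation of the vectors of highest spin. -/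
theorem singletOp_down_apply (m : ℕ) (f : ℕ → ℕ → ℂ) (x : Fin (m + 2)) (y : Fin (m + 1)) :
    (singletOp ⟨m + 1, m⟩ ⟨m + 2, m + 1⟩ *ᵥ fun p : Fin (m + 2 + 1) × Fin (m + 1 + 1) => f p.1 p.2)
      (x, y) =
      ((m : ℂ) + 2 - x) * (y + 1) * f x (y + 1) - (x + 1) * ((m : ℂ) + 1 - y) * f (x + 1) y := by
  have h1 : ∀ A B, (bispinorOp ⟨m + 1, m⟩ ⟨m + 2, m + 1⟩ A B *ᵥ
      fun p : Fin (m + 2 + 1) × Fin (m + 1 + 1) => f p.1 p.2) (x, y) =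
      ∑ a : Fin (m + 1 + 1 + 1), lowerOp (m + 1) A x a *
        ∑ b : Fin (m + 1 + 1), lowerOp m B y b * f a b := by
    intro A B
    rw [← spinorOp_lower, ← spinorOp_lower]
    exact kron_mulVec _ _ f x y
  rw [singletOp, Matrix.sub_mulVec, Pi.sub_apply, h1, h1]
  simp only [sum_lowerOp_zero, sum_lowerOp_one]
  rw [sum_lowerOp_zero (m + 1) (fun a => ((y : ℂ) - (m + 1)) * f a y),
    sum_lowerOp_one (m + 1) (fun a => ((y : ℂ) + 1) * f a (y + 1))]
  push_cast
  ring

/-- After division by the binomials the equation says that the quotient is constant along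
$x+y=\mathrm{const}$. -/
theorem exists_eq_topVec (n : ℕ) (f : ℕ → ℕ → ℂ)
    (hf : ∀ x ≤ n, ∀ y < n, ((n : ℂ) + 1 - x) * (y + 1) * f x (y + 1) =
      (x + 1) * ((n : ℂ) - y) * f (x + 1) y) :
    ∃ g, (fun p : (lab n false).Carrier => f p.1 p.2) = topVec n g := by
  let h : ℕ → ℕ → ℂ := fun x y => f x y / ((n + 1).choose x * n.choose y)
  have hne : ∀ {x y}, x ≤ n + 1 → y ≤ n → ((n + 1).choose x * n.choose y : ℂ) ≠ 0 := fun hx hy =>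
    mul_ne_zero (Nat.cast_ne_zero.mpr (Nat.choose_pos hx).ne')
      (Nat.cast_ne_zero.mpr (Nat.choose_pos hy).ne')
  have hstep : ∀ x ≤ n, ∀ y < n, h x (y + 1) = h (x + 1) y := by
    intro x hx y hy
    have e1 : ((n + 1).choose (x + 1) : ℂ) * (x + 1) = (n + 1).choose x * (n + 1 - x) := by
      have h3 : ((n + 1 - x : ℕ) : ℂ) = (n : ℂ) + 1 - x := by
        rw [Nat.cast_sub (by omega)]
        push_cast
        rfl
      rw [← h3]
      exact_mod_cast Nat.choose_succ_right_eq (n + 1) x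
    have e2 : (n.choose (y + 1) : ℂ) * (y + 1) = n.choose y * (n - y) := by
      rw [← Nat.cast_sub hy.le]
      exact_mod_cast Nat.choose_succ_right_eq n y
    have h1 := hf x hx y hy
    have hy1 : (y : ℂ) + 1 ≠ 0 := Nat.cast_add_one_ne_zero y
    have hx1 : (n : ℂ) + 1 - x ≠ 0 := by
      have : ((n + 1 - x : ℕ) : ℂ) ≠ 0 := Nat.cast_ne_zero.mpr (by omega)
      rwa [Nat.cast_sub (by omega), Nat.cast_add, Nat.cast_one] at this
    rw [div_eq_div_iff (hne (by omega) (by omega)) (hne (by omega) (by omega))]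
    refine mul_left_cancel₀ (mul_ne_zero hx1 hy1) ?_
    linear_combination ((n + 1).choose (x + 1) * n.choose y : ℂ) * h1 +
      f (x + 1) y * n.choose y * (n - y) * e1 - ((n : ℂ) + 1 - x) * f (x + 1) y * (n + 1).choose x * e2
  -- The value on the diagonal $x+y=k$ is read off at the point with the largest admissible `x`.
  refine ⟨fun k => h (min k (n + 1)) (k - min k (n + 1)), ?_⟩
  have key : ∀ y ≤ n, ∀ x ≤ n + 1, h x y = h (min (x + y) (n + 1)) (x + y - min (x + y) (n + 1)) := by
    intro y
    induction y with
    | zero =>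
      intro _ x hx
      rw [add_zero, min_eq_left hx, Nat.sub_self]
    | succ y ih =>
      intro hy x hx
      rcases Nat.lt_or_ge n x with h1 | h1
      · rw [min_eq_right (by omega), show x + (y + 1) - (n + 1) = y + 1 by omega,
          show x = n + 1 by omega]
      · rw [hstep x h1 y (by omega), ih (by omega) (x + 1) (by omega),
          show x + 1 + y = x + (y + 1) by ring]
  funext p
  have hp1 : (p.1 : ℕ) < n + 2 := p.1.2
  have hp2 : (p.2 : ℕ) < n + 1 := p.2.2
  have h1 := key p.2 (by omega) p.1 (by omega)
  change f p.1 p.2 = ((n + 1).choose p.1 : ℂ) * (n.choose p.2 : ℂ) * _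
  dsimp only
  rw [← h1, mul_div_cancel₀ _ (hne (by omega) (by omega))]

/-- `spinNumSq` is minus the square of the flip. The flip acts on these vectors as $n+1$ times the
exchange, and the exchange anticommutes with it. -/
theorem spinNumSq_mulVec_topVec (n : ℕ) (g : ℕ → ℂ) :
    spinNumSq (lab n false) *ᵥ topVec n g = ((n : ℂ) + 1) ^ 2 • topVec n g := by
  have h1 : spinNumSq (lab n false) =
      -(singletOp (lab n false) (lab n true) * singletOp (lab n true) (lab n false)) := by
    have h := lab_flip_flip n false
    rw [Bool.not_false] at h
    rw [h, neg_neg]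
  have h2 : swapOp (lab n true) (lab n false) * singletOp (lab n false) (lab n true) =
      -(singletOp (lab n true) (lab n false) * swapOp (lab n false) (lab n true)) :=
    swapOp_mul_singletOp (lab n false) (lab n true)
  have h3 : swapOp (lab n false) (lab n true) * singletOp (lab n true) (lab n false) =
      -(singletOp (lab n false) (lab n true) * swapOp (lab n true) (lab n false)) :=
    swapOp_mul_singletOp (lab n true) (lab n false)
  have h4 : swapOp (lab n false) (lab n true) * swapOp (lab n true) (lab n false) = 1 :=
    swapOp_mul_swapOp (lab n false)
  have h5 : singletOp (lab n false) (lab n true) *ᵥ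
      (swapOp (lab n true) (lab n false) *ᵥ topVec n g) = -((n : ℂ) + 1) • topVec n g := by
    rw [Matrix.mulVec_mulVec, ← neg_eq_iff_eq_neg.mpr h3, Matrix.neg_mulVec, ← Matrix.mulVec_mulVec,
      singletOp_flip_topVec, Matrix.mulVec_smul, Matrix.mulVec_mulVec, h4, Matrix.one_mulVec, neg_smul]
  rw [h1, Matrix.neg_mulVec, ← Matrix.mulVec_mulVec, singletOp_flip_topVec, Matrix.mulVec_smul, h5]
  module

/-- The spin $n+\tfrac12$ does not occur in `lab m false` for `n = m + 1`, so lowering annihilates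
`w`. In coordinates this is the hypothesis of `exists_eq_topVec`, which is empty for `n = 0`. -/
theorem exists_topVec {n : ℕ} {w : (lab n false).Carrier → ℂ}
    (hw : spinNumSq (lab n false) *ᵥ w = ((n : ℂ) + 1) ^ 2 • w) : ∃ g, w = topVec n g := by
  let f : ℕ → ℕ → ℂ := fun x y => if h : x < n + 2 ∧ y < n + 1 then w (⟨x, h.1⟩, ⟨y, h.2⟩) else 0
  have hfw : (fun p : (lab n false).Carrier => f p.1 p.2) = w := by
    funext p
    exact dif_pos ⟨p.1.2, p.2.2⟩
  rw [← hfw]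
  refine exists_eq_topVec n f fun x hx y hy => ?_
  obtain ⟨m, rfl⟩ : ∃ m, n = m + 1 := ⟨n - 1, by omega⟩
  have h1 : singletOp (lab m false) (lab (m + 1) false) *ᵥ w = 0 := by
    refine eq_zero_of_spinNumSq false m (fun k _ hk h => ?_) _ (spinNumSq_mulVec_singletOp hw)
    have h3 : (((m + 1 + 1) ^ 2 : ℕ) : ℂ) = ((k ^ 2 : ℕ) : ℂ) := by push_cast at h ⊢; exact h
    have h4 := Nat.pow_left_injective two_ne_zero (Nat.cast_injective h3)
    omega
  rw [← hfw] at h1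
  have h2 : ((m : ℂ) + 2 - x) * (y + 1) * f x (y + 1) - (x + 1) * ((m : ℂ) + 1 - y) * f (x + 1) y =
      0 := (singletOp_down_apply m f ⟨x, by omega⟩ ⟨y, hy⟩).symm.trans (congrFun h1 _)
  rw [sub_eq_zero] at h2
  push_cast
  linear_combination h2

/-- All binomials involved are nonzero, so the $2n+2=2j+1$ values of `g` are free coordinates on the
highest spin. -/
theorem topVec_injective {n : ℕ} {g : ℕ → ℂ} (h : topVec n g = 0) {k : ℕ} (hk : k < 2 * n + 2) :
    g k = 0 := by
  have h1 := congrFun h (⟨min k (n + 1), Nat.lt_succ_of_le (min_le_right _ _)⟩,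
    ⟨k - min k (n + 1), show k - min k (n + 1) < n + 1 by omega⟩)
  change ((n + 1).choose (min k (n + 1)) : ℂ) * (n.choose (k - min k (n + 1)) : ℂ) *
    g (min k (n + 1) + (k - min k (n + 1))) = 0 at h1
  rw [Nat.add_sub_cancel' (min_le_left _ _)] at h1
  exact (mul_eq_zero.mp h1).resolve_left (mul_ne_zero
    (Nat.cast_ne_zero.mpr (Nat.choose_pos (min_le_right _ _)).ne')
    (Nat.cast_ne_zero.mpr (Nat.choose_pos (by omega)).ne'))

theorem swapOp_swapOp_mulVec (r : ℕ) (d : Bool) (w : (lab r d).Carrier → ℂ) :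
    swapOp (lab r d) (lab r (!d)) *ᵥ (swapOp (lab r (!d)) (lab r d) *ᵥ w) = w := by
  have h : swapOp (lab r d) (lab r (!d)) * swapOp (lab r (!d)) (lab r d) = 1 := by
    rw [lab_not]
    exact swapOp_mul_swapOp (lab r d)
  rw [Matrix.mulVec_mulVec, h, Matrix.one_mulVec]

theorem swapOp_mul_spinNumSq (r : ℕ) (d : Bool) :
    swapOp (lab r (!d)) (lab r d) * spinNumSq (lab r d) =
      spinNumSq (lab r (!d)) * swapOp (lab r (!d)) (lab r d) := by
  have h1 := swapOp_mul_singletOp (lab r (!d)) (lab r d)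
  have h2 := swapOp_mul_singletOp (lab r d) (lab r (!d))
  rw [← lab_not, ← lab_not, Bool.not_not] at h1 h2
  have h3 := lab_flip_flip r (!d)
  rw [Bool.not_not] at h3
  rw [← neg_eq_iff_eq_neg.mpr (lab_flip_flip r d), ← neg_eq_iff_eq_neg.mpr h3, Matrix.mul_neg,
    ← Matrix.mul_assoc, h2, Matrix.neg_mul, Matrix.mul_assoc, h1]
  simp [Matrix.mul_assoc]

/-- On the highest spin the coupling of the highest level is the exchange of the two factors. -/
theorem singletOp_flip_of_top {n : ℕ} (d : Bool) {w : (lab n d).Carrier → ℂ}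
    (hw : spinNumSq (lab n d) *ᵥ w = ((n : ℂ) + 1) ^ 2 • w) :
    singletOp (lab n (!d)) (lab n d) *ᵥ w =
      ((if d then -1 else 1) * ((n : ℂ) + 1)) • (swapOp (lab n (!d)) (lab n d) *ᵥ w) := by
  cases d
  · obtain ⟨g, rfl⟩ := exists_topVec hw
    rw [if_neg Bool.false_ne_true, one_mul]
    exact singletOp_flip_topVec n g
  -- The dotted case is carried to the undotted one by the exchange. Applying the flip once more,
  -- whose square is $-(n+1)^2$, yields the opposite sign.
  · have h1 : spinNumSq (lab n false) *ᵥ (swapOp (lab n false) (lab n true) *ᵥ w) =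
        ((n : ℂ) + 1) ^ 2 • (swapOp (lab n false) (lab n true) *ᵥ w) := by
      have := swapOp_mul_spinNumSq n true
      rw [Bool.not_true] at this
      rw [Matrix.mulVec_mulVec, ← this, ← Matrix.mulVec_mulVec, hw, Matrix.mulVec_smul]
    obtain ⟨g, hg⟩ := exists_topVec h1
    have h2 := swapOp_swapOp_mulVec n true w
    rw [Bool.not_true, hg] at h2
    have h3 := singletOp_flip_topVec n g
    rw [h2] at h3
    have h4 := congrArg (singletOp (lab n false) (lab n true) *ᵥ ·) h3
    have h5 := lab_flip_flip n false
    rw [Bool.not_false] at h5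
    simp only [Matrix.mulVec_mulVec, h5, Matrix.neg_mulVec, spinNumSq_mulVec_topVec,
      Matrix.mulVec_smul] at h4
    have hN : (n : ℂ) + 1 ≠ 0 := Nat.cast_add_one_ne_zero n
    rw [if_pos rfl, Bool.not_true, hg]
    refine smul_right_injective _ hN ?_
    dsimp only
    rw [← h4]
    module

end HighestSpin

/-! ### The spectrum of `X₀` -/

section LinearAlgebra

variable {ι : Type} [Fintype ι] [DecidableEq ι]

/-- The kernels of the powers become stationary at the dimension at the latest. This gives one
exponent for all vectors. -/
theorem pow_card_mulVec_eq_zero {A : Matrix ι ι ℂ} {k : ℕ} {v : ι → ℂ} (h : A ^ k *ᵥ v = 0) :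
    A ^ Fintype.card ι *ᵥ v = 0 := by
  have h1 : v ∈ LinearMap.ker (Matrix.toLin' A ^ k) := by
    rw [LinearMap.mem_ker, ← Matrix.toLin'_pow, Matrix.toLin'_apply, h]
  have h2 := Module.End.ker_pow_le_ker_pow_finrank _ _ h1
  rwa [LinearMap.mem_ker, ← Matrix.toLin'_pow, Matrix.toLin'_apply,
    Module.finrank_fintype_fun_eq_card] at h2

/-- A matrix is nilpotent on an invariant subspace which contains no eigenvector of a non-zero
eigenvalue. -/
theorem pow_card_mulVec_of_mem {A : Matrix ι ι ℂ} (E : Submodule ℂ (ι → ℂ))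
    (hE : ∀ v ∈ E, A *ᵥ v ∈ E) (h : ∀ a : ℂ, a ≠ 0 → ∀ v ∈ E, A *ᵥ v = a • v → v = 0)
    {v : ι → ℂ} (hv : v ∈ E) : A ^ Fintype.card ι *ᵥ v = 0 := by
  let f : Module.End ℂ E := (Matrix.toLin' A).restrict hE
  have hf : ∀ w : E, ((f w : E) : ι → ℂ) = A *ᵥ (w : ι → ℂ) := fun w => rfl
  have hpow : ∀ (k : ℕ) (w : E), (((f ^ k) w : E) : ι → ℂ) = A ^ k *ᵥ (w : ι → ℂ) := by
    intro k
    induction k with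
    | zero => intro w; simp
    | succ k ih => intro w; rw [pow_succ', Module.End.mul_apply, hf, ih, Matrix.mulVec_mulVec, ← pow_succ']
  have h0 : ∀ a : ℂ, a ≠ 0 → f.maxGenEigenspace a = ⊥ := by
    intro a ha
    rw [Submodule.eq_bot_iff]
    intro w hw
    obtain ⟨k, hk⟩ := (Module.End.mem_maxGenEigenspace _ _ _).mp hw
    have hinj : Function.Injective (f - a • 1 : Module.End ℂ E) := by
      rw [injective_iff_map_eq_zero]
      intro u hu
      refine Subtype.ext (h a ha u u.2 ?_)
      have h1 := congrArg Subtype.val hu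
      rwa [LinearMap.sub_apply, Submodule.coe_sub, hf, LinearMap.smul_apply, Module.End.one_apply,
        Submodule.coe_smul, ZeroMemClass.coe_zero, sub_eq_zero] at h1
    rw [Module.End.pow_apply] at hk
    exact hinj.iterate k (hk.trans (by rw [← Module.End.pow_apply, map_zero]))
  have h1 : (⟨v, hv⟩ : E) ∈ ⨆ a, f.maxGenEigenspace a := by
    rw [Module.End.iSup_maxGenEigenspace_eq_top]
    trivial
  have h2 : ∃ k, (f ^ k) (⟨v, hv⟩ : E) = 0 := by
    have h3 : ⨆ a, f.maxGenEigenspace a ≤ f.maxGenEigenspace 0 := by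
      refine iSup_le fun a => ?_
      by_cases ha : a = 0
      · rw [ha]
      · rw [h0 a ha]
        exact bot_le
    obtain ⟨k, hk⟩ := (Module.End.mem_maxGenEigenspace _ _ _).mp (h3 h1)
    rw [show f - (0 : ℂ) • 1 = f by rw [zero_smul]; exact sub_zero f] at hk
    exact ⟨k, hk⟩
  obtain ⟨k, hk⟩ := h2
  have h4 := congrArg Subtype.val hk
  rw [hpow] at h4
  exact pow_card_mulVec_eq_zero h4

/-- A linear identity holds if it holds on the generalized eigenvectors of a matrix. -/
theorem eq_zero_of_genEigenvectors {A B : Matrix ι ι ℂ}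
    (h : ∀ (μ : ℂ) (k : ℕ) (v : ι → ℂ), (A - μ • 1) ^ k *ᵥ v = 0 → B *ᵥ v = 0) : B = 0 := by
  have hpow : ∀ (μ : ℂ) (k : ℕ) (v : ι → ℂ),
      ((Matrix.toLin' A - μ • 1) ^ k : Module.End ℂ (ι → ℂ)) v = (A - μ • 1) ^ k *ᵥ v := by
    intro μ k v
    rw [← Matrix.toLin'_apply, Matrix.toLin'_pow, map_sub, map_smul, Matrix.toLin'_one]
    rfl
  have h1 : ∀ v, B *ᵥ v = 0 := by
    intro v
    have h1 : v ∈ ⨆ a, Module.End.maxGenEigenspace (Matrix.toLin' A) a := by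
      rw [Module.End.iSup_maxGenEigenspace_eq_top]
      trivial
    refine Submodule.iSup_induction _ (motive := fun v => B *ᵥ v = 0) h1 ?_ (Matrix.mulVec_zero B)
      fun x y hx hy => by rw [Matrix.mulVec_add, hx, hy, add_zero]
    intro μ w hw
    obtain ⟨k, hk⟩ := (Module.End.mem_maxGenEigenspace _ _ _).mp hw
    exact h μ k w (by rw [← hpow, hk])
  exact Matrix.toLin'.injective (LinearMap.ext fun v => by simpa using h1 v)

/-- Generalized eigenvectors of a semisimple eigenvalue are eigenvectors. -/
theorem eigenvector_of_semisimple {A : Matrix ι ι ℂ} {μ : ℂ}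
    (hA : ∀ v : ι → ℂ, A *ᵥ (A *ᵥ v - μ • v) = μ • (A *ᵥ v - μ • v) → A *ᵥ v = μ • v) :
    ∀ (k : ℕ) (v : ι → ℂ), (A - μ • 1) ^ k *ᵥ v = 0 → A *ᵥ v = μ • v := by
  intro k
  induction k with
  | zero =>
    intro v hv
    rw [pow_zero, Matrix.one_mulVec] at hv
    rw [hv, Matrix.mulVec_zero, smul_zero]
  | succ k ih =>
    intro v hv
    rw [pow_succ, ← Matrix.mulVec_mulVec, Matrix.sub_mulVec, Matrix.smul_mulVec,
      Matrix.one_mulVec] at hv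
    exact hA v (ih _ hv)

theorem angSq_mul_zero {ι : Type} [Fintype ι] {G : Fin 4 → Fin 4 → Matrix ι ι ℂ} {X : Fin 4 → Matrix ι ι ℂ}
    (hX : IsVectorOperator G X) : angSq G * X 0 = X 0 * angSq G := by
  have h : ∀ α β : Fin 4, α ≠ 0 → β ≠ 0 → G α β * X 0 = X 0 * G α β := by
    intro α β hα hβ
    have h1 := hX 0 α β
    simp only [mink, Matrix.diagonal_apply_ne' _ hα, Matrix.diagonal_apply_ne' _ hβ,
      Complex.ofReal_zero, mul_zero, zero_smul, sub_zero] at h1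
    exact (sub_eq_zero.mp h1).symm
  have h1 : ∀ g : Matrix ι ι ℂ, g * X 0 = X 0 * g → g * g * X 0 = X 0 * (g * g) := fun g hg => by
    rw [Matrix.mul_assoc, hg, ← Matrix.mul_assoc, hg, Matrix.mul_assoc]
  rw [angSq, Matrix.add_mul, Matrix.add_mul, Matrix.mul_add, Matrix.mul_add,
    h1 _ (h 2 3 (by decide) (by decide)), h1 _ (h 3 1 (by decide) (by decide)),
    h1 _ (h 1 2 (by decide) (by decide))]

end LinearAlgebra

/-! ### The polynomial identity satisfied by X₀. -/

section Spectrum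

variable {n : ℕ} {M : ℕ → ℕ}

theorem angSq_rhoGen : angSq (rhoGen n M) =
    Matrix.blockDiagonal' fun s : Summand n M => rotSq (Summand.label s) := by
  simp only [angSq, rhoGen, ← Matrix.blockDiagonal'_mul, ← Matrix.blockDiagonal'_add]
  rfl

theorem angSq_mulVec_iff (v : RhoIdx n M → ℂ) (μ : ℂ) : angSq (rhoGen n M) *ᵥ v = μ • v ↔
    ∀ r c d, spinNumSq (lab r d) *ᵥ comp v r c d = (μ + 1 / 4) • comp v r c d := by
  have h1 : ∀ r c d, comp (angSq (rhoGen n M) *ᵥ v - μ • v) r c d =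
      spinNumSq (lab r d) *ᵥ comp v r c d - (μ + 1 / 4) • comp v r c d := by
    intro r c d
    rw [comp_sub, comp_smul, angSq_rhoGen, comp_blockDiagonal rotSq, spinNumSq, Matrix.add_mulVec,
      Matrix.smul_mulVec, Matrix.one_mulVec]
    module
  rw [← sub_eq_zero]
  constructor
  · intro h r c d
    rw [← sub_eq_zero, ← h1, h]
    unfold comp
    split_ifs <;> rfl
  · intro h
    exact eq_zero_of_comp fun r c d _ _ => by rw [h1, h, sub_self]

theorem angSq_semisimple (μ : ℂ) (v : RhoIdx n M → ℂ)
    (h : angSq (rhoGen n M) *ᵥ (angSq (rhoGen n M) *ᵥ v - μ • v) =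
      μ • (angSq (rhoGen n M) *ᵥ v - μ • v)) : angSq (rhoGen n M) *ᵥ v = μ • v := by
  rw [angSq_mulVec_iff] at h ⊢
  intro r c d
  refine spinNumSq_semisimple _ d r _ ?_
  have h1 : comp (angSq (rhoGen n M) *ᵥ v - μ • v) r c d =
      spinNumSq (lab r d) *ᵥ comp v r c d - (μ + 1 / 4) • comp v r c d := by
    rw [comp_sub, comp_smul, angSq_rhoGen, comp_blockDiagonal rotSq, spinNumSq, Matrix.add_mulVec,
      Matrix.smul_mulVec, Matrix.one_mulVec]
    module
  rw [← h1]
  exact h r c d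

theorem angSq_eigenvalue {μ : ℂ} {v : RhoIdx n M → ℂ} (h : angSq (rhoGen n M) *ᵥ v = μ • v)
    (hv : v ≠ 0) : ∃ m ≤ n, μ + 1 / 4 = ((m : ℂ) + 1) ^ 2 := by
  by_contra! h1
  refine hv (eq_zero_of_comp fun r c d hr _ =>
    eq_zero_of_spinNumSq d r (fun k hk hk' h2 => ?_) _ ((angSq_mulVec_iff v μ).mp h r c d))
  obtain ⟨m, rfl⟩ : ∃ m, k = m + 1 := ⟨k - 1, by omega⟩
  refine h1 m (by omega) ?_
  rw [h2]
  push_cast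
  rfl

theorem angSq_mulVec_diracOp {μ : ℂ} {v : RhoIdx n M → ℂ}
    (h : angSq (rhoGen n M) *ᵥ v = μ • v) :
    angSq (rhoGen n M) *ᵥ (diracOp n M 0 *ᵥ v) = μ • (diracOp n M 0 *ᵥ v) := by
  rw [Matrix.mulVec_mulVec, angSq_mul_zero (diracOp_isVector n M), ← Matrix.mulVec_mulVec, h,
    Matrix.mulVec_smul]

/-- `X₀` is nilpotent on the spins below `j`. -/
theorem diracOp_nilpotent (hM : IsAdmissible n M) {m : ℕ} (hm : m < n) {μ : ℂ}
    (hμ : μ + 1 / 4 = ((m : ℂ) + 1) ^ 2) {v : RhoIdx n M → ℂ}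
    (h : angSq (rhoGen n M) *ᵥ v = μ • v) :
    diracOp n M 0 ^ Fintype.card (RhoIdx n M) *ᵥ v = 0 := by
  refine pow_card_mulVec_of_mem (LinearMap.ker (Matrix.mulVecLin (angSq (rhoGen n M) - μ • 1)))
    ?_ ?_ ?_
  · intro w hw
    rw [LinearMap.mem_ker, Matrix.mulVecLin_apply, Matrix.sub_mulVec, Matrix.smul_mulVec,
      Matrix.one_mulVec, sub_eq_zero] at hw ⊢
    exact angSq_mulVec_diracOp hw
  · intro a ha w hw hw'
    rw [LinearMap.mem_ker, Matrix.mulVecLin_apply, Matrix.sub_mulVec, Matrix.smul_mulVec,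
      Matrix.one_mulVec, sub_eq_zero] at hw
    refine eq_zero_of_eigenvector hM (fun r c d => ?_) hw' ha hm
    rw [← hμ]
    exact (angSq_mulVec_iff w μ).mp hw r c d
  · rw [LinearMap.mem_ker, Matrix.mulVecLin_apply, Matrix.sub_mulVec, Matrix.smul_mulVec,
      Matrix.one_mulVec, h, sub_self]

/-- The eigenvalue of `J²` on the highest spin. -/
abbrev topEigenvalue (n : ℕ) : ℂ := ((n : ℂ) + 1 / 2) * ((n : ℂ) + 3 / 2)

theorem topEigenvalue_add (n : ℕ) : topEigenvalue n + 1 / 4 = ((n : ℂ) + 1) ^ 2 := by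
  ring

/-- The vectors of the highest spin. -/
def IsTop (v : RhoIdx n M → ℂ) : Prop := angSq (rhoGen n M) *ᵥ v = topEigenvalue n • v

theorem IsTop.spinNumSq {v : RhoIdx n M → ℂ} (hv : IsTop v) (r c : ℕ) (d : Bool) :
    DiracType.spinNumSq (lab r d) *ᵥ comp v r c d = ((n : ℂ) + 1) ^ 2 • comp v r c d := by
  rw [← topEigenvalue_add]
  exact (angSq_mulVec_iff v _).mp hv r c d

theorem IsTop.comp_eq_zero {v : RhoIdx n M → ℂ} (hv : IsTop v) {r : ℕ} (hr : r ≠ n) (c : ℕ)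
    (d : Bool) : comp v r c d = 0 := by
  rcases Nat.lt_or_ge r n with h | h
  · refine eq_zero_of_spinNumSq d r (fun k _ hk h2 => ?_) _ (hv.spinNumSq r c d)
    have h3 : (((n + 1) ^ 2 : ℕ) : ℂ) = ((k ^ 2 : ℕ) : ℂ) := by push_cast; exact h2
    have h4 := Nat.pow_left_injective two_ne_zero (Nat.cast_injective h3)
    omega
  · exact comp_of_le v c d (by omega)

/-- Spin $j$ occurs only in $\tau_{n+1}$ and its conjugate, each of which has a single copy; two
components determine the vector. -/
theorem IsTop.ext (hM : IsAdmissible n M) {v w : RhoIdx n M → ℂ} (hv : IsTop v) (hw : IsTop w)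
    (h : ∀ d, comp v n 0 d = comp w n 0 d) : v = w := by
  rw [← sub_eq_zero]
  refine eq_zero_of_comp fun r c d hr hc => ?_
  rw [comp_sub]
  by_cases h1 : r = n
  · subst h1
    rw [hM.last] at hc
    obtain rfl : c = 0 := by omega
    rw [h, sub_self]
  · rw [hv.comp_eq_zero h1, hw.comp_eq_zero h1, sub_zero]

theorem IsTop.diracOp {v : RhoIdx n M → ℂ} (hv : IsTop v) : IsTop (diracOp n M 0 *ᵥ v) :=
  angSq_mulVec_diracOp hv

/-- The coefficient $1/(n+1)$ of the flip cancels the factor in `singletOp_flip_of_top`, and the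
signs of the two flips cancel as well. What remains is the bare exchange. -/
theorem IsTop.comp_diracOp (hM : IsAdmissible n M) {v : RhoIdx n M → ℂ} (hv : IsTop v) (d : Bool) :
    comp (DiracType.diracOp n M 0 *ᵥ v) n 0 d = swapOp (lab n d) (lab n (!d)) *ᵥ comp v n 0 (!d) := by
  have h1 : comp v n 1 (!d) = 0 := comp_of_le' v _ hM.last.le
  have h2 := singletOp_flip_of_top (!d) (hv.spinNumSq n 0 (!d))
  have hN : (n : ℂ) + 1 ≠ 0 := Nat.cast_add_one_ne_zero n
  rw [comp_diracOp_of_lower v d (Nat.lt_succ_self n) (by rw [hM.last]; exact one_pos)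
    (fun r' h c' d' => hv.comp_eq_zero h.ne c' d'), levelTerm_of_le v n 0 d le_rfl, add_zero,
    levelTerm_self, h1, smul_zero, add_zero, Matrix.mulVec_smul]
  rw [Bool.not_not] at h2
  rw [h2]
  simp only [flipCoef, if_true, smul_smul]
  have e : ((if d = true then (1 : ℂ) else -1) * (1 / ((n + 1 : ℕ) : ℂ) *
      ((if (!d) = true then -1 else 1) * ((n : ℂ) + 1)))) = 1 := by
    push_cast
    cases d <;> simp [hN] <;> field_simp <;> ring
  rw [e, one_smul]

theorem IsTop.sq (hM : IsAdmissible n M) {v : RhoIdx n M → ℂ} (hv : IsTop v) :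
    DiracType.diracOp n M 0 *ᵥ (DiracType.diracOp n M 0 *ᵥ v) = v := by
  refine hv.diracOp.diracOp.ext hM hv fun d => ?_
  rw [hv.diracOp.comp_diracOp hM, hv.comp_diracOp hM]
  have h := swapOp_swapOp_mulVec n d (comp v n 0 d)
  rw [Bool.not_not]
  exact h

/-- $J^2$ is semisimple, so its eigenvectors span. On spins below $j$ the power of $X_0$ vanishes,
and on spin $j$ the second factor does. -/
theorem diracOp_pow_mul_sub (hM : IsAdmissible n M) :
    diracOp n M 0 ^ Fintype.card (RhoIdx n M) * (diracOp n M 0 * diracOp n M 0 - 1) = 0 := by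
  refine eq_zero_of_genEigenvectors (A := angSq (rhoGen n M)) fun μ k v hk => ?_
  have hv := eigenvector_of_semisimple (angSq_semisimple μ) k v hk
  by_cases h0 : v = 0
  · rw [h0, Matrix.mulVec_zero]
  obtain ⟨m, hm, hμ⟩ := angSq_eigenvalue hv h0
  rcases hm.lt_or_eq with h | rfl
  · rw [← Matrix.mulVec_mulVec]
    refine diracOp_nilpotent hM h hμ ?_
    rw [Matrix.sub_mulVec, Matrix.mulVec_sub, Matrix.one_mulVec, hv, ← Matrix.mulVec_mulVec,
      angSq_mulVec_diracOp (angSq_mulVec_diracOp hv), smul_sub]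
  · have h1 : IsTop v := by
      rw [IsTop, hv, add_right_cancel (hμ.trans (topEigenvalue_add m).symm)]
    rw [← Matrix.mulVec_mulVec, Matrix.sub_mulVec, Matrix.one_mulVec, ← Matrix.mulVec_mulVec,
      h1.sq hM, sub_self, Matrix.mulVec_zero]

/-- The high power of $X_0$ annihilates the lower spins, so its image has spin $j$. An eigenvector
of $X_0$ with nonzero eigenvalue lies in this image. -/
theorem angSq_sub_mul_diracOp_pow (hM : IsAdmissible n M) :
    (angSq (rhoGen n M) - topEigenvalue n • 1) * diracOp n M 0 ^ Fintype.card (RhoIdx n M) = 0 := by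
  have hcomm : (angSq (rhoGen n M) - topEigenvalue n • 1) *
        diracOp n M 0 ^ Fintype.card (RhoIdx n M) =
      diracOp n M 0 ^ Fintype.card (RhoIdx n M) * (angSq (rhoGen n M) - topEigenvalue n • 1) :=
    (Commute.pow_right (((show Commute (angSq (rhoGen n M)) (diracOp n M 0) from
      angSq_mul_zero (diracOp_isVector n M))).sub_left
      ((Commute.one_left _).smul_left _)) _).eq
  refine eq_zero_of_genEigenvectors (A := angSq (rhoGen n M)) fun μ k v hk => ?_
  have hv := eigenvector_of_semisimple (angSq_semisimple μ) k v hk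
  by_cases h0 : v = 0
  · rw [h0, Matrix.mulVec_zero]
  obtain ⟨m, hm, hμ⟩ := angSq_eigenvalue hv h0
  rcases hm.lt_or_eq with h | rfl
  · rw [← Matrix.mulVec_mulVec, diracOp_nilpotent hM h hμ hv, Matrix.mulVec_zero]
  · rw [hcomm, ← Matrix.mulVec_mulVec, Matrix.sub_mulVec, Matrix.smul_mulVec, Matrix.one_mulVec, hv,
      add_right_cancel (hμ.trans (topEigenvalue_add m).symm), sub_self, Matrix.mulVec_zero]

theorem IsTop.of_eigenvector (hM : IsAdmissible n M) {v : RhoIdx n M → ℂ} {s : ℂ} (hs : s ≠ 0)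
    (hv : DiracType.diracOp n M 0 *ᵥ v = s • v) : IsTop v := by
  have hpow : ∀ k : ℕ, DiracType.diracOp n M 0 ^ k *ᵥ v = s ^ k • v := by
    intro k
    induction k with
    | zero => simp
    | succ k ih =>
      rw [pow_succ', ← Matrix.mulVec_mulVec, ih, Matrix.mulVec_smul, hv, smul_smul, pow_succ]
  have h := congrArg (· *ᵥ v) (angSq_sub_mul_diracOp_pow hM)
  rw [← Matrix.mulVec_mulVec, hpow, Matrix.mulVec_smul, Matrix.zero_mulVec, Matrix.sub_mulVec,
    Matrix.smul_mulVec, Matrix.one_mulVec] at h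
  exact sub_eq_zero.mp ((smul_eq_zero.mp h).resolve_left (pow_ne_zero _ hs))

end Spectrum

/-! ### Parity, form and dimension of the eigenspaces on the highest spin. -/

section TopSpin

variable {n : ℕ} {M : ℕ → ℕ}

theorem parityOp_mul_angSq : parityOp n M * angSq (rhoGen n M) = angSq (rhoGen n M) * parityOp n M := by
  have h : ∀ α β : Fin 4, mink α α * mink β β = 1 → Commute (parityOp n M) (rhoGen n M α β) := by
    intro α β h
    have h1 := (parityOp_isParity n M).2 α β
    rwa [h, Complex.ofReal_one, one_smul] at h1
  have h1 := h 2 3 (by simp [mink])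
  have h2 := h 3 1 (by simp [mink])
  have h3 := h 1 2 (by simp [mink])
  exact ((h1.mul_right h1).add_right (h2.mul_right h2)).add_right (h3.mul_right h3)

theorem comp_parityOp (hM : IsAdmissible n M) (v : RhoIdx n M → ℂ) (d : Bool) :
    comp (parityOp n M *ᵥ v) n 0 d = swapOp (lab n d) (lab n (!d)) *ᵥ comp v n 0 (!d) := by
  have h : n < n + 1 ∧ 0 < M (n + 1) := ⟨Nat.lt_succ_self n, by rw [hM.last]; exact one_pos⟩
  funext x
  rw [comp, comp, dif_pos h, dif_pos h]
  simp only [Matrix.mulVec, dotProduct, sum_rhoIdx, parityOp, coefOp, Matrix.of_apply]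
  rw [Finset.sum_eq_single (⟨⟨n, h.1⟩, ⟨0, h.2⟩, !d⟩ : Summand n M)]
  · refine Finset.sum_congr rfl fun y _ => ?_
    simp only [parityCoef, flip, paritySign, Matrix.of_apply, if_true, ← two_mul, pow_mul]
    rw [neg_one_sq, one_pow, one_mul]
    rfl
  · intro s _ hs
    refine Finset.sum_eq_zero fun y _ => ?_
    rw [parityCoef, Matrix.of_apply, if_neg (by simpa [flip] using hs), zero_mul, zero_mul]
  · simp

/-- Both sides are the exchange of the factors: `paritySign` is `+1` on the highest level, which is
the reason for the summand `n` in its exponent. -/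
theorem IsTop.parityOp_mulVec (hM : IsAdmissible n M) {v : RhoIdx n M → ℂ} (hv : IsTop v) :
    parityOp n M *ᵥ v = DiracType.diracOp n M 0 *ᵥ v := by
  have h : IsTop (parityOp n M *ᵥ v) := by
    have h1 : angSq (rhoGen n M) *ᵥ v = topEigenvalue n • v := hv
    rw [IsTop, Matrix.mulVec_mulVec, ← parityOp_mul_angSq, ← Matrix.mulVec_mulVec, h1,
      Matrix.mulVec_smul]
  refine h.ext hM hv.diracOp fun d => ?_
  rw [comp_parityOp hM, hv.comp_diracOp hM]

theorem IsTop.formOp_mulVec (hM : IsAdmissible n M) {v : RhoIdx n M → ℂ} (hv : IsTop v) (d : Bool) :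
    comp (formOp n M *ᵥ v) n 0 d = irrepGram (lab n d) *ᵥ comp v n 0 d := by
  have h0 : 0 < M (n + 1) := by rw [hM.last]; exact one_pos
  rw [formOp, comp_coefOp _ _ _ d (Nat.lt_succ_self n) h0, Finset.sum_range_succ,
    Finset.sum_eq_zero, zero_add, hM.last, Finset.sum_range_one,
    Finset.sum_eq_single_of_mem d (Finset.mem_univ _)]
  · have : formCoef n n 0 d n 0 d = 1 := by simp [formCoef, gramCoef, normCoef_self]
    rw [this, one_smul, gramFam_self]
  · intro d' _ hd
    rw [formCoef, if_neg (by simp [hd]), zero_smul]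
  · intro r hr
    have : r ≠ n := (Finset.mem_range.mp hr).ne
    simp [hv.comp_eq_zero this]

/-- `formOp` need not be positive as a whole, but at the highest level its coefficient is `1` and it
is the positive inner product there. -/
theorem IsTop.form_pos (hM : IsAdmissible n M) {v : RhoIdx n M → ℂ} (hv : IsTop v) (h0 : v ≠ 0) :
    0 < (star v ⬝ᵥ (formOp n M *ᵥ v)).re := by
  have key : ∀ a : RhoIdx n M, star v a * (formOp n M *ᵥ v) a =
      ((weight (Summand.label a.1).twoJ₁ a.2.1 * weight (Summand.label a.1).twoJ₂ a.2.2 *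
        Complex.normSq (v a) : ℝ) : ℂ) := by
    rintro ⟨⟨⟨r, hr⟩, ⟨c, hc⟩, d⟩, x⟩
    by_cases h : r = n
    · subst h
      obtain rfl : c = 0 := by
        change c < M (r + 1) at hc
        rw [hM.last] at hc
        omega
      have h1 : ∀ y : (lab r d).Carrier, comp (formOp r M *ᵥ v) r 0 d y =
          (weight (lab r d).twoJ₁ y.1 : ℂ) * (weight (lab r d).twoJ₂ y.2 : ℂ) * comp v r 0 d y := by
        intro y
        rw [hv.formOp_mulVec hM d, irrepGram_eq, Matrix.mulVec_diagonal]
      have h2 := (comp_apply (formOp r M *ᵥ v) ⟨⟨r, hr⟩, ⟨0, hc⟩, d⟩ x).trans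
        ((h1 x).trans (congrArg _ (comp_apply v ⟨⟨r, hr⟩, ⟨0, hc⟩, d⟩ x).symm))
      rw [h2, Pi.star_apply, Complex.ofReal_mul, Complex.normSq_eq_conj_mul_self, Complex.ofReal_mul,
        Complex.star_def]
      exact mul_left_comm _ _ _
    · have h1 : v ⟨⟨⟨r, hr⟩, ⟨c, hc⟩, d⟩, x⟩ = 0 := by
        rw [comp_apply v, hv.comp_eq_zero h]
        rfl
      rw [Pi.star_apply, h1]
      simp
  rw [dotProduct, Complex.re_sum]
  simp only [key, Complex.ofReal_re]
  obtain ⟨a, ha⟩ := Function.ne_iff.mp h0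
  exact Finset.sum_pos' (fun b _ => mul_nonneg (mul_pos (weight_pos _ _) (weight_pos _ _)).le
    (Complex.normSq_nonneg _)) ⟨a, Finset.mem_univ _, mul_pos
      (mul_pos (weight_pos _ _) (weight_pos _ _)) (Complex.normSq_pos.mpr ha)⟩

/-- On the highest spin parity equals $X_0$, so form times parity times $X_0$ is form times $X_0^2$,
for both eigenvalues alike. -/
theorem diracForm_pos (hM : IsAdmissible n M) {v : RhoIdx n M → ℂ} {s : ℂ} (hs : s ≠ 0)
    (hv : diracOp n M 0 *ᵥ v = s • v) (h0 : v ≠ 0) :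
    0 < chargeDensity (diracForm n M) (diracOp n M) v := by
  have h1 := IsTop.of_eigenvector hM hs hv
  rw [chargeDensity, diracForm, ← Matrix.mulVec_mulVec, h1.diracOp.parityOp_mulVec hM, h1.sq hM]
  exact h1.form_pos hM h0

variable (n M) in
/-- The vectors of highest spin with vanishing dotted part. -/
def undottedTop : (Fin (2 * n + 2) → ℂ) →ₗ[ℂ] RhoIdx n M → ℂ where
  toFun g a := if (a.1.1 : ℕ) = n ∧ a.1.2.2 = false then
    topFun n (fun k => if h : k < 2 * n + 2 then g ⟨k, h⟩ else 0) a.2.1 a.2.2 else 0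
  map_add' g g' := by
    funext a
    simp only [topFun, Pi.add_apply]
    split_ifs <;> ring
  map_smul' c g := by
    funext a
    simp only [topFun, Pi.smul_apply, smul_eq_mul, RingHom.id_apply]
    split_ifs <;> ring

theorem comp_undottedTop (hM : IsAdmissible n M) (g : Fin (2 * n + 2) → ℂ) :
    comp (undottedTop n M g) n 0 false =
      topVec n (fun k => if h : k < 2 * n + 2 then g ⟨k, h⟩ else 0) := by
  have h0 : 0 < M (n + 1) := by rw [hM.last]; exact one_pos
  funext x
  rw [comp, dif_pos ⟨Nat.lt_succ_self n, h0⟩]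
  exact if_pos ⟨rfl, rfl⟩

theorem comp_undottedTop_of_not (g : Fin (2 * n + 2) → ℂ) {r c : ℕ} {d : Bool}
    (h : ¬ (r = n ∧ d = false)) : comp (undottedTop n M g) r c d = 0 := by
  unfold comp
  split_ifs
  · funext x
    exact if_neg h
  · rfl

theorem undottedTop_isTop (hM : IsAdmissible n M) (g : Fin (2 * n + 2) → ℂ) :
    IsTop (undottedTop n M g) := by
  rw [IsTop, angSq_mulVec_iff]
  intro r c d
  by_cases h : r = n ∧ d = false
  · obtain ⟨rfl, rfl⟩ := h
    by_cases hc : c = 0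
    · rw [hc, comp_undottedTop hM, spinNumSq_mulVec_topVec, topEigenvalue_add]
    · rw [comp_of_le' _ _ (by rw [hM.last]; omega), Matrix.mulVec_zero, smul_zero]
  · rw [comp_undottedTop_of_not g h, Matrix.mulVec_zero, smul_zero]

variable (n M) in
/-- The eigenvectors of `X₀`. -/
def eigenTop (s : ℂ) : (Fin (2 * n + 2) → ℂ) →ₗ[ℂ] RhoIdx n M → ℂ :=
  (1 + s • Matrix.mulVecLin (diracOp n M 0)) ∘ₗ undottedTop n M

theorem eigenTop_apply (s : ℂ) (g : Fin (2 * n + 2) → ℂ) : eigenTop n M s g =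
    undottedTop n M g + s • (diracOp n M 0 *ᵥ undottedTop n M g) := rfl

theorem comp_add (v w : RhoIdx n M → ℂ) (r c : ℕ) (d : Bool) :
    comp (v + w) r c d = comp v r c d + comp w r c d := by
  unfold comp
  split_ifs
  · rfl
  · simp

theorem IsTop.add {v w : RhoIdx n M → ℂ} (hv : IsTop v) (hw : IsTop w) : IsTop (v + w) := by
  unfold IsTop at *
  rw [Matrix.mulVec_add, hv, hw, smul_add]

theorem IsTop.smul {v : RhoIdx n M → ℂ} (hv : IsTop v) (s : ℂ) : IsTop (s • v) := by
  unfold IsTop at *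
  rw [Matrix.mulVec_smul, hv, smul_comm]

theorem eigenTop_isTop (hM : IsAdmissible n M) (s : ℂ) (g : Fin (2 * n + 2) → ℂ) :
    IsTop (eigenTop n M s g) :=
  (undottedTop_isTop hM g).add ((undottedTop_isTop hM g).diracOp.smul s)

theorem comp_eigenTop (hM : IsAdmissible n M) (s : ℂ) (g : Fin (2 * n + 2) → ℂ) :
    comp (eigenTop n M s g) n 0 false = comp (undottedTop n M g) n 0 false ∧
      comp (eigenTop n M s g) n 0 true =
        s • (swapOp (lab n true) (lab n false) *ᵥ comp (undottedTop n M g) n 0 false) := by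
  have h := (undottedTop_isTop hM g).comp_diracOp hM
  have h1 : comp (undottedTop n M g) n 0 true = 0 := comp_undottedTop_of_not g (by simp)
  have h2 := h false
  have h3 := h true
  rw [Bool.not_false, h1, Matrix.mulVec_zero] at h2
  rw [Bool.not_true] at h3
  rw [eigenTop_apply, comp_add, comp_add, comp_smul, comp_smul, h1, h2, h3]
  simp

/-- An eigenvector with $s^2=1$ has spin $j$ and is determined by its undotted part, which is
arbitrary: $(1+sX_0)$ applied to an undotted vector of spin $j$ is an eigenvector because $X_0^2=1$
there. -/
theorem finrank_ker_diracOp (hM : IsAdmissible n M) {s : ℂ} (hs : s * s = 1) :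
    Module.finrank ℂ (LinearMap.ker (Matrix.mulVecLin (diracOp n M 0 - s • 1))) = 2 * n + 2 := by
  have hinj : Function.Injective (eigenTop n M s) := by
    rw [injective_iff_map_eq_zero]
    intro g hg
    have h1 := (comp_eigenTop hM s g).1
    rw [hg, comp_undottedTop hM] at h1
    have h2 : comp (0 : RhoIdx n M → ℂ) n 0 false = 0 := by unfold comp; split_ifs <;> rfl
    funext k
    have h3 := topVec_injective (h1.symm.trans h2) k.2
    rwa [dif_pos k.2] at h3
  have hs0 : s ≠ 0 := left_ne_zero_of_mul_eq_one hs
  have hmem : ∀ v : RhoIdx n M → ℂ, v ∈ LinearMap.ker (Matrix.mulVecLin (diracOp n M 0 - s • 1)) ↔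
      diracOp n M 0 *ᵥ v = s • v := fun v => by
    rw [LinearMap.mem_ker, Matrix.mulVecLin_apply, Matrix.sub_mulVec, Matrix.smul_mulVec,
      Matrix.one_mulVec, sub_eq_zero]
  have hrange : LinearMap.range (eigenTop n M s) =
      LinearMap.ker (Matrix.mulVecLin (diracOp n M 0 - s • 1)) := by
    ext v
    rw [hmem, LinearMap.mem_range]
    constructor
    · rintro ⟨g, rfl⟩
      rw [eigenTop_apply, Matrix.mulVec_add, Matrix.mulVec_smul, (undottedTop_isTop hM g).sq hM,
        smul_add, smul_smul, hs, one_smul, add_comm]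
    · intro hv
      have hv' := IsTop.of_eigenvector hM hs0 hv
      obtain ⟨g, hg⟩ := exists_topVec (hv'.spinNumSq n 0 false)
      let g' : Fin (2 * n + 2) → ℂ := fun k => g k
      have h1 : comp (undottedTop n M g') n 0 false = comp v n 0 false := by
        rw [comp_undottedTop hM, hg]
        funext x
        have hx1 : (x.1 : ℕ) < n + 2 := x.1.2
        have hx2 : (x.2 : ℕ) < n + 1 := x.2.2
        change topFun n _ _ _ = topFun n _ _ _
        rw [topFun, topFun, dif_pos (show (x.1 : ℕ) + x.2 < 2 * n + 2 by omega)]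
      refine ⟨g', (eigenTop_isTop hM s g').ext hM hv' fun d => ?_⟩
      cases d
      · rw [(comp_eigenTop hM s g').1, h1]
      · have h2 := hv'.comp_diracOp hM true
        rw [hv, comp_smul, Bool.not_true] at h2
        rw [(comp_eigenTop hM s g').2, h1, ← h2, smul_smul, hs, one_smul]
  rw [← hrange, LinearMap.finrank_range_of_inj hinj, Module.finrank_fintype_fun_eq_card,
    Fintype.card_fin]

theorem diracOp_eliminatesLowerSpins (hM : IsAdmissible n M) :
    EliminatesLowerSpins n (rhoGen n M) (diracOp n M) := by
  refine ⟨fun i hi hin v hv => ⟨_, diracOp_nilpotent hM (m := i - 1) (by omega) ?_ hv⟩,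
    fun v hv => IsTop.sq hM hv, fun s hs => ?_⟩
  · rw [Nat.cast_sub hi]
    push_cast
    ring
  · have hs1 : s * s = 1 := by rcases hs with rfl | rfl <;> norm_num
    have h := finrank_ker_diracOp hM hs1
    have h1 : LinearMap.ker (Matrix.mulVecLin (diracOp n M 0 - s • 1)) ≠ ⊥ := by
      intro h2
      rw [h2, finrank_bot] at h
      omega
    obtain ⟨v, hv, hv0⟩ := Submodule.exists_mem_ne_zero_of_ne_bot h1
    rw [LinearMap.mem_ker, Matrix.mulVecLin_apply, Matrix.sub_mulVec, Matrix.smul_mulVec,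
      Matrix.one_mulVec, sub_eq_zero] at hv
    exact ⟨v, hv0, IsTop.of_eigenvector hM (left_ne_zero_of_mul_eq_one hs1) hv, hv⟩

end TopSpin

/-! ### Covariance -/

section Covariance

variable {ι : Type} [Fintype ι]

section Norms

variable [DecidableEq ι]

attribute [local instance] Matrix.linftyOpNormedRing Matrix.linftyOpNormedAlgebra

/-- Conjugation with `exp D` transports the solutions of `Q' = [Q, D]`. -/
theorem exp_mul_eq_mul_exp (D : Matrix ι ι ℂ) (Q : ℝ → Matrix ι ι ℂ)
    (hQ : ∀ t, HasDerivAt Q (Q t * D - D * Q t) t) :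
    NormedSpace.exp D * Q 1 = Q 0 * NormedSpace.exp D := by
  let _ : NormedAlgebra ℝ (Matrix ι ι ℂ) := NormedAlgebra.restrictScalars ℝ ℂ _
  -- The conjugate $e^{tD}Q(t)e^{-tD}$ is constant; comparing $t=1$ with $t=0$ gives the claim.
  have h1 : ∀ t : ℝ, HasDerivAt (fun t : ℝ => NormedSpace.exp (t • D) * Q t * NormedSpace.exp (t • -D)) 0 t := by
    intro t
    have e1 : HasDerivAt (fun t : ℝ => NormedSpace.exp (t • D)) (NormedSpace.exp (t • D) * D) t :=
      hasDerivAt_exp_smul_const D t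
    have e2 : HasDerivAt (fun t : ℝ => NormedSpace.exp (t • -D)) (-D * NormedSpace.exp (t • -D)) t :=
      hasDerivAt_exp_smul_const' (-D) t
    refine ((e1.mul (hQ t)).mul e2).congr_deriv ?_
    simp only [Pi.mul_apply]
    noncomm_ring
  have h2 := is_const_of_deriv_eq_zero (fun t => (h1 t).differentiableAt) (fun t => (h1 t).deriv) 1 0
  simp only [one_smul, zero_smul, NormedSpace.exp_zero, one_mul, mul_one] at h2
  have h3 : NormedSpace.exp (-D) * NormedSpace.exp D = 1 := by
    rw [← Matrix.exp_add_of_commute _ _ (Commute.neg_left (Commute.refl D)), neg_add_cancel,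
      NormedSpace.exp_zero]
  rw [← h2, Matrix.mul_assoc _ (NormedSpace.exp (-D)), h3, Matrix.mul_one]

/-- The matrices `T(p)` which depend linearly on a covector. -/
def linComb (T : Fin 4 → Matrix ι ι ℂ) (p : Fin 4 → ℝ) : Matrix ι ι ℂ := ∑ σ, (p σ : ℂ) • T σ

theorem hasDerivAt_linComb (T : Fin 4 → Matrix ι ι ℂ) {q : ℝ → Fin 4 → ℝ} {q' : Fin 4 → ℝ} {t : ℝ}
    (hq : HasDerivAt q q' t) : HasDerivAt (fun t => linComb T (q t)) (linComb T q') t := by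
  refine HasDerivAt.fun_sum fun σ _ => ?_
  exact ((hasDerivAt_pi.mp hq σ).ofReal_comp).smul_const (T σ)

theorem exp_mul_linComb {T : Fin 4 → Matrix ι ι ℂ} {D : Matrix ι ι ℂ} {q : ℝ → Fin 4 → ℝ}
    {L : Matrix (Fin 4) (Fin 4) ℝ} (hD : ∀ p, linComb T p * D - D * linComb T p = linComb T (p ᵥ* L))
    (hq : ∀ t, HasDerivAt q (q t ᵥ* L) t) :
    NormedSpace.exp D * linComb T (q 1) = linComb T (q 0) * NormedSpace.exp D := by
  refine exp_mul_eq_mul_exp D (fun t => linComb T (q t)) fun t => ?_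
  rw [hD]
  exact hasDerivAt_linComb T (hq t)

/-- The square of a pseudovector which depends linearly on a covector. -/
theorem exp_mul_sum_sq {W : Fin 4 → Fin 4 → Matrix ι ι ℂ} {D : Matrix ι ι ℂ} {q : ℝ → Fin 4 → ℝ}
    {L : Matrix (Fin 4) (Fin 4) ℝ} {A : Fin 4 → Fin 4 → ℂ} {e : Fin 4 → ℂ}
    (hA : ∀ μ ν, e μ * A μ ν = -(e ν * A ν μ))
    (hD : ∀ μ p, linComb (W μ) p * D - D * linComb (W μ) p =
      linComb (W μ) (p ᵥ* L) + ∑ ν, A μ ν • linComb (W ν) p)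
    (hq : ∀ t, HasDerivAt q (q t ᵥ* L) t) :
    NormedSpace.exp D * ∑ μ, e μ • (linComb (W μ) (q 1) * linComb (W μ) (q 1)) =
      (∑ μ, e μ • (linComb (W μ) (q 0) * linComb (W μ) (q 0))) * NormedSpace.exp D := by
  refine exp_mul_eq_mul_exp D
    (fun t => ∑ μ, e μ • (linComb (W μ) (q t) * linComb (W μ) (q t))) fun t => ?_
  have h1 : HasDerivAt (fun t => ∑ μ, e μ • (linComb (W μ) (q t) * linComb (W μ) (q t)))
      (∑ μ, e μ • (linComb (W μ) (q t ᵥ* L) * linComb (W μ) (q t) +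
        linComb (W μ) (q t) * linComb (W μ) (q t ᵥ* L))) t := by
    refine HasDerivAt.fun_sum fun μ _ => ?_
    exact ((hasDerivAt_linComb (W μ) (hq t)).mul (hasDerivAt_linComb (W μ) (hq t))).const_smul (e μ)
  refine h1.congr_deriv ?_
  set V := fun μ => linComb (W μ) (q t) with hV
  have h2 : ∀ μ, V μ * V μ * D - D * (V μ * V μ) =
      linComb (W μ) (q t ᵥ* L) * V μ + V μ * linComb (W μ) (q t ᵥ* L) +
        ∑ ν, A μ ν • (V ν * V μ + V μ * V ν) := by
    intro μ
    have h3 : V μ * V μ * D - D * (V μ * V μ) =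
        (V μ * D - D * V μ) * V μ + V μ * (V μ * D - D * V μ) := by noncomm_ring
    have h4 : ∑ ν, A μ ν • (V ν * V μ + V μ * V ν) =
        (∑ ν, A μ ν • V ν) * V μ + V μ * ∑ ν, A μ ν • V ν := by
      simp only [smul_add, Finset.sum_add_distrib, Finset.sum_mul, Finset.mul_sum, Matrix.smul_mul,
        Matrix.mul_smul]
    rw [h3, hD μ (q t), h4]
    noncomm_ring
  -- The anticommutator is symmetric in the two indices while `e μ * A μ ν` is antisymmetric, so the
  -- rotation of the index drops out of the square.
  have h4 : ∑ μ, e μ • ∑ ν, A μ ν • (V ν * V μ + V μ * V ν) = 0 := by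
    have h5 : ∀ f : Fin 4 → Fin 4 → Matrix ι ι ℂ, (∀ μ ν, f μ ν = -f ν μ) → ∑ μ, ∑ ν, f μ ν = 0 := by
      intro f hf
      have h6 : ∑ μ, ∑ ν, f μ ν = -∑ μ, ∑ ν, f μ ν := by
        conv_lhs => rw [Finset.sum_comm]
        rw [← Finset.sum_neg_distrib]
        refine Finset.sum_congr rfl fun μ _ => ?_
        rw [← Finset.sum_neg_distrib]
        exact Finset.sum_congr rfl fun ν _ => hf ν μ
      have h7 : (2 : ℂ) • ∑ μ, ∑ ν, f μ ν = 0 := by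
        rw [two_smul]
        nth_rewrite 1 [h6]
        exact neg_add_cancel _
      exact (smul_eq_zero.mp h7).resolve_left two_ne_zero
    simp only [Finset.smul_sum, smul_smul]
    refine h5 _ fun μ ν => ?_
    rw [hA μ ν, neg_smul, add_comm]
  have h5 : (∑ μ, e μ • (V μ * V μ)) * D - D * ∑ μ, e μ • (V μ * V μ) =
      ∑ μ, e μ • (V μ * V μ * D - D * (V μ * V μ)) := by
    simp only [Finset.sum_mul, Finset.mul_sum, Matrix.smul_mul, Matrix.mul_smul, smul_sub,
      Finset.sum_sub_distrib]
  change _ = (∑ μ, e μ • (V μ * V μ)) * D - D * ∑ μ, e μ • (V μ * V μ)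
  rw [h5, ← sub_eq_zero, ← Finset.sum_sub_distrib, ← neg_eq_zero, ← Finset.sum_neg_distrib, ← h4]
  refine Finset.sum_congr rfl fun μ _ => ?_
  rw [h2 μ, smul_add (e μ) _ (∑ ν, A μ ν • (V ν * V μ + V μ * V ν)), neg_sub, add_sub_cancel_left]

theorem hasDerivAt_vecMul_exp (p : Fin 4 → ℝ) (L : Matrix (Fin 4) (Fin 4) ℝ) (t : ℝ) :
    HasDerivAt (fun t : ℝ => p ᵥ* NormedSpace.exp (t • L)) ((p ᵥ* NormedSpace.exp (t • L)) ᵥ* L) t := by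
  have e1 : HasDerivAt (fun t : ℝ => NormedSpace.exp (t • L)) (NormedSpace.exp (t • L) * L) t :=
    hasDerivAt_exp_smul_const L t
  let f : Matrix (Fin 4) (Fin 4) ℝ →ₗ[ℝ] Fin 4 → ℝ :=
    { toFun := fun B => p ᵥ* B
      map_add' := fun B C => Matrix.vecMul_add B C p
      map_smul' := fun c B => Matrix.vecMul_smul _ c B }
  rw [Matrix.vecMul_vecMul]
  exact (f.toContinuousLinearMap.hasFDerivAt.comp_hasDerivAt t e1)

end Norms

theorem isUnit_lorentzRep [DecidableEq ι] (G : Fin 4 → Fin 4 → Matrix ι ι ℂ) (θ : Matrix (Fin 4) (Fin 4) ℝ) :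
    IsUnit (lorentzRep G θ) :=
  Matrix.isUnit_exp _

variable {G : Fin 4 → Fin 4 → Matrix ι ι ℂ} {X : Fin 4 → Matrix ι ι ℂ}

/-- The contravariant components `X^β`. -/
def contra (X : Fin 4 → Matrix ι ι ℂ) (β : Fin 4) : Matrix ι ι ℂ := (mink β β : ℂ) • X β

theorem mink_self_mul (β : Fin 4) : mink β β * mink β β = 1 := by
  fin_cases β <;> simp [mink]

theorem mink_of_ne {α β : Fin 4} (h : α ≠ β) : mink α β = 0 := Matrix.diagonal_apply_ne _ h

theorem sum_mink {E : Type*} [AddCommMonoid E] (β : Fin 4) (f : ℝ → Fin 4 → E)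
    (hf : ∀ α, f 0 α = 0) : ∑ α, f (mink β α) α = f (mink β β) β :=
  Finset.sum_eq_single_of_mem β (Finset.mem_univ _) fun α _ h => by rw [mink_of_ne h.symm, hf]

theorem slash_eq (p : Fin 4 → ℝ) : slash X p = linComb (contra X) p := by
  rw [slash, linComb]
  refine Finset.sum_congr rfl fun α _ => ?_
  rw [sum_mink α (fun m β => ((m * p β : ℝ) : ℂ) • X α) (by simp), contra, smul_smul,
    Complex.ofReal_mul, mul_comm]

theorem diracExpr_eq (κ : ℝ) (ψ : ι → ℂ) (d : Fin 4 → ι → ℂ) :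
    diracExpr X κ ψ d = ∑ α, Complex.I • (contra X α *ᵥ d α) - (κ : ℂ) • ψ := by
  rw [diracExpr]
  congr 1
  refine Finset.sum_congr rfl fun α _ => ?_
  rw [sum_mink α (fun m β => (Complex.I * (m : ℂ)) • (X α *ᵥ d β)) (by simp), contra,
    Matrix.smul_mulVec, smul_smul]

/-- The generator of a Lorentz transformation. -/
def lorentzGen (G : Fin 4 → Fin 4 → Matrix ι ι ℂ) (θ : Matrix (Fin 4) (Fin 4) ℝ) : Matrix ι ι ℂ :=
  ∑ α, ∑ β, (-(Complex.I / 2) * (θ α β : ℂ)) • G α β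

/-- The upper-index matrices change by `θ * mink`. The antisymmetry of `θ` makes the two terms of
the vector relation equal, which cancels the factor one half in the generator. -/
theorem contra_commutator (hX : IsVectorOperator G X) {θ : Matrix (Fin 4) (Fin 4) ℝ} (hθ : θᵀ = -θ)
    (γ : Fin 4) : contra X γ * lorentzGen G θ - lorentzGen G θ * contra X γ =
      ∑ β, ((θ * mink) γ β : ℂ) • contra X β := by
  have hθ' : ∀ α β, (θ α β : ℂ) = -(θ β α : ℂ) := fun α β => by
    have := congrFun (congrFun hθ β) α
    rw [Matrix.transpose_apply, Matrix.neg_apply] at this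
    rw [this, Complex.ofReal_neg]
  have h1 : X γ * lorentzGen G θ - lorentzGen G θ * X γ =
      ∑ α, ∑ β, (-(Complex.I / 2) * (θ α β : ℂ)) •
        ((Complex.I * (mink γ α : ℂ)) • X β - (Complex.I * (mink γ β : ℂ)) • X α) := by
    simp only [lorentzGen, Matrix.mul_sum, Matrix.sum_mul, Matrix.mul_smul, Matrix.smul_mul,
      ← Finset.sum_sub_distrib, ← smul_sub, hX γ]
  have h2 : ∑ α, ∑ β, (-(Complex.I / 2) * (θ α β : ℂ)) • ((Complex.I * (mink γ α : ℂ)) • X β) =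
      ∑ β, ((1 / 2) * (mink γ γ : ℂ) * (θ γ β : ℂ)) • X β := by
    rw [sum_mink γ (fun m α => ∑ β, (-(Complex.I / 2) * (θ α β : ℂ)) • ((Complex.I * (m : ℂ)) • X β))
      (by simp)]
    refine Finset.sum_congr rfl fun β _ => ?_
    rw [smul_smul]
    congr 1
    linear_combination (-(1 / 2) * (θ γ β : ℂ) * (mink γ γ : ℂ)) * Complex.I_mul_I
  have h3 : ∑ α, ∑ β, (-(Complex.I / 2) * (θ α β : ℂ)) • ((Complex.I * (mink γ β : ℂ)) • X α) =
      ∑ α, ((1 / 2) * (mink γ γ : ℂ) * (θ α γ : ℂ)) • X α := by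
    refine Finset.sum_congr rfl fun α _ => ?_
    rw [sum_mink γ (fun m β => (-(Complex.I / 2) * (θ α β : ℂ)) • ((Complex.I * (m : ℂ)) • X α))
      (by simp), smul_smul]
    congr 1
    linear_combination (-(1 / 2) * (θ α γ : ℂ) * (mink γ γ : ℂ)) * Complex.I_mul_I
  have h4 : X γ * lorentzGen G θ - lorentzGen G θ * X γ =
      ∑ β, ((mink γ γ : ℂ) * (θ γ β : ℂ)) • X β := by
    rw [h1]
    simp only [smul_sub, Finset.sum_sub_distrib]
    rw [h2, h3, ← Finset.sum_sub_distrib]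
    refine Finset.sum_congr rfl fun β _ => ?_
    rw [← sub_smul, hθ' β γ]
    congr 1
    ring
  have h5 : (mink γ γ : ℂ) * (mink γ γ : ℂ) = 1 := by exact_mod_cast mink_self_mul γ
  rw [contra, Matrix.smul_mul, Matrix.mul_smul, ← smul_sub, h4, Finset.smul_sum]
  refine Finset.sum_congr rfl fun β _ => ?_
  have h6 : (mink β β : ℂ) * (mink β β : ℂ) = 1 := by exact_mod_cast mink_self_mul β
  have h7 : (θ * mink) γ β = θ γ β * mink β β := by
    rw [mink, Matrix.mul_diagonal, Matrix.diagonal_apply_eq]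
  rw [contra, smul_smul, smul_smul, h7]
  congr 1
  push_cast
  linear_combination (θ γ β : ℂ) * h5 - (θ γ β : ℂ) * h6

theorem linComb_contra_commutator (hX : IsVectorOperator G X) {θ : Matrix (Fin 4) (Fin 4) ℝ}
    (hθ : θᵀ = -θ) (p : Fin 4 → ℝ) :
    linComb (contra X) p * lorentzGen G θ - lorentzGen G θ * linComb (contra X) p =
      linComb (contra X) (p ᵥ* (θ * mink)) := by
  simp only [linComb, Matrix.sum_mul, Matrix.mul_sum, Matrix.smul_mul, Matrix.mul_smul,
    ← Finset.sum_sub_distrib, ← smul_sub, contra_commutator hX hθ, Finset.smul_sum, smul_smul,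
    Matrix.vecMul, dotProduct, Complex.ofReal_sum, Complex.ofReal_mul, Finset.sum_smul]
  exact Finset.sum_comm

variable [DecidableEq ι]

/-- Transport of the matrices `S(p)` along a curve of covectors. -/
theorem lorentzRep_mul_slash (hX : IsVectorOperator G X) {θ : Matrix (Fin 4) (Fin 4) ℝ}
    (hθ : θᵀ = -θ) {q : ℝ → Fin 4 → ℝ} (hq : ∀ t, HasDerivAt q (q t ᵥ* (θ * mink)) t) :
    lorentzRep G θ * slash X (q 1) = slash X (q 0) * lorentzRep G θ := by
  rw [slash_eq, slash_eq]
  exact exp_mul_linComb (linComb_contra_commutator hX hθ) hq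

/-- By the chain rule invariance of the equation reduces to one algebraic intertwining relation. It
serves for Poincaré transformations and for the space reflection. -/
theorem isSolution_transform {A : Matrix ι ι ℂ} {B : Matrix (Fin 4) (Fin 4) ℝ}
    (h : ∀ γ, ∑ β, (B γ β : ℂ) • (contra X β * A) = A * contra X γ) {κ : ℝ} (a : Fin 4 → ℝ)
    {Ψ : (Fin 4 → ℝ) → ι → ℂ} (hΨ : IsSolution X κ Ψ) :
    IsSolution X κ fun x => A *ᵥ Ψ (B *ᵥ (x - a)) := by
  let b : (Fin 4 → ℝ) →L[ℝ] (Fin 4 → ℝ) := (Matrix.mulVecLin B).toContinuousLinearMap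
  let c : (ι → ℂ) →L[ℝ] (ι → ℂ) := ((Matrix.mulVecLin A).restrictScalars ℝ).toContinuousLinearMap
  have hd : ∀ x, HasFDerivAt (fun x => A *ᵥ Ψ (B *ᵥ (x - a)))
      (c.comp ((fderiv ℝ Ψ (B *ᵥ (x - a))).comp b)) x := by
    intro x
    have h1 : HasFDerivAt (fun x : Fin 4 → ℝ => b (x - a)) b x :=
      b.hasFDerivAt.comp x ((hasFDerivAt_id x).sub_const a)
    exact c.hasFDerivAt.comp x ((hΨ.1 (B *ᵥ (x - a))).hasFDerivAt.comp x h1)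
  refine ⟨fun x => (hd x).differentiableAt, fun x => ?_⟩
  have hp : ∀ β, pderiv β (fun x => A *ᵥ Ψ (B *ᵥ (x - a))) x =
      ∑ γ, (B γ β : ℂ) • (A *ᵥ pderiv γ Ψ (B *ᵥ (x - a))) := by
    intro β
    rw [pderiv, (hd x).fderiv]
    change A *ᵥ (fderiv ℝ Ψ (B *ᵥ (x - a)) (B *ᵥ Pi.single β 1)) = _
    have h2 : B *ᵥ Pi.single β (1 : ℝ) = ∑ γ, B γ β • (Pi.single γ (1 : ℝ) : Fin 4 → ℝ) := by
      funext γ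
      simp [Finset.sum_apply, Pi.single_apply]
    rw [h2, map_sum, ← Matrix.mulVecLin_apply, map_sum]
    refine Finset.sum_congr rfl fun γ _ => ?_
    rw [map_smul, ← Complex.coe_smul, map_smul]
    rfl
  have h0 := hΨ.2 (B *ᵥ (x - a))
  rw [diracExpr_eq] at h0 ⊢
  have h1 : ∑ α, Complex.I • (contra X α *ᵥ pderiv α (fun x => A *ᵥ Ψ (B *ᵥ (x - a))) x) =
      A *ᵥ ∑ γ, Complex.I • (contra X γ *ᵥ pderiv γ Ψ (B *ᵥ (x - a))) := by
    simp only [hp, Matrix.mulVec_sum, Matrix.mulVec_smul, Finset.smul_sum]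
    rw [Finset.sum_comm]
    refine Finset.sum_congr rfl fun γ _ => ?_
    rw [Matrix.mulVec_mulVec, ← h γ, Matrix.sum_mulVec, Finset.smul_sum]
    exact Finset.sum_congr rfl fun β _ => by rw [Matrix.smul_mulVec, Matrix.mulVec_mulVec]
  rw [h1, ← Matrix.mulVec_smul, ← Matrix.mulVec_sub, h0, Matrix.mulVec_zero]

theorem poincareInvariant (hX : IsVectorOperator G X) (κ : ℝ) : PoincareInvariant G X κ := by
  intro θ a hθ Ψ hΨ
  refine isSolution_transform (fun γ => ?_) a hΨ
  -- The curve of covectors starts at row `γ` of $\Lambda^{-1}$ and reaches the unit covector at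
  -- time one, since $\Lambda^{-1}\Lambda=1$.
  have h1 := lorentzRep_mul_slash hX hθ (fun t => hasDerivAt_vecMul_exp ((lorentz θ)⁻¹ γ) _ t)
  have h2 : (lorentz θ)⁻¹ * lorentz θ = 1 :=
    Matrix.nonsing_inv_mul _ ((Matrix.isUnit_iff_isUnit_det _).mp (Matrix.isUnit_exp _))
  have h3 : (lorentz θ)⁻¹ γ ᵥ* NormedSpace.exp ((1 : ℝ) • (θ * mink)) = Pi.single γ 1 := by
    rw [one_smul]
    funext δ
    have := congrFun (congrFun h2 γ) δ
    rw [Matrix.mul_apply_eq_vecMul, Matrix.one_apply] at this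
    rw [Pi.single_apply]
    simp only [eq_comm (a := δ)]
    exact this
  rw [h3, zero_smul, NormedSpace.exp_zero, Matrix.vecMul_one, slash_eq, slash_eq] at h1
  rw [linComb, Finset.sum_eq_single_of_mem γ (Finset.mem_univ _) fun σ _ h => by
    rw [Pi.single_eq_of_ne h, Complex.ofReal_zero, zero_smul], Pi.single_eq_same, Complex.ofReal_one,
    one_smul] at h1
  rw [h1, linComb, Finset.sum_mul]
  exact Finset.sum_congr rfl fun β _ => (Matrix.smul_mul _ _ _).symm

theorem parityInvariant {P : Matrix ι ι ℂ} (hP : ∀ α, P * X α = (mink α α : ℂ) • (X α * P)) (κ : ℝ) :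
    ParityInvariant P X κ := by
  refine ⟨hP, fun Ψ hΨ => ?_⟩
  have h := isSolution_transform (A := P) (B := mink) (fun γ => ?_) 0 hΨ
  · simpa only [sub_zero] using h
  · rw [sum_mink γ (fun m β => (m : ℂ) • (contra X β * P)) (by simp), contra, Matrix.smul_mul,
      Matrix.mul_smul, hP]

end Covariance

/-! ### Boosts -/

section Boosts

variable {ι : Type} [Fintype ι] [DecidableEq ι]

/-- The covector of energy `cosh t` and momentum `sinh t` in the direction `v`. -/
def boostCurve (v : Fin 3 → ℝ) (t : ℝ) : Fin 4 → ℝ :=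
  ![Real.cosh t, Real.sinh t * v 0, Real.sinh t * v 1, Real.sinh t * v 2]

/-- The parameters of the boost in the direction `v`. -/
def boostParam (v : Fin 3 → ℝ) : Matrix (Fin 4) (Fin 4) ℝ :=
  !![0, -v 0, -v 1, -v 2; v 0, 0, 0, 0; v 1, 0, 0, 0; v 2, 0, 0, 0]

theorem boostParam_transpose (v : Fin 3 → ℝ) : (boostParam v)ᵀ = -boostParam v := by
  ext i j
  fin_cases i <;> fin_cases j <;> simp [boostParam]

theorem hasDerivAt_boostCurve {v : Fin 3 → ℝ} (hv : v 0 ^ 2 + v 1 ^ 2 + v 2 ^ 2 = 1) (t : ℝ) :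
    HasDerivAt (boostCurve v) (boostCurve v t ᵥ* (boostParam v * mink)) t := by
  have e : boostCurve v t ᵥ* (boostParam v * mink) =
      ![Real.sinh t, Real.cosh t * v 0, Real.cosh t * v 1, Real.cosh t * v 2] := by
    have h1 : boostParam v * mink =
        !![0, v 0, v 1, v 2; v 0, 0, 0, 0; v 1, 0, 0, 0; v 2, 0, 0, 0] := by
      rw [mink]
      ext i j
      rw [Matrix.mul_diagonal]
      fin_cases i <;> fin_cases j <;> simp [boostParam]
    rw [h1]
    funext i
    fin_cases i <;> simp [boostCurve, Matrix.vecMul, dotProduct, Fin.sum_univ_four]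
    linear_combination Real.sinh t * hv
  rw [e, hasDerivAt_pi]
  intro i
  fin_cases i
  · exact Real.hasDerivAt_cosh t
  · exact (Real.hasDerivAt_sinh t).mul_const _
  · exact (Real.hasDerivAt_sinh t).mul_const _
  · exact (Real.hasDerivAt_sinh t).mul_const _

/-- Part of a boost orbit, parametrized over the unit interval. -/
theorem hasDerivAt_boostOrbit {v : Fin 3 → ℝ} (hv : v 0 ^ 2 + v 1 ^ 2 + v 2 ^ 2 = 1) (m ξ s t : ℝ) :
    HasDerivAt (fun t : ℝ => m • boostCurve v (ξ * t + s))
      ((m • boostCurve v (ξ * t + s)) ᵥ* (ξ • boostParam v * mink)) t := by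
  have h1 : HasDerivAt (fun t : ℝ => ξ * t + s) ξ t := by
    simpa using ((hasDerivAt_id t).const_mul ξ).add_const s
  have h2 := ((hasDerivAt_boostCurve hv (ξ * t + s)).scomp t h1).const_smul m
  refine h2.congr_deriv ?_
  rw [Matrix.smul_mul, Matrix.vecMul_smul, Matrix.smul_vecMul, smul_comm]

theorem minkSq_eq (p : Fin 4 → ℝ) : minkSq p = p 0 ^ 2 - (p 1 ^ 2 + p 2 ^ 2 + p 3 ^ 2) := by
  simp [minkSq, mink, Fin.sum_univ_four, Matrix.diagonal_apply]
  ring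

/-- Every timelike covector is on a boost orbit through the rest frame. -/
theorem exists_boost {p : Fin 4 → ℝ} {m : ℝ} (hm : 0 < m) (hp : minkSq p = m ^ 2) :
    ∃ (v : Fin 3 → ℝ) (ξ s : ℝ), v 0 ^ 2 + v 1 ^ 2 + v 2 ^ 2 = 1 ∧ s * s = 1 ∧
      p = (s * m) • boostCurve v ξ := by
  rw [minkSq_eq] at hp
  set r := Real.sqrt (p 1 ^ 2 + p 2 ^ 2 + p 3 ^ 2) with hr
  have hr2 : r ^ 2 = p 1 ^ 2 + p 2 ^ 2 + p 3 ^ 2 := Real.sq_sqrt (by positivity)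
  obtain ⟨v, hv, hpv⟩ : ∃ v : Fin 3 → ℝ, v 0 ^ 2 + v 1 ^ 2 + v 2 ^ 2 = 1 ∧
      p 1 = r * v 0 ∧ p 2 = r * v 1 ∧ p 3 = r * v 2 := by
    by_cases h : r = 0
    · rw [h] at hr2
      refine ⟨![1, 0, 0], by simp, ?_⟩
      have h1 : p 1 = 0 := by nlinarith [sq_nonneg (p 1), sq_nonneg (p 2), sq_nonneg (p 3)]
      have h2 : p 2 = 0 := by nlinarith [sq_nonneg (p 1), sq_nonneg (p 2), sq_nonneg (p 3)]
      have h3 : p 3 = 0 := by nlinarith [sq_nonneg (p 1), sq_nonneg (p 2), sq_nonneg (p 3)]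
      simp [h, h1, h2, h3]
    · refine ⟨![p 1 / r, p 2 / r, p 3 / r], ?_, ?_⟩
      · simp only [Matrix.cons_val_zero, Matrix.cons_val_one, Matrix.cons_val]
        field_simp
        exact hr2.symm
      · simp only [Matrix.cons_val_zero, Matrix.cons_val_one, Matrix.cons_val]
        refine ⟨?_, ?_, ?_⟩ <;> field_simp
  -- `s` is the sign of the energy, so that both mass hyperboloids are treated at once.
  obtain ⟨s, hs, hs0⟩ : ∃ s : ℝ, s * s = 1 ∧ s * p 0 = |p 0| := by
    rcases le_total 0 (p 0) with h | h
    · exact ⟨1, by norm_num, by rw [abs_of_nonneg h, one_mul]⟩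
    · exact ⟨-1, by norm_num, by rw [abs_of_nonpos h]; ring⟩
  have hcosh : Real.cosh (Real.arsinh (s * (r / m))) = s * (p 0 / m) := by
    have h1 : s * (p 0 / m) = |p 0| / m := by rw [← hs0, mul_div_assoc]
    have h2 : 1 + (s * (r / m)) ^ 2 = (|p 0| / m) ^ 2 := by
      rw [div_pow, sq_abs]
      field_simp
      linear_combination r ^ 2 * hs + hr2 - hp
    rw [Real.cosh_arsinh, h1, h2, Real.sqrt_sq (by positivity)]
  refine ⟨v, Real.arsinh (s * (r / m)), s, hv, hs, ?_⟩
  have h1 : ∀ x, s * m * (s * (x / m)) = x := fun x => by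
    field_simp
    linear_combination x * hs
  funext i
  fin_cases i
  · change p 0 = s * m * Real.cosh _
    rw [hcosh, h1]
  · change p 1 = s * m * (Real.sinh _ * v 0)
    rw [Real.sinh_arsinh, ← mul_assoc, h1, hpv.1]
  · change p 2 = s * m * (Real.sinh _ * v 1)
    rw [Real.sinh_arsinh, ← mul_assoc, h1, hpv.2.1]
  · change p 3 = s * m * (Real.sinh _ * v 2)
    rw [Real.sinh_arsinh, ← mul_assoc, h1, hpv.2.2]

variable {G : Fin 4 → Fin 4 → Matrix ι ι ℂ} {X : Fin 4 → Matrix ι ι ℂ}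

theorem boostCurve_zero (v : Fin 3 → ℝ) : boostCurve v 0 = Pi.single 0 1 := by
  funext i
  fin_cases i <;> simp [boostCurve]

theorem slash_smul (c : ℝ) (p : Fin 4 → ℝ) : slash X (c • p) = (c : ℂ) • slash X p := by
  simp only [slash_eq, linComb, Finset.smul_sum, smul_smul, Pi.smul_apply, smul_eq_mul,
    Complex.ofReal_mul]

theorem slash_single : slash X (Pi.single 0 1) = X 0 := by
  rw [slash_eq, linComb, Finset.sum_eq_single_of_mem 0 (Finset.mem_univ _) fun σ _ h => by
    rw [Pi.single_eq_of_ne h, Complex.ofReal_zero, zero_smul]]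
  simp [contra, mink]

theorem slash_add_single (p : Fin 4 → ℝ) (s : ℝ) :
    slash X (p + s • Pi.single 0 1) = slash X p + (s : ℂ) • X 0 := by
  have h2 := slash_smul (X := X) s (Pi.single 0 1)
  rw [slash_single] at h2
  rw [← h2, slash_eq, slash_eq, slash_eq, linComb, linComb, linComb, ← Finset.sum_add_distrib]
  exact Finset.sum_congr rfl fun σ _ => by rw [Pi.add_apply, Complex.ofReal_add, add_smul]

/-- A boost takes `S(p)` to the rest frame. -/
theorem boost_mul_slash (hX : IsVectorOperator G X) {v : Fin 3 → ℝ}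
    (hv : v 0 ^ 2 + v 1 ^ 2 + v 2 ^ 2 = 1) (m ξ : ℝ) :
    lorentzRep G (ξ • boostParam v) * slash X (m • boostCurve v ξ) =
      ((m : ℂ) • X 0) * lorentzRep G (ξ • boostParam v) := by
  have h := lorentzRep_mul_slash hX (θ := ξ • boostParam v)
    (by rw [Matrix.transpose_smul, boostParam_transpose, smul_neg]) (hasDerivAt_boostOrbit hv m ξ 0)
  rw [mul_one, mul_zero, add_zero, add_zero, boostCurve_zero, slash_smul m (Pi.single 0 1), slash_single] at h
  exact h

/-- The inverse boost takes `X₀` to the moving frame. -/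
theorem boost_mul_zero (hX : IsVectorOperator G X) {v : Fin 3 → ℝ}
    (hv : v 0 ^ 2 + v 1 ^ 2 + v 2 ^ 2 = 1) (ξ : ℝ) :
    lorentzRep G (ξ • boostParam v) * X 0 =
      slash X (boostCurve v (-ξ)) * lorentzRep G (ξ • boostParam v) := by
  have h := lorentzRep_mul_slash hX (θ := ξ • boostParam v)
    (by rw [Matrix.transpose_smul, boostParam_transpose, smul_neg]) (hasDerivAt_boostOrbit hv 1 ξ (-ξ))
  rw [mul_one, mul_zero, zero_add, add_neg_cancel, boostCurve_zero, one_smul, one_smul,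
    slash_single] at h
  exact h

/-- `X₀` has only the eigenvalues `0`, `1`, `-1`, the latter being semisimple. -/
def IsReduced (X : Fin 4 → Matrix ι ι ℂ) : Prop :=
  X 0 ^ Fintype.card ι * (X 0 * X 0 - 1) = 0

/-- A boost conjugates `slash X p` to a multiple of $X_0$ whose square factor is $p^2$, and the
identity of $X_0$ is transported. -/
theorem slash_pow_of_timelike (hX : IsVectorOperator G X) (h0 : IsReduced X) {p : Fin 4 → ℝ}
    (hp : 0 < minkSq p) :
    slash X p ^ Fintype.card ι * (slash X p * slash X p - (minkSq p : ℂ) • 1) = 0 := by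
  have hm : minkSq p = Real.sqrt (minkSq p) ^ 2 := (Real.sq_sqrt hp.le).symm
  obtain ⟨v, ξ, s, hv, hs, hpv⟩ := exists_boost (Real.sqrt_pos.mpr hp) hm
  set m := Real.sqrt (minkSq p)
  have h1 := boost_mul_slash (G := G) hX hv (s * m) ξ
  rw [← hpv] at h1
  set g := lorentzRep G (ξ • boostParam v)
  have hg : IsUnit g := isUnit_lorentzRep G _
  have hpow : ∀ k : ℕ, g * slash X p ^ k = (((s * m : ℝ) : ℂ) • X 0) ^ k * g := by
    intro k
    induction k with
    | zero => simp
    | succ k ih => rw [pow_succ, ← mul_assoc, ih, mul_assoc, h1, ← mul_assoc, ← pow_succ]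
  have h2 : g * (slash X p ^ Fintype.card ι * (slash X p * slash X p - (minkSq p : ℂ) • 1)) = 0 := by
    have h3 : g * (slash X p * slash X p - (minkSq p : ℂ) • 1) =
        ((minkSq p : ℂ) • (X 0 * X 0 - 1)) * g := by
      have h4 := hpow 2
      rw [pow_two, pow_two] at h4
      have h5 : (((s * m : ℝ) : ℂ)) * ((s * m : ℝ) : ℂ) = (minkSq p : ℂ) := by
        rw [← Complex.ofReal_mul, hm]
        congr 1
        linear_combination m ^ 2 * hs
      rw [mul_sub, h4, Matrix.mul_smul g, mul_one, Matrix.smul_mul (_ : ℂ) (X 0), Matrix.mul_smul,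
        smul_smul, h5, smul_sub, sub_mul, Matrix.smul_mul _ (1 : Matrix ι ι ℂ), one_mul]
    rw [← mul_assoc, hpow, mul_assoc, h3, ← mul_assoc, smul_pow, Matrix.smul_mul, Matrix.mul_smul]
    rw [h0, smul_zero, smul_zero, zero_mul]
  exact hg.mul_right_eq_zero.mp h2

/-- The characteristic identity of the matrices `S(p)`, for complex energies. -/
theorem slash_pow_identity (hX : IsVectorOperator G X) (h0 : IsReduced X) (p : Fin 4 → ℝ) (s : ℂ) :
    (slash X p + s • X 0) ^ Fintype.card ι * ((slash X p + s • X 0) * (slash X p + s • X 0) -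
      ((minkSq p : ℂ) + 2 * p 0 * s + s ^ 2) • 1) = 0 := by
  -- The energy shift is made a polynomial variable: each entry of `F` is a polynomial, and it
  -- suffices to find infinitely many zeros.
  let N : Matrix ι ι (Polynomial ℂ) := (slash X p).map Polynomial.C + (Polynomial.X : Polynomial ℂ) • (X 0).map Polynomial.C
  let c : Polynomial ℂ := Polynomial.C (minkSq p : ℂ) + Polynomial.C (2 * p 0 : ℂ) * Polynomial.X + Polynomial.X ^ 2
  let F : Matrix ι ι (Polynomial ℂ) := N ^ Fintype.card ι * (N * N - c • 1)
  have hev : ∀ s : ℂ, (Polynomial.evalRingHom s).mapMatrix F =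
      (slash X p + s • X 0) ^ Fintype.card ι * ((slash X p + s • X 0) * (slash X p + s • X 0) -
        ((minkSq p : ℂ) + 2 * p 0 * s + s ^ 2) • 1) := by
    intro s
    have hN : (Polynomial.evalRingHom s).mapMatrix N = slash X p + s • X 0 := by
      ext i j
      simp [N]
      exact mul_comm _ _
    have hc : (Polynomial.evalRingHom s).mapMatrix (c • (1 : Matrix ι ι (Polynomial ℂ))) =
        ((minkSq p : ℂ) + 2 * p 0 * s + s ^ 2) • 1 := by
      ext i j
      by_cases h : i = j <;> simp [c, h]
    rw [map_mul, map_pow, map_sub, map_mul, hN, hc]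
  -- For real shifts beyond this bound the energy exceeds $1+|\mathbf p|^2$, so the shifted covector
  -- is timelike and the boosted identity applies.
  have hreal : ∀ s : ℝ, |p 0| + (p 1 ^ 2 + p 2 ^ 2 + p 3 ^ 2) + 1 < s →
      (Polynomial.evalRingHom (s : ℂ)).mapMatrix F = 0 := by
    intro s hs
    have h1 := (slash_add_single (X := X) p s).symm
    have h2 : minkSq (p + s • Pi.single 0 1) = minkSq p + 2 * p 0 * s + s ^ 2 := by
      rw [minkSq_eq, minkSq_eq]
      simp
      ring
    have h3 := slash_pow_of_timelike hX h0 (p := p + s • Pi.single 0 1) (by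
      rw [h2, minkSq_eq]
      have h4 := neg_abs_le (p 0)
      have h5 : 0 ≤ p 1 ^ 2 + p 2 ^ 2 + p 3 ^ 2 := by positivity
      have h6 : (p 1 ^ 2 + p 2 ^ 2 + p 3 ^ 2) + 1 < p 0 + s := by linarith
      nlinarith)
    rw [hev, h1, ← h3, h2]
    push_cast
    rfl
  have hF : ∀ i j, F i j = 0 := by
    intro i j
    refine Polynomial.eq_zero_of_infinite_isRoot _ ?_
    refine Set.Infinite.mono (s := (fun s : ℝ => (s : ℂ)) ''
      Set.Ioi (|p 0| + (p 1 ^ 2 + p 2 ^ 2 + p 3 ^ 2) + 1)) ?_ ?_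
    · rintro _ ⟨s, hs, rfl⟩
      exact congrFun (congrFun (hreal s hs) i) j
    · exact (Set.Ioi_infinite _).image Complex.ofReal_injective.injOn
  rw [← hev, show F = 0 from Matrix.ext hF, map_zero]

/-- The mass shell, for complex energies. -/
theorem energy_of_amplitude (hX : IsVectorOperator G X) (h0 : IsReduced X) {p : Fin 4 → ℝ} {s κ : ℂ}
    (hκ : κ ≠ 0) {u : ι → ℂ} (hu : u ≠ 0) (h : (slash X p + s • X 0) *ᵥ u = κ • u) :
    (minkSq p : ℂ) + 2 * p 0 * s + s ^ 2 = κ ^ 2 := by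
  have hpow : ∀ k : ℕ, (slash X p + s • X 0) ^ k *ᵥ u = κ ^ k • u := by
    intro k
    induction k with
    | zero => simp
    | succ k ih =>
      rw [pow_succ', ← Matrix.mulVec_mulVec, ih, Matrix.mulVec_smul, h, smul_smul, pow_succ]
  have h1 := congrArg (· *ᵥ u) (slash_pow_identity hX h0 p s)
  simp only [Matrix.zero_mulVec] at h1
  rw [← Matrix.mulVec_mulVec, Matrix.sub_mulVec, ← Matrix.mulVec_mulVec, h, Matrix.mulVec_smul, h,
    Matrix.smul_mulVec, Matrix.one_mulVec, smul_smul, ← sub_smul, Matrix.mulVec_smul, hpow, smul_smul]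
    at h1
  have h2 := (mul_eq_zero.mp ((smul_eq_zero.mp h1).resolve_right hu)).resolve_right (pow_ne_zero _ hκ)
  rw [← sub_eq_zero.mp h2, pow_two]

end Boosts

/-! ### Mass and spin of the plane waves -/

section ParticleContent

variable {ι : Type} [Fintype ι]

/-- The matrix selecting the rows `μ, ν, ρ, σ`, times the Vandermonde matrix of $0,1,2,3$, is the
Vandermonde matrix of the selected values. The determinant $12$ of the former is divided out,
leaving a formula which can be evaluated. -/
theorem levi_eq (μ ν ρ σ : Fin 4) : levi μ ν ρ σ =
    (((ν : ℕ) : ℂ) - (μ : ℕ)) * (((ρ : ℕ) : ℂ) - (μ : ℕ)) * (((σ : ℕ) : ℂ) - (μ : ℕ)) *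
      (((ρ : ℕ) : ℂ) - (ν : ℕ)) * (((σ : ℕ) : ℂ) - (ν : ℕ)) * (((σ : ℕ) : ℂ) - (ρ : ℕ)) / 12 := by
  have h1 : (Matrix.of fun a b : Fin 4 => if ![μ, ν, ρ, σ] a = b then (1 : ℂ) else 0) *
      Matrix.vandermonde (fun b : Fin 4 => ((b : ℕ) : ℂ)) =
        Matrix.vandermonde fun a => ((![μ, ν, ρ, σ] a : ℕ) : ℂ) := by
    ext a k
    rw [Matrix.mul_apply, Finset.sum_eq_single_of_mem (![μ, ν, ρ, σ] a) (Finset.mem_univ _)]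
    · simp [Matrix.vandermonde]
    · intro b _ h
      rw [Matrix.of_apply, if_neg (Ne.symm h), zero_mul]
  have h2 := congrArg Matrix.det h1
  rw [Matrix.det_mul, Matrix.det_vandermonde, Matrix.det_vandermonde] at h2
  have e3 : ∀ f : Fin 4 → Fin 4 → ℂ, ∏ i, ∏ j ∈ Finset.Ioi i, f i j =
      f 0 1 * f 0 2 * f 0 3 * (f 1 2 * f 1 3) * f 2 3 := by
    intro f
    rw [Fin.prod_univ_four, show Finset.Ioi (0 : Fin 4) = {1, 2, 3} by decide,
      show Finset.Ioi (1 : Fin 4) = {2, 3} by decide, show Finset.Ioi (2 : Fin 4) = {3} by decide,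
      show Finset.Ioi (3 : Fin 4) = ∅ by decide, Finset.prod_insert (by decide),
      Finset.prod_insert (by decide), Finset.prod_insert (by decide), Finset.prod_singleton,
      Finset.prod_singleton, Finset.prod_singleton, Finset.prod_empty]
    ring
  rw [e3, e3] at h2
  rw [levi, eq_div_iff (by norm_num)]
  simp only [Matrix.cons_val_zero, Matrix.cons_val_one, Matrix.cons_val] at h2
  have h4 : ((((1 : Fin 4) : ℕ) : ℂ) - ((0 : Fin 4) : ℕ)) * ((((2 : Fin 4) : ℕ) : ℂ) - ((0 : Fin 4) : ℕ)) *
      ((((3 : Fin 4) : ℕ) : ℂ) - ((0 : Fin 4) : ℕ)) * (((((2 : Fin 4) : ℕ) : ℂ) - ((1 : Fin 4) : ℕ)) *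
        ((((3 : Fin 4) : ℕ) : ℂ) - ((1 : Fin 4) : ℕ))) * ((((3 : Fin 4) : ℕ) : ℂ) - ((2 : Fin 4) : ℕ)) =
      12 := by
    simp only [Fin.val_zero, Fin.val_one, Fin.val_two, show ((3 : Fin 4) : ℕ) = 3 from rfl]
    norm_num
  rw [h4] at h2
  rw [h2]
  ring

/-- The tensor `M_{αβ}` of rotation and boost generators. -/
def lorentzTensor (J B : Fin 3 → Matrix ι ι ℂ) : Fin 4 → Fin 4 → Matrix ι ι ℂ :=
  ![![0, B 0, B 1, B 2], ![-B 0, 0, J 2, -J 1], ![-B 1, -J 2, 0, J 0], ![-B 2, J 1, -J 0, 0]]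

/-- The coefficients of the Pauli-Lubanski vector. -/
def pseudoTensor (J B : Fin 3 → Matrix ι ι ℂ) : Fin 4 → Fin 4 → Matrix ι ι ℂ :=
  ![![0, -J 0, -J 1, -J 2], ![-J 0, 0, B 2, -B 1], ![-J 1, -B 2, 0, B 0], ![-J 2, B 1, -B 0, 0]]

variable {J B : Fin 3 → Matrix ι ι ℂ}

theorem pauliLubanski_eq (p : Fin 4 → ℝ) (μ : Fin 4) :
    pauliLubanski (lorentzTensor J B) p μ = linComb (pseudoTensor J B μ) p := by
  have e : ∀ i : Fin 4, mink i i = ![1, -1, -1, -1] i := fun i => Matrix.diagonal_apply_eq _ _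
  rw [pauliLubanski, linComb]
  simp only [levi_eq, e]
  fin_cases μ <;>
  · simp [Fin.sum_univ_four, lorentzTensor, pseudoTensor]
    module

theorem lorentzGen_boost (ξ : ℝ) (v : Fin 3 → ℝ) :
    lorentzGen (lorentzTensor J B) (ξ • boostParam v) =
      (Complex.I * (ξ : ℂ)) • ((v 0 : ℂ) • B 0 + (v 1 : ℂ) • B 1 + (v 2 : ℂ) • B 2) := by
  simp [lorentzGen, Fin.sum_univ_four, lorentzTensor, boostParam]
  module

theorem commutator_smul {Z Y C : Matrix ι ι ℂ} (h : Z * Y - Y * Z = Complex.I • C) (ξ : ℂ) :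
    Z * ((Complex.I * ξ) • Y) - ((Complex.I * ξ) • Y) * Z = -(ξ • C) := by
  rw [Matrix.mul_smul, Matrix.smul_mul, ← smul_sub, h, smul_smul, ← neg_smul]
  congr 1
  linear_combination ξ * Complex.I_mul_I

/-- The coefficients form a tensor, so a boost acts on the momentum argument and on the free index.
The second contribution is antisymmetric relative to the metric, as `exp_mul_sum_sq` requires. -/
theorem pseudoTensor_commutator [DecidableEq ι] (h : LorentzRelations J B) (ξ : ℝ) (v : Fin 3 → ℝ) (μ : Fin 4)
    (p : Fin 4 → ℝ) :
    linComb (pseudoTensor J B μ) p * lorentzGen (lorentzTensor J B) (ξ • boostParam v) -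
        lorentzGen (lorentzTensor J B) (ξ • boostParam v) * linComb (pseudoTensor J B μ) p =
      linComb (pseudoTensor J B μ) (p ᵥ* (ξ • boostParam v * mink)) +
        ∑ ν, (-((ξ • boostParam v * mink) μ ν : ℂ)) • linComb (pseudoTensor J B ν) p := by
  have hL : ∀ α β, (ξ • boostParam v * mink) α β = ξ *
      (!![0, v 0, v 1, v 2; v 0, 0, 0, 0; v 1, 0, 0, 0; v 2, 0, 0, 0] : Matrix (Fin 4) (Fin 4) ℝ) α β := by
    intro α β
    rw [mink, Matrix.mul_diagonal]
    fin_cases α <;> fin_cases β <;> simp [boostParam]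
  rw [lorentzGen_boost]
  set Y := (v 0 : ℂ) • B 0 + (v 1 : ℂ) • B 1 + (v 2 : ℂ) • B 2 with hY
  have hJ0 : J 0 * Y - Y * J 0 = Complex.I • ((v 1 : ℂ) • B 2 - (v 2 : ℂ) • B 1) := by
    simp only [hY, Matrix.mul_add, Matrix.add_mul, Matrix.mul_smul, Matrix.smul_mul, h.JB00, h.JB01,
      h.JB02]
    module
  have hJ1 : J 1 * Y - Y * J 1 = Complex.I • ((v 2 : ℂ) • B 0 - (v 0 : ℂ) • B 2) := by
    simp only [hY, Matrix.mul_add, Matrix.add_mul, Matrix.mul_smul, Matrix.smul_mul, h.JB11, h.JB12,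
      h.JB10]
    module
  have hJ2 : J 2 * Y - Y * J 2 = Complex.I • ((v 0 : ℂ) • B 1 - (v 1 : ℂ) • B 0) := by
    simp only [hY, Matrix.mul_add, Matrix.add_mul, Matrix.mul_smul, Matrix.smul_mul, h.JB22, h.JB20,
      h.JB21]
    module
  have hB0 : B 0 * Y - Y * B 0 = Complex.I • ((v 2 : ℂ) • J 1 - (v 1 : ℂ) • J 2) := by
    simp only [hY, Matrix.mul_add, Matrix.add_mul, Matrix.mul_smul, Matrix.smul_mul, h.B01, h.B20]
    module
  have hB1 : B 1 * Y - Y * B 1 = Complex.I • ((v 0 : ℂ) • J 2 - (v 2 : ℂ) • J 0) := by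
    simp only [hY, Matrix.mul_add, Matrix.add_mul, Matrix.mul_smul, Matrix.smul_mul, h.B01, h.B12]
    module
  have hB2 : B 2 * Y - Y * B 2 = Complex.I • ((v 1 : ℂ) • J 0 - (v 0 : ℂ) • J 1) := by
    simp only [hY, Matrix.mul_add, Matrix.add_mul, Matrix.mul_smul, Matrix.smul_mul, h.B20, h.B12]
    module
  have kJ0 := sub_eq_iff_eq_add.mp (commutator_smul hJ0 ξ)
  have kJ1 := sub_eq_iff_eq_add.mp (commutator_smul hJ1 ξ)
  have kJ2 := sub_eq_iff_eq_add.mp (commutator_smul hJ2 ξ)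
  have kB0 := sub_eq_iff_eq_add.mp (commutator_smul hB0 ξ)
  have kB1 := sub_eq_iff_eq_add.mp (commutator_smul hB1 ξ)
  have kB2 := sub_eq_iff_eq_add.mp (commutator_smul hB2 ξ)
  generalize (Complex.I * (ξ : ℂ)) • Y = D at kJ0 kJ1 kJ2 kB0 kB1 kB2
  simp only [linComb, Fin.sum_univ_four, hL, Matrix.vecMul, dotProduct]
  fin_cases μ <;>
  · simp [pseudoTensor, Matrix.add_mul, Matrix.mul_add, kJ0, kJ1, kJ2, kB0, kB1, kB2]
    module

/-- A boost takes the square of the Pauli-Lubanski vector to the rest frame. -/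
theorem boost_mul_pauliLubanskiSq [DecidableEq ι] (h : LorentzRelations J B) {v : Fin 3 → ℝ}
    (hv : v 0 ^ 2 + v 1 ^ 2 + v 2 ^ 2 = 1) (m ξ : ℝ) :
    lorentzRep (lorentzTensor J B) (ξ • boostParam v) *
        pauliLubanskiSq (lorentzTensor J B) (m • boostCurve v ξ) =
      (-((m : ℂ) ^ 2) • angSq (lorentzTensor J B)) *
        lorentzRep (lorentzTensor J B) (ξ • boostParam v) := by
  have hA : ∀ μ ν : Fin 4, (mink μ μ : ℂ) * (-((ξ • boostParam v * mink) μ ν : ℂ)) =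
      -((mink ν ν : ℂ) * (-((ξ • boostParam v * mink) ν μ : ℂ))) := by
    intro μ ν
    have h1 : ∀ α β, (ξ • boostParam v * mink) α β = ξ * (boostParam v α β * mink β β) := by
      intro α β
      rw [mink, Matrix.mul_diagonal, Matrix.diagonal_apply_eq, Matrix.smul_apply, smul_eq_mul, mul_assoc]
    have h2 : boostParam v ν μ = -boostParam v μ ν := congrFun (congrFun (boostParam_transpose v) μ) ν
    rw [h1, h1, h2]
    push_cast
    ring
  have h1 := exp_mul_sum_sq (W := pseudoTensor J B) (e := fun μ => (mink μ μ : ℂ)) hA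
    (pseudoTensor_commutator h ξ v) (hasDerivAt_boostOrbit hv m ξ 0)
  rw [mul_one, mul_zero, add_zero, add_zero, boostCurve_zero] at h1
  simp only [← pauliLubanski_eq] at h1
  refine h1.trans ?_
  congr 1
  -- At rest the time component vanishes and the space components are $-m$ times the angular
  -- momentum, so $W^2=-m^2J^2$.
  simp only [pauliLubanski_eq, linComb, Fin.sum_univ_four]
  simp [pseudoTensor, lorentzTensor, angSq, mink]
  module

variable {G : Fin 4 → Fin 4 → Matrix ι ι ℂ} {X : Fin 4 → Matrix ι ι ℂ}

theorem slash_add_zero (p : Fin 4 → ℝ) (u : ι → ℂ) :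
    (slash X p + (0 : ℂ) • X 0) *ᵥ u = slash X p *ᵥ u := by
  rw [zero_smul, add_zero]

variable [DecidableEq ι]

theorem mem_amplitudes {κ : ℝ} {p : Fin 4 → ℝ} {u : ι → ℂ} :
    u ∈ amplitudes X κ p ↔ slash X p *ᵥ u = (κ : ℂ) • u := by
  rw [amplitudes, LinearMap.mem_ker, Matrix.mulVecLin_apply, Matrix.sub_mulVec, Matrix.smul_mulVec,
    Matrix.one_mulVec, sub_eq_zero]

theorem minkSq_of_amplitude (hX : IsVectorOperator G X) (h0 : IsReduced X) {κ : ℝ} (hκ : κ ≠ 0)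
    {p : Fin 4 → ℝ} {u : ι → ℂ} (hu : u ≠ 0) (h : u ∈ amplitudes X κ p) : minkSq p = κ ^ 2 := by
  have h1 := energy_of_amplitude hX h0 (s := 0) (Complex.ofReal_ne_zero.mpr hκ) hu
    (by rw [slash_add_zero, mem_amplitudes.mp h])
  rw [mul_zero, add_zero, zero_pow two_ne_zero, add_zero] at h1
  exact_mod_cast h1

/-- A boost takes the amplitudes to eigenvectors of `X₀`. -/
theorem mem_amplitudes_boost (hX : IsVectorOperator G X) {κ : ℝ} (hκ : 0 < κ) {v : Fin 3 → ℝ}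
    (hv : v 0 ^ 2 + v 1 ^ 2 + v 2 ^ 2 = 1) {s : ℝ} (hs : s * s = 1) (ξ : ℝ) (u : ι → ℂ) :
    u ∈ amplitudes X κ ((s * κ) • boostCurve v ξ) ↔
      X 0 *ᵥ (lorentzRep G (ξ • boostParam v) *ᵥ u) =
        (s : ℂ) • (lorentzRep G (ξ • boostParam v) *ᵥ u) := by
  have h1 := boost_mul_slash (G := G) hX hv (s * κ) ξ
  set g := lorentzRep G (ξ • boostParam v)
  have hinj : Function.Injective (g *ᵥ ·) :=
    Matrix.mulVec_injective_iff_isUnit.mpr (isUnit_lorentzRep G _)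
  have hs' : (s : ℂ) * s = 1 := by exact_mod_cast hs
  have hκ' : (κ : ℂ) ≠ 0 := Complex.ofReal_ne_zero.mpr hκ.ne'
  have hc : (((s * κ : ℝ) : ℂ)) ≠ 0 := by
    rw [Complex.ofReal_mul]
    exact mul_ne_zero (left_ne_zero_of_mul_eq_one hs') hκ'
  rw [mem_amplitudes, ← hinj.eq_iff]
  rw [Matrix.mulVec_mulVec, h1, ← Matrix.mulVec_mulVec, Matrix.smul_mulVec, Matrix.mulVec_smul]
  have h2 : (κ : ℂ) • (g *ᵥ u) = ((s * κ : ℝ) : ℂ) • ((s : ℂ) • (g *ᵥ u)) := by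
    rw [smul_smul]
    congr 1
    push_cast
    linear_combination (-(κ : ℂ)) * hs'
  rw [h2]
  exact (smul_right_injective _ hc).eq_iff

/-- The boost is an isomorphism from the amplitudes at `p` to an eigenspace of $X_0$ for the sign of
the energy, and it carries $W^2$ to $-\kappa^2J^2$. Dimension and spin are thus those at rest. -/
theorem describesOnlySpin {n : ℕ} (h : LorentzRelations J B)
    (hX : IsVectorOperator (lorentzTensor J B) X) (h0 : IsReduced X)
    (hJ : ∀ (s : ℂ) (u : ι → ℂ), s * s = 1 → X 0 *ᵥ u = s • u → angSq (lorentzTensor J B) *ᵥ u =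
      (((n : ℂ) + 1 / 2) * ((n : ℂ) + 3 / 2)) • u)
    (hdim : ∀ s : ℂ, s * s = 1 →
      Module.finrank ℂ (LinearMap.ker (Matrix.mulVecLin (X 0 - s • 1))) = 2 * n + 2)
    {κ : ℝ} (hκ : 0 < κ) : DescribesOnlySpin n (lorentzTensor J B) X κ := by
  refine ⟨fun p hp => ?_, fun p hp => ?_⟩
  · obtain ⟨u, hu, hu0⟩ := Submodule.exists_mem_ne_zero_of_ne_bot hp
    exact minkSq_of_amplitude hX h0 hκ.ne' hu0 hu
  obtain ⟨v, ξ, s, hv, hs, rfl⟩ := exists_boost hκ hp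
  have hs' : (s : ℂ) * s = 1 := by exact_mod_cast hs
  have hmem := mem_amplitudes_boost hX hκ hv hs ξ
  have hW := boost_mul_pauliLubanskiSq h hv (s * κ) ξ
  have hgu : IsUnit (lorentzRep (lorentzTensor J B) (ξ • boostParam v)) := isUnit_lorentzRep _ _
  set g := lorentzRep (lorentzTensor J B) (ξ • boostParam v)
  have hinj : Function.Injective (g *ᵥ ·) := Matrix.mulVec_injective_iff_isUnit.mpr hgu
  constructor
  · rw [← hdim s hs']
    let e : (ι → ℂ) ≃ₗ[ℂ] (ι → ℂ) := LinearEquiv.ofBijective (Matrix.mulVecLin g)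
      ⟨hinj, (Matrix.mulVec_surjective_iff_isUnit.mpr hgu)⟩
    have hmap : amplitudes X κ ((s * κ) • boostCurve v ξ) =
        (LinearMap.ker (Matrix.mulVecLin (X 0 - (s : ℂ) • 1))).comap e.toLinearMap := by
      ext u
      rw [hmem, Submodule.mem_comap, LinearMap.mem_ker, Matrix.mulVecLin_apply, Matrix.sub_mulVec,
        Matrix.smul_mulVec, Matrix.one_mulVec, sub_eq_zero]
      rfl
    rw [hmap, Submodule.comap_equiv_eq_map_symm, LinearEquiv.finrank_map_eq]
  · intro u hu
    have h1 := hJ s _ hs' ((hmem u).mp hu)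
    refine hinj ?_
    dsimp only
    rw [Matrix.mulVec_mulVec, hW, ← Matrix.mulVec_mulVec, Matrix.smul_mulVec, h1, smul_smul,
      Matrix.mulVec_smul]
    congr 1
    push_cast
    linear_combination (-((κ : ℂ) ^ 2 * ((n + 1 / 2) * (n + 3 / 2)))) * hs'

end ParticleContent

/-! ### The invariant form: Lagrangian and charge of plane waves -/

section Form

variable {ι : Type} [Fintype ι]

/-- The Hermitean form of a matrix. -/
def hForm (H : Matrix ι ι ℂ) : (ι → ℂ) →ₗ⋆[ℂ] (ι → ℂ) →ₗ[ℂ] ℂ :=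
  LinearMap.mk₂'ₛₗ (starRingEnd ℂ) (RingHom.id ℂ) (fun u w => star u ⬝ᵥ (H *ᵥ w))
    (fun u u' w => by rw [star_add, add_dotProduct])
    (fun c u w => by rw [star_smul, smul_dotProduct]; rfl)
    (fun u w w' => by rw [Matrix.mulVec_add, dotProduct_add])
    (fun c u w => by rw [Matrix.mulVec_smul, dotProduct_smul]; rfl)

theorem hForm_apply (H : Matrix ι ι ℂ) (u w : ι → ℂ) : hForm H u w = star u ⬝ᵥ (H *ᵥ w) := rfl

theorem hForm_adjoint {H A : Matrix ι ι ℂ} (h : Aᴴ * H = H * A) (u w : ι → ℂ) :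
    hForm H (A *ᵥ u) w = hForm H u (A *ᵥ w) := by
  rw [hForm_apply, hForm_apply, Matrix.star_mulVec, ← Matrix.dotProduct_mulVec, Matrix.mulVec_mulVec,
    Matrix.mulVec_mulVec, h]

theorem hForm_conj {H : Matrix ι ι ℂ} (h : H.IsHermitian) (u w : ι → ℂ) :
    (starRingEnd ℂ) (hForm H u w) = hForm H w u := by
  rw [hForm_apply, hForm_apply, ← Complex.star_def, Matrix.star_dotProduct, star_star,
    Matrix.star_mulVec, h.eq, Matrix.dotProduct_mulVec]

variable {X : Fin 4 → Matrix ι ι ℂ} {H : Matrix ι ι ℂ}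

theorem contra_adjoint (hX : ∀ α, (X α)ᴴ * H = H * X α) (α : Fin 4) :
    (contra X α)ᴴ * H = H * contra X α := by
  rw [contra, Matrix.conjTranspose_smul, Matrix.smul_mul, Matrix.mul_smul, hX, Complex.star_def,
    Complex.conj_ofReal]

/-- The test vector `H *ᵥ w` turns the form into the squared norm of `H *ᵥ w`. -/
theorem eq_zero_of_hForm_re [DecidableEq ι] (hu : IsUnit H.det) {w : ι → ℂ}
    (h : ∀ v, (hForm H v w).re = 0) : w = 0 := by
  have h1 := h (H *ᵥ w)
  have h2 : hForm H (H *ᵥ w) w = ((∑ i, Complex.normSq ((H *ᵥ w) i) : ℝ) : ℂ) := by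
    rw [hForm_apply, dotProduct, Complex.ofReal_sum]
    exact Finset.sum_congr rfl fun i _ => by
      rw [Pi.star_apply, Complex.star_def, Complex.normSq_eq_conj_mul_self]
  rw [h2, Complex.ofReal_re, Finset.sum_eq_zero_iff_of_nonneg fun i _ => Complex.normSq_nonneg _] at h1
  have h3 : H *ᵥ w = 0 := funext fun i => Complex.normSq_eq_zero.mp (h1 i (Finset.mem_univ _))
  exact Matrix.mulVec_injective_iff_isUnit.mpr ((Matrix.isUnit_iff_isUnit_det _).mpr hu)
    (h3.trans (Matrix.mulVec_zero H).symm)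

/-- The real part of the form, as a continuous bilinear map. -/
def reForm (H : Matrix ι ι ℂ) : (ι → ℂ) →L[ℝ] (ι → ℂ) →L[ℝ] ℝ :=
  LinearMap.toContinuousLinearMap
    { toFun := fun u => LinearMap.toContinuousLinearMap
        { toFun := fun w => (hForm H u w).re
          map_add' := fun w w' => by rw [map_add, Complex.add_re]
          map_smul' := fun c w => by
            rw [← Complex.coe_smul, map_smul, smul_eq_mul, Complex.re_ofReal_mul]; rfl }
      map_add' := fun u u' => by
        ext w
        change (hForm H (u + u') w).re = (hForm H u w).re + (hForm H u' w).re
        rw [map_add, LinearMap.add_apply, Complex.add_re]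
      map_smul' := fun c u => by
        ext w
        change (hForm H (c • u) w).re = c * (hForm H u w).re
        rw [← Complex.coe_smul, LinearMap.map_smulₛₗ, Complex.conj_ofReal, LinearMap.smul_apply,
          smul_eq_mul, Complex.re_ofReal_mul] }

theorem reForm_apply (u w : ι → ℂ) : reForm H u w = (hForm H u w).re := rfl

/-- The derivative part of the equation. -/
def kinetic (X : Fin 4 → Matrix ι ι ℂ) : (Fin 4 → ι → ℂ) →L[ℝ] ι → ℂ :=
  LinearMap.toContinuousLinearMap
    { toFun := fun d => ∑ α, Complex.I • (contra X α *ᵥ d α)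
      map_add' := fun d d' => by
        simp only [Pi.add_apply, Matrix.mulVec_add, smul_add, Finset.sum_add_distrib]
      map_smul' := fun c d => by
        simp only [Pi.smul_apply, Matrix.mulVec_smul, RingHom.id_apply, Finset.smul_sum]
        exact Finset.sum_congr rfl fun α _ => smul_comm _ _ _ }

theorem kinetic_apply (d : Fin 4 → ι → ℂ) : kinetic X d = ∑ α, Complex.I • (contra X α *ᵥ d α) := rfl

theorem lagrangian_eq (κ : ℝ) (ψ : ι → ℂ) (d : Fin 4 → ι → ℂ) :
    lagrangian H X κ ψ d = reForm H ψ (kinetic X d - κ • ψ) := by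
  rw [lagrangian, diracExpr_eq, reForm_apply, hForm_apply, kinetic_apply, Complex.coe_smul]

/-- The kinetic term is antisymmetric under the real part of the form (`hkin`), so varying the field
and varying its derivatives contribute equally. Together they give twice the equation, tested
against an arbitrary direction; non-degeneracy removes the test. -/
theorem derivableFromLagrangian [DecidableEq ι] (hH : H.IsHermitian) (hu : IsUnit H.det)
    (hX : ∀ α, (X α)ᴴ * H = H * X α) (κ : ℝ) : DerivableFromLagrangian H X κ := by
  intro Ψ hΨ
  have hdiff : Differentiable ℝ Ψ := hΨ.differentiable (by simp)
  have hsymm : ∀ u w, reForm H u w = reForm H w u := fun u w => by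
    rw [reForm_apply, reForm_apply, ← hForm_conj hH, Complex.conj_re]
  have hkin : ∀ α u w, reForm H u (Complex.I • (contra X α *ᵥ w)) =
      -reForm H w (Complex.I • (contra X α *ᵥ u)) := by
    intro α u w
    rw [hsymm, reForm_apply, reForm_apply, LinearMap.map_smulₛₗ, map_smul, LinearMap.smul_apply,
      hForm_adjoint (contra_adjoint hX α), Complex.conj_I, neg_smul, Complex.neg_re]
  have h1 : ∀ x v, fderiv ℝ (fun ψ => lagrangian H X κ ψ fun β => pderiv β Ψ x) (Ψ x) v =
      reForm H v (kinetic X (fun β => pderiv β Ψ x) - κ • Ψ x) - κ * reForm H v (Ψ x) := by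
    intro x v
    simp only [lagrangian_eq]
    have h2 : HasFDerivAt (fun ψ : ι → ℂ => kinetic X (fun β => pderiv β Ψ x) - κ • ψ)
        (-(κ • ContinuousLinearMap.id ℝ (ι → ℂ))) (Ψ x) :=
      ((hasFDerivAt_id (Ψ x)).const_smul κ).const_sub _
    rw [((reForm H).hasFDerivAt.clm_apply h2).fderiv]
    simp [hsymm (Ψ x) v]
    ring
  have h2 : ∀ (ψ : ι → ℂ) (d : Fin 4 → ι → ℂ) (μ : Fin 4) (v : ι → ℂ),
      fderiv ℝ (fun d => lagrangian H X κ ψ d) d (Pi.single μ v) =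
        reForm H ψ (Complex.I • (contra X μ *ᵥ v)) := by
    intro ψ d μ v
    simp only [lagrangian_eq]
    have h3 : HasFDerivAt (fun d => reForm H ψ (kinetic X d - κ • ψ))
        ((reForm H ψ).comp (kinetic X)) d :=
      (reForm H ψ).hasFDerivAt.comp d ((kinetic X).hasFDerivAt.sub_const _)
    rw [h3.fderiv, ContinuousLinearMap.comp_apply, kinetic_apply,
      Finset.sum_eq_single_of_mem μ (Finset.mem_univ _) fun α _ h => by
        rw [Pi.single_eq_of_ne h, Matrix.mulVec_zero, smul_zero], Pi.single_eq_same]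
  have h3 : ∀ (μ : Fin 4) (w : ι → ℂ) x, pderiv μ (fun y => reForm H (Ψ y) w) x =
      reForm H (pderiv μ Ψ x) w := by
    intro μ w x
    have h4 : HasFDerivAt (fun y => reForm H (Ψ y) w)
        (((reForm H).flip w).comp (fderiv ℝ Ψ x)) x :=
      ((reForm H).flip w).hasFDerivAt.comp x (hdiff x).hasFDerivAt
    rw [pderiv, h4.fderiv]
    rfl
  have key : ∀ x v, fderiv ℝ (fun ψ => lagrangian H X κ ψ fun β => pderiv β Ψ x) (Ψ x) v =
      (∑ μ, pderiv μ (fun y => fderiv ℝ (fun d => lagrangian H X κ (Ψ y) d)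
        (fun β => pderiv β Ψ y) (Pi.single μ v)) x) ↔
      reForm H v (diracExpr X κ (Ψ x) fun β => pderiv β Ψ x) = 0 := by
    intro x v
    have h4 : (∑ μ, reForm H (pderiv μ Ψ x) (Complex.I • (contra X μ *ᵥ v))) =
        -reForm H v (kinetic X fun β => pderiv β Ψ x) := by
      rw [kinetic_apply, map_sum, ← Finset.sum_neg_distrib]
      exact Finset.sum_congr rfl fun μ _ => hkin μ _ _
    simp only [h1, h2, h3, h4]
    rw [diracExpr_eq, ← kinetic_apply, Complex.coe_smul]
    simp only [map_sub, map_smul, smul_eq_mul]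
    constructor <;> intro h <;> linarith
  constructor
  · intro h
    refine ⟨hdiff, fun x => eq_zero_of_hForm_re hu fun v => ?_⟩
    exact (key x v).mp (h x v)
  · intro h x v
    refine (key x v).mpr ?_
    rw [h.2 x, map_zero]

variable {G : Fin 4 → Fin 4 → Matrix ι ι ℂ}

/-- The real combination of generators times $-i/2$ is skew for the form, so its exponential
preserves the form. -/
theorem lorentzRep_form [DecidableEq ι] (hu : IsUnit H.det) (hG : ∀ α β, (G α β)ᴴ * H = H * G α β)
    (θ : Matrix (Fin 4) (Fin 4) ℝ) : (lorentzRep G θ)ᴴ * H * lorentzRep G θ = H := by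
  have hU : IsUnit H := (Matrix.isUnit_iff_isUnit_det _).mpr hu
  have h1 : (lorentzGen G θ)ᴴ * H = H * -lorentzGen G θ := by
    rw [lorentzGen]
    simp only [Matrix.conjTranspose_sum, Finset.sum_mul, Matrix.conjTranspose_smul, Matrix.smul_mul, hG,
      Matrix.mul_neg, Finset.mul_sum, Matrix.mul_smul, ← Finset.sum_neg_distrib]
    refine Finset.sum_congr rfl fun α _ => Finset.sum_congr rfl fun β _ => ?_
    rw [← neg_smul]
    congr 1
    simp
    ring
  have h2 : (lorentzGen G θ)ᴴ = H * -lorentzGen G θ * H⁻¹ := by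
    rw [← h1, Matrix.mul_assoc, Matrix.mul_nonsing_inv _ hu, Matrix.mul_one]
  have h3 : (lorentzRep G θ)ᴴ = H * NormedSpace.exp (-lorentzGen G θ) * H⁻¹ := by
    rw [← Matrix.exp_conj _ _ hU, ← h2, Matrix.exp_conjTranspose]
    rfl
  have h4 : NormedSpace.exp (-lorentzGen G θ) * lorentzRep G θ = 1 := by
    change NormedSpace.exp (-lorentzGen G θ) * NormedSpace.exp (lorentzGen G θ) = 1
    rw [← Matrix.exp_add_of_commute _ _ (Commute.neg_left (Commute.refl (lorentzGen G θ))),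
      neg_add_cancel, NormedSpace.exp_zero]
  rw [h3, Matrix.mul_assoc _ H⁻¹, Matrix.nonsing_inv_mul _ hu, Matrix.mul_one, Matrix.mul_assoc, h4,
    Matrix.mul_one]

/-- The space components of the current vanish at rest. -/
theorem current_at_rest (hX : IsVectorOperator G X) (hXH : ∀ α, (X α)ᴴ * H = H * X α) {s : ℝ}
    {w : ι → ℂ} (hw : X 0 *ᵥ w = (s : ℂ) • w) {k : Fin 4} (hk : k ≠ 0) :
    hForm H w (X k *ᵥ w) = 0 := by
  have h1 := congrArg (· *ᵥ w) (hX 0 0 k)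
  simp only [mink, Matrix.diagonal_apply_eq, Matrix.diagonal_apply_ne' _ hk, Matrix.cons_val_zero,
    Complex.ofReal_one, Complex.ofReal_zero, mul_one, mul_zero, zero_smul, sub_zero, Matrix.sub_mulVec,
    Matrix.smul_mulVec, ← Matrix.mulVec_mulVec, hw, Matrix.mulVec_smul] at h1
  have h2 := congrArg (hForm H w) h1
  rw [map_sub, ← hForm_adjoint (hXH 0), hw, LinearMap.map_smulₛₗ, LinearMap.smul_apply, map_smul,
    map_smul, Complex.conj_ofReal, sub_self] at h2
  exact (smul_eq_zero.mp h2.symm).resolve_left Complex.I_ne_zero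

theorem chargeDensity_eq (u : ι → ℂ) : chargeDensity H X u = (hForm H u (X 0 *ᵥ u)).re := rfl

/-- Charge is the time component of a current which at rest has no space part (`current_at_rest`).
In the moving frame it is therefore the rest value multiplied by $\cosh\xi>0$. -/
theorem chargeDensity_amplitude_pos [DecidableEq ι] (hX : IsVectorOperator G X) (h0 : IsReduced X)
    (hu : IsUnit H.det) (hG : ∀ α β, (G α β)ᴴ * H = H * G α β) (hXH : ∀ α, (X α)ᴴ * H = H * X α)
    (hpos : ∀ (s : ℂ) (w : ι → ℂ), s ≠ 0 → X 0 *ᵥ w = s • w → w ≠ 0 → 0 < chargeDensity H X w)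
    {κ : ℝ} (hκ : 0 < κ) {p : Fin 4 → ℝ} {u : ι → ℂ} (hup : u ∈ amplitudes X κ p) (hu0 : u ≠ 0) :
    0 < chargeDensity H X u := by
  obtain ⟨v, ξ, s, hv, hs, rfl⟩ := exists_boost hκ (minkSq_of_amplitude hX h0 hκ.ne' hu0 hup)
  have hw := (mem_amplitudes_boost hX hκ hv hs ξ u).mp hup
  have hg := lorentzRep_form hu hG (ξ • boostParam v)
  have hX0 := boost_mul_zero (G := G) hX hv ξ
  have hgu := isUnit_lorentzRep G (ξ • boostParam v)
  set g := lorentzRep G (ξ • boostParam v)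
  set w := g *ᵥ u with hwdef
  have hw0 : w ≠ 0 := fun h => hu0 (Matrix.mulVec_injective_iff_isUnit.mpr hgu
    (h.trans (Matrix.mulVec_zero g).symm))
  have hs0 : (s : ℂ) ≠ 0 := Complex.ofReal_ne_zero.mpr (left_ne_zero_of_mul_eq_one hs)
  have h1 : hForm H u (X 0 *ᵥ u) = (Real.cosh ξ : ℂ) * hForm H w (X 0 *ᵥ w) := by
    have h2 : ∀ y, hForm H u y = hForm H w (g *ᵥ y) := by
      intro y
      rw [hForm_apply, hForm_apply, hwdef, Matrix.star_mulVec, ← Matrix.dotProduct_mulVec,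
        Matrix.mulVec_mulVec, Matrix.mulVec_mulVec, hg]
    have h3 := fun k hk => current_at_rest hX hXH hw (k := k) hk
    rw [h2, Matrix.mulVec_mulVec, hX0, ← Matrix.mulVec_mulVec, slash_eq, linComb, Matrix.sum_mulVec,
      map_sum, Fin.sum_univ_four]
    simp only [contra, smul_smul, Matrix.smul_mulVec, map_smul, ← hwdef, h3 1 (by decide),
      h3 2 (by decide), h3 3 (by decide),  smul_eq_mul]
    simp [boostCurve, mink]
  rw [chargeDensity_eq, h1, Complex.re_ofReal_mul]
  exact mul_pos (Real.cosh_pos ξ) (hpos s w hs0 hw hw0)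

end Form

/-! ### The modes of a fixed momentum -/

section Modes

variable {ι : Type} [Fintype ι] [DecidableEq ι] {G : Fin 4 → Fin 4 → Matrix ι ι ℂ}
  {X : Fin 4 → Matrix ι ι ℂ} {H : Matrix ι ι ℂ}

/-- The equation at fixed momentum, without the time derivative. -/
def massOp (X : Fin 4 → Matrix ι ι ℂ) (κ : ℝ) (p : Fin 4 → ℝ) : Matrix ι ι ℂ :=
  (κ : ℂ) • 1 - slash X p

theorem massOp_mulVec (κ : ℝ) (p : Fin 4 → ℝ) (u : ι → ℂ) :
    massOp X κ p *ᵥ u = (κ : ℂ) • u - slash X p *ᵥ u := by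
  rw [massOp, Matrix.sub_mulVec, Matrix.smul_mulVec, Matrix.one_mulVec]

/-- The operator which determines the modes of fixed momentum. -/
def modeOp (X : Fin 4 → Matrix ι ι ℂ) (κ : ℝ) (p : Fin 4 → ℝ) : Matrix ι ι ℂ :=
  (massOp X κ p)⁻¹ * X 0

/-- The hypotheses on the matrices: only the eigenvalues `0`, `±1` occur, and the charge of plane
waves is positive. -/
structure IsCharged (G : Fin 4 → Fin 4 → Matrix ι ι ℂ) (X : Fin 4 → Matrix ι ι ℂ)
    (H : Matrix ι ι ℂ) : Prop where
  isVector : IsVectorOperator G X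
  isReduced : IsReduced X
  adjoint : ∀ α, (X α)ᴴ * H = H * X α
  pos : ∀ (κ : ℝ) (p : Fin 4 → ℝ) (u : ι → ℂ), 0 < κ → u ∈ amplitudes X κ p → u ≠ 0 →
    0 < chargeDensity H X u

variable {κ E : ℝ} {p : Fin 4 → ℝ}

theorem massOp_adjoint (h : ∀ α, (X α)ᴴ * H = H * X α) (κ : ℝ) (p : Fin 4 → ℝ) :
    (massOp X κ p)ᴴ * H = H * massOp X κ p := by
  rw [massOp, slash_eq, linComb, Matrix.conjTranspose_sub, Matrix.conjTranspose_smul,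
    Matrix.conjTranspose_one, Matrix.conjTranspose_sum, sub_mul, mul_sub, Finset.sum_mul, Finset.mul_sum]
  congr 1
  · rw [Complex.star_def, Complex.conj_ofReal, Matrix.smul_mul, Matrix.mul_smul, one_mul, mul_one]
  · refine Finset.sum_congr rfl fun σ _ => ?_
    rw [Matrix.conjTranspose_smul, Complex.star_def, Complex.conj_ofReal, Matrix.smul_mul,
      Matrix.mul_smul, contra_adjoint h]

/-- A vector in the kernel would be an amplitude with $p^2=\kappa^2>0$, whereas $p^2\le0$ for a
purely spatial covector. -/
theorem massOp_isUnit (hc : IsCharged G X H) (hκ : 0 < κ) (hp : p 0 = 0) :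
    IsUnit (massOp X κ p) := by
  have h1 : ∀ u : ι → ℂ, massOp X κ p *ᵥ u = 0 → u = 0 := by
    intro u hu
    by_contra h0
    rw [massOp_mulVec, sub_eq_zero, eq_comm] at hu
    have h2 := minkSq_of_amplitude hc.isVector hc.isReduced hκ.ne' h0 (mem_amplitudes.mpr hu)
    rw [minkSq_eq, hp] at h2
    nlinarith [sq_nonneg (p 1), sq_nonneg (p 2), sq_nonneg (p 3), pow_pos hκ 2]
  rw [← Matrix.mulVec_injective_iff_isUnit]
  intro u w huw
  refine sub_eq_zero.mp (h1 _ ?_)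
  rw [Matrix.mulVec_sub]
  exact sub_eq_zero.mpr huw

theorem massOp_mul_modeOp (hc : IsCharged G X H) (hκ : 0 < κ) (hp : p 0 = 0) :
    massOp X κ p * modeOp X κ p = X 0 := by
  rw [modeOp, ← Matrix.mul_assoc, Matrix.mul_nonsing_inv _
    ((Matrix.isUnit_iff_isUnit_det _).mp (massOp_isUnit hc hκ hp)), one_mul]

theorem modeOp_mulVec_iff (hc : IsCharged G X H) (hκ : 0 < κ) (hp : p 0 = 0) (u w : ι → ℂ) :
    modeOp X κ p *ᵥ u = w ↔ X 0 *ᵥ u = massOp X κ p *ᵥ w := by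
  rw [← massOp_mul_modeOp hc hκ hp, ← Matrix.mulVec_mulVec]
  exact (Matrix.mulVec_injective_iff_isUnit.mpr (massOp_isUnit hc hκ hp)).eq_iff.symm

theorem mem_amplitudes_of_mode (hc : IsCharged G X H) (hκ : 0 < κ) (hp : p 0 = 0) {m : ℝ}
    (hm : m ≠ 0) {u : ι → ℂ} (hu : modeOp X κ p *ᵥ u = (m⁻¹ : ℂ) • u) :
    u ∈ amplitudes X κ (p + m • Pi.single 0 1) := by
  have hm' : (m : ℂ) ≠ 0 := Complex.ofReal_ne_zero.mpr hm
  rw [modeOp_mulVec_iff hc hκ hp, Matrix.mulVec_smul, massOp_mulVec] at hu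
  rw [mem_amplitudes, slash_add_single, Matrix.add_mulVec, Matrix.smul_mulVec, hu, smul_smul,
    mul_inv_cancel₀ hm', one_smul]
  abel

/-- An eigenvector with nonzero eigenvalue is a plane-wave amplitude of energy $1/\mu$, whence
$\mu=\pm1/E$. A Jordan block would produce an amplitude `u` of zero charge, against positivity. -/
theorem modeOp_semisimple (hc : IsCharged G X H) (hκ : 0 < κ) (hp : p 0 = 0) (hE : 0 < E)
    (hE2 : E ^ 2 = κ ^ 2 - minkSq p) {μ : ℂ} (hμ : μ ≠ 0) :
    (∀ u : ι → ℂ, modeOp X κ p *ᵥ u = μ • u → u ≠ 0 → μ = (E : ℂ)⁻¹ ∨ μ = -(E : ℂ)⁻¹) ∧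
      ∀ w : ι → ℂ, modeOp X κ p *ᵥ (modeOp X κ p *ᵥ w - μ • w) = μ • (modeOp X κ p *ᵥ w - μ • w) →
        modeOp X κ p *ᵥ w = μ • w := by
  have hE' : (E : ℂ) ≠ 0 := Complex.ofReal_ne_zero.mpr hE.ne'
  have h1 : ∀ u : ι → ℂ, modeOp X κ p *ᵥ u = μ • u → u ≠ 0 → μ = (E : ℂ)⁻¹ ∨ μ = -(E : ℂ)⁻¹ := by
    intro u hu hu0
    rw [modeOp_mulVec_iff hc hκ hp, Matrix.mulVec_smul, massOp_mulVec] at hu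
    have h2 := energy_of_amplitude hc.isVector hc.isReduced (p := p) (s := μ⁻¹)
      (Complex.ofReal_ne_zero.mpr hκ.ne') hu0 (by
        rw [Matrix.add_mulVec, Matrix.smul_mulVec, hu, smul_smul, inv_mul_cancel₀ hμ, one_smul]
        abel)
    have h3 : (E : ℂ) ^ 2 = (κ : ℂ) ^ 2 - (minkSq p : ℂ) := by exact_mod_cast hE2
    rw [hp, Complex.ofReal_zero, mul_zero, zero_mul, add_zero] at h2
    have h4 : μ ^ 2 = (E : ℂ)⁻¹ ^ 2 := by
      rw [inv_pow, h3, ← h2, add_sub_cancel_left, inv_pow, inv_inv]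
    exact sq_eq_sq_iff_eq_or_eq_neg.mp h4
  refine ⟨h1, fun w hw => ?_⟩
  by_contra hne
  set u := modeOp X κ p *ᵥ w - μ • w with hu
  have hu0 : u ≠ 0 := fun h => hne (sub_eq_zero.mp h)
  obtain ⟨m, hm0, hm⟩ : ∃ m : ℝ, m ≠ 0 ∧ μ = ((m⁻¹ : ℝ) : ℂ) := by
    rcases h1 u hw hu0 with h | h
    · exact ⟨E, hE.ne', by rw [h, Complex.ofReal_inv]⟩
    · exact ⟨-E, neg_ne_zero.mpr hE.ne', by rw [h, Complex.ofReal_inv, Complex.ofReal_neg, inv_neg]⟩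
  have hamp : u ∈ amplitudes X κ (p + m • Pi.single 0 1) :=
    mem_amplitudes_of_mode hc hκ hp hm0 (by rw [hw, hm, Complex.ofReal_inv])
  have hpos := hc.pos κ _ u hκ hamp hu0
  have hadj := massOp_adjoint hc.adjoint κ p
  have h2 : X 0 *ᵥ u = μ • (massOp X κ p *ᵥ u) := by
    rw [← Matrix.mulVec_smul]
    exact (modeOp_mulVec_iff hc hκ hp _ _).mp hw
  -- `massOp *ᵥ u` equals $(X_0-\mu A)w$ with $A$ = `massOp`. Both matrices are symmetric for the
  -- form, and `μ` is real; moving them to `u` gives $(X_0-\mu A)u=0$.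
  have h3 : hForm H u (massOp X κ p *ᵥ u) = 0 := by
    have h4 : massOp X κ p *ᵥ u = X 0 *ᵥ w - μ • (massOp X κ p *ᵥ w) := by
      rw [hu, Matrix.mulVec_sub, Matrix.mulVec_mulVec, massOp_mul_modeOp hc hκ hp, Matrix.mulVec_smul]
    rw [h4, map_sub, map_smul, ← hForm_adjoint (hc.adjoint 0), ← hForm_adjoint hadj, h2,
      LinearMap.map_smulₛₗ, LinearMap.smul_apply, hm, Complex.conj_ofReal, sub_self]
  rw [chargeDensity_eq, h2, map_smul, h3, smul_zero, Complex.zero_re] at hpos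
  exact lt_irrefl _ hpos

/-- The nonzero eigenvalues are $\pm1/E$ without Jordan blocks; the eigenvalue zero is absorbed by
the power. -/
theorem modeOp_pow (hc : IsCharged G X H) (hκ : 0 < κ) (hp : p 0 = 0) (hE : 0 < E)
    (hE2 : E ^ 2 = κ ^ 2 - minkSq p) :
    modeOp X κ p ^ Fintype.card ι * ((E : ℂ) ^ 2 • (modeOp X κ p * modeOp X κ p) - 1) = 0 := by
  have hE' : (E : ℂ) ≠ 0 := Complex.ofReal_ne_zero.mpr hE.ne'
  set R := modeOp X κ p with hR
  have hcomm : R ^ Fintype.card ι * ((E : ℂ) ^ 2 • (R * R) - 1) =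
      ((E : ℂ) ^ 2 • (R * R) - 1) * R ^ Fintype.card ι := by
    rw [mul_sub, sub_mul, mul_one, one_mul, Matrix.mul_smul, Matrix.smul_mul, ← pow_two, ← pow_add,
      ← pow_add, add_comm]
  refine eq_zero_of_genEigenvectors (A := R) fun μ k v hk => ?_
  by_cases hμ : μ = 0
  · rw [hμ, zero_smul, sub_zero] at hk
    rw [hcomm, ← Matrix.mulVec_mulVec, pow_card_mulVec_eq_zero hk, Matrix.mulVec_zero]
  · by_cases hv : v = 0
    · rw [hv, Matrix.mulVec_zero]
    have h1 := modeOp_semisimple hc hκ hp hE hE2 hμ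
    have h2 : R *ᵥ v = μ • v := eigenvector_of_semisimple h1.2 k v hk
    have h3 : (E : ℂ) ^ 2 * μ * μ = 1 := by
      rcases h1.1 v h2 hv with h | h <;> · rw [h]; field_simp
    rw [← Matrix.mulVec_mulVec, Matrix.sub_mulVec, Matrix.smul_mulVec, ← Matrix.mulVec_mulVec, h2,
      Matrix.mulVec_smul, h2, smul_smul, smul_smul, h3, one_smul,
      Matrix.one_mulVec, sub_self, Matrix.mulVec_zero]

/-- A superposition of the modes of both energies has positive charge. -/
theorem charge_pos_of_modes (hc : IsCharged G X H) (hκ : 0 < κ) (hp : p 0 = 0) (hE : 0 < E)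
    {u : ι → ℂ} (hu : (E : ℂ) ^ 2 • (modeOp X κ p *ᵥ (modeOp X κ p *ᵥ u)) = u) :
    0 ≤ (hForm H u (X 0 *ᵥ u)).re ∧ (u ≠ 0 → 0 < (hForm H u (X 0 *ᵥ u)).re) := by
  have hE' : (E : ℂ) ≠ 0 := Complex.ofReal_ne_zero.mpr hE.ne'
  set R := modeOp X κ p with hR
  let a : ι → ℂ := (1 / 2 : ℂ) • (u + (E : ℂ) • (R *ᵥ u))
  let b : ι → ℂ := (1 / 2 : ℂ) • (u - (E : ℂ) • (R *ᵥ u))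
  have hab : u = a + b := by
    simp only [a, b]
    module
  have hRR : R *ᵥ (R *ᵥ u) = ((E : ℂ) ^ 2)⁻¹ • u := by
    rw [eq_inv_smul_iff₀ (pow_ne_zero 2 hE'), hu]
  have ha : R *ᵥ a = (E : ℂ)⁻¹ • a := by
    simp only [a, Matrix.mulVec_smul, Matrix.mulVec_add, hRR, smul_add, smul_smul]
    match_scalars <;> field_simp
  have hb : R *ᵥ b = (-(E : ℂ)⁻¹) • b := by
    simp only [b, Matrix.mulVec_smul, Matrix.mulVec_sub, hRR, smul_sub, smul_smul]
    match_scalars <;> field_simp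
  have ha' : a ∈ amplitudes X κ (p + E • Pi.single 0 1) := mem_amplitudes_of_mode hc hκ hp hE.ne' ha
  have hb' : b ∈ amplitudes X κ (p + (-E) • Pi.single 0 1) :=
    mem_amplitudes_of_mode hc hκ hp (neg_ne_zero.mpr hE.ne')
      (by rw [hb, Complex.ofReal_neg, inv_neg])
  have hXa : X 0 *ᵥ a = (E : ℂ)⁻¹ • (massOp X κ p *ᵥ a) := by
    rw [← Matrix.mulVec_smul]
    exact (modeOp_mulVec_iff hc hκ hp _ _).mp ha
  have hXb : X 0 *ᵥ b = (-(E : ℂ)⁻¹) • (massOp X κ p *ᵥ b) := by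
    rw [← Matrix.mulVec_smul]
    exact (modeOp_mulVec_iff hc hκ hp _ _).mp hb
  have hadj := massOp_adjoint hc.adjoint κ p
  -- Evaluating $X_0$ on the right or, by symmetry, on the left gives opposite eigenvalues $\mp1/E$
  -- times the same number, so the mixed term is zero.
  have hcross : hForm H a (X 0 *ᵥ b) = 0 := by
    have h1 : hForm H a (X 0 *ᵥ b) = -(E : ℂ)⁻¹ * hForm H a (massOp X κ p *ᵥ b) := by
      rw [hXb, map_smul, smul_eq_mul]
    have h2 : hForm H a (X 0 *ᵥ b) = (E : ℂ)⁻¹ * hForm H a (massOp X κ p *ᵥ b) := by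
      rw [← hForm_adjoint (hc.adjoint 0), hXa, LinearMap.map_smulₛₗ₂,
        hForm_adjoint hadj, smul_eq_mul, ← Complex.ofReal_inv, Complex.conj_ofReal]
    linear_combination (1 / 2 : ℂ) * h1 + (1 / 2 : ℂ) * h2
  have hcross' : hForm H b (X 0 *ᵥ a) = 0 := by
    have h1 : hForm H b (X 0 *ᵥ a) = (E : ℂ)⁻¹ * hForm H b (massOp X κ p *ᵥ a) := by
      rw [hXa, map_smul, smul_eq_mul]
    have h2 : hForm H b (X 0 *ᵥ a) = -(E : ℂ)⁻¹ * hForm H b (massOp X κ p *ᵥ a) := by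
      rw [← hForm_adjoint (hc.adjoint 0), hXb, LinearMap.map_smulₛₗ₂,
        hForm_adjoint hadj, smul_eq_mul, ← Complex.ofReal_inv, ← Complex.ofReal_neg, Complex.conj_ofReal]
    linear_combination (1 / 2 : ℂ) * h1 + (1 / 2 : ℂ) * h2
  have hsum : (hForm H u (X 0 *ᵥ u)).re = chargeDensity H X a + chargeDensity H X b := by
    rw [chargeDensity_eq, chargeDensity_eq, ← Complex.add_re, hab, Matrix.mulVec_add, map_add,
      LinearMap.map_add₂, LinearMap.map_add₂, hcross, hcross', add_zero, zero_add]
  have hnonneg : ∀ (q : Fin 4 → ℝ) (w : ι → ℂ), w ∈ amplitudes X κ q → 0 ≤ chargeDensity H X w := by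
    intro q w hw
    by_cases h : w = 0
    · rw [h, chargeDensity_eq, Matrix.mulVec_zero, map_zero, Complex.zero_re]
    · exact (hc.pos κ q w hκ hw h).le
  rw [hsum]
  refine ⟨add_nonneg (hnonneg _ _ ha') (hnonneg _ _ hb'), fun h0 => ?_⟩
  by_cases h : a = 0
  · have hb0 : b ≠ 0 := fun h1 => h0 (by rw [hab, h, h1, add_zero])
    exact add_pos_of_nonneg_of_pos (hnonneg _ _ ha') (hc.pos κ _ b hκ hb' hb0)
  · exact add_pos_of_pos_of_nonneg (hc.pos κ _ a hκ ha' h) (hnonneg _ _ hb')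

/-- A solution of the equation at fixed momentum is a superposition of the modes of both
energies, and it vanishes if it vanishes at one time. -/
theorem mode_solution (hc : IsCharged G X H) (hκ : 0 < κ) (hp : p 0 = 0) (hE : 0 < E)
    (hE2 : E ^ 2 = κ ^ 2 - minkSq p) {f f' : ℝ → ι → ℂ} (hf : ∀ t, HasDerivAt f (f' t) t)
    (heq : ∀ t, Complex.I • (X 0 *ᵥ f' t) = massOp X κ p *ᵥ f t) :
    (∀ t, (E : ℂ) ^ 2 • (modeOp X κ p *ᵥ (modeOp X κ p *ᵥ f t)) = f t) ∧
      ∀ t₀, f t₀ = 0 → ∀ t, f t = 0 := by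
  have hRf : ∀ t, Complex.I • (modeOp X κ p *ᵥ f' t) = f t := by
    intro t
    rw [← Matrix.mulVec_smul, modeOp_mulVec_iff hc hκ hp, Matrix.mulVec_smul, heq]
  have hpow := modeOp_pow hc hκ hp hE hE2
  set R := modeOp X κ p with hR
  have hder : ∀ (A : Matrix ι ι ℂ) (t : ℝ), HasDerivAt (fun t => A *ᵥ f t) (A *ᵥ f' t) t := by
    intro A t
    exact (((Matrix.mulVecLin A).restrictScalars ℝ).toContinuousLinearMap.hasFDerivAt.comp_hasDerivAt t
      (hf t))
  set Q := (E : ℂ) ^ 2 • (R * R) - 1 with hQ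
  -- Descent in the exponent: if $R^{m+1}Q$ annihilates `f` at all times, it annihilates `f'`, and
  -- $f=iRf'$ then shows that already $R^mQ$ annihilates `f`.
  have hdown : ∀ k : ℕ, ∀ m : ℕ, m + k = Fintype.card ι → ∀ t, (R ^ m * Q) *ᵥ f t = 0 := by
    intro k
    induction k with
    | zero =>
      intro m hm t
      rw [show m = Fintype.card ι from hm, hpow, Matrix.zero_mulVec]
    | succ k ih =>
      intro m hm t
      have h1 := ih (m + 1) (by omega)
      have h2 : (R ^ (m + 1) * Q) *ᵥ f' t = 0 := by
        have h3 := hder (R ^ (m + 1) * Q) t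
        simp only [h1] at h3
        exact h3.unique (hasDerivAt_const t 0)
      have h4 : R ^ (m + 1) * Q = R ^ m * Q * R := by
        rw [pow_succ, mul_assoc, mul_assoc]
        congr 1
        rw [hQ, mul_sub, sub_mul, mul_one, one_mul, Matrix.mul_smul, Matrix.smul_mul, mul_assoc]
      rw [← hRf t, Matrix.mulVec_smul, Matrix.mulVec_mulVec, ← h4, h2, smul_zero]
  have hQ0 : ∀ t, Q *ᵥ f t = 0 := fun t => by
    have := hdown (Fintype.card ι) 0 (by omega) t
    rwa [pow_zero, one_mul] at this
  have hmode : ∀ t, (E : ℂ) ^ 2 • (R *ᵥ (R *ᵥ f t)) = f t := by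
    intro t
    have := hQ0 t
    rw [hQ, Matrix.sub_mulVec, Matrix.smul_mulVec, Matrix.one_mulVec, ← Matrix.mulVec_mulVec] at this
    exact sub_eq_zero.mp this
  refine ⟨hmode, fun t₀ h0 => ?_⟩
  have hQ' : ∀ t, (E : ℂ) ^ 2 • (R *ᵥ (R *ᵥ f' t)) = f' t := by
    intro t
    have h3 := hder Q t
    simp only [hQ0] at h3
    have := h3.unique (hasDerivAt_const t 0)
    rw [hQ, Matrix.sub_mulVec, Matrix.smul_mulVec, Matrix.one_mulVec, ← Matrix.mulVec_mulVec] at this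
    exact sub_eq_zero.mp this
  -- Since $E^2R^2$ is the identity on `f'`, the relation $f=iRf'$ can be solved for `f'`;
  -- uniqueness for linear equations then applies.
  have hode : ∀ t, f' t = (-(Complex.I * (E : ℂ) ^ 2) • R) *ᵥ f t := by
    intro t
    rw [Matrix.smul_mulVec, ← hRf t, Matrix.mulVec_smul, smul_smul]
    have e : -(Complex.I * (E : ℂ) ^ 2) * Complex.I = (E : ℂ) ^ 2 := by
      linear_combination (-((E : ℂ) ^ 2)) * Complex.I_mul_I
    rw [e, hQ']
  let A : (ι → ℂ) →L[ℝ] (ι → ℂ) :=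
    ((Matrix.mulVecLin (-(Complex.I * (E : ℂ) ^ 2) • R)).restrictScalars ℝ).toContinuousLinearMap
  have h1 : f = fun _ => 0 :=
    ODE_solution_unique_univ (v := fun _ => A) (s := fun _ => Set.univ) (t₀ := t₀)
      (fun t => A.lipschitz.lipschitzOnWith)
      (fun t => ⟨(hf t).congr_deriv (hode t), trivial⟩)
      (fun t => ⟨(hasDerivAt_const t 0).congr_deriv (map_zero A).symm, trivial⟩) h0
  exact fun t => congrFun h1 t

end Modes

/-! ### Fourier analysis of wave packets and positivity of the total charge. -/

section WavePackets

open scoped SchwartzMap FourierTransform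

variable {ι : Type} [Fintype ι]

/-- The inclusion of the space of positions as the hyperplane of vanishing time. -/
def spatial : EuclideanSpace ℝ (Fin 3) →L[ℝ] (Fin 4 → ℝ) :=
  LinearMap.toContinuousLinearMap
    { toFun := event 0
      map_add' := fun x y => by ext i; fin_cases i <;> simp [event]
      map_smul' := fun c x => by ext i; fin_cases i <;> simp [event] }

theorem spatial_apply (x : EuclideanSpace ℝ (Fin 3)) : spatial x = event 0 x := rfl

theorem event_eq (t : ℝ) (x : EuclideanSpace ℝ (Fin 3)) : event t x = event t 0 + spatial x := by
  ext i
  fin_cases i <;> simp [event, spatial_apply]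

theorem spatial_single (k : Fin 3) :
    spatial (EuclideanSpace.single k 1) = Pi.single k.succ 1 := by
  rw [spatial_apply]
  ext i
  fin_cases k <;> fin_cases i <;> simp [event]

theorem hasDerivAt_event (t : ℝ) (x : EuclideanSpace ℝ (Fin 3)) :
    HasDerivAt (fun t => event t x) (Pi.single 0 1) t := by
  rw [hasDerivAt_pi]
  intro i
  fin_cases i
  · exact hasDerivAt_id t
  · exact hasDerivAt_const t _
  · exact hasDerivAt_const t _
  · exact hasDerivAt_const t _

variable {Ψ : (Fin 4 → ℝ) → ι → ℂ}

theorem IsWavePacket.pderiv (h : IsWavePacket Ψ) (μ : Fin 4) : IsWavePacket (pderiv μ Ψ) := by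
  have hd : ContDiff ℝ ∞ (fderiv ℝ Ψ) := h.1.fderiv_right (by simp)
  let L : ((Fin 4 → ℝ) →L[ℝ] ι → ℂ) →L[ℝ] ι → ℂ := ContinuousLinearMap.apply ℝ (ι → ℂ) (Pi.single μ 1)
  have hL : DiracType.pderiv μ Ψ = L ∘ fderiv ℝ Ψ := rfl
  refine ⟨hL ▸ L.contDiff.comp hd, fun T m N => ?_⟩
  obtain ⟨C, hC⟩ := h.2 T (m + 1) N
  refine ⟨‖L‖ * C, fun t x ht => ?_⟩
  have h1 : ‖iteratedFDeriv ℝ m (DiracType.pderiv μ Ψ) (event t x)‖ ≤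
      ‖L‖ * ‖iteratedFDeriv ℝ (m + 1) Ψ (event t x)‖ := by
    rw [hL, ← norm_iteratedFDeriv_fderiv]
    exact L.norm_iteratedFDeriv_comp_left hd.contDiffAt (by exact_mod_cast le_top)
  calc ‖x‖ ^ N * ‖iteratedFDeriv ℝ m (DiracType.pderiv μ Ψ) (event t x)‖
      ≤ ‖x‖ ^ N * (‖L‖ * ‖iteratedFDeriv ℝ (m + 1) Ψ (event t x)‖) := by gcongr
    _ = ‖L‖ * (‖x‖ ^ N * ‖iteratedFDeriv ℝ (m + 1) Ψ (event t x)‖) := by ring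
    _ ≤ ‖L‖ * C := by gcongr; exact hC t x ht

/-- A wave packet at a fixed time is a Schwartz function of the position. -/
def IsWavePacket.slice (h : IsWavePacket Ψ) (t : ℝ) : 𝓢(EuclideanSpace ℝ (Fin 3), ι → ℂ) where
  toFun x := Ψ (event t x)
  smooth' := by
    have h1 : ContDiff ℝ ∞ (event t) := by
      rw [funext (event_eq t)]
      exact contDiff_const.add spatial.contDiff
    exact h.1.comp h1
  decay' N m := by
    obtain ⟨C, hC⟩ := h.2 |t| m N
    have hshift : ContDiff ℝ ∞ fun y => Ψ (event t 0 + y) :=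
      h.1.comp (contDiff_const.add contDiff_id)
    have hfun : (fun x => Ψ (event t x)) = (fun y => Ψ (event t 0 + y)) ∘ spatial := by
      ext x
      rw [Function.comp_apply, ← event_eq]
    refine ⟨C * ‖spatial‖ ^ m, fun x => ?_⟩
    have h1 : ‖iteratedFDeriv ℝ m (fun x => Ψ (event t x)) x‖ ≤
        ‖iteratedFDeriv ℝ m Ψ (event t x)‖ * ‖spatial‖ ^ m := by
      rw [hfun, spatial.iteratedFDeriv_comp_right hshift x (by exact_mod_cast le_top),
        iteratedFDeriv_comp_add_left, ← event_eq]
      refine (ContinuousMultilinearMap.norm_compContinuousLinearMap_le _ _).trans_eq ?_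
      simp
    calc ‖x‖ ^ N * ‖iteratedFDeriv ℝ m (fun x => Ψ (event t x)) x‖
        ≤ ‖x‖ ^ N * (‖iteratedFDeriv ℝ m Ψ (event t x)‖ * ‖spatial‖ ^ m) := by gcongr
      _ = ‖x‖ ^ N * ‖iteratedFDeriv ℝ m Ψ (event t x)‖ * ‖spatial‖ ^ m := by ring
      _ ≤ C * ‖spatial‖ ^ m := by gcongr; exact hC t x le_rfl

theorem IsWavePacket.slice_apply (h : IsWavePacket Ψ) (t : ℝ) (x : EuclideanSpace ℝ (Fin 3)) :
    h.slice t x = Ψ (event t x) := rfl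

/-- The exponent $-4$ makes the majorant integrable in three dimensions; its uniformity in time
permits differentiation under the integral. -/
theorem IsWavePacket.exists_majorant (h : IsWavePacket Ψ) (T : ℝ) :
    ∃ C : ℝ, ∀ t x, |t| ≤ T → ‖Ψ (event t x)‖ ≤ C * (1 + ‖x‖) ^ (-4 : ℝ) := by
  obtain ⟨C₀, h₀⟩ := h.2 T 0 0
  obtain ⟨C₄, h₄⟩ := h.2 T 0 4
  refine ⟨8 * (C₀ + C₄), fun t x ht => ?_⟩
  have e0 := h₀ t x ht
  have e4 := h₄ t x ht
  rw [norm_iteratedFDeriv_zero] at e0 e4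
  have hx : 0 ≤ ‖x‖ := norm_nonneg x
  have h1 : (1 + ‖x‖) ^ 4 ≤ 8 * (‖x‖ ^ 0 + ‖x‖ ^ 4) := by
    have := add_pow_le (zero_le_one' ℝ) hx 4
    norm_num at this ⊢
    linarith
  have h2 : (1 + ‖x‖) ^ (-4 : ℝ) = ((1 + ‖x‖) ^ 4)⁻¹ := by
    rw [Real.rpow_neg (by positivity)]
    norm_cast
  rw [h2, ← div_eq_mul_inv, le_div_iff₀ (by positivity)]
  calc ‖Ψ (event t x)‖ * (1 + ‖x‖) ^ 4 ≤ ‖Ψ (event t x)‖ * (8 * (‖x‖ ^ 0 + ‖x‖ ^ 4)) := by gcongr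
    _ = 8 * (‖x‖ ^ 0 * ‖Ψ (event t x)‖ + ‖x‖ ^ 4 * ‖Ψ (event t x)‖) := by ring
    _ ≤ 8 * (C₀ + C₄) := by gcongr

/-- Differentiation under the Fourier integral, dominated by the majorant of the time derivative on
an interval of length two around `t`. -/
theorem IsWavePacket.hasDerivAt_fourier_slice (h : IsWavePacket Ψ) (t : ℝ)
    (ξ : EuclideanSpace ℝ (Fin 3)) :
    HasDerivAt (fun t => 𝓕 (h.slice t) ξ) (𝓕 ((h.pderiv 0).slice t) ξ) t := by
  obtain ⟨C, hC⟩ := (h.pderiv 0).exists_majorant (|t| + 1)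
  have hcont : ∀ f : 𝓢(EuclideanSpace ℝ (Fin 3), ι → ℂ),
      Continuous fun x => Real.fourierChar (-inner ℝ x ξ) • f x := fun f => by
    have : Continuous fun x : EuclideanSpace ℝ (Fin 3) => Real.fourierChar (-inner ℝ x ξ) := by fun_prop
    exact this.smul f.continuous
  have hint : MeasureTheory.Integrable fun x => Real.fourierChar (-inner ℝ x ξ) • h.slice t x :=
    (h.slice t).integrable.mono (hcont _).aestronglyMeasurable
      (Filter.Eventually.of_forall fun x => by rw [Circle.norm_smul])
  simp only [SchwartzMap.fourier_coe, Real.fourier_eq]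
  refine (hasDerivAt_integral_of_dominated_loc_of_deriv_le (s := Metric.ball t 1)
    (F := fun t x => Real.fourierChar (-inner ℝ x ξ) • h.slice t x)
    (F' := fun t x => Real.fourierChar (-inner ℝ x ξ) • (h.pderiv 0).slice t x)
    (bound := fun x => C * (1 + ‖x‖) ^ (-4 : ℝ)) (Metric.ball_mem_nhds t one_pos)
    (Filter.Eventually.of_forall fun s => (hcont (h.slice s)).aestronglyMeasurable) hint
    (hcont _).aestronglyMeasurable (Filter.Eventually.of_forall fun x s hs => ?_)
    ((integrable_one_add_norm (by simp; norm_num)).const_mul C)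
    (Filter.Eventually.of_forall fun x s _ => ?_)).2
  · rw [Circle.norm_smul]
    refine hC s x ?_
    rw [Metric.mem_ball, Real.dist_eq] at hs
    have := abs_sub_abs_le_abs_sub s t
    linarith
  · refine HasDerivAt.const_smul _ ?_
    have h1 : HasFDerivAt Ψ (fderiv ℝ Ψ (event s x)) (event s x) :=
      (h.1.differentiable (by simp) _).hasFDerivAt
    exact h1.comp_hasDerivAt s (hasDerivAt_event s x)

theorem IsWavePacket.lineDeriv_slice (h : IsWavePacket Ψ) (t : ℝ) (k : Fin 3) :
    LineDeriv.lineDerivOp (EuclideanSpace.single k (1 : ℝ)) (h.slice t) = (h.pderiv k.succ).slice t := by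
  ext1 x
  rw [SchwartzMap.lineDerivOp_apply_eq_fderiv]
  have h1 : HasFDerivAt Ψ (fderiv ℝ Ψ (event t x)) (event t x) :=
    (h.1.differentiable (by simp) _).hasFDerivAt
  have h2 : HasFDerivAt (event t) spatial x := by
    have := (spatial.hasFDerivAt (x := x)).const_add (event t 0)
    simpa only [← event_eq] using this
  have h3 : HasFDerivAt (h.slice t) ((fderiv ℝ Ψ (event t x)).comp spatial) x := h1.comp x h2
  rw [h3.fderiv, ContinuousLinearMap.comp_apply, spatial_single]
  rfl

theorem IsWavePacket.fourier_slice_pderiv (h : IsWavePacket Ψ) (t : ℝ) (k : Fin 3)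
    (ξ : EuclideanSpace ℝ (Fin 3)) :
    𝓕 ((h.pderiv k.succ).slice t) ξ = (2 * Real.pi * Complex.I * ξ k) • 𝓕 (h.slice t) ξ := by
  rw [← h.lineDeriv_slice, SchwartzMap.fourier_lineDerivOp_eq, smul_apply,
    SchwartzMap.smulLeftCLM_apply_apply (by fun_prop)]
  simp only [EuclideanSpace.inner_single_right]
  ext i
  simp
  ring

theorem mulVec_fourier (A : Matrix ι ι ℂ) (f : 𝓢(EuclideanSpace ℝ (Fin 3), ι → ℂ))
    (ξ : EuclideanSpace ℝ (Fin 3)) :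
    A *ᵥ 𝓕 f ξ =
      𝓕 (f.postcompCLM (LinearMap.toContinuousLinearMap (Matrix.mulVecLin A))) ξ := by
  rw [SchwartzMap.fourier_coe, SchwartzMap.fourier_coe, Real.fourier_eq, Real.fourier_eq]
  have hint : MeasureTheory.Integrable fun x => Real.fourierChar (-inner ℝ x ξ) • f x := by
    have : Continuous fun x : EuclideanSpace ℝ (Fin 3) => Real.fourierChar (-inner ℝ x ξ) := by fun_prop
    exact f.integrable.mono (this.smul f.continuous).aestronglyMeasurable
      (Filter.Eventually.of_forall fun x => by rw [Circle.norm_smul])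
  have h1 := (LinearMap.toContinuousLinearMap (Matrix.mulVecLin A)).integral_comp_comm hint
  rw [LinearMap.coe_toContinuousLinearMap', Matrix.mulVecLin_apply] at h1
  rw [← h1]
  congr 1
  ext1 x
  rw [SchwartzMap.postcompCLM_apply, LinearMap.coe_toContinuousLinearMap', Matrix.mulVecLin_apply,
    Matrix.mulVecLin_apply, Circle.smul_def, Circle.smul_def, Matrix.mulVec_smul]

/-- The momentum of the Fourier mode `ξ`. -/
def modeMomentum (ξ : EuclideanSpace ℝ (Fin 3)) : Fin 4 → ℝ := (-(2 * Real.pi)) • spatial ξ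

theorem modeMomentum_zero (ξ : EuclideanSpace ℝ (Fin 3)) : modeMomentum ξ 0 = 0 := by
  simp [modeMomentum, spatial_apply, event]

/-- The sesquilinear form whose real diagonal is the charge density. -/
def chargeForm (H : Matrix ι ι ℂ) (X : Fin 4 → Matrix ι ι ℂ) : (ι → ℂ) →L⋆[ℂ] (ι → ℂ) →L[ℂ] ℂ :=
  (LinearMap.toContinuousLinearMap
    ((LinearMap.toContinuousLinearMap : ((ι → ℂ) →ₗ[ℂ] ℂ) ≃ₗ[ℂ] (ι → ℂ) →L[ℂ] ℂ).toLinearMap ∘ₗ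
      LinearMap.mk₂ ℂ (fun u w => u ⬝ᵥ (H *ᵥ (X 0 *ᵥ w))) (fun u u' w => add_dotProduct u u' _)
        (fun c u w => smul_dotProduct c u _)
        (fun u w w' => by rw [Matrix.mulVec_add, Matrix.mulVec_add, dotProduct_add])
        (fun c u w => by rw [Matrix.mulVec_smul, Matrix.mulVec_smul, dotProduct_smul]))).comp
    (starL ℂ : (ι → ℂ) ≃L⋆[ℂ] (ι → ℂ)).toContinuousLinearMap

variable [DecidableEq ι] {G : Fin 4 → Fin 4 → Matrix ι ι ℂ} {X : Fin 4 → Matrix ι ι ℂ}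
  {H : Matrix ι ι ℂ} {κ : ℝ}

/-- A space derivative becomes multiplication by $2\pi i\xi_k$; with the factor $i$ of the equation
this is $-2\pi\xi_k$, the component of `modeMomentum`. -/
theorem IsWavePacket.fourier_mode (h : IsWavePacket Ψ) (hs : IsSolution X κ Ψ) (t : ℝ)
    (ξ : EuclideanSpace ℝ (Fin 3)) :
    Complex.I • (X 0 *ᵥ 𝓕 ((h.pderiv 0).slice t) ξ) =
      massOp X κ (modeMomentum ξ) *ᵥ 𝓕 (h.slice t) ξ := by
  let post (A : Matrix ι ι ℂ) (f : 𝓢(EuclideanSpace ℝ (Fin 3), ι → ℂ)) :=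
    f.postcompCLM (LinearMap.toContinuousLinearMap (Matrix.mulVecLin A))
  have h1 : ∑ α, Complex.I • post (contra X α) ((h.pderiv α).slice t) = (κ : ℂ) • h.slice t := by
    ext1 x
    have := hs.2 (event t x)
    rw [diracExpr_eq, sub_eq_zero] at this
    rw [sum_apply, smul_apply, h.slice_apply, ← this]
    rfl
  have h2 := congrArg (fun f => FourierTransform.fourierCLM ℂ 𝓢(EuclideanSpace ℝ (Fin 3), ι → ℂ) f ξ) h1
  simp only [map_sum, map_smul, sum_apply, smul_apply,
    FourierTransform.fourierCLM_apply, post, ← mulVec_fourier] at h2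
  have h3 : ∀ k : Fin 3, Complex.I • (contra X k.succ *ᵥ 𝓕 ((h.pderiv k.succ).slice t) ξ) =
      (modeMomentum ξ k.succ : ℂ) • (contra X k.succ *ᵥ 𝓕 (h.slice t) ξ) := by
    intro k
    rw [h.fourier_slice_pderiv, Matrix.mulVec_smul, smul_smul]
    congr 1
    have : spatial ξ k.succ = ξ k := by fin_cases k <;> simp [spatial_apply, event]
    rw [modeMomentum, Pi.smul_apply, this, smul_eq_mul]
    push_cast
    linear_combination (2 * Real.pi * ξ k : ℂ) * Complex.I_mul_I
  have h4 : slash X (modeMomentum ξ) *ᵥ 𝓕 (h.slice t) ξ =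
      ∑ k : Fin 3, (modeMomentum ξ k.succ : ℂ) • (contra X k.succ *ᵥ 𝓕 (h.slice t) ξ) := by
    rw [slash_eq, linComb, Matrix.sum_mulVec, Fin.sum_univ_succ, modeMomentum_zero]
    simp only [Complex.ofReal_zero, zero_smul, Matrix.zero_mulVec, zero_add, Matrix.smul_mulVec]
  have h5 : contra X 0 = X 0 := by simp [contra, mink]
  rw [Fin.sum_univ_succ, h5, Finset.sum_congr rfl fun k _ => h3 k, ← h4] at h2
  rw [massOp_mulVec, ← h2, add_sub_cancel_right]

/-- By Plancherel the charge is the integral of the charges of the Fourier modes. These are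
nonnegative and continuous in `ξ`, and one of them is positive. -/
theorem IsCharged.integral_pos (hc : IsCharged G X H) (hκ : 0 < κ)
    (h : IsWavePacket Ψ) (hs : IsSolution X κ Ψ) (hΨ : Ψ ≠ 0) (t : ℝ) :
    0 < ∫ x : EuclideanSpace ℝ (Fin 3), chargeDensity H X (Ψ (event t x)) := by
  let M := chargeForm H X
  have hE (ξ : EuclideanSpace ℝ (Fin 3)) : ∃ E : ℝ, 0 < E ∧ E ^ 2 = κ ^ 2 - minkSq (modeMomentum ξ) := by
    have h1 : 0 < κ ^ 2 - minkSq (modeMomentum ξ) := by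
      rw [minkSq_eq, modeMomentum_zero]
      nlinarith [sq_nonneg (modeMomentum ξ 1), sq_nonneg (modeMomentum ξ 2),
        sq_nonneg (modeMomentum ξ 3), pow_pos hκ 2]
    exact ⟨_, Real.sqrt_pos.mpr h1, Real.sq_sqrt h1.le⟩
  have hmode (ξ : EuclideanSpace ℝ (Fin 3)) {E : ℝ} (hE : 0 < E)
      (hE2 : E ^ 2 = κ ^ 2 - minkSq (modeMomentum ξ)) :=
    mode_solution hc hκ (modeMomentum_zero ξ) hE hE2 (fun t => h.hasDerivAt_fourier_slice t ξ)
      (fun t => h.fourier_mode hs t ξ)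
  have hpos (ξ : EuclideanSpace ℝ (Fin 3)) : 0 ≤ (M (𝓕 (h.slice t) ξ) (𝓕 (h.slice t) ξ)).re ∧
      (𝓕 (h.slice t) ξ ≠ 0 → 0 < (M (𝓕 (h.slice t) ξ) (𝓕 (h.slice t) ξ)).re) := by
    obtain ⟨E, h1, h2⟩ := hE ξ
    exact charge_pos_of_modes hc hκ (modeMomentum_zero ξ) h1 ((hmode ξ h1 h2).1 t)
  -- If all modes vanished at time `t`, they would vanish at all times by `mode_solution`, and
  -- Fourier inversion would give `Ψ = 0`.
  have hne : ∃ ξ, 𝓕 (h.slice t) ξ ≠ 0 := by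
    by_contra! h0
    refine hΨ (funext fun y => ?_)
    have h1 : 𝓕 (h.slice (y 0)) = 0 := by
      ext1 ξ
      obtain ⟨E, h2, h3⟩ := hE ξ
      exact (hmode ξ h2 h3).2 t (h0 ξ) (y 0)
    have h2 : h.slice (y 0) = 0 := by
      rw [← FourierTransform.fourierInv_fourier_eq (F := 𝓢(EuclideanSpace ℝ (Fin 3), ι → ℂ))
        (h.slice (y 0)), h1]
      exact map_zero (FourierTransform.fourierInvCLM ℂ 𝓢(EuclideanSpace ℝ (Fin 3), ι → ℂ))
    have h3 := congrArg (fun f => f !₂[y 1, y 2, y 3]) h2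
    simp only [h.slice_apply] at h3
    have h4 : event (y 0) !₂[y 1, y 2, y 3] = y := by
      ext i
      fin_cases i <;> rfl
    rw [h4] at h3
    exact h3
  have hcont (f : 𝓢(EuclideanSpace ℝ (Fin 3), ι → ℂ)) : Continuous fun x => M (f x) (f x) :=
    (M.continuous.comp f.continuous).clm_apply f.continuous
  have hint (f : 𝓢(EuclideanSpace ℝ (Fin 3), ι → ℂ)) : MeasureTheory.Integrable fun x => M (f x) (f x) := by
    obtain ⟨C, -, hC⟩ := f.decay 0 0
    refine (f.integrable.norm.const_mul (‖M‖ * C)).mono' (hcont f).aestronglyMeasurable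
      (Filter.Eventually.of_forall fun x => (M.le_opNorm₂ _ _).trans ?_)
    have := hC x
    rw [pow_zero, one_mul, norm_iteratedFDeriv_zero] at this
    gcongr
  have h1 := congrArg Complex.re (SchwartzMap.integral_sesq_fourier_fourier (h.slice t) (h.slice t) M)
  rw [← Complex.reCLM_apply, ← Complex.reCLM_apply, ← Complex.reCLM.integral_comp_comm (hint _),
    ← Complex.reCLM.integral_comp_comm (hint _)] at h1
  refine lt_of_lt_of_eq ?_ h1
  refine (MeasureTheory.integral_pos_iff_support_of_nonneg (fun ξ => (hpos ξ).1)
    (Complex.reCLM.integrable_comp (hint _))).mpr ?_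
  obtain ⟨ξ, hξ⟩ := hne
  refine IsOpen.measure_pos _ (Continuous.isOpen_support ?_) ⟨ξ, ((hpos ξ).2 hξ).ne'⟩
  exact Complex.continuous_re.comp (hcont (𝓕 (h.slice t)))

theorem IsCharged.positiveCharge (hc : IsCharged G X H) (hκ : 0 < κ) : PositiveCharge H X κ :=
  ⟨fun _ hs h hΨ t => hc.integral_pos hκ h hs hΨ t, fun p u hu hu0 => hc.pos κ p u hκ hu hu0⟩

end WavePackets

/-! ### Assembly of the results for the concrete representation. -/

section Assembly

variable (n : ℕ) (M : ℕ → ℕ)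

/-- The rotation generators of `rhoGen n M`. -/
def rhoRot (k : Fin 3) : Matrix (RhoIdx n M) (RhoIdx n M) ℂ :=
  Matrix.blockDiagonal' fun s : Summand n M => rotGen (Summand.label s) k

/-- The boost generators of `rhoGen n M`. -/
def rhoBoost (k : Fin 3) : Matrix (RhoIdx n M) (RhoIdx n M) ℂ :=
  Matrix.blockDiagonal' fun s : Summand n M => boostGen (Summand.label s) k

theorem rho_relations : LorentzRelations (rhoRot n M) (rhoBoost n M) := by
  have h (s : Summand n M) := irrep_relations (Summand.label s)
  constructor <;>
    simp only [rhoRot, rhoBoost, ← Matrix.blockDiagonal'_mul, ← Matrix.blockDiagonal'_smul,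
      ← Matrix.blockDiagonal'_add, ← Matrix.blockDiagonal'_sub] <;>
    refine congrArg _ (funext fun s => ?_)
  exacts [(h s).J01, (h s).J12, (h s).J20, (h s).B01, (h s).B12, (h s).B20, (h s).JB00, (h s).JB11,
    (h s).JB22, (h s).JB01, (h s).JB12, (h s).JB20, (h s).JB10, (h s).JB21, (h s).JB02]

theorem rhoGen_eq_lorentzTensor : rhoGen n M = lorentzTensor (rhoRot n M) (rhoBoost n M) := by
  have h0 : (Matrix.blockDiagonal' fun s : Summand n M =>
      (0 : Matrix (Summand.label s).Carrier (Summand.label s).Carrier ℂ)) = 0 :=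
    Matrix.blockDiagonal'_zero
  have hneg (A : ∀ s : Summand n M, Matrix (Summand.label s).Carrier (Summand.label s).Carrier ℂ) :
      (Matrix.blockDiagonal' fun s => -A s) = -Matrix.blockDiagonal' A :=
    Matrix.blockDiagonal'_neg A
  funext α β
  fin_cases α <;> fin_cases β <;>
    first
    | exact h0
    | exact hneg _
    | rfl

variable {n M}

theorem diracOp_isCharged (hM : IsAdmissible n M) :
    IsCharged (rhoGen n M) (diracOp n M) (diracForm n M) := by
  obtain ⟨-, hu, hG, -, hX⟩ := diracForm_isInvariantForm hM
  exact ⟨diracOp_isVector n M, diracOp_pow_mul_sub hM, hX, fun κ p u hκ hup hu0 =>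
    chargeDensity_amplitude_pos (diracOp_isVector n M) (diracOp_pow_mul_sub hM) hu hG hX
      (fun s w hs hw hw0 => diracForm_pos hM hs hw hw0) hκ hup hu0⟩

theorem diracOp_describesOnlySpin (hM : IsAdmissible n M) {κ : ℝ} (hκ : 0 < κ) :
    DescribesOnlySpin n (rhoGen n M) (diracOp n M) κ := by
  have hX := diracOp_isVector n M
  have hJ : ∀ (s : ℂ) (u : RhoIdx n M → ℂ), s * s = 1 → diracOp n M 0 *ᵥ u = s • u →
      angSq (rhoGen n M) *ᵥ u = (((n : ℂ) + 1 / 2) * ((n : ℂ) + 3 / 2)) • u := fun s u hs hu =>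
    IsTop.of_eigenvector hM (left_ne_zero_of_mul_eq_one hs) hu
  rw [rhoGen_eq_lorentzTensor] at hX hJ ⊢
  exact describesOnlySpin (rho_relations n M) hX (diracOp_pow_mul_sub hM) hJ
    (fun s hs => finrank_ker_diracOp hM hs) hκ

end Assembly

end DiracType

end

theorem theorem1 (n : ℕ) :
    ∃ M : ℕ → ℕ,
      DiracType.AlgOutput n M ∧ (∀ M', DiracType.AlgOutput n M' → M' = M) ∧
      (∀ i, 1 ≤ i → i ≤ n + 1 →
        1 ≤ M i ∧ (DiracType.numFixed n M i : ℤ) ≤ DiracType.numFree n M i) ∧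
      (∀ d : Fin 6, (d : ℕ) ≤ n → M (n + 1 - d) = ![1, 1, 2, 2, 2, 3] d) ∧
      ∃ (X : Fin 4 → Matrix (DiracType.RhoIdx n M) (DiracType.RhoIdx n M) ℂ)
        (P H : Matrix (DiracType.RhoIdx n M) (DiracType.RhoIdx n M) ℂ),
        DiracType.IsVectorOperator (DiracType.rhoGen n M) X ∧
        DiracType.FollowsScheme X ∧
        DiracType.IsParityOperator (DiracType.rhoGen n M) P ∧
        DiracType.IsInvariantForm (DiracType.rhoGen n M) P X H ∧
        DiracType.EliminatesLowerSpins n (DiracType.rhoGen n M) X ∧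
        ∀ κ : ℝ, 0 < κ →
          DiracType.PoincareInvariant (DiracType.rhoGen n M) X κ ∧
          DiracType.ParityInvariant P X κ ∧
          DiracType.DerivableFromLagrangian H X κ ∧
          DiracType.DescribesOnlySpin n (DiracType.rhoGen n M) X κ ∧
          DiracType.PositiveCharge H X κ := by
  obtain ⟨M, hout, hfree, hval, hlast, hnext, hbelow⟩ := DiracType.exists_algOutput n
  -- From the algorithm the construction needs only these bounds on the multiplicities.
  have hM : DiracType.IsAdmissible n M := ⟨hlast, hnext, hbelow⟩
  have hX := DiracType.diracOp_isVector n M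
  have hH := DiracType.diracForm_isInvariantForm hM
  exact ⟨M, hout, fun M' h => DiracType.algOutput_unique n hout h, hfree, hval,
    DiracType.diracOp n M, DiracType.parityOp n M, DiracType.diracForm n M, hX,
    DiracType.diracOp_followsScheme n M, DiracType.parityOp_isParity n M, hH,
    DiracType.diracOp_eliminatesLowerSpins hM, fun κ hκ =>
      ⟨DiracType.poincareInvariant hX κ,
        DiracType.parityInvariant (DiracType.parityOp_diracOp) κ,
        DiracType.derivableFromLagrangian hH.1 hH.2.1 hH.2.2.2.2 κ,
        DiracType.diracOp_describesOnlySpin hM hκ,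
        (DiracType.diracOp_isCharged hM).positiveCharge hκ⟩⟩
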